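/- Let $(N,g)$ be a closed connected Riemannian manifold with universal covering $p:\widetilde N\to N$ (with the lifted metric), $\tau:T^*N\to N$ its cotangent bundle, $\omega_0=dp\wedge dq=d\lambda$ the canonical symplectic form, $U\in C^\infty(N,\mathbb R)$ and $H_U(q,p)=\frac12|p|_g^2+U(q)$. Let $\mathcal M(N)$ be the set of smooth 2-forms $\sigma$ on $N$ such that $p^*\sigma=d\theta$ for a smooth 1-form $\theta$ on $\widetilde N$ with $\|\theta\|_\infty<\infty$; for $\sigma\in\mathcal M(N)$ let $$c(g,\sigma,U)=\inf_{d\theta=p^*\sigma}\ \sup_{q\in\widetilde N}\Big(\tfrac12|\theta_q|^2+U(p(q))\Big)$$ be the Mañé critical value. Fix $k\in\mathbb R$, $\xi>0$, $\epsilon_\xi=\min\{\frac13,\frac\xi3\}$ and a smooth $\beta_\xi:\mathbb R\to\mathbb R$ with $0\le\dot\beta_\xi\le1$, $\beta_\xi(t)=t$ for $|t|\le\xi-\epsilon_\xi$ and $\beta_\xi(t)=\pm\xi$ for $\pm t\ge\xi+\epsilon_\xi$, and put $H=\beta_\xi\circ(H_U-k):T^*N\to\mathbb R$. Fix $\mu\in\mathcal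 M(N)$ and a smooth $\beta:\mathbb R\to[0,1]$ with $\beta(s)=0$ for $s\le0$, $\beta(s)=1$ for $s\ge1$ and $0\le\dot\beta\le2$. For a 2-form $\sigma$ on $N$ put $$\omega_s=\omega_0+\tau^*(\mu+\beta(s)\sigma),\qquad s\in\mathbb R,$$ and let $X_H^{\omega_s}$ be defined by $dH=-\omega_s(X_H^{\omega_s},\cdot)$. For loops $v\in C^\infty(S^1,T^*N)$, $S^1=\mathbb R/\mathbb Z$, freely homotopic to a reference loop $v_\nu$, and $\eta\in\mathbb R$, the Rabinowitz action functional is $$\mathcal A_{\omega_s}(v,\eta)=\int_{[0,1]\times S^1}\bar v^*\omega_s-\eta\int_0^1H(v(t))\,dt,$$ where $\bar v$ is any smooth cylinder from $v_\nu$ to $v$. Let $J=(J_{t,s})$, $t\in S^1$, $s\in\mathbb R$, denote smooth families of almost complex structures on $T^*N$ such that $\omega_s(\cdot,J_{t,s}\cdot)$ is a Riemannian metric for all $t,s$, with norm $|\cdot|_{t,s}$. For a constant $A$ we say that $J$ is bounded by $A$ if for all $t,s$ one has $|d\tau(u)|_g^2\le A\,|u|_{t,s}^2$ for every tangent vector $u$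 of $T^*N$, and $|X_H^{\omega_s}|_{t,s}^2\le A$ everywhere on $T^*N$. **Proposition.** For every $A$ there are $\delta>0$ and a real-valued function $B$ of pairs $(w_-,w_+)$ of elements of $C^\infty(S^1,T^*N)\times\mathbb R$ (depending only on $A$ and the data $N,g,U,k,\beta_\xi,\mu,\beta$ fixed above) such that the following holds. Let $\sigma\in\mathcal M(N)$ satisfy $|\sigma|_g\le\delta$, that is, $|\sigma_x(u,w)|\le\delta|u|_g|w|_g$ for all $x\in N$ and $u,w\in T_xN$, and suppose that $k>c(g,\mu+\beta(s)\sigma,U)$ for all $s\in\mathbb R$. Let $J$ be as above, bounded by $A$, and let $w_-$ and $w_+$ be critical points of $\mathcal A_{\omega_0+\tau^*\mu}$ and of $\mathcal A_{\omega_0+\tau^*(\mu+\sigma)}$, respectively, in the same free homotopy class of loops. Let $w=(v,\eta)\in C^\infty(\mathbb R\times S^1,T^*N)\times C^\infty(\mathbb R,\mathbb R)$ be a gradient flow line of $\mathcal A_{\omega_s}$, i.e. a solution of $$\partial_sv+J_{t,s}(v)\big(\partial_tv-\eta X_H^{\omega_s}(v)\big)=0,\qquad \partial_s\eta+\int_0^1H(v(s,t))\,dt=0,$$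 such that $w(s)\to w_\pm$ as $s\to\pm\infty$ (the loops $v(s,\cdot)$ in the $C^1$-topology, hence in particular if they converge in $C^\infty(S^1,T^*N)$). Then $$\|\eta\|_\infty\le B(w_-,w_+)\qquad\text{and}\qquad E(w)=\int_{-\infty}^\infty\Big(\int_0^1|\partial_sv|_{t,s}^2\,dt+|\partial_s\eta|^2\Big)ds\le B(w_-,w_+).$$ -/

import Mathlib

open Bundle Manifold Filter Topology MeasureTheory
open scoped ContDiff

noncomputable section

namespace RabinowitzFloer

/-! ### One-forms and their exterior derivative -/

section OneForms

variable {E : Type*} [NormedAddCommGroup E] [NormedSpace ℝ E]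
  {H : Type*} [TopologicalSpace H] (I : ModelWithCorners ℝ E H)
  {M : Type*} [TopologicalSpace M] [ChartedSpace H M] [IsManifold I ∞ M]

/-- The expression of the one-form `α` in the preferred chart around `x₀`
(the pull-back of `α` by the inverse of this chart). -/
def oneFormInChart (α : (x : M) → TangentSpace I x →L[ℝ] ℝ) (x₀ : M) (y : E) : E →L[ℝ] ℝ :=
  (α ((extChartAt I x₀).symm y)).comp (mfderiv 𝓘(ℝ, E) I (extChartAt I x₀).symm y)

/-- The exterior derivative of a one-form on a manifold without boundary, computed in the preferred
chart at `x`: `dα(u, w) = (D_u α)(w) - (D_w α)(u)`. -/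
def extDerivOneForm (α : (x : M) → TangentSpace I x →L[ℝ] ℝ) (x : M) (u w : TangentSpace I x) : ℝ :=
  fderiv ℝ (oneFormInChart I α x) (extChartAt I x x)
      (mfderiv I 𝓘(ℝ, E) (extChartAt I x) x u) (mfderiv I 𝓘(ℝ, E) (extChartAt I x) x w)
    - fderiv ℝ (oneFormInChart I α x) (extChartAt I x x)
      (mfderiv I 𝓘(ℝ, E) (extChartAt I x) x w) (mfderiv I 𝓘(ℝ, E) (extChartAt I x) x u)

/-- A one-form is smooth if it is a smooth section of the cotangent bundle. -/
def IsSmoothOneForm (α : (x : M) → TangentSpace I x →L[ℝ] ℝ) : Prop :=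
  ContMDiff I (I.prod 𝓘(ℝ, E →L[ℝ] ℝ)) ∞
    (fun x : M => (TotalSpace.mk' (E →L[ℝ] ℝ) x (α x) :
      TotalSpace (E →L[ℝ] ℝ) (fun x : M => TangentSpace I x →L[ℝ] ℝ)))

/-- A smooth two-form: a smooth section of the bundle of bilinear forms, alternating at each
point. -/
structure IsSmoothTwoForm (σ : (x : M) → TangentSpace I x →L[ℝ] TangentSpace I x →L[ℝ] ℝ) :
    Prop where
  alternating : ∀ (x : M) (u : TangentSpace I x), σ x u u = 0
  smooth : ContMDiff I (I.prod 𝓘(ℝ, E →L[ℝ] E →L[ℝ] ℝ)) ∞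
    (fun x : M => (TotalSpace.mk' (E →L[ℝ] E →L[ℝ] ℝ) x (σ x) :
      TotalSpace (E →L[ℝ] E →L[ℝ] ℝ)
        (fun x : M => TangentSpace I x →L[ℝ] TangentSpace I x →L[ℝ] ℝ)))

end OneForms

/-! ### The base manifold: metric, magnetic forms, Mañé critical value -/

section Base

/-- A smooth Riemannian metric on an `n`-dimensional manifold. -/
abbrev Metric (n : ℕ) (N : Type*) [TopologicalSpace N]
    [ChartedSpace (EuclideanSpace ℝ (Fin n)) N] [IsManifold (𝓡 n) ∞ N] : Type _ :=
  ContMDiffRiemannianMetric (𝓡 n) ∞ (EuclideanSpace ℝ (Fin n))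
    (fun x : N => TangentSpace (𝓡 n) x)

/-- Fields of bilinear forms on the tangent spaces (two-forms, when smooth and alternating). -/
abbrev FormField (n : ℕ) (N : Type*) [TopologicalSpace N]
    [ChartedSpace (EuclideanSpace ℝ (Fin n)) N] : Type _ :=
  (x : N) → TangentSpace (𝓡 n) x →L[ℝ] TangentSpace (𝓡 n) x →L[ℝ] ℝ

variable {n : ℕ} {N : Type*} [TopologicalSpace N] [ChartedSpace (EuclideanSpace ℝ (Fin n)) N]
  [IsManifold (𝓡 n) ∞ N]
  {N' : Type*} [TopologicalSpace N'] [ChartedSpace (EuclideanSpace ℝ (Fin n)) N']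
  [IsManifold (𝓡 n) ∞ N']

/-- The square `|a|_g²` of the dual norm of a covector: `a` evaluated on the tangent vector `a^♯`
that represents `a` with respect to the scalar product `g_x`. -/
def dualNormSq (g : Metric n N) (x : N) (a : TangentSpace (𝓡 n) x →L[ℝ] ℝ) : ℝ :=
  a ((g.inner x).inverse a)

/-- `|σ|_g ≤ δ` for the supremum norm of a two-form:
`|σ_x(u, w)| ≤ δ |u|_g |w|_g` for all tangent vectors `u, w` at all points. -/
def TwoFormNormLE (g : Metric n N) (σ : FormField n N) (δ : ℝ) : Prop :=
  ∀ (x : N) (u w : TangentSpace (𝓡 n) x),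
    |σ x u w| ≤ δ * Real.sqrt (g.inner x u u) * Real.sqrt (g.inner x w w)

/-- `p : N' → N` is a smooth universal covering. -/
structure IsUniversalCovering (n : ℕ) {N N' : Type*}
    [TopologicalSpace N] [ChartedSpace (EuclideanSpace ℝ (Fin n)) N]
    [TopologicalSpace N'] [ChartedSpace (EuclideanSpace ℝ (Fin n)) N'] (p : N' → N) : Prop where
  covering : IsCoveringMap p
  surjective : Function.Surjective p
  localDiffeo : IsLocalDiffeomorph (𝓡 n) (𝓡 n) ∞ p
  simplyConnected : SimplyConnectedSpace N'

/-- `θ` is a smooth primitive of the pull-back `p^*σ` of the two-form `σ`. -/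
structure IsPrimitive (p : N' → N) (σ : FormField n N)
    (θ : (x : N') → TangentSpace (𝓡 n) x →L[ℝ] ℝ) : Prop where
  smooth : IsSmoothOneForm (𝓡 n) θ
  deriv_eq : ∀ (x : N') (u w : TangentSpace (𝓡 n) x),
    extDerivOneForm (𝓡 n) θ x u w
      = σ (p x) (mfderiv (𝓡 n) (𝓡 n) p x u) (mfderiv (𝓡 n) (𝓡 n) p x w)

/-- The square of the dual norm of a covector at a point of the covering, with respect to the lifted
metric `p^*g`. -/
def liftedDualNormSq (g : Metric n N) (p : N' → N) (x : N')
    (a : TangentSpace (𝓡 n) x →L[ℝ] ℝ) : ℝ :=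
  dualNormSq g (p x) (a.comp (mfderiv (𝓡 n) (𝓡 n) p x).inverse)

/-- The class of two-forms whose pull-back to the universal covering has a bounded primitive. -/
structure HasBoundedPrimitive (g : Metric n N) (p : N' → N) (σ : FormField n N) : Prop where
  isTwoForm : IsSmoothTwoForm (𝓡 n) σ
  exists_primitive : ∃ θ : (x : N') → TangentSpace (𝓡 n) x →L[ℝ] ℝ, IsPrimitive p σ θ ∧
    ∃ C : ℝ, ∀ x : N', liftedDualNormSq g p x (θ x) ≤ C

/-- The Mañé critical value `inf_θ sup_q (½|θ_q|² + U(q))`, where `θ` runs over the primitives of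
the pull-back of `σ` to the universal covering and `q` over the points of the covering. -/
def maneCriticalValue (g : Metric n N) (p : N' → N) (σ : FormField n N) (U : N → ℝ) : EReal :=
  ⨅ θ ∈ {θ : (x : N') → TangentSpace (𝓡 n) x →L[ℝ] ℝ | IsPrimitive p σ θ},
    ⨆ q : N', ((liftedDualNormSq g p q (θ q) / 2 + U (p q) : ℝ) : EReal)

end Base

/-! ### The twisted cotangent bundle -/

section Cotangent

/-- The total space of the cotangent bundle. -/
abbrev CotangentBundle (n : ℕ) (N : Type*) [TopologicalSpace N]
    [ChartedSpace (EuclideanSpace ℝ (Fin n)) N] : Type _ :=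
  TotalSpace (EuclideanSpace ℝ (Fin n) →L[ℝ] ℝ)
    (fun x : N => TangentSpace (𝓡 n) x →L[ℝ] ℝ)

/-- The model with corners of the cotangent bundle. -/
abbrev cotangentModel (n : ℕ) :=
  (𝓡 n).prod 𝓘(ℝ, EuclideanSpace ℝ (Fin n) →L[ℝ] ℝ)

/-- The model vector space of the cotangent bundle. -/
abbrev CotangentModelSpace (n : ℕ) : Type :=
  EuclideanSpace ℝ (Fin n) × (EuclideanSpace ℝ (Fin n) →L[ℝ] ℝ)

variable {n : ℕ} {N : Type*} [TopologicalSpace N] [ChartedSpace (EuclideanSpace ℝ (Fin n)) N]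
  [IsManifold (𝓡 n) ∞ N]

/-- The differential of the foot point projection `τ : T^*N → N`. -/
def dProj (z : CotangentBundle n N) :
    TangentSpace (cotangentModel n) z →L[ℝ] TangentSpace (𝓡 n) z.proj :=
  mfderiv (cotangentModel n) (𝓡 n)
    (fun y : CotangentBundle n N => y.proj) z

/-- The Liouville one-form `λ = p dq`. -/
def liouvilleForm (z : CotangentBundle n N) : TangentSpace (cotangentModel n) z →L[ℝ] ℝ :=
  ContinuousLinearMap.comp (z.snd : TangentSpace (𝓡 n) z.proj →L[ℝ] ℝ) (dProj z)

/-- Fields of (not necessarily linear) pairings of tangent vectors of the cotangent bundle. -/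
abbrev Pairing (n : ℕ) (N : Type*) [TopologicalSpace N]
    [ChartedSpace (EuclideanSpace ℝ (Fin n)) N] [IsManifold (𝓡 n) ∞ N] : Type _ :=
  (z : CotangentBundle n N) →
    TangentSpace (cotangentModel n) z → TangentSpace (cotangentModel n) z → ℝ

/-- The twisted symplectic form `ω_σ = ω_0 + τ^*σ`, where `ω_0 = dλ = dp ∧ dq`. -/
def twistedForm (σ : FormField n N) : Pairing n N := fun z u w =>
  extDerivOneForm (cotangentModel n) (fun y : CotangentBundle n N => liouvilleForm y) z u w
    + σ z.proj (dProj z u) (dProj z w)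

/-- The deformation `ω_s = ω_0 + τ^*(μ + β(s) σ)`, `s ∈ ℝ`. -/
def twistedDeformation (μ σ : FormField n N) (β : ℝ → ℝ) (s : ℝ) : Pairing n N :=
  twistedForm (fun x => μ x + β s • σ x)

/-- The mechanical Hamiltonian `H_U(q, p) = ½|p|² + U(q)`. -/
def mechanicalHamiltonian (g : Metric n N) (U : N → ℝ) (z : CotangentBundle n N) : ℝ :=
  dualNormSq g z.proj z.snd / 2 + U z.proj

/-- The cut-off functions `b = β_ξ` with which the Hamiltonian is truncated. -/
structure IsLevelCutoff (ξ : ℝ) (b : ℝ → ℝ) : Prop where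
  smooth : ContDiff ℝ ∞ b
  deriv_nonneg : ∀ t, 0 ≤ deriv b t
  deriv_le_one : ∀ t, deriv b t ≤ 1
  eq_self : ∀ t, |t| ≤ ξ - min (1 / 3) (ξ / 3) → b t = t
  eq_top : ∀ t, ξ + min (1 / 3) (ξ / 3) ≤ t → b t = ξ
  eq_bot : ∀ t, ξ + min (1 / 3) (ξ / 3) ≤ -t → b t = -ξ

/-- The defining Hamiltonian `H = β_ξ ∘ (H_U - k)` of the hypersurface `Σ_k = {H_U = k}`. -/
def definingHamiltonian (g : Metric n N) (U : N → ℝ) (k : ℝ) (b : ℝ → ℝ)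
    (z : CotangentBundle n N) : ℝ :=
  b (mechanicalHamiltonian g U z - k)

/-- The Hamiltonian vector field of `H` with respect to `Ω`: the vector field `X` (unique, for
nondegenerate `Ω`) with `dH = -Ω(X, ·)`. -/
def hamVectorField (Ω : Pairing n N) (H : CotangentBundle n N → ℝ) (z : CotangentBundle n N) :
    TangentSpace (cotangentModel n) z :=
  haveI : Nonempty (TangentSpace (cotangentModel n) z) := ⟨0⟩
  Classical.epsilon fun X : TangentSpace (cotangentModel n) z =>
    ∀ u : TangentSpace (cotangentModel n) z,
      (mfderiv (cotangentModel n) 𝓘(ℝ, ℝ) H z u : ℝ) = -Ω z X u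

/-- Cut-off functions `β` in the flow parameter `s`. -/
structure IsTimeCutoff (β : ℝ → ℝ) : Prop where
  smooth : ContDiff ℝ ∞ β
  mem_unit : ∀ s, β s ∈ Set.Icc (0 : ℝ) 1
  eq_zero : ∀ s ≤ 0, β s = 0
  eq_one : ∀ s, 1 ≤ s → β s = 1
  deriv_nonneg : ∀ s, 0 ≤ deriv β s
  deriv_le_two : ∀ s, deriv β s ≤ 2

/-! ### Loops, the Rabinowitz action functional and its critical points -/

/-- Smooth loops `S¹ = ℝ/ℤ → T^*N`, as one-periodic smooth maps on the line. -/
structure IsSmoothLoop (x : ℝ → CotangentBundle n N) : Prop where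
  smooth : ContMDiff 𝓘(ℝ, ℝ) (cotangentModel n) ∞ x
  periodic : ∀ t, x (t + 1) = x t

/-- The velocity of a curve in the cotangent bundle. -/
def velocity (x : ℝ → CotangentBundle n N) (t : ℝ) : TangentSpace (cotangentModel n) (x t) :=
  mfderiv 𝓘(ℝ, ℝ) (cotangentModel n) x t (1 : ℝ)

/-- `∂_s v` at `(s, t)`. -/
def partialS (v : ℝ → ℝ → CotangentBundle n N) (s t : ℝ) :
    TangentSpace (cotangentModel n) (v s t) :=
  velocity (fun s' => v s' t) s

/-- `∂_t v` at `(s, t)`. -/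
def partialT (v : ℝ → ℝ → CotangentBundle n N) (s t : ℝ) :
    TangentSpace (cotangentModel n) (v s t) :=
  velocity (v s) t

/-- Smooth maps `ℝ × S¹ → T^*N`, that is, smooth one-parameter families of loops. -/
structure IsSmoothCylinder (v : ℝ → ℝ → CotangentBundle n N) : Prop where
  smooth : ContMDiff 𝓘(ℝ, ℝ × ℝ) (cotangentModel n) ∞ (fun q : ℝ × ℝ => v q.1 q.2)
  periodic : ∀ s t, v s (t + 1) = v s t

/-- `V` restricted to `[0, 1] × S¹` is a cylinder from the loop `x₀` to the loop `x₁`. -/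
structure IsCylinderBetween (x₀ x₁ : ℝ → CotangentBundle n N)
    (V : ℝ → ℝ → CotangentBundle n N) : Prop where
  isSmooth : IsSmoothCylinder V
  start : V 0 = x₀
  finish : V 1 = x₁

/-- Two loops are freely homotopic if they bound a common cylinder. -/
def FreelyHomotopic (x₀ x₁ : ℝ → CotangentBundle n N) : Prop :=
  ∃ V, IsCylinderBetween x₀ x₁ V

/-- The integral of the two-form `Ω` over the cylinder `V` restricted to `[0, 1] × S¹`. -/
def cylinderArea (Ω : Pairing n N) (V : ℝ → ℝ → CotangentBundle n N) : ℝ :=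
  ∫ r in (0 : ℝ)..1, ∫ t in (0 : ℝ)..1, Ω (V r t) (partialS V r t) (partialT V r t)

open Classical in
/-- The Rabinowitz action functional `∫_D v̄^*Ω - η ∫ H(v) dt` on the loops freely homotopic to the
reference loop `x₀`; here `v̄` is any cylinder from `x₀` to `v` (the value is independent of this
choice for the twisted forms considered here). -/
def rabinowitzAction (Ω : Pairing n N) (H : CotangentBundle n N → ℝ)
    (x₀ : ℝ → CotangentBundle n N) (v : ℝ → CotangentBundle n N) (η : ℝ) : ℝ :=
  (if h : FreelyHomotopic x₀ v then cylinderArea Ω h.choose else 0)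
    - η * ∫ t in (0 : ℝ)..1, H (v t)

/-- `w = (v, η)` is a critical point of the Rabinowitz action functional on the loops freely
homotopic to `x₀`: the derivative of the action vanishes along every smooth variation of `w`. -/
structure IsCriticalPoint (Ω : Pairing n N) (H : CotangentBundle n N → ℝ)
    (x₀ : ℝ → CotangentBundle n N) (w : (ℝ → CotangentBundle n N) × ℝ) : Prop where
  isLoop : IsSmoothLoop w.1
  homotopic : FreelyHomotopic x₀ w.1
  stationary : ∀ (V : ℝ → ℝ → CotangentBundle n N) (ζ : ℝ), IsSmoothCylinder V → V 0 = w.1 →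
    HasDerivAt (fun r : ℝ => rabinowitzAction Ω H x₀ (V r) (w.2 + r * ζ)) 0 0

/-! ### Almost complex structures and gradient flow lines -/

/-- Families `J_{t,s}` of endomorphisms of the tangent spaces of `T^*N`, as functions of `t`, `s`
and the point. -/
abbrev EndoFamily (n : ℕ) (N : Type*) [TopologicalSpace N]
    [ChartedSpace (EuclideanSpace ℝ (Fin n)) N] [IsManifold (𝓡 n) ∞ N] : Type _ :=
  ℝ → ℝ → (z : CotangentBundle n N) →
    TangentSpace (cotangentModel n) z →L[ℝ] TangentSpace (cotangentModel n) z

/-- `J_{t,s}`, `t ∈ S¹`, `s ∈ ℝ`, is a smooth family of almost complex structures such that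
`J_{t,s}` is `ω_s`-compatible, i.e. `ω_s(·, J_{t,s} ·)` is a Riemannian metric. -/
structure IsCompatibleFamily (Ω : ℝ → Pairing n N) (J : EndoFamily n N) : Prop where
  smooth : ContMDiff (𝓘(ℝ, ℝ × ℝ).prod (cotangentModel n))
    ((cotangentModel n).prod 𝓘(ℝ, CotangentModelSpace n →L[ℝ] CotangentModelSpace n)) ∞
    (fun q : (ℝ × ℝ) × CotangentBundle n N =>
      (TotalSpace.mk' (CotangentModelSpace n →L[ℝ] CotangentModelSpace n) q.2
        (J q.1.1 q.1.2 q.2) :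
        TotalSpace (CotangentModelSpace n →L[ℝ] CotangentModelSpace n)
          (fun z : CotangentBundle n N =>
            TangentSpace (cotangentModel n) z →L[ℝ] TangentSpace (cotangentModel n) z)))
  periodic : ∀ t s z, J (t + 1) s z = J t s z
  sq_eq_neg : ∀ t s z (u : TangentSpace (cotangentModel n) z), J t s z (J t s z u) = -u
  symm : ∀ t s z (u w : TangentSpace (cotangentModel n) z),
    Ω s z u (J t s z w) = Ω s z w (J t s z u)
  pos : ∀ t s z (u : TangentSpace (cotangentModel n) z), u ≠ 0 → 0 < Ω s z u (J t s z u)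

/-- The bounds by `A` on the norms `|·|_{t,s}` of the metrics `ω_s(·, J_{t,s} ·)`:
`|dτ u|_g² ≤ A |u|_{t,s}²` for all tangent vectors `u` of `T^*N`, and `|X_H^{ω_s}|_{t,s}² ≤ A`. -/
structure IsBoundedFamily (g : Metric n N) (Ω : ℝ → Pairing n N) (H : CotangentBundle n N → ℝ)
    (J : EndoFamily n N) (A : ℝ) : Prop where
  proj_le : ∀ t s z (u : TangentSpace (cotangentModel n) z),
    g.inner z.proj (dProj z u) (dProj z u) ≤ A * Ω s z u (J t s z u)
  ham_le : ∀ t s z,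
    Ω s z (hamVectorField (Ω s) H z) (J t s z (hamVectorField (Ω s) H z)) ≤ A

/-- `w = (v, η)` is a gradient flow line of the `s`-dependent Rabinowitz action functional:
`∂_s v + J_{t,s}(v)(∂_t v - η X_H^{ω_s}(v)) = 0` and `∂_s η + ∫ H(v) dt = 0`. -/
structure IsGradientFlowLine (Ω : ℝ → Pairing n N) (H : CotangentBundle n N → ℝ)
    (J : EndoFamily n N) (v : ℝ → ℝ → CotangentBundle n N) (η : ℝ → ℝ) : Prop where
  isSmooth : IsSmoothCylinder v
  smooth_multiplier : ContDiff ℝ ∞ η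
  loop_eq : ∀ s t, partialS v s t
    + J t s (v s t) (partialT v s t - η s • hamVectorField (Ω s) H (v s t)) = 0
  multiplier_eq : ∀ s, deriv η s + ∫ t in (0 : ℝ)..1, H (v s t) = 0

/-- `w(s) = (v(s, ·), η(s))` converges to `w₀` along the filter `l`: the loops converge in the
`C¹`-topology (their lifts `∂_t v` to the tangent bundle of `T^*N` converge uniformly in
`t ∈ S¹`, which is expressed as continuous convergence), and the multipliers converge. -/
structure ConvergesTo (v : ℝ → ℝ → CotangentBundle n N) (η : ℝ → ℝ) (l : Filter ℝ)
    (w₀ : (ℝ → CotangentBundle n N) × ℝ) : Prop where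
  loops : ∀ t₀ : ℝ, Tendsto
    (fun q : ℝ × ℝ => (⟨v q.1 q.2, partialT v q.1 q.2⟩ :
      TangentBundle (cotangentModel n) (CotangentBundle n N)))
    (l ×ˢ 𝓝 t₀) (𝓝 ⟨w₀.1 t₀, velocity w₀.1 t₀⟩)
  multipliers : Tendsto η l (𝓝 w₀.2)

/-- The energy `E(w) = ∫ ‖∂_s w‖_s² ds ∈ [0, ∞]`, where
`‖∂_s w‖_s² = ∫ ω_s(∂_s v, J_{t,s} ∂_s v) dt + |∂_s η|²`. -/
def energy (Ω : ℝ → Pairing n N) (J : EndoFamily n N)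
    (v : ℝ → ℝ → CotangentBundle n N) (η : ℝ → ℝ) : ENNReal :=
  ∫⁻ s : ℝ, ENNReal.ofReal
    ((∫ t in (0 : ℝ)..1, Ω s (v s t) (partialS v s t) (J t s (v s t) (partialS v s t)))
      + deriv η s ^ 2)

end Cotangent

end RabinowitzFloer

end

noncomputable section

namespace RabinowitzFloer

/-! ### Pull-backs of one-forms to normed spaces -/

section PullBack

/-! Let `e(s)` be the squared norm of the gradient at time `s`. Along a flow line the action has
derivative `e(s) + β'(s) Q(s)`, where `Q(s)` is the σ-area swept by the projected cylinder since the
initial time. So the energy is bounded by the action at the two ends and by `∫ β' |Q|`, and the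
theorem follows once this last integral can be absorbed.

The multiplier is controlled by the gap between `k` and the Mañé value of `μ`. Choose a primitive
`θ` of the lift of `μ` with `½|θ|² + U ≤ k - ε₀`. At a time of small gradient the loop lies near the
level `H_U = k`, where a momentum `m` satisfies `(m + θ)(m^♯) ≥ ½|m|² - ½|θ|² ≥ ε₀/2`. The velocity
is `J ∂_s v + η X_H`, and `X_H` projects to `m^♯`, so integrating `λ + θ` over the loop bounds `|η|`
by the action (`IsBoundedFlow.abs_multiplier_le`). Since `∂_s η` is bounded by `ξ` and an interval
without small gradient has length at most `E/ε²`, `η` is then controlled at all times by the energy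
and the action.

The second ingredient is the cylinder estimate `exists_cylinderBound`: `|Q| ≤ C |σ| (length +
length)`, with `C` independent of `σ`. The length of the loop at time `s` is at most `A (1 + e +
|η|)`, so for small `|σ|` the term `∫ β' |Q|` is absorbed. This bootstrap is the calculus lemma
`window_bound`, applied on `[-S, S]` for large `S`; convergence at the ends bounds the boundary
data.

For a fixed form the cylinder estimate follows from Green's formula and a bounded primitive on the
covering. The lift of a cylinder of non-contractible loops is a strip that need not be periodic, but
the form to be integrated is; averaging over many periods makes the sides of the strip negligible
(`le_integral_curl_of_periodic`).

The linear dependence on `|σ|` is more delicate, since the supremum of a primitive is not controlled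
by `|σ|`. In a chart, subtracting from `θ` the derivative of its radial primitive leaves a form of
size `O(|σ|)`. Gluing these local forms is a Čech–de Rham argument on a finite cover. The
obstruction consists of finitely many numbers, the holonomies of triangles, each of size `O(|σ|)`.
If they vanish, a partition of unity glues the local forms into one form of size `O(|σ|)`. In
general the holonomies are linear functionals on the space of pairs `(σ, θ)`, and an abstract
finite-rank correction (`IsGauge.exists_domination`) extends the estimate from their common kernel
to the whole space. -/

theorem two_le_smooth : (2 : WithTop ℕ∞) ≤ ∞ :=
  WithTop.coe_le_coe.2 (le_top : (2 : ℕ∞) ≤ ⊤)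

/-- The antisymmetrised derivative of a one-form on a normed space. -/
def curl {F : Type*} [NormedAddCommGroup F] [NormedSpace ℝ F] (Θ : F → F →L[ℝ] ℝ)
    (y u w : F) : ℝ :=
  fderiv ℝ Θ y u w - fderiv ℝ Θ y w u

variable {E : Type*} [NormedAddCommGroup E] [NormedSpace ℝ E]
  {H : Type*} [TopologicalSpace H] {I : ModelWithCorners ℝ E H}
  {M : Type*} [TopologicalSpace M] [ChartedSpace H M]
  {F : Type*} [NormedAddCommGroup F] [NormedSpace ℝ F]

/-- The pull-back of a one-form on a manifold by a map from a normed space. -/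
def pullOneForm (I : ModelWithCorners ℝ E H) (α : (x : M) → TangentSpace I x →L[ℝ] ℝ) (f : F → M)
    (y : F) : F →L[ℝ] ℝ :=
  (α (f y)).comp (mfderiv 𝓘(ℝ, F) I f y)

variable [IsManifold I ∞ M]

/-- The space of linear maps on a finite-dimensional space is a finite product of copies of the
target. Hence smoothness of pulled-back forms can be tested on one fixed vector at a time. -/
theorem contDiffAt_of_clm_apply [FiniteDimensional ℝ F] {F' : Type*} [NormedAddCommGroup F']
    [NormedSpace ℝ F'] {G : Type*} [NormedAddCommGroup G] [NormedSpace ℝ G] {m : WithTop ℕ∞}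
    {Θ : F' → F →L[ℝ] G} {y : F'} (h : ∀ e, ContDiffAt ℝ m (fun y => Θ y e) y) :
    ContDiffAt ℝ m Θ y := by
  let d := Module.finrank ℝ F
  have hd : d = Module.finrank ℝ (Fin d → ℝ) := (Module.finrank_fin_fun ℝ).symm
  let e₁ := ContinuousLinearEquiv.ofFinrankEq hd
  let e₂ := (e₁.arrowCongr (1 : G ≃L[ℝ] G)).trans (ContinuousLinearEquiv.piRing (Fin d))
  rw [← Function.id_comp Θ, ← e₂.symm_comp_self]
  exact e₂.symm.contDiff.contDiffAt.comp y (contDiffAt_pi.mpr fun i => h _)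

theorem contMDiffAt_mfderiv_apply {f : F → M} {y : F} (hf : ContMDiffAt 𝓘(ℝ, F) I ∞ f y) (e : F) :
    ContMDiffAt 𝓘(ℝ, F) (I.prod 𝓘(ℝ, E)) ∞
      (fun y : F => (TotalSpace.mk' E (f y) (mfderiv 𝓘(ℝ, F) I f y e) : TangentBundle I M)) y := by
  have h1 := hf.mfderiv_const (m := ∞) (by simp)
  have h2 : ContMDiffAt 𝓘(ℝ, F) (𝓘(ℝ, F).prod 𝓘(ℝ, F)) ∞
      (fun y : F => (TotalSpace.mk' F y e : TangentBundle 𝓘(ℝ, F) F)) y := by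
    rw [contMDiffAt_totalSpace]
    refine ⟨contMDiffAt_id, ?_⟩
    simp only [mfld_simps]
    exact contMDiffAt_const
  exact ContMDiffAt.clm_apply_of_inCoordinates (b₁ := id) (b₂ := f) (v := fun _ => e)
    (ϕ := fun y => mfderiv 𝓘(ℝ, F) I f y) h1 h2 hf

theorem contDiffAt_pullOneForm [FiniteDimensional ℝ F] {α : (x : M) → TangentSpace I x →L[ℝ] ℝ}
    (hα : IsSmoothOneForm I α) {f : F → M} {y : F} (hf : ContMDiffAt 𝓘(ℝ, F) I ∞ f y) :
    ContDiffAt ℝ ∞ (pullOneForm I α f) y := by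
  have key : ∀ e, ContDiffAt ℝ ∞ (fun y => pullOneForm I α f y e) y := by
    intro e
    have h1 : ContMDiffAt 𝓘(ℝ, F) (I.prod 𝓘(ℝ, E →L[ℝ] ℝ)) ∞
        (fun y => (TotalSpace.mk' (E →L[ℝ] ℝ) (f y) (α (f y)) :
          TotalSpace (E →L[ℝ] ℝ) (fun x : M => TangentSpace I x →L[ℝ] ℝ))) y :=
      (hα (f y)).comp y hf
    have h2 := ContMDiffAt.clm_bundle_apply (F₂ := ℝ) (E₂ := fun _ : M => ℝ) h1
      (contMDiffAt_mfderiv_apply hf e)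
    rw [contMDiffAt_totalSpace] at h2
    exact contMDiffAt_iff_contDiffAt.1 h2.2
  exact contDiffAt_of_clm_apply key

theorem contDiffAt_chart_comp {f : F → M} {y : F} (hf : ContMDiffAt 𝓘(ℝ, F) I ∞ f y) :
    ContDiffAt ℝ ∞ (extChartAt I (f y) ∘ f) y := by
  rw [← contMDiffAt_iff_contDiffAt]
  exact (contMDiffAt_extChartAt (n := ∞) (I := I) (x := f y)).comp y hf

/-- Factoring `f` through the fixed chart at `f y` turns the pull-back near `y` into a composition
of maps between normed spaces. The chart is the one that enters the definition of `extDerivOneForm`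
at `f y`. -/
theorem eventually_pullOneForm_eq [I.Boundaryless] (α : (x : M) → TangentSpace I x →L[ℝ] ℝ)
    {f : F → M} {y : F} (hf : ContMDiffAt 𝓘(ℝ, F) I ∞ f y) :
    ∀ᶠ y' in 𝓝 y, pullOneForm I α f y' =
      (oneFormInChart I α (f y) (extChartAt I (f y) (f y'))).comp
        (fderiv ℝ (extChartAt I (f y) ∘ f) y') := by
  have h1 : ∀ᶠ y' in 𝓝 y, f y' ∈ (extChartAt I (f y)).source :=
    hf.continuousAt.preimage_mem_nhds (extChartAt_source_mem_nhds (I := I) (f y))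
  have h2 : ∀ᶠ y' in 𝓝 y, ContMDiffAt 𝓘(ℝ, F) I 1 f y' :=
    (contMDiffAt_iff_contMDiffAt_nhds (by simp)).1 (hf.of_le (m := 1) (by simp))
  filter_upwards [h1, h2, h1.eventually_nhds] with y' h1 h2 h3
  have hs : MDifferentiableAt 𝓘(ℝ, E) I (extChartAt I (f y)).symm (extChartAt I (f y) (f y')) :=
    ((contMDiffOn_extChartAt_symm (n := 1) (f y)).contMDiffAt
      ((isOpen_extChartAt_target (f y)).mem_nhds
        ((extChartAt I (f y)).map_source h1))).mdifferentiableAt (by simp)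
  have hφ : MDifferentiableAt 𝓘(ℝ, F) 𝓘(ℝ, E) (extChartAt I (f y) ∘ f) y' :=
    ((contMDiffAt_extChartAt' (n := 1) (I := I) (by simpa using h1)).comp y' h2).mdifferentiableAt
      (by simp)
  have he : f =ᶠ[𝓝 y'] (extChartAt I (f y)).symm ∘ (extChartAt I (f y) ∘ f) := by
    filter_upwards [h3] with z hz
    exact ((extChartAt I (f y)).left_inv hz).symm
  have hd : mfderiv 𝓘(ℝ, F) I f y' =
      (mfderiv 𝓘(ℝ, E) I (extChartAt I (f y)).symm (extChartAt I (f y) (f y'))).comp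
        (fderiv ℝ (extChartAt I (f y) ∘ f) y') := by
    rw [he.mfderiv_eq]
    refine (mfderiv_comp (I' := 𝓘(ℝ, E)) y' hs hφ).trans ?_
    rw [mfderiv_eq_fderiv]
    rfl
  have hx := (extChartAt I (f y)).left_inv h1
  ext e
  have h := congrArg (fun L : F →L[ℝ] E => L e) hd
  change α (f y') (mfderiv 𝓘(ℝ, F) I f y' e) = α _ (mfderiv 𝓘(ℝ, E) I _ _ _)
  have hα : ∀ x x' : M, x = x' → ∀ e : E, (α x : E →L[ℝ] ℝ) e = (α x' : E →L[ℝ] ℝ) e := by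
    rintro x _ rfl e
    rfl
  exact (congrArg (α (f y')) h).trans (hα _ _ hx.symm _)

/-- In the product rule the terms with the second derivative of the coordinate map cancel by
symmetry. Smoothness is required only of the chart expressions at their base points, so that the
lemma serves smooth sections and the Liouville form alike. -/
theorem curl_pullOneForm [FiniteDimensional ℝ E] [I.Boundaryless] {α : (x : M) → TangentSpace I x →L[ℝ] ℝ}
    (hα : ∀ x, ContDiffAt ℝ ∞ (oneFormInChart I α x) (extChartAt I x x))
    {f : F → M} {y : F} (hf : ContMDiffAt 𝓘(ℝ, F) I ∞ f y) (u w : F) :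
    curl (pullOneForm I α f) y u w =
      extDerivOneForm I α (f y) (mfderiv 𝓘(ℝ, F) I f y u) (mfderiv 𝓘(ℝ, F) I f y w) := by
  have hφ := contDiffAt_chart_comp hf
  have hφ1 : DifferentiableAt ℝ (extChartAt I (f y) ∘ f) y := hφ.differentiableAt (by simp)
  have hφ2 : DifferentiableAt ℝ (fderiv ℝ (extChartAt I (f y) ∘ f)) y :=
    (hφ.fderiv_right (m := 1) (by rw [one_add_one_eq_two]; exact two_le_smooth)).differentiableAt (by simp)
  have hΘ : DifferentiableAt ℝ (oneFormInChart I α (f y)) ((extChartAt I (f y) ∘ f) y) :=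
    (hα (f y)).differentiableAt (by simp)
  have hD : HasFDerivAt (pullOneForm I α f) _ y :=
    ((hΘ.hasFDerivAt.comp y hφ1.hasFDerivAt).clm_comp hφ2.hasFDerivAt).congr_of_eventuallyEq
      (eventually_pullOneForm_eq α hf)
  have hsym : IsSymmSndFDerivAt ℝ (extChartAt I (f y) ∘ f) y :=
    hφ.isSymmSndFDerivAt (by simpa using two_le_smooth)
  have hchain : ∀ e, mfderiv I 𝓘(ℝ, E) (extChartAt I (f y)) (f y) (mfderiv 𝓘(ℝ, F) I f y e) =
      fderiv ℝ (extChartAt I (f y) ∘ f) y e := by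
    intro e
    rw [← mfderiv_eq_fderiv]
    rw [mfderiv_comp (I' := I) y
      (mdifferentiableAt_extChartAt (mem_chart_source H (f y))) (hf.mdifferentiableAt (by simp))]
    rfl
  have he : extDerivOneForm I α (f y) (mfderiv 𝓘(ℝ, F) I f y u) (mfderiv 𝓘(ℝ, F) I f y w) = _ :=
    congrArg₂ (fun a b : E => fderiv ℝ (oneFormInChart I α (f y)) (extChartAt I (f y) (f y)) a b
      - fderiv ℝ (oneFormInChart I α (f y)) (extChartAt I (f y) (f y)) b a) (hchain u) (hchain w)
  rw [he, curl, hD.fderiv]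
  have hsym' := hsym.eq u w
  change oneFormInChart I α (f y) (extChartAt I (f y) (f y))
      (fderiv ℝ (fderiv ℝ (extChartAt I (f y) ∘ f)) y u w) + fderiv ℝ (oneFormInChart I α (f y))
        (extChartAt I (f y) (f y)) (fderiv ℝ (extChartAt I (f y) ∘ f) y u)
          (fderiv ℝ (extChartAt I (f y) ∘ f) y w) -
    (oneFormInChart I α (f y) (extChartAt I (f y) (f y))
      (fderiv ℝ (fderiv ℝ (extChartAt I (f y) ∘ f)) y w u) + fderiv ℝ (oneFormInChart I α (f y))
        (extChartAt I (f y) (f y)) (fderiv ℝ (extChartAt I (f y) ∘ f) y w)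
          (fderiv ℝ (extChartAt I (f y) ∘ f) y u)) = _
  rw [hsym']
  ring

theorem contDiffAt_oneFormInChart [FiniteDimensional ℝ E] [I.Boundaryless]
    {α : (x : M) → TangentSpace I x →L[ℝ] ℝ} (hα : IsSmoothOneForm I α) (x : M) :
    ContDiffAt ℝ ∞ (oneFormInChart I α x) (extChartAt I x x) :=
  contDiffAt_pullOneForm hα ((contMDiffOn_extChartAt_symm x).contMDiffAt
    (extChartAt_target_mem_nhds x))

theorem curl_pullOneForm_of_isSmooth [FiniteDimensional ℝ E] [I.Boundaryless]
    {α : (x : M) → TangentSpace I x →L[ℝ] ℝ} (hα : IsSmoothOneForm I α) {f : F → M} {y : F}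
    (hf : ContMDiffAt 𝓘(ℝ, F) I ∞ f y) (u w : F) :
    curl (pullOneForm I α f) y u w =
      extDerivOneForm I α (f y) (mfderiv 𝓘(ℝ, F) I f y u) (mfderiv 𝓘(ℝ, F) I f y w) :=
  curl_pullOneForm (contDiffAt_oneFormInChart hα) hf u w

end PullBack

/-! ### Integrals depending on a parameter and Green's formula -/

section Plane

theorem hasDerivAt_integral_param {F : ℝ × ℝ → ℝ} (hF : ContDiff ℝ 1 F) (a b s : ℝ) :
    HasDerivAt (fun s => ∫ t in a..b, F (s, t)) (∫ t in a..b, fderiv ℝ F (s, t) (1, 0)) s := by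
  have hc : Continuous fun q : ℝ × ℝ => fderiv ℝ F q (1, 0) :=
    (hF.continuous_fderiv (by simp)).clm_apply continuous_const
  have hd : ∀ s t, HasDerivAt (fun s => F (s, t)) (fderiv ℝ F (s, t) (1, 0)) s := by
    intro s t
    exact ((hF.differentiable (by simp)) (s, t)).hasFDerivAt.comp_hasDerivAt s
      ((hasDerivAt_id s).prodMk (hasDerivAt_const s t))
  obtain ⟨C, hC⟩ := ((isCompact_Icc (a := s - 1) (b := s + 1)).prod
    (isCompact_uIcc (a := a) (b := b))).exists_bound_of_continuousOn hc.continuousOn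
  refine (intervalIntegral.hasDerivAt_integral_of_dominated_loc_of_deriv_le
    (F := fun s t => F (s, t)) (F' := fun s t => fderiv ℝ F (s, t) (1, 0)) (bound := fun _ => C)
    (Icc_mem_nhds (sub_one_lt s) (lt_add_one s)) ?_ ?_ ?_ ?_ ?_ ?_).2
  · exact Eventually.of_forall fun s =>
      (hF.continuous.comp (by fun_prop : Continuous fun t : ℝ => (s, t))).aestronglyMeasurable
  · exact (hF.continuous.comp (by fun_prop : Continuous fun t : ℝ => (s, t))).intervalIntegrable _ _
  · exact (hc.comp (by fun_prop : Continuous fun t : ℝ => (s, t))).aestronglyMeasurable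
  · exact Eventually.of_forall fun t ht s hs => hC (s, t) ⟨hs, Set.uIoc_subset_uIcc ht⟩
  · exact intervalIntegrable_const
  · exact Eventually.of_forall fun t ht s hs => hd s t

/-- The `s`-derivative of the `dt`-coefficient is the curl plus the `t`-derivative of the
`ds`-coefficient, and the latter integrates to boundary values. For closed loops these values
cancel, which gives the first variation of the action. -/
theorem hasDerivAt_integral_oneForm {Θ : ℝ × ℝ → ℝ × ℝ →L[ℝ] ℝ} (hΘ : ContDiff ℝ 1 Θ) (a b s : ℝ) :
    HasDerivAt (fun s => ∫ t in a..b, Θ (s, t) (0, 1))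
      ((∫ t in a..b, curl Θ (s, t) (1, 0) (0, 1)) + (Θ (s, b) (1, 0) - Θ (s, a) (1, 0))) s := by
  have h1 : ∀ e : ℝ × ℝ, ContDiff ℝ 1 fun q => Θ q e := fun e => hΘ.clm_apply contDiff_const
  have h2 : ∀ (e q e' : ℝ × ℝ), fderiv ℝ (fun q => Θ q e) q e' = fderiv ℝ Θ q e' e := by
    intro e q e'
    have := ((hΘ.differentiable (by simp) q).hasFDerivAt.clm_apply (hasFDerivAt_const e q)).fderiv
    rw [this]
    simp
  have hc : ∀ e e' : ℝ × ℝ, Continuous fun t : ℝ => fderiv ℝ Θ (s, t) e e' := by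
    intro e e'
    have : Continuous fun q : ℝ × ℝ => fderiv ℝ Θ q e e' :=
      ((hΘ.continuous_fderiv (by simp)).clm_apply continuous_const).clm_apply continuous_const
    exact this.comp (by fun_prop : Continuous fun t : ℝ => (s, t))
  have h3 := hasDerivAt_integral_param (h1 (0, 1)) a b s
  have h4 : ∫ t in a..b, fderiv ℝ Θ (s, t) (0, 1) (1, 0) = Θ (s, b) (1, 0) - Θ (s, a) (1, 0) := by
    refine intervalIntegral.integral_eq_sub_of_hasDerivAt (f := fun t => Θ (s, t) (1, 0)) ?_
      ((hc _ _).intervalIntegrable _ _)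
    intro t _
    rw [← h2]
    exact (((h1 (1, 0)).differentiable (by simp)) (s, t)).hasFDerivAt.comp_hasDerivAt t
      ((hasDerivAt_const t s).prodMk (hasDerivAt_id t))
  convert h3 using 1
  rw [← h4, ← intervalIntegral.integral_add]
  · refine intervalIntegral.integral_congr fun t _ => ?_
    simp only [h2, curl]
    ring
  · exact ((hc _ _).sub (hc _ _)).intervalIntegrable _ _
  · exact (hc _ _).intervalIntegrable _ _

theorem continuous_curl {F : Type*} [NormedAddCommGroup F] [NormedSpace ℝ F] {Θ : F → F →L[ℝ] ℝ}
    (hΘ : ContDiff ℝ 1 Θ) (u w : F) : Continuous fun q => curl Θ q u w :=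
  (((hΘ.continuous_fderiv (by simp)).clm_apply continuous_const).clm_apply continuous_const).sub
    (((hΘ.continuous_fderiv (by simp)).clm_apply continuous_const).clm_apply continuous_const)

theorem continuous_integral_param {F : ℝ × ℝ → ℝ} (hF : Continuous F) (a b : ℝ) :
    Continuous fun s => ∫ t in a..b, F (s, t) :=
  intervalIntegral.continuous_parametric_intervalIntegral_of_continuous' (f := fun s t => F (s, t))
    hF a b

/-- Green's formula. -/
theorem integral_integral_curl {Θ : ℝ × ℝ → ℝ × ℝ →L[ℝ] ℝ} (hΘ : ContDiff ℝ 1 Θ) (a b s₀ s₁ : ℝ) :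
    ∫ s in s₀..s₁, ∫ t in a..b, curl Θ (s, t) (1, 0) (0, 1) =
      (∫ t in a..b, Θ (s₁, t) (0, 1)) - (∫ t in a..b, Θ (s₀, t) (0, 1))
        - ((∫ s in s₀..s₁, Θ (s, b) (1, 0)) - ∫ s in s₀..s₁, Θ (s, a) (1, 0)) := by
  have hc : ∀ t : ℝ, Continuous fun s : ℝ => Θ (s, t) (1, 0) := fun t =>
    ((hΘ.continuous.clm_apply continuous_const).comp (by fun_prop : Continuous fun s : ℝ => (s, t)))
  have h1 := continuous_integral_param (continuous_curl hΘ (1, 0) (0, 1)) a b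
  have h2 := intervalIntegral.integral_eq_sub_of_hasDerivAt (a := s₀) (b := s₁)
    (fun s _ => hasDerivAt_integral_oneForm hΘ a b s)
    ((h1.add ((hc b).sub (hc a))).intervalIntegrable _ _)
  have h3 : Continuous fun s => Θ (s, b) (1, 0) - Θ (s, a) (1, 0) := (hc b).sub (hc a)
  rw [intervalIntegral.integral_add (h1.intervalIntegrable _ _)
    (h3.intervalIntegrable _ _), intervalIntegral.integral_sub
      ((hc b).intervalIntegrable _ _) ((hc a).intervalIntegrable _ _)] at h2
  linarith

end Plane

end RabinowitzFloer
end

noncomputable section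

namespace RabinowitzFloer

/-! ### The metric and the dual norm -/

section Metric

theorem isInvertible_of_posDef {E : Type*} [NormedAddCommGroup E] [NormedSpace ℝ E]
    [FiniteDimensional ℝ E] (B : E →L[ℝ] E →L[ℝ] ℝ) (hB : ∀ v, v ≠ 0 → 0 < B v v) :
    B.IsInvertible := by
  have hinj : Function.Injective (B : E →ₗ[ℝ] E →L[ℝ] ℝ) := by
    rw [← LinearMap.ker_eq_bot, LinearMap.ker_eq_bot']
    intro v hv
    by_contra h
    have h1 := hB v h
    have h2 : B v v = 0 := by
      have : B v = 0 := hv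
      rw [this]; rfl
    exact h1.ne' h2
  have hdim : Module.finrank ℝ E = Module.finrank ℝ (E →L[ℝ] ℝ) := by
    rw [← (LinearMap.toContinuousLinearMap (𝕜 := ℝ) (E := E) (F' := ℝ)).finrank_eq]
    exact (Subspace.dual_finrank_eq).symm
  exact ⟨(LinearEquiv.ofInjectiveOfFinrankEq (B : E →ₗ[ℝ] E →L[ℝ] ℝ) hinj
    hdim).toContinuousLinearEquiv, by ext; rfl⟩

variable {n : ℕ} {N : Type*} [TopologicalSpace N] [ChartedSpace (EuclideanSpace ℝ (Fin n)) N]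
  [IsManifold (𝓡 n) ∞ N]

theorem isInvertible_metric (g : Metric n N) (x : N) : (g.inner x).IsInvertible :=
  isInvertible_of_posDef (E := EuclideanSpace ℝ (Fin n)) (g.inner x) (g.pos x)

/-- The tangent vector representing a covector. -/
def sharp (g : Metric n N) (x : N) (a : TangentSpace (𝓡 n) x →L[ℝ] ℝ) : TangentSpace (𝓡 n) x :=
  (g.inner x).inverse a

theorem inner_sharp (g : Metric n N) (x : N) (a : TangentSpace (𝓡 n) x →L[ℝ] ℝ) :
    g.inner x (sharp g x a) = a :=
  (isInvertible_metric g x).self_apply_inverse a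

theorem inner_self_nonneg (g : Metric n N) (x : N) (u : TangentSpace (𝓡 n) x) :
    0 ≤ g.inner x u u := by
  by_cases h : u = 0
  · simp [h]
  · exact (g.pos x u h).le

theorem inner_mul_le (g : Metric n N) (x : N) (u w : TangentSpace (𝓡 n) x) :
    g.inner x u w ^ 2 ≤ g.inner x u u * g.inner x w w := by
  by_cases h : u = 0
  · simp [h]
  have h1 := g.pos x u h
  have h2 := inner_self_nonneg g x (g.inner x u u • w - g.inner x u w • u)
  simp only [map_sub, map_smul, sub_apply, smul_apply,
    smul_eq_mul, g.symm x w u] at h2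
  have h3 : 0 ≤ g.inner x u u * (g.inner x u u * g.inner x w w - g.inner x u w ^ 2) := by
    nlinarith
  linarith [nonneg_of_mul_nonneg_right h3 h1]

/-- The length of a tangent vector. -/
def tangentNorm (g : Metric n N) (x : N) (u : TangentSpace (𝓡 n) x) : ℝ :=
  Real.sqrt (g.inner x u u)

theorem tangentNorm_nonneg (g : Metric n N) (x : N) (u : TangentSpace (𝓡 n) x) :
    0 ≤ tangentNorm g x u := Real.sqrt_nonneg _

theorem tangentNorm_sq (g : Metric n N) (x : N) (u : TangentSpace (𝓡 n) x) :
    tangentNorm g x u ^ 2 = g.inner x u u := Real.sq_sqrt (inner_self_nonneg g x u)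

theorem abs_inner_le (g : Metric n N) (x : N) (u w : TangentSpace (𝓡 n) x) :
    |g.inner x u w| ≤ tangentNorm g x u * tangentNorm g x w := by
  apply abs_le_of_sq_le_sq _ (mul_nonneg (tangentNorm_nonneg _ _ _) (tangentNorm_nonneg _ _ _))
  rw [mul_pow, tangentNorm_sq, tangentNorm_sq]
  exact inner_mul_le g x u w

theorem tangentNorm_add_le (g : Metric n N) (x : N) (u w : TangentSpace (𝓡 n) x) :
    tangentNorm g x (u + w) ≤ tangentNorm g x u + tangentNorm g x w := by
  refine (le_abs_self _).trans (abs_le_of_sq_le_sq ?_ (add_nonneg (tangentNorm_nonneg _ _ _) (tangentNorm_nonneg _ _ _)))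
  have h := (abs_le.1 (abs_inner_le g x u w)).2
  have h1 := tangentNorm_sq g x u
  have h2 := tangentNorm_sq g x w
  rw [tangentNorm_sq]
  simp only [map_add, add_apply, g.symm x w u]
  nlinarith

theorem tangentNorm_smul (g : Metric n N) (x : N) (c : ℝ) (u : TangentSpace (𝓡 n) x) :
    tangentNorm g x (c • u) = |c| * tangentNorm g x u := by
  unfold tangentNorm
  simp only [map_smul, smul_apply, smul_eq_mul]
  rw [← mul_assoc, Real.sqrt_mul (mul_self_nonneg c), Real.sqrt_mul_self_eq_abs]

theorem dualNormSq_eq (g : Metric n N) (x : N) (a : TangentSpace (𝓡 n) x →L[ℝ] ℝ) :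
    dualNormSq g x a = tangentNorm g x (sharp g x a) ^ 2 := by
  rw [tangentNorm_sq, inner_sharp]
  rfl

theorem apply_sharp (g : Metric n N) (x : N) (a b : TangentSpace (𝓡 n) x →L[ℝ] ℝ) :
    b (sharp g x a) = g.inner x (sharp g x b) (sharp g x a) := by
  rw [inner_sharp]

theorem dualNormSq_nonneg (g : Metric n N) (x : N) (a : TangentSpace (𝓡 n) x →L[ℝ] ℝ) :
    0 ≤ dualNormSq g x a := by
  rw [dualNormSq_eq]; positivity

theorem abs_apply_le (g : Metric n N) (x : N) (a : TangentSpace (𝓡 n) x →L[ℝ] ℝ)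
    (u : TangentSpace (𝓡 n) x) : |a u| ≤ Real.sqrt (dualNormSq g x a) * tangentNorm g x u := by
  have h := abs_inner_le g x (sharp g x a) u
  rwa [inner_sharp, ← Real.sqrt_sq (tangentNorm_nonneg g x (sharp g x a)), ← dualNormSq_eq] at h

/-- In local trivialisations the metric is an invertible linear map depending smoothly on the point,
and inversion is smooth at invertible maps. -/
theorem contMDiff_metric_inverse (g : Metric n N) :
    ContMDiff (𝓡 n) ((𝓡 n).prod
        𝓘(ℝ, (EuclideanSpace ℝ (Fin n) →L[ℝ] ℝ) →L[ℝ] EuclideanSpace ℝ (Fin n))) ∞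
      (fun x : N => (TotalSpace.mk'
        ((EuclideanSpace ℝ (Fin n) →L[ℝ] ℝ) →L[ℝ] EuclideanSpace ℝ (Fin n)) x
        (g.inner x).inverse :
        TotalSpace ((EuclideanSpace ℝ (Fin n) →L[ℝ] ℝ) →L[ℝ] EuclideanSpace ℝ (Fin n))
          (fun x : N => (TangentSpace (𝓡 n) x →L[ℝ] ℝ) →L[ℝ] TangentSpace (𝓡 n) x))) := by
  intro x₀
  rw [contMDiffAt_hom_bundle]
  refine ⟨contMDiffAt_id, ?_⟩
  have h1 := ((contMDiffAt_hom_bundle _).1 (g.contMDiff x₀)).2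
  have h2 := ContMDiffAt.comp x₀ (ContDiffAt.contMDiffAt
    (ContinuousLinearMap.IsInvertible.contDiffAt_map_inverse (𝕜 := ℝ) (n := ∞) ?_)) h1
  · refine h2.congr_of_eventuallyEq ?_
    have A : (trivializationAt (EuclideanSpace ℝ (Fin n)) (TangentSpace (𝓡 n)) x₀).baseSet
        ∈ 𝓝 x₀ :=
      (trivializationAt _ _ _).open_baseSet.mem_nhds (FiberBundle.mem_baseSet_trivializationAt' _)
    have B : (trivializationAt (EuclideanSpace ℝ (Fin n) →L[ℝ] ℝ)
        (fun x : N => TangentSpace (𝓡 n) x →L[ℝ] ℝ) x₀).baseSet ∈ 𝓝 x₀ :=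
      (trivializationAt _ _ _).open_baseSet.mem_nhds (FiberBundle.mem_baseSet_trivializationAt' _)
    filter_upwards [A, B] with x hx h'x
    simp only [Function.comp_apply]
    rw [ContinuousLinearMap.inCoordinates_eq hx h'x, ContinuousLinearMap.inCoordinates_eq h'x hx]
    simp only [ContinuousLinearMap.inverse_equiv_comp, ContinuousLinearMap.inverse_comp_equiv,
      ContinuousLinearEquiv.symm_symm]
    rfl
  · rw [ContinuousLinearMap.inCoordinates_eq (FiberBundle.mem_baseSet_trivializationAt' x₀)
      (FiberBundle.mem_baseSet_trivializationAt' x₀)]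
    exact ContinuousLinearMap.isInvertible_equiv.comp
      ((isInvertible_metric g x₀).comp ContinuousLinearMap.isInvertible_equiv)

theorem contMDiff_proj_cotangent :
    ContMDiff (cotangentModel n) (𝓡 n) ∞ (fun z : CotangentBundle n N => z.proj) :=
  contMDiff_proj _

theorem contMDiff_dualNormSq (g : Metric n N) :
    ContMDiff (cotangentModel n) 𝓘(ℝ, ℝ) ∞
      (fun z : CotangentBundle n N => dualNormSq g z.proj z.snd) := by
  intro z
  have h0 : ContMDiffAt (cotangentModel n) (cotangentModel n) ∞
      (fun z : CotangentBundle n N => (TotalSpace.mk' (EuclideanSpace ℝ (Fin n) →L[ℝ] ℝ) z.proj z.snd :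
        CotangentBundle n N)) z := contMDiffAt_id
  have h1 := ContMDiffAt.clm_bundle_apply (b := fun z : CotangentBundle n N => z.proj)
    ((contMDiff_metric_inverse g z.proj).comp z (contMDiff_proj_cotangent z)) h0
  have h2 := ContMDiffAt.clm_bundle_apply (F₂ := ℝ) (E₂ := fun _ : N => ℝ) h0 h1
  rw [contMDiffAt_totalSpace] at h2
  exact h2.2

end Metric

end RabinowitzFloer
end

noncomputable section

namespace RabinowitzFloer

/-! ### The Liouville form and the twisted forms -/

section Liouville

variable {n : ℕ} {N : Type*} [TopologicalSpace N] [ChartedSpace (EuclideanSpace ℝ (Fin n)) N]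
  [IsManifold (𝓡 n) ∞ N]
  {F : Type*} [NormedAddCommGroup F] [NormedSpace ℝ F]

theorem dProj_mfderiv {f : F → CotangentBundle n N} {y : F}
    (hf : ContMDiffAt 𝓘(ℝ, F) (cotangentModel n) 1 f y) (e : F) :
    dProj (f y) (mfderiv 𝓘(ℝ, F) (cotangentModel n) f y e) =
      mfderiv 𝓘(ℝ, F) (𝓡 n) (fun y => (f y).proj) y e := by
  have h : mfderiv 𝓘(ℝ, F) (𝓡 n) ((fun z : CotangentBundle n N => z.proj) ∘ f) y = _ :=
    mfderiv_comp (I' := cotangentModel n) y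
    ((contMDiff_proj_cotangent (f y)).mdifferentiableAt (by simp)) (hf.mdifferentiableAt (by simp))
  exact (congrArg (fun L : F →L[ℝ] EuclideanSpace ℝ (Fin n) => L e) h).symm

theorem pullOneForm_liouville {f : F → CotangentBundle n N} {y : F}
    (hf : ContMDiffAt 𝓘(ℝ, F) (cotangentModel n) 1 f y) (e : F) :
    pullOneForm (cotangentModel n) liouvilleForm f y e =
      (f y).snd (mfderiv 𝓘(ℝ, F) (𝓡 n) (fun y => (f y).proj) y e) := by
  rw [← dProj_mfderiv hf]
  rfl

/-- The map `f` is itself a smooth field of covectors along its projection, and the pulled-back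
Liouville form is its value on the derivative of that projection. -/
theorem contDiffAt_pullOneForm_liouville [FiniteDimensional ℝ F] {f : F → CotangentBundle n N}
    {y : F} (hf : ContMDiffAt 𝓘(ℝ, F) (cotangentModel n) ∞ f y) :
    ContDiffAt ℝ ∞ (pullOneForm (cotangentModel n) liouvilleForm f) y := by
  refine contDiffAt_of_clm_apply fun e => ?_
  have h1 : ContMDiffAt 𝓘(ℝ, F) (𝓡 n) ∞ (fun y => (f y).proj) y :=
    (contMDiff_proj_cotangent (f y)).comp y hf
  have h2 := ContMDiffAt.clm_bundle_apply (F₂ := ℝ) (E₂ := fun _ : N => ℝ)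
    (ϕ := fun y => (f y).snd) (b := fun y => (f y).proj) hf (contMDiffAt_mfderiv_apply h1 e)
  rw [contMDiffAt_totalSpace] at h2
  refine (contMDiffAt_iff_contDiffAt.1 h2.2).congr_of_eventuallyEq ?_
  filter_upwards [(contMDiffAt_iff_contMDiffAt_nhds (by simp)).1 (hf.of_le (m := 1) (by simp))]
    with y' hy'
  exact pullOneForm_liouville hy' e

theorem curl_pullOneForm_liouville {f : F → CotangentBundle n N} {y : F}
    (hf : ContMDiffAt 𝓘(ℝ, F) (cotangentModel n) ∞ f y) (u w : F) :
    curl (pullOneForm (cotangentModel n) liouvilleForm f) y u w =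
      extDerivOneForm (cotangentModel n) (fun y : CotangentBundle n N => liouvilleForm y) (f y)
        (mfderiv 𝓘(ℝ, F) (cotangentModel n) f y u) (mfderiv 𝓘(ℝ, F) (cotangentModel n) f y w) :=
  curl_pullOneForm (fun z => contDiffAt_pullOneForm_liouville
    ((contMDiffOn_extChartAt_symm z).contMDiffAt (extChartAt_target_mem_nhds z))) hf u w

/-- The curve `b ↦ z + b ζ` in the fibre through `z`. -/
def fiberLine (z : CotangentBundle n N) (ζ : TangentSpace (𝓡 n) z.proj →L[ℝ] ℝ) (b : ℝ) :
    CotangentBundle n N :=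
  ⟨z.proj, z.snd + b • ζ⟩

theorem mfderiv_comp_curve {E : Type*} [NormedAddCommGroup E] [NormedSpace ℝ E]
    {H : Type*} [TopologicalSpace H] {I : ModelWithCorners ℝ E H}
    {M : Type*} [TopologicalSpace M] [ChartedSpace H M] {f : F → M} {c : ℝ → F} {c' : F} {a : ℝ}
    (hf : MDifferentiableAt 𝓘(ℝ, F) I f (c a)) (hc : HasDerivAt c c' a) :
    (mfderiv 𝓘(ℝ, ℝ) I (fun a => f (c a)) a (1 : ℝ) : E) = mfderiv 𝓘(ℝ, F) I f (c a) c' := by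
  have h : mfderiv 𝓘(ℝ, ℝ) I (f ∘ c) a = _ := mfderiv_comp (I' := 𝓘(ℝ, F)) a hf
    hc.hasFDerivAt.differentiableAt.mdifferentiableAt
  have h1 : mfderiv 𝓘(ℝ, ℝ) 𝓘(ℝ, F) c a = fderiv ℝ c a := mfderiv_eq_fderiv
  have h2 : fderiv ℝ c a (1 : ℝ) = c' := by
    rw [hc.hasFDerivAt.fderiv]; simp
  have h3 := congrArg (fun L : ℝ →L[ℝ] E => L 1) h
  refine h3.trans ?_
  change (mfderiv 𝓘(ℝ, F) I f (c a) : F →L[ℝ] E) ((mfderiv 𝓘(ℝ, ℝ) 𝓘(ℝ, F) c a : ℝ →L[ℝ] F) 1) = _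
  exact congrArg (mfderiv 𝓘(ℝ, F) I f (c a) : F →L[ℝ] E)
    ((congrArg (fun L : ℝ →L[ℝ] F => L 1) h1).trans h2)

theorem exists_curve_mfderiv_eq {E : Type*} [NormedAddCommGroup E] [NormedSpace ℝ E]
    {H : Type*} [TopologicalSpace H] (I : ModelWithCorners ℝ E H) [I.Boundaryless]
    {M : Type*} [TopologicalSpace M] [ChartedSpace H M] [IsManifold I ∞ M] (z : M)
    (u : TangentSpace I z) :
    ∃ γ : ℝ → M, ContMDiffAt 𝓘(ℝ, ℝ) I ∞ γ 0 ∧ γ 0 = z ∧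
      (mfderiv 𝓘(ℝ, ℝ) I γ 0 (1 : ℝ) : E) = u := by
  let û : E := mfderiv I 𝓘(ℝ, E) (extChartAt I z) z u
  let c : ℝ → E := fun a => extChartAt I z z + a • û
  have hc : HasDerivAt c û 0 := by
    have h := ((hasDerivAt_id (0 : ℝ)).smul_const û).const_add (extChartAt I z z)
    rwa [one_smul] at h
  have hc0 : c 0 = extChartAt I z z := by simp [c]
  have hs : ContMDiffAt 𝓘(ℝ, E) I ∞ (extChartAt I z).symm (c 0) := by
    rw [hc0]
    exact (contMDiffOn_extChartAt_symm z).contMDiffAt (extChartAt_target_mem_nhds z)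
  have hcs : ContMDiffAt 𝓘(ℝ, ℝ) 𝓘(ℝ, E) ∞ c 0 :=
    ContDiffAt.contMDiffAt (by fun_prop)
  refine ⟨fun a => (extChartAt I z).symm (c a), hs.comp 0 hcs, ?_, ?_⟩
  · simp only [hc0]
    exact extChartAt_to_inv z
  · refine (mfderiv_comp_curve (hs.mdifferentiableAt (by simp)) hc).trans ?_
    rw [hc0]
    have h : mfderiv I I ((extChartAt I z).symm ∘ extChartAt I z) z = _ :=
      mfderiv_comp (I' := 𝓘(ℝ, E)) z (by rw [← hc0]; exact hs.mdifferentiableAt (by simp))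
        (mdifferentiableAt_extChartAt (mem_chart_source H z))
    have h' : mfderiv I I ((extChartAt I z).symm ∘ extChartAt I z) z = mfderiv I I id z := by
      apply Filter.EventuallyEq.mfderiv_eq
      filter_upwards [extChartAt_source_mem_nhds (I := I) z] with y hy
      exact (extChartAt I z).left_inv hy
    have h3 := congrArg (fun L : E →L[ℝ] E => L u) (h.symm.trans h')
    refine h3.trans ?_
    rw [mfderiv_id]
    rfl

/-- Every tangent vector of the cotangent bundle and every vertical tangent vector at the same point
span a parametrised surface that is affine in the fibres. -/
theorem exists_fiberwise_surface (z : CotangentBundle n N)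
    (u : TangentSpace (cotangentModel n) z) (ζ : TangentSpace (𝓡 n) z.proj →L[ℝ] ℝ) :
    ∃ f : ℝ × ℝ → CotangentBundle n N,
      ContMDiffAt 𝓘(ℝ, ℝ × ℝ) (cotangentModel n) ∞ f (0, 0) ∧
      (∀ b, f (0, b) = fiberLine z ζ b) ∧
      (∀ᶠ q : ℝ × ℝ in 𝓝 (0, 0), (f q).proj = (f (q.1, 0)).proj) ∧
      f (0, 0) = z ∧
      (mfderiv 𝓘(ℝ, ℝ × ℝ) (cotangentModel n) f (0, 0) (1, 0) : CotangentModelSpace n) = u := by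
  obtain ⟨γ, hγ, hγ0, hγu⟩ := exists_curve_mfderiv_eq (cotangentModel n) z u
  let e := trivializationAt (EuclideanSpace ℝ (Fin n) →L[ℝ] ℝ)
    (fun x : N => TangentSpace (𝓡 n) x →L[ℝ] ℝ) z.proj
  have hz : z.proj ∈ e.baseSet := FiberBundle.mem_baseSet_trivializationAt' _
  let ζ' := (e ⟨z.proj, ζ⟩).2
  -- In a trivialisation, multiples of the coordinates `ζ'` of `ζ` are added to the curve `γ`. The
  -- base point therefore depends on the first parameter only.
  let f : ℝ × ℝ → CotangentBundle n N := fun q =>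
    e.toOpenPartialHomeomorph.symm ((γ q.1).proj, (e (γ q.1)).2 + q.2 • ζ')
  have hγe : ∀ᶠ a in 𝓝 (0 : ℝ), (γ a).proj ∈ e.baseSet := by
    have h : ContinuousAt (fun a => (γ a).proj) 0 :=
      ((contMDiff_proj_cotangent (γ 0)).comp 0 hγ).continuousAt
    exact h.preimage_mem_nhds (e.open_baseSet.mem_nhds (by rw [hγ0]; exact hz))
  have hγ1 : ContMDiffAt 𝓘(ℝ, ℝ × ℝ) (cotangentModel n) ∞ (fun q : ℝ × ℝ => γ q.1) (0, 0) :=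
    hγ.comp ((0 : ℝ), (0 : ℝ)) (contDiff_fst (E := ℝ) (F := ℝ)).contDiffAt.contMDiffAt
  have hf0 : ∀ b, f (0, b) = fiberLine z ζ b := by
    intro b
    have hl := (e.linear ℝ hz)
    have h1 : (e (γ 0)).2 + b • ζ' = (e (fiberLine z ζ b)).2 := by
      have h2 := hl.map_add z.snd (b • ζ)
      rw [hl.map_smul] at h2
      rw [hγ0]
      exact h2.symm
    have h3 : ((γ 0).proj, (e (γ 0)).2 + b • ζ') = e (fiberLine z ζ b) := by
      rw [h1, hγ0]
      exact (e.mk_proj_snd (x := fiberLine z ζ b) (e.mem_source.2 hz))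
    change e.toOpenPartialHomeomorph.symm ((γ 0).proj, (e (γ 0)).2 + b • ζ') = _
    rw [h3]
    exact e.toOpenPartialHomeomorph.left_inv (e.mem_source.2 hz)
  have hfa : ∀ᶠ a in 𝓝 (0 : ℝ), f (a, 0) = γ a := by
    filter_upwards [hγe] with a ha
    have h3 : ((γ a).proj, (e (γ a)).2 + (0 : ℝ) • ζ') = e (γ a) := by
      rw [zero_smul, add_zero]
      exact (e.mk_proj_snd (e.mem_source.2 ha))
    change e.toOpenPartialHomeomorph.symm ((γ a).proj, (e (γ a)).2 + (0 : ℝ) • ζ') = _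
    rw [h3]
    exact e.toOpenPartialHomeomorph.left_inv (e.mem_source.2 ha)
  have hfs : ContMDiffAt 𝓘(ℝ, ℝ × ℝ) (cotangentModel n) ∞ f (0, 0) := by
    have h1 : ContMDiffAt ((𝓡 n).prod 𝓘(ℝ, EuclideanSpace ℝ (Fin n) →L[ℝ] ℝ)) (cotangentModel n) ∞
        e.toOpenPartialHomeomorph.symm ((γ 0).proj, (e (γ 0)).2 + (0 : ℝ) • ζ') := by
      refine (Bundle.Trivialization.contMDiffOn_symm e).contMDiffAt (e.open_target.mem_nhds ?_)
      rw [e.mem_target, hγ0]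
      exact hz
    have h2 : ContMDiffAt 𝓘(ℝ, ℝ × ℝ) 𝓘(ℝ, EuclideanSpace ℝ (Fin n) →L[ℝ] ℝ) ∞
        (fun q : ℝ × ℝ => (e (γ q.1)).2 + q.2 • ζ') (0, 0) := by
      have h3 := (contMDiffAt_totalSpace.1 hγ1).2
      rw [hγ0] at h3
      exact h3.add (ContDiffAt.contMDiffAt (by fun_prop))
    exact ContMDiffAt.comp (I' := (𝓡 n).prod 𝓘(ℝ, EuclideanSpace ℝ (Fin n) →L[ℝ] ℝ)) (0, 0) h1
      (((contMDiff_proj_cotangent _).comp (0, 0) hγ1).prodMk h2)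
  refine ⟨f, hfs, hf0, ?_, ?_, ?_⟩
  · have h : ∀ᶠ q : ℝ × ℝ in 𝓝 (0, 0), (γ q.1).proj ∈ e.baseSet :=
      (continuous_fst.tendsto ((0 : ℝ), (0 : ℝ))).eventually hγe
    filter_upwards [h] with q hq
    exact (e.proj_symm_apply' hq).trans (e.proj_symm_apply' hq).symm
  · rw [hf0]
    simp [fiberLine]
  · have h1 := mfderiv_comp_curve (f := f) (c := fun a : ℝ => (a, (0 : ℝ))) (c' := (1, 0)) (a := 0)
      (hfs.mdifferentiableAt (by simp)) ((hasDerivAt_id _).prodMk (hasDerivAt_const _ _))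
    rw [← hγu]
    refine h1.symm.trans ?_
    exact congrArg (fun L : ℝ →L[ℝ] CotangentModelSpace n => L 1)
      (Filter.EventuallyEq.mfderiv_eq hfa)

/-- The value of a covector on a vector of the model space. -/
def covectorApply (z : CotangentBundle n N) (e : EuclideanSpace ℝ (Fin n)) : ℝ :=
  (z.snd : EuclideanSpace ℝ (Fin n) →L[ℝ] ℝ) e

/-- On the surface, `dλ(∂_a, ∂_b) = ∂_a λ(∂_b) - ∂_b λ(∂_a)`. The first term vanishes because `∂_b`
is vertical near the origin. Along the fibre `λ(∂_a)` is affine in `b`, with slope the value of `ζ`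
on the projected velocity. -/
theorem extDeriv_liouville_of_surface {f : ℝ × ℝ → CotangentBundle n N}
    (hfs : ContMDiffAt 𝓘(ℝ, ℝ × ℝ) (cotangentModel n) ∞ f (0, 0))
    (ζ : TangentSpace (𝓡 n) (f (0, 0)).proj →L[ℝ] ℝ)
    (hf0 : ∀ b, f (0, b) = fiberLine (f (0, 0)) ζ b)
    (hfp : ∀ᶠ q : ℝ × ℝ in 𝓝 (0, 0), (f q).proj = (f (q.1, 0)).proj) :
    dProj (f (0, 0)) (mfderiv 𝓘(ℝ, ℝ × ℝ) (cotangentModel n) f (0, 0) (0, 1)) = 0 ∧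
    extDerivOneForm (cotangentModel n) (fun y : CotangentBundle n N => liouvilleForm y) (f (0, 0))
      (mfderiv 𝓘(ℝ, ℝ × ℝ) (cotangentModel n) f (0, 0) (1, 0))
      (mfderiv 𝓘(ℝ, ℝ × ℝ) (cotangentModel n) f (0, 0) (0, 1)) =
      - ζ (dProj (f (0, 0)) (mfderiv 𝓘(ℝ, ℝ × ℝ) (cotangentModel n) f (0, 0) (1, 0))) := by
  let x : ℝ → N := fun a => (f (a, 0)).proj
  have hf1 : ∀ᶠ q in 𝓝 ((0 : ℝ), (0 : ℝ)), ContMDiffAt 𝓘(ℝ, ℝ × ℝ) (cotangentModel n) 1 f q :=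
    (contMDiffAt_iff_contMDiffAt_nhds (by simp)).1 (hfs.of_le (m := 1) (by simp))
  have hpd : ∀ᶠ q in 𝓝 ((0 : ℝ), (0 : ℝ)),
      MDifferentiableAt 𝓘(ℝ, ℝ × ℝ) (𝓡 n) (fun q => (f q).proj) q := by
    filter_upwards [hf1] with q hq
    exact (((contMDiff_proj_cotangent (f q)).of_le (m := 1) (by simp)).comp q hq).mdifferentiableAt
      (by simp)
  have hξ : ∀ᶠ q in 𝓝 ((0 : ℝ), (0 : ℝ)),
      (mfderiv 𝓘(ℝ, ℝ × ℝ) (𝓡 n) (fun q => (f q).proj) q (0, 1) : EuclideanSpace ℝ (Fin n)) = 0 ∧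
      (mfderiv 𝓘(ℝ, ℝ × ℝ) (𝓡 n) (fun q => (f q).proj) q (1, 0) : EuclideanSpace ℝ (Fin n)) =
        mfderiv 𝓘(ℝ, ℝ) (𝓡 n) x q.1 (1 : ℝ) := by
    filter_upwards [hpd, hfp.eventually_nhds] with q hq hq'
    constructor
    · refine (mfderiv_comp_curve (f := fun q => (f q).proj) (c := fun b : ℝ => (q.1, b))
        (c' := (0, 1)) (a := q.2) hq
        ((hasDerivAt_const _ _).prodMk (hasDerivAt_id _))).symm.trans ?_
      have h : (fun b : ℝ => (f (q.1, b)).proj) =ᶠ[𝓝 q.2] fun _ => (f (q.1, 0)).proj :=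
        ((by fun_prop : Continuous fun b : ℝ => (q.1, b)).tendsto q.2).eventually hq'
      refine (congrArg (fun L : ℝ →L[ℝ] EuclideanSpace ℝ (Fin n) => L 1) h.mfderiv_eq).trans ?_
      exact congrArg (fun L : ℝ →L[ℝ] EuclideanSpace ℝ (Fin n) => L 1) mfderiv_const
    · refine (mfderiv_comp_curve (f := fun q => (f q).proj) (c := fun a : ℝ => (a, q.2))
        (c' := (1, 0)) (a := q.1) hq
        ((hasDerivAt_id _).prodMk (hasDerivAt_const _ _))).symm.trans ?_
      have h : (fun a : ℝ => (f (a, q.2)).proj) =ᶠ[𝓝 q.1] x :=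
        ((by fun_prop : Continuous fun a : ℝ => (a, q.2)).tendsto q.1).eventually hq'
      exact (congrArg (fun L : ℝ →L[ℝ] EuclideanSpace ℝ (Fin n) => L 1) h.mfderiv_eq)
  have hξ0 := hξ.self_of_nhds
  have hd0 := hf1.self_of_nhds
  refine ⟨(dProj_mfderiv hd0 (0, 1)).trans hξ0.1, ?_⟩
  rw [dProj_mfderiv hd0 (1, 0), ← curl_pullOneForm_liouville hfs]
  have hΘ : DifferentiableAt ℝ (pullOneForm (cotangentModel n) liouvilleForm f) (0, 0) :=
    (contDiffAt_pullOneForm_liouville hfs).differentiableAt (by simp)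
  have happ : ∀ e : ℝ × ℝ, HasFDerivAt
      (fun q => pullOneForm (cotangentModel n) liouvilleForm f q e)
      ((fderiv ℝ (pullOneForm (cotangentModel n) liouvilleForm f) (0, 0)).flip e) (0, 0) := by
    intro e
    simpa using hΘ.hasFDerivAt.clm_apply (hasFDerivAt_const e ((0 : ℝ), (0 : ℝ)))
  have h1 : fderiv ℝ (pullOneForm (cotangentModel n) liouvilleForm f) (0, 0) (1, 0) (0, 1) = 0 := by
    have h : (fun q => pullOneForm (cotangentModel n) liouvilleForm f q (0, 1))
        =ᶠ[𝓝 ((0 : ℝ), (0 : ℝ))] fun _ => 0 := by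
      filter_upwards [hf1, hξ] with q hq hq'
      rw [pullOneForm_liouville hq]
      exact (congrArg (covectorApply (f q)) hq'.1).trans
        (map_zero ((f q).snd : EuclideanSpace ℝ (Fin n) →L[ℝ] ℝ))
    have h' := (happ (0, 1)).fderiv
    rw [h.fderiv_eq, fderiv_fun_const] at h'
    have := congrArg (fun L : ℝ × ℝ →L[ℝ] ℝ => L (1, 0)) h'
    simpa using this.symm
  have h2 : fderiv ℝ (pullOneForm (cotangentModel n) liouvilleForm f) (0, 0) (0, 1) (1, 0) =
      ζ (mfderiv 𝓘(ℝ, ℝ × ℝ) (𝓡 n) (fun q => (f q).proj) (0, 0) (1, 0)) := by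
    let ξ : EuclideanSpace ℝ (Fin n) := mfderiv 𝓘(ℝ, ℝ) (𝓡 n) x 0 (1 : ℝ)
    have hb : (fun b : ℝ => pullOneForm (cotangentModel n) liouvilleForm f (0, b) (1, 0))
        =ᶠ[𝓝 (0 : ℝ)] fun b => covectorApply (f (0, 0)) ξ
          + b * (ζ : EuclideanSpace ℝ (Fin n) →L[ℝ] ℝ) ξ := by
      have hc : Tendsto (fun b : ℝ => ((0 : ℝ), b)) (𝓝 0) (𝓝 (0, 0)) :=
        (by fun_prop : Continuous fun b : ℝ => ((0 : ℝ), b)).tendsto 0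
      filter_upwards [hc.eventually hf1, hc.eventually hξ] with b hq hq'
      rw [pullOneForm_liouville hq]
      refine (congrArg (covectorApply (f (0, b))) hq'.2).trans ?_
      rw [hf0 b]
      rfl
    have hd1 : HasDerivAt (fun b : ℝ => pullOneForm (cotangentModel n) liouvilleForm f (0, b) (1, 0))
        (fderiv ℝ (pullOneForm (cotangentModel n) liouvilleForm f) (0, 0) (0, 1) (1, 0)) 0 :=
      (happ (1, 0)).comp_hasDerivAt (0 : ℝ)
        ((hasDerivAt_const (0 : ℝ) (0 : ℝ)).prodMk (hasDerivAt_id (0 : ℝ)))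
    have hd2 := ((hasDerivAt_id (0 : ℝ)).mul_const
      ((ζ : EuclideanSpace ℝ (Fin n) →L[ℝ] ℝ) ξ)).const_add (covectorApply (f (0, 0)) ξ)
    have hd3 := hd1.unique (hd2.congr_of_eventuallyEq hb)
    rw [hd3, one_mul]
    exact congrArg (ζ : EuclideanSpace ℝ (Fin n) →L[ℝ] ℝ) hξ0.2.symm
  rw [curl, h1, h2, zero_sub]

/-- The tangent vector at `z` of the curve `b ↦ z + b ζ` in the fibre. -/
theorem exists_vertical (z : CotangentBundle n N) (ζ : TangentSpace (𝓡 n) z.proj →L[ℝ] ℝ) :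
    ∃ w : TangentSpace (cotangentModel n) z, dProj z w = 0 ∧
      (∀ u : TangentSpace (cotangentModel n) z,
        extDerivOneForm (cotangentModel n) (fun y : CotangentBundle n N => liouvilleForm y) z u w
          = - ζ (dProj z u)) ∧
      ∀ H : CotangentBundle n N → ℝ, MDifferentiableAt (cotangentModel n) 𝓘(ℝ, ℝ) H z →
        HasDerivAt (fun b => H (fiberLine z ζ b)) (mfderiv (cotangentModel n) 𝓘(ℝ, ℝ) H z w) 0 := by
  let w₀ : CotangentModelSpace n := mfderiv 𝓘(ℝ, ℝ) (cotangentModel n) (fiberLine z ζ) 0 (1 : ℝ)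
  -- The surface varies with `u`, but its velocity in the fibre direction is always that of the
  -- fixed curve `fiberLine z ζ`. Hence the single vector `w₀` serves every `u`.
  have key : ∀ u : CotangentModelSpace n,
      dProj z w₀ = 0 ∧
      extDerivOneForm (cotangentModel n) (fun y : CotangentBundle n N => liouvilleForm y) z u w₀
          = - ζ (dProj z u) ∧
      ∀ H : CotangentBundle n N → ℝ, MDifferentiableAt (cotangentModel n) 𝓘(ℝ, ℝ) H z →
        HasDerivAt (fun b => H (fiberLine z ζ b))
          (mfderiv (cotangentModel n) 𝓘(ℝ, ℝ) H z w₀) 0 := by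
    intro u
    obtain ⟨f, hfs, hf0, hfp, hz, hu⟩ := exists_fiberwise_surface z u ζ
    have hf0' : (fun b : ℝ => f (0, b)) = fiberLine z ζ := funext hf0
    have hcd : HasDerivAt (fun b : ℝ => ((0 : ℝ), b)) (0, 1) 0 :=
      (hasDerivAt_const (0 : ℝ) (0 : ℝ)).prodMk (hasDerivAt_id (0 : ℝ))
    have hw : w₀ = mfderiv 𝓘(ℝ, ℝ × ℝ) (cotangentModel n) f (0, 0) (0, 1) := by
      have h1 := mfderiv_comp_curve (f := f) (c := fun b : ℝ => ((0 : ℝ), b)) (c' := (0, 1))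
        (a := 0) (hfs.mdifferentiableAt (by simp)) hcd
      rw [hf0'] at h1
      exact h1
    clear_value w₀
    subst hw hz
    obtain ⟨h1, h2⟩ := extDeriv_liouville_of_surface hfs ζ hf0 hfp
    rw [hu] at h2
    refine ⟨h1, h2, fun H hH => ?_⟩
    have h3 : MDifferentiableAt 𝓘(ℝ, ℝ × ℝ) 𝓘(ℝ, ℝ) (H ∘ f) (0, 0) :=
      hH.comp _ (hfs.mdifferentiableAt (by simp))
    have h4 := (mdifferentiableAt_iff_differentiableAt.1 h3).hasFDerivAt.comp_hasDerivAt (0 : ℝ) hcd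
    have h5 : mfderiv 𝓘(ℝ, ℝ × ℝ) 𝓘(ℝ, ℝ) (H ∘ f) (0, 0) = _ :=
      mfderiv_comp (I' := cotangentModel n) _ hH (hfs.mdifferentiableAt (by simp))
    rw [mfderiv_eq_fderiv] at h5
    rw [h5] at h4
    have h6 : (fun b => H (fiberLine (f (0, 0)) ζ b)) = (H ∘ f) ∘ fun b : ℝ => ((0 : ℝ), b) := by
      rw [← hf0']; rfl
    rw [h6]
    exact h4
  exact ⟨w₀, (key 0).1, fun u => (key u).2.1, (key 0).2.2⟩

end Liouville

end RabinowitzFloer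
end

noncomputable section

namespace RabinowitzFloer

/-! ### The Hamiltonian and its vector field -/

section Hamiltonian

variable {n : ℕ} {N : Type*} [TopologicalSpace N] [ChartedSpace (EuclideanSpace ℝ (Fin n)) N]
  [IsManifold (𝓡 n) ∞ N]

theorem contMDiff_mechanicalHamiltonian (g : Metric n N) {U : N → ℝ}
    (hU : ContMDiff (𝓡 n) 𝓘(ℝ, ℝ) ∞ U) :
    ContMDiff (cotangentModel n) 𝓘(ℝ, ℝ) ∞ (mechanicalHamiltonian g U) :=
  ((contMDiff_dualNormSq g).div_const 2).add (hU.comp contMDiff_proj_cotangent)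

theorem contMDiff_definingHamiltonian (g : Metric n N) {U : N → ℝ}
    (hU : ContMDiff (𝓡 n) 𝓘(ℝ, ℝ) ∞ U) (k : ℝ) {b : ℝ → ℝ} (hb : ContDiff ℝ ∞ b) :
    ContMDiff (cotangentModel n) 𝓘(ℝ, ℝ) ∞ (definingHamiltonian g U k b) :=
  hb.contMDiff.comp ((contMDiff_mechanicalHamiltonian g hU).sub contMDiff_const)

instance (z : CotangentBundle n N) : FiniteDimensional ℝ (TangentSpace (cotangentModel n) z) :=
  inferInstanceAs (FiniteDimensional ℝ (CotangentModelSpace n))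

/-- The bilinear form `(u, w) ↦ D(Lu, Lw) - D(Lw, Lu) + S(Pu, Pw)`. -/
def altBilin {T E E' : Type*} [NormedAddCommGroup T] [NormedSpace ℝ T] [NormedAddCommGroup E]
    [NormedSpace ℝ E] [NormedAddCommGroup E'] [NormedSpace ℝ E'] (D : E →L[ℝ] E →L[ℝ] ℝ)
    (L : T →L[ℝ] E) (S : E' →L[ℝ] E' →L[ℝ] ℝ) (P : T →L[ℝ] E') : T →ₗ[ℝ] T →ₗ[ℝ] ℝ :=
  LinearMap.mk₂ ℝ (fun u w => D (L u) (L w) - D (L w) (L u) + S (P u) (P w))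
    (by intro u u' w; simp only [map_add, add_apply]; ring)
    (by intro c u w; simp only [map_smul, smul_apply, smul_eq_mul]; ring)
    (by intro u u' w; simp only [map_add, add_apply]; ring)
    (by intro c u w; simp only [map_smul, smul_apply, smul_eq_mul]; ring)

/-- The twisted form at a point as a bilinear map. -/
def twistedBilin (σ : FormField n N) (z : CotangentBundle n N) :
    TangentSpace (cotangentModel n) z →ₗ[ℝ] TangentSpace (cotangentModel n) z →ₗ[ℝ] ℝ :=
  altBilin (T := CotangentModelSpace n) (E := CotangentModelSpace n)
    (E' := EuclideanSpace ℝ (Fin n))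
    (fderiv ℝ (oneFormInChart (cotangentModel n) (fun y : CotangentBundle n N => liouvilleForm y) z)
      (extChartAt (cotangentModel n) z z))
    (mfderiv (cotangentModel n) 𝓘(ℝ, CotangentModelSpace n) (extChartAt (cotangentModel n) z) z)
    (σ z.proj) (dProj z)

theorem twistedBilin_apply (σ : FormField n N) (z : CotangentBundle n N)
    (u w : TangentSpace (cotangentModel n) z) : twistedBilin σ z u w = twistedForm σ z u w := rfl

/-- Pointwise alternating fields of bilinear forms. -/
def IsAlternating (σ : FormField n N) : Prop := ∀ (x : N) (u : TangentSpace (𝓡 n) x), σ x u u = 0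

theorem IsAlternating.swap {σ : FormField n N} (hσ : IsAlternating σ) (x : N)
    (u w : TangentSpace (𝓡 n) x) : σ x u w = - σ x w u := by
  have h := hσ x (u + w)
  simp only [map_add, add_apply, hσ x u, hσ x w] at h
  linarith

theorem twistedForm_swap {σ : FormField n N} (hσ : IsAlternating σ) (z : CotangentBundle n N)
    (u w : TangentSpace (cotangentModel n) z) : twistedForm σ z u w = - twistedForm σ z w u := by
  simp only [twistedForm, extDerivOneForm]
  rw [hσ.swap]
  ring

theorem twistedForm_self {σ : FormField n N} (hσ : IsAlternating σ) (z : CotangentBundle n N)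
    (u : TangentSpace (cotangentModel n) z) : twistedForm σ z u u = 0 := by
  have := twistedForm_swap hσ z u u
  linarith

/-- A nondegenerate form on a finite-dimensional tangent space is an isomorphism onto the dual, so
the defining equation is solvable and the choice operator in `hamVectorField` returns a solution. -/
theorem hamVectorField_spec {σ : FormField n N} {z : CotangentBundle n N}
    (hnd : ∀ u : TangentSpace (cotangentModel n) z, u ≠ 0 → ∃ w, twistedForm σ z u w ≠ 0)
    (H : CotangentBundle n N → ℝ) (u : TangentSpace (cotangentModel n) z) :
    (mfderiv (cotangentModel n) 𝓘(ℝ, ℝ) H z u : ℝ)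
      = - twistedForm σ z (hamVectorField (twistedForm σ) H z) u := by
  have hinj : Function.Injective (twistedBilin σ z) := by
    rw [← LinearMap.ker_eq_bot, LinearMap.ker_eq_bot']
    intro v hv
    by_contra h
    obtain ⟨w, hw⟩ := hnd v h
    exact hw (by rw [← twistedBilin_apply, hv]; rfl)
  have hsurj : Function.Surjective (twistedBilin σ z) :=
    (LinearMap.injective_iff_surjective_of_finrank_eq_finrank
      (Subspace.dual_finrank_eq (K := ℝ) (V := TangentSpace (cotangentModel n) z)).symm).1 hinj
  let dH : CotangentModelSpace n →L[ℝ] ℝ := mfderiv (cotangentModel n) 𝓘(ℝ, ℝ) H z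
  obtain ⟨X, hX⟩ := hsurj (-(dH : CotangentModelSpace n →ₗ[ℝ] ℝ))
  have hex : ∃ X : TangentSpace (cotangentModel n) z, ∀ u : TangentSpace (cotangentModel n) z,
      (mfderiv (cotangentModel n) 𝓘(ℝ, ℝ) H z u : ℝ) = - twistedForm σ z X u := by
    refine ⟨X, fun u => ?_⟩
    rw [← twistedBilin_apply, hX]
    exact (neg_neg (dH u)).symm
  exact Classical.epsilon_spec hex u

theorem fiberLine_mechanicalHamiltonian (g : Metric n N) (U : N → ℝ) (z : CotangentBundle n N)
    (ζ : TangentSpace (𝓡 n) z.proj →L[ℝ] ℝ) (r : ℝ) :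
    mechanicalHamiltonian g U (fiberLine z ζ r) =
      mechanicalHamiltonian g U z + r * ζ (sharp g z.proj z.snd) + r ^ 2 * (dualNormSq g z.proj ζ / 2) := by
  have h : dualNormSq g z.proj (z.snd + r • ζ) = dualNormSq g z.proj z.snd
      + 2 * (r * ζ (sharp g z.proj z.snd)) + r ^ 2 * dualNormSq g z.proj ζ := by
    have h1 : (z.snd : TangentSpace (𝓡 n) z.proj →L[ℝ] ℝ) (sharp g z.proj ζ)
        = ζ (sharp g z.proj z.snd) := by
      rw [apply_sharp, g.symm, ← apply_sharp]
    have h2 : sharp g z.proj (z.snd + r • ζ) = sharp g z.proj z.snd + r • sharp g z.proj ζ := by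
      unfold sharp
      rw [map_add, map_smul]
    change (z.snd + r • ζ) (sharp g z.proj (z.snd + r • ζ)) = z.snd (sharp g z.proj z.snd) + _ +
      r ^ 2 * ζ (sharp g z.proj ζ)
    rw [h2]
    simp only [map_add, map_smul, add_apply, smul_apply, smul_eq_mul, h1]
    ring
  change dualNormSq g z.proj (z.snd + r • ζ) / 2 + U z.proj = dualNormSq g z.proj z.snd / 2 + U z.proj + _ + _
  rw [h]
  ring

theorem fiberLine_zero (z : CotangentBundle n N) (ζ : TangentSpace (𝓡 n) z.proj →L[ℝ] ℝ) :
    fiberLine z ζ 0 = z := by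
  simp [fiberLine]

/-- The projection of the Hamiltonian vector field to the base is the rescaled momentum. -/
theorem dProj_hamVectorField {σ : FormField n N} (g : Metric n N) {U : N → ℝ}
    (hU : ContMDiff (𝓡 n) 𝓘(ℝ, ℝ) ∞ U) (k : ℝ) {b : ℝ → ℝ} (hb : ContDiff ℝ ∞ b)
    {z : CotangentBundle n N}
    (hnd : ∀ u : TangentSpace (cotangentModel n) z, u ≠ 0 → ∃ w, twistedForm σ z u w ≠ 0) :
    dProj z (hamVectorField (twistedForm σ) (definingHamiltonian g U k b) z) =
      deriv b (mechanicalHamiltonian g U z - k) • sharp g z.proj z.snd := by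
  set X := hamVectorField (twistedForm σ) (definingHamiltonian g U k b) z
  set v := dProj z X - deriv b (mechanicalHamiltonian g U z - k) • sharp g z.proj z.snd with hv
  -- The defining equation of `X` is paired with the vertical vector of `ζ`. The magnetic term does
  -- not see vertical vectors, `dλ` returns `-ζ(dτ X)`, and `dH` is the derivative of the
  -- Hamiltonian along the fibre.
  have key : ∀ ζ : TangentSpace (𝓡 n) z.proj →L[ℝ] ℝ, ζ v = 0 := by
    intro ζ
    obtain ⟨w, hw1, hw2, hw3⟩ := exists_vertical z ζ
    have h1 := hamVectorField_spec hnd (definingHamiltonian g U k b) w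
    have h2 := hw3 _ ((contMDiff_definingHamiltonian g hU k hb z).mdifferentiableAt (by simp))
    have h3 : HasDerivAt (fun r => definingHamiltonian g U k b (fiberLine z ζ r))
        (deriv b (mechanicalHamiltonian g U z - k) * ζ (sharp g z.proj z.snd)) 0 := by
      unfold definingHamiltonian
      have h4 : HasDerivAt (fun r => mechanicalHamiltonian g U (fiberLine z ζ r) - k)
          (ζ (sharp g z.proj z.snd)) 0 := by
        simp only [fiberLine_mechanicalHamiltonian]
        have := ((((hasDerivAt_id (0 : ℝ)).mul_const (ζ (sharp g z.proj z.snd))).const_add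
          (mechanicalHamiltonian g U z)).add (((hasDerivAt_id (0 : ℝ)).pow 2).mul_const
            (dualNormSq g z.proj ζ / 2))).sub_const k
        simpa using this
      have h5 : HasDerivAt b (deriv b (mechanicalHamiltonian g U z - k))
          (mechanicalHamiltonian g U (fiberLine z ζ 0) - k) := by
        rw [fiberLine_zero]
        exact (hb.differentiable (by simp) _).hasDerivAt
      exact h5.comp (0 : ℝ) h4
    have h6 := h2.unique h3
    have h7 : twistedForm σ z X w = - ζ (dProj z X) := by
      simp only [twistedForm, hw1, hw2, map_zero, add_zero]
    have h8 : (mfderiv (cotangentModel n) 𝓘(ℝ, ℝ) (definingHamiltonian g U k b) z w : ℝ)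
        = ζ (dProj z X) := h1.trans (by rw [h7, neg_neg])
    rw [hv, map_sub, map_smul, smul_eq_mul, sub_eq_zero]
    exact h8.symm.trans h6
  have h0 : v = 0 := by
    by_contra h
    exact (g.pos z.proj v h).ne' (key (g.inner z.proj v))
  exact sub_eq_zero.1 h0

end Hamiltonian

end RabinowitzFloer
end

noncomputable section

namespace RabinowitzFloer

set_option linter.unusedSectionVars false

/-! ### Lifts to the universal covering -/

section Covering

variable {n : ℕ} {N : Type*} [TopologicalSpace N] [ChartedSpace (EuclideanSpace ℝ (Fin n)) N]
  [IsManifold (𝓡 n) ∞ N]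
  {N' : Type*} [TopologicalSpace N'] [ChartedSpace (EuclideanSpace ℝ (Fin n)) N']
  [IsManifold (𝓡 n) ∞ N']
  {p : N' → N}
  {F : Type*} [NormedAddCommGroup F] [NormedSpace ℝ F]

theorem IsUniversalCovering.contMDiff (hp : IsUniversalCovering n p) :
    ContMDiff (𝓡 n) (𝓡 n) ∞ p := hp.localDiffeo.contMDiff

theorem IsUniversalCovering.isInvertible_mfderiv (hp : IsUniversalCovering n p) (x : N') :
    (mfderiv (𝓡 n) (𝓡 n) p x).IsInvertible :=
  ⟨hp.localDiffeo.mfderivToContinuousLinearEquiv (by simp) x,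
    hp.localDiffeo.mfderivToContinuousLinearEquiv_coe (by simp) x⟩

/-- The plane is simply connected, so a continuous lift exists globally. It is smooth because near
each point it is the given map followed by a smooth local inverse of `p`. The lift of a map periodic
in `t` need not be periodic. -/
theorem IsUniversalCovering.exists_lift (hp : IsUniversalCovering n p) {q : ℝ × ℝ → N}
    (hq : ContMDiff 𝓘(ℝ, ℝ × ℝ) (𝓡 n) ∞ q) :
    ∃ q' : ℝ × ℝ → N', ContMDiff 𝓘(ℝ, ℝ × ℝ) (𝓡 n) ∞ q' ∧ ∀ z, p (q' z) = q z := by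
  obtain ⟨e, he⟩ := hp.surjective (q 0)
  obtain ⟨q', ⟨h0, h1⟩, -⟩ := hp.covering.existsUnique_continuousMap_lifts
    ⟨q, hq.continuous⟩ 0 e he
  have h2 : ∀ z, p (q' z) = q z := fun z => congrFun h1 z
  refine ⟨q', fun z => ?_, h2⟩
  obtain ⟨Φ, hz, hΦ⟩ := hp.localDiffeo (q' z)
  have hs : ∀ᶠ y in 𝓝 z, q' y ∈ Φ.source :=
    q'.continuous.continuousAt.preimage_mem_nhds (Φ.open_source.mem_nhds hz)
  have hd : ContMDiffAt 𝓘(ℝ, ℝ × ℝ) (𝓡 n) ∞ (Φ.symm ∘ q) z := by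
    refine ContMDiffAt.comp z (I' := 𝓡 n) ?_ (hq z)
    refine Φ.contMDiffOn_invFun.contMDiffAt (Φ.open_target.mem_nhds ?_)
    rw [← h2, hΦ hz]
    exact Φ.map_source hz
  refine hd.congr_of_eventuallyEq ?_
  filter_upwards [hs] with y hy
  rw [Function.comp_apply, ← h2, hΦ hy]
  exact (Φ.left_inv hy).symm

theorem mfderiv_comp_covering (hp : IsUniversalCovering n p) {f : F → N'} {y : F}
    (hf : ContMDiffAt 𝓘(ℝ, F) (𝓡 n) ∞ f y) (u : F) :
    mfderiv (𝓡 n) (𝓡 n) p (f y) (mfderiv 𝓘(ℝ, F) (𝓡 n) f y u) =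
      mfderiv 𝓘(ℝ, F) (𝓡 n) (p ∘ f) y u := by
  have h : mfderiv 𝓘(ℝ, F) (𝓡 n) (p ∘ f) y = _ := mfderiv_comp (I' := 𝓡 n) y
    ((hp.contMDiff _).mdifferentiableAt (by simp)) (hf.mdifferentiableAt (by simp))
  exact (congrArg (fun L : F →L[ℝ] EuclideanSpace ℝ (Fin n) => L u) h).symm

theorem IsPrimitive.curl_eq (hp : IsUniversalCovering n p) {σ : FormField n N}
    {θ : (x : N') → TangentSpace (𝓡 n) x →L[ℝ] ℝ} (hθ : IsPrimitive p σ θ) {f : F → N'} {y : F}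
    (hf : ContMDiffAt 𝓘(ℝ, F) (𝓡 n) ∞ f y) (u w : F) :
    curl (pullOneForm (𝓡 n) θ f) y u w =
      σ (p (f y)) (mfderiv 𝓘(ℝ, F) (𝓡 n) (p ∘ f) y u) (mfderiv 𝓘(ℝ, F) (𝓡 n) (p ∘ f) y w) := by
  rw [curl_pullOneForm_of_isSmooth hθ.smooth hf, hθ.deriv_eq, mfderiv_comp_covering hp hf,
    mfderiv_comp_covering hp hf]

/-- The push-forward of a covector on the covering. -/
def pushCovector (p : N' → N) (x : N') (a : TangentSpace (𝓡 n) x →L[ℝ] ℝ) :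
    TangentSpace (𝓡 n) (p x) →L[ℝ] ℝ :=
  a.comp (mfderiv (𝓡 n) (𝓡 n) p x).inverse

theorem pushCovector_apply (hp : IsUniversalCovering n p) (x : N')
    (a : TangentSpace (𝓡 n) x →L[ℝ] ℝ) (u : TangentSpace (𝓡 n) x) :
    pushCovector p x a (mfderiv (𝓡 n) (𝓡 n) p x u) = a u :=
  congrArg a ((hp.isInvertible_mfderiv x).inverse_apply_self u)

theorem liftedDualNormSq_eq (g : Metric n N) (x : N') (a : TangentSpace (𝓡 n) x →L[ℝ] ℝ) :
    liftedDualNormSq g p x a = dualNormSq g (p x) (pushCovector p x a) := rfl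

theorem pullOneForm_eq_pushCovector (hp : IsUniversalCovering n p)
    (θ : (x : N') → TangentSpace (𝓡 n) x →L[ℝ] ℝ) {f : F → N'} {y : F}
    (hf : ContMDiffAt 𝓘(ℝ, F) (𝓡 n) ∞ f y) (u : F) :
    pullOneForm (𝓡 n) θ f y u =
      pushCovector p (f y) (θ (f y)) (mfderiv 𝓘(ℝ, F) (𝓡 n) (p ∘ f) y u) := by
  rw [← mfderiv_comp_covering hp hf, pushCovector_apply hp]
  rfl

theorem abs_pullOneForm_le (hp : IsUniversalCovering n p) (g : Metric n N)
    {θ : (x : N') → TangentSpace (𝓡 n) x →L[ℝ] ℝ} {C : ℝ}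
    (hC : ∀ x, liftedDualNormSq g p x (θ x) ≤ C) {f : F → N'} {y : F}
    (hf : ContMDiffAt 𝓘(ℝ, F) (𝓡 n) ∞ f y) (u : F) :
    |pullOneForm (𝓡 n) θ f y u| ≤
      Real.sqrt C * tangentNorm g (p (f y)) (mfderiv 𝓘(ℝ, F) (𝓡 n) (p ∘ f) y u) := by
  rw [pullOneForm_eq_pushCovector hp θ hf]
  refine (abs_apply_le g _ _ _).trans ?_
  exact mul_le_mul_of_nonneg_right (Real.sqrt_le_sqrt (hC (f y))) (tangentNorm_nonneg _ _ _)

end Covering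

/-! ### Maps of the plane to the base -/

section PlaneMaps

variable {n : ℕ} {N : Type*} [TopologicalSpace N] [ChartedSpace (EuclideanSpace ℝ (Fin n)) N]
  [IsManifold (𝓡 n) ∞ N]

/-- The coefficient `σ(∂_s q, ∂_t q)` of the pull-back of a two-form to the plane. -/
def planeForm (σ : FormField n N) (q : ℝ × ℝ → N) (z : ℝ × ℝ) : ℝ :=
  σ (q z) (mfderiv 𝓘(ℝ, ℝ × ℝ) (𝓡 n) q z (1, 0)) (mfderiv 𝓘(ℝ, ℝ × ℝ) (𝓡 n) q z (0, 1))

/-- The length of the derivative of a map of the plane in the direction `e`. -/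
def planeSpeed (g : Metric n N) (q : ℝ × ℝ → N) (e : ℝ × ℝ) (z : ℝ × ℝ) : ℝ :=
  tangentNorm g (q z) (mfderiv 𝓘(ℝ, ℝ × ℝ) (𝓡 n) q z e)

theorem continuous_planeSpeed (g : Metric n N) {q : ℝ × ℝ → N}
    (hq : ContMDiff 𝓘(ℝ, ℝ × ℝ) (𝓡 n) ∞ q) (e : ℝ × ℝ) : Continuous (planeSpeed g q e) := by
  have h : ContMDiff 𝓘(ℝ, ℝ × ℝ) 𝓘(ℝ, ℝ) ∞ fun z => g.inner (q z)
      (mfderiv 𝓘(ℝ, ℝ × ℝ) (𝓡 n) q z e) (mfderiv 𝓘(ℝ, ℝ × ℝ) (𝓡 n) q z e) := by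
    intro z
    have h1 := contMDiffAt_mfderiv_apply (hq z) e
    have h2 := ContMDiffAt.clm_bundle_apply₂ (F₃ := ℝ) (E₃ := fun _ : N => ℝ)
      ((g.contMDiff (q z)).comp z (hq z)) h1 h1
    rw [contMDiffAt_totalSpace] at h2
    exact h2.2
  exact Real.continuous_sqrt.comp h.continuous

theorem planeSpeed_nonneg (g : Metric n N) (q : ℝ × ℝ → N) (e z : ℝ × ℝ) :
    0 ≤ planeSpeed g q e z := tangentNorm_nonneg _ _ _

theorem mfderiv_periodic {q : ℝ × ℝ → N} (hq : ContMDiff 𝓘(ℝ, ℝ × ℝ) (𝓡 n) ∞ q)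
    (hper : ∀ s t, q (s, t + 1) = q (s, t)) (s t : ℝ) (e : ℝ × ℝ) :
    (mfderiv 𝓘(ℝ, ℝ × ℝ) (𝓡 n) q (s, t + 1) e : EuclideanSpace ℝ (Fin n)) =
      mfderiv 𝓘(ℝ, ℝ × ℝ) (𝓡 n) q (s, t) e := by
  have h : q ∘ (fun z : ℝ × ℝ => z + (0, 1)) = q := by
    ext ⟨s, t⟩
    simpa using hper s t
  have h1 : mfderiv 𝓘(ℝ, ℝ × ℝ) (𝓡 n) (q ∘ fun z : ℝ × ℝ => z + (0, 1)) (s, t) = _ :=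
    mfderiv_comp (I' := 𝓘(ℝ, ℝ × ℝ)) (s, t) ((hq _).mdifferentiableAt (by simp))
      (by fun_prop : DifferentiableAt ℝ (fun z : ℝ × ℝ => z + (0, 1)) (s, t)).mdifferentiableAt
  have h2 : mfderiv 𝓘(ℝ, ℝ × ℝ) 𝓘(ℝ, ℝ × ℝ) (fun z : ℝ × ℝ => z + (0, 1)) (s, t) =
      ContinuousLinearMap.id ℝ (ℝ × ℝ) := by
    rw [mfderiv_eq_fderiv, fderiv_add_const]
    exact fderiv_fun_id
  rw [h] at h1
  have h3 := congrArg (fun L : ℝ × ℝ →L[ℝ] EuclideanSpace ℝ (Fin n) => L e) h1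
  have h4 : (s, t) + ((0 : ℝ), (1 : ℝ)) = (s, t + 1) := by simp
  refine Eq.trans ?_ h3.symm
  change _ = (mfderiv 𝓘(ℝ, ℝ × ℝ) (𝓡 n) q ((s, t) + ((0 : ℝ), (1 : ℝ))) :
    ℝ × ℝ →L[ℝ] EuclideanSpace ℝ (Fin n)) ((mfderiv 𝓘(ℝ, ℝ × ℝ) 𝓘(ℝ, ℝ × ℝ)
      (fun z : ℝ × ℝ => z + (0, 1)) (s, t) : ℝ × ℝ →L[ℝ] ℝ × ℝ) e)
  rw [show (mfderiv 𝓘(ℝ, ℝ × ℝ) 𝓘(ℝ, ℝ × ℝ)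
      (fun z : ℝ × ℝ => z + (0, 1)) (s, t) : ℝ × ℝ →L[ℝ] ℝ × ℝ) e = e from
    congrArg (fun L : ℝ × ℝ →L[ℝ] ℝ × ℝ => L e) h2, h4]

theorem planeForm_periodic (σ : FormField n N) {q : ℝ × ℝ → N}
    (hq : ContMDiff 𝓘(ℝ, ℝ × ℝ) (𝓡 n) ∞ q)
    (hper : ∀ s t, q (s, t + 1) = q (s, t)) (s t : ℝ) :
    planeForm σ q (s, t + 1) = planeForm σ q (s, t) := by
  have hσ : ∀ x x' : N, x = x' → ∀ u w : EuclideanSpace ℝ (Fin n),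
      (σ x : EuclideanSpace ℝ (Fin n) →L[ℝ] EuclideanSpace ℝ (Fin n) →L[ℝ] ℝ) u w =
      (σ x' : EuclideanSpace ℝ (Fin n) →L[ℝ] EuclideanSpace ℝ (Fin n) →L[ℝ] ℝ) u w := by
    rintro x _ rfl u w; rfl
  refine Eq.trans ?_ (hσ _ _ (hper s t) _ _)
  exact congrArg₂ (fun u w : EuclideanSpace ℝ (Fin n) => (σ (q (s, t + 1)) :
    EuclideanSpace ℝ (Fin n) →L[ℝ] EuclideanSpace ℝ (Fin n) →L[ℝ] ℝ) u w)
    (mfderiv_periodic hq hper s t (1, 0)) (mfderiv_periodic hq hper s t (0, 1))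

theorem planeSpeed_periodic (g : Metric n N) {q : ℝ × ℝ → N}
    (hq : ContMDiff 𝓘(ℝ, ℝ × ℝ) (𝓡 n) ∞ q)
    (hper : ∀ s t, q (s, t + 1) = q (s, t)) (e : ℝ × ℝ) (s t : ℝ) :
    planeSpeed g q e (s, t + 1) = planeSpeed g q e (s, t) := by
  have hσ : ∀ x x' : N, x = x' → ∀ u : EuclideanSpace ℝ (Fin n),
      tangentNorm g x u = tangentNorm g x' u := by
    rintro x _ rfl u; rfl
  refine Eq.trans ?_ (hσ _ _ (hper s t) _)
  exact congrArg (fun u : EuclideanSpace ℝ (Fin n) => tangentNorm g (q (s, t + 1)) u)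
    (mfderiv_periodic hq hper s t e)

end PlaneMaps

/-! ### Averaging over long strips -/

section Strip

theorem integral_periodic_mul {f : ℝ → ℝ} (hfc : Continuous f) (hf : ∀ t, f (t + 1) = f t) (m : ℕ) :
    ∫ t in (0 : ℝ)..m, f t = m * ∫ t in (0 : ℝ)..1, f t := by
  have h : Function.Periodic f 1 := hf
  have := h.intervalIntegral_add_zsmul_eq m 0
  simpa using this fun _ _ => hfc.intervalIntegrable _ _

/-- A lower bound for the integral of the curl of a one-form over a fundamental domain of a strip,
if the curl is periodic and the form is bounded by periodic functions. -/
theorem le_integral_curl_of_periodic {Θ : ℝ × ℝ → ℝ × ℝ →L[ℝ] ℝ} (hΘ : ContDiff ℝ 1 Θ)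
    (hper : ∀ s t, curl Θ (s, t + 1) (1, 0) (0, 1) = curl Θ (s, t) (1, 0) (0, 1))
    {a : ℝ → ℝ → ℝ} (ha : ∀ t, Continuous fun s => a s t) (haper : ∀ s t, a s (t + 1) = a s t)
    (hΘa : ∀ s t, |Θ (s, t) (1, 0)| ≤ a s t) {s₀ s₁ : ℝ} {B f : ℝ → ℝ} (hB : Continuous B)
    (hBper : ∀ t, B (t + 1) = B t) (hΘB : ∀ t, |Θ (s₀, t) (0, 1)| ≤ B t)
    (hf : Continuous f) (hfper : ∀ t, f (t + 1) = f t) (hΘf : ∀ t, f t ≤ Θ (s₁, t) (0, 1)) :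
    (∫ t in (0 : ℝ)..1, f t) - ∫ t in (0 : ℝ)..1, B t ≤
      ∫ s in s₀..s₁, ∫ t in (0 : ℝ)..1, curl Θ (s, t) (1, 0) (0, 1) := by
  set R := ∫ s in s₀..s₁, ∫ t in (0 : ℝ)..1, curl Θ (s, t) (1, 0) (0, 1) with hR
  have hcs : ∀ t, Continuous fun s : ℝ => Θ (s, t) (1, 0) := fun t =>
    (hΘ.continuous.comp (by fun_prop : Continuous fun s : ℝ => (s, t))).clm_apply continuous_const
  have hct : ∀ s, Continuous fun t : ℝ => Θ (s, t) (0, 1) := fun s =>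
    (hΘ.continuous.comp (by fun_prop : Continuous fun t : ℝ => (s, t))).clm_apply continuous_const
  set c := |∫ s in s₀..s₁, a s 0| with hc
  have hside : ∀ m : ℕ, |∫ s in s₀..s₁, Θ (s, m) (1, 0)| ≤ c := by
    intro m
    have ham : ∀ s, a s m = a s 0 := by
      intro s
      induction m with
      | zero => simp
      | succ m ih => rw [Nat.cast_succ, haper, ih]
    have h := intervalIntegral.norm_integral_le_abs_of_norm_le (μ := volume)
      (f := fun s => Θ (s, m) (1, 0)) (g := fun s => a s 0) (a := s₀) (b := s₁)
      (Eventually.of_forall fun s => (hΘa s m).trans_eq (ham s)) ((ha 0).intervalIntegrable _ _)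
    exact h
  -- Green's formula over `m` periods. The curl is periodic, so the area term scales with `m`,
  -- whereas each of the two sides stays below `c`. Taking `m` large removes the sides, although `Θ`
  -- itself need not be periodic.
  have hm : ∀ m : ℕ, m * ((∫ t in (0 : ℝ)..1, f t) - ∫ t in (0 : ℝ)..1, B t) - 2 * c ≤ m * R := by
    intro m
    have h1 := integral_integral_curl hΘ 0 m s₀ s₁
    have h2 : ∫ s in s₀..s₁, ∫ t in (0 : ℝ)..m, curl Θ (s, t) (1, 0) (0, 1) = m * R := by
      rw [hR, ← intervalIntegral.integral_const_mul]
      exact intervalIntegral.integral_congr fun s _ => integral_periodic_mul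
        ((continuous_curl hΘ (1, 0) (0, 1)).comp (by fun_prop : Continuous fun t : ℝ => (s, t)))
        (hper s) m
    have h3 : m * ∫ t in (0 : ℝ)..1, f t ≤ ∫ t in (0 : ℝ)..m, Θ (s₁, t) (0, 1) := by
      rw [← integral_periodic_mul hf hfper]
      exact intervalIntegral.integral_mono_on (Nat.cast_nonneg m) (hf.intervalIntegrable _ _)
        ((hct s₁).intervalIntegrable _ _) fun t _ => hΘf t
    have h4 : ∫ t in (0 : ℝ)..m, Θ (s₀, t) (0, 1) ≤ m * ∫ t in (0 : ℝ)..1, B t := by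
      rw [← integral_periodic_mul hB hBper]
      exact intervalIntegral.integral_mono_on (Nat.cast_nonneg m) ((hct s₀).intervalIntegrable _ _)
        (hB.intervalIntegrable _ _) fun t _ => (abs_le.1 (hΘB t)).2
    have h5 := abs_le.1 (hside m)
    have h6 := abs_le.1 (hside 0)
    rw [Nat.cast_zero] at h6
    linarith [h5.1, h5.2, h6.1, h6.2]
  by_contra hlt
  push Not at hlt
  obtain ⟨m, hm'⟩ := exists_nat_gt (2 * c / ((∫ t in (0 : ℝ)..1, f t) - (∫ t in (0 : ℝ)..1, B t) - R))
  have hpos : 0 < (∫ t in (0 : ℝ)..1, f t) - (∫ t in (0 : ℝ)..1, B t) - R := by linarith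
  rw [div_lt_iff₀ hpos] at hm'
  linarith [hm m]

end Strip

/-! ### Areas of cylinders and bounded primitives -/

section StripForms

variable {n : ℕ} {N : Type*} [TopologicalSpace N] [ChartedSpace (EuclideanSpace ℝ (Fin n)) N]
  [IsManifold (𝓡 n) ∞ N]
  {N' : Type*} [TopologicalSpace N'] [ChartedSpace (EuclideanSpace ℝ (Fin n)) N']
  [IsManifold (𝓡 n) ∞ N']
  {p : N' → N}

theorem curl_lift_eq_planeForm (hp : IsUniversalCovering n p) {σ : FormField n N}
    {θ : (x : N') → TangentSpace (𝓡 n) x →L[ℝ] ℝ} (hθ : IsPrimitive p σ θ) {q : ℝ × ℝ → N}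
    {q' : ℝ × ℝ → N'} (hq' : ContMDiff 𝓘(ℝ, ℝ × ℝ) (𝓡 n) ∞ q') (hpq : ∀ z, p (q' z) = q z)
    (z : ℝ × ℝ) : curl (pullOneForm (𝓡 n) θ q') z (1, 0) (0, 1) = planeForm σ q z := by
  have h : q = p ∘ q' := funext fun z => (hpq z).symm
  subst h
  exact hθ.curl_eq hp (hq' z) _ _

theorem contDiff_pullOneForm_plane {θ : (x : N') → TangentSpace (𝓡 n) x →L[ℝ] ℝ}
    (hθ : IsSmoothOneForm (𝓡 n) θ) {q' : ℝ × ℝ → N'} (hq' : ContMDiff 𝓘(ℝ, ℝ × ℝ) (𝓡 n) ∞ q') :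
    ContDiff ℝ ∞ (pullOneForm (𝓡 n) θ q') :=
  contDiff_iff_contDiffAt.2 fun z => contDiffAt_pullOneForm hθ (hq' z)

theorem continuous_planeForm (hp : IsUniversalCovering n p) {σ : FormField n N}
    {θ : (x : N') → TangentSpace (𝓡 n) x →L[ℝ] ℝ} (hθ : IsPrimitive p σ θ) {q : ℝ × ℝ → N}
    (hq : ContMDiff 𝓘(ℝ, ℝ × ℝ) (𝓡 n) ∞ q) : Continuous (planeForm σ q) := by
  obtain ⟨q', hq', hpq⟩ := hp.exists_lift hq
  have h : planeForm σ q = fun z => curl (pullOneForm (𝓡 n) θ q') z (1, 0) (0, 1) :=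
    funext fun z => (curl_lift_eq_planeForm hp hθ hq' hpq z).symm
  rw [h]
  exact continuous_curl ((contDiff_pullOneForm_plane hθ.smooth hq').of_le (by simp)) _ _

/-- The area of a cylinder with respect to a form with a bounded primitive is bounded from below by
the integrals of the primitive along the boundary, also for non-contractible loops. -/
theorem le_integral_planeForm (hp : IsUniversalCovering n p) (g : Metric n N) {σ : FormField n N}
    {θ : (x : N') → TangentSpace (𝓡 n) x →L[ℝ] ℝ} (hθ : IsPrimitive p σ θ) {C : ℝ}
    (hC : ∀ x, liftedDualNormSq g p x (θ x) ≤ C) {q : ℝ × ℝ → N}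
    (hq : ContMDiff 𝓘(ℝ, ℝ × ℝ) (𝓡 n) ∞ q) (hper : ∀ s t, q (s, t + 1) = q (s, t))
    {q' : ℝ × ℝ → N'} (hq' : ContMDiff 𝓘(ℝ, ℝ × ℝ) (𝓡 n) ∞ q') (hpq : ∀ z, p (q' z) = q z)
    (s₀ s₁ : ℝ) {f : ℝ → ℝ} (hf : Continuous f) (hfper : ∀ t, f (t + 1) = f t)
    (hΘf : ∀ t, f t ≤ pullOneForm (𝓡 n) θ q' (s₁, t) (0, 1)) :
    (∫ t in (0 : ℝ)..1, f t) - Real.sqrt C * ∫ t in (0 : ℝ)..1, planeSpeed g q (0, 1) (s₀, t) ≤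
      ∫ s in s₀..s₁, ∫ t in (0 : ℝ)..1, planeForm σ q (s, t) := by
  have hΘ : ContDiff ℝ 1 (pullOneForm (𝓡 n) θ q') :=
    (contDiff_pullOneForm_plane hθ.smooth hq').of_le (by simp)
  have hb : ∀ e z, |pullOneForm (𝓡 n) θ q' z e| ≤ Real.sqrt C * planeSpeed g q e z := by
    intro e z
    have h : q = p ∘ q' := funext fun z => (hpq z).symm
    subst h
    exact abs_pullOneForm_le hp g hC (hq' z) e
  have hcs : ∀ e, Continuous (planeSpeed g q e) := continuous_planeSpeed g hq
  have key := le_integral_curl_of_periodic hΘ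
    (a := fun s t => Real.sqrt C * planeSpeed g q (1, 0) (s, t))
    (B := fun t => Real.sqrt C * planeSpeed g q (0, 1) (s₀, t)) (s₀ := s₀) (s₁ := s₁)
    (fun s t => by
      rw [curl_lift_eq_planeForm hp hθ hq' hpq, curl_lift_eq_planeForm hp hθ hq' hpq,
        planeForm_periodic σ hq hper])
    (fun t => continuous_const.mul ((hcs _).comp (by fun_prop)))
    (fun s t => by simp only [planeSpeed_periodic g hq hper])
    (fun s t => hb _ _)
    (continuous_const.mul ((hcs _).comp (by fun_prop)))
    (fun t => by simp only [planeSpeed_periodic g hq hper])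
    (fun t => hb _ _) hf hfper hΘf
  rw [intervalIntegral.integral_const_mul] at key
  simpa only [curl_lift_eq_planeForm hp hθ hq' hpq] using key

/-- Exchanging the two boundary times reverses the sign of the area, so the lower bound used twice
gives both inequalities. -/
theorem abs_integral_planeForm_le (hp : IsUniversalCovering n p) (g : Metric n N)
    {σ : FormField n N} {θ : (x : N') → TangentSpace (𝓡 n) x →L[ℝ] ℝ} (hθ : IsPrimitive p σ θ)
    {C : ℝ} (hC : ∀ x, liftedDualNormSq g p x (θ x) ≤ C) {q : ℝ × ℝ → N}
    (hq : ContMDiff 𝓘(ℝ, ℝ × ℝ) (𝓡 n) ∞ q) (hper : ∀ s t, q (s, t + 1) = q (s, t)) (s₀ s₁ : ℝ) :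
    |∫ s in s₀..s₁, ∫ t in (0 : ℝ)..1, planeForm σ q (s, t)| ≤
      Real.sqrt C * ((∫ t in (0 : ℝ)..1, planeSpeed g q (0, 1) (s₀, t)) +
        ∫ t in (0 : ℝ)..1, planeSpeed g q (0, 1) (s₁, t)) := by
  obtain ⟨q', hq', hpq⟩ := hp.exists_lift hq
  have hb : ∀ e z, |pullOneForm (𝓡 n) θ q' z e| ≤ Real.sqrt C * planeSpeed g q e z := by
    intro e z
    have h : q = p ∘ q' := funext fun z => (hpq z).symm
    subst h
    exact abs_pullOneForm_le hp g hC (hq' z) e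
  have hcs : ∀ s, Continuous fun t => -(Real.sqrt C * planeSpeed g q (0, 1) (s, t)) := fun s =>
    (continuous_const.mul ((continuous_planeSpeed g hq _).comp (by fun_prop))).neg
  have hlow : ∀ s₀ s₁, -(Real.sqrt C * ((∫ t in (0 : ℝ)..1, planeSpeed g q (0, 1) (s₀, t)) +
        ∫ t in (0 : ℝ)..1, planeSpeed g q (0, 1) (s₁, t))) ≤
      ∫ s in s₀..s₁, ∫ t in (0 : ℝ)..1, planeForm σ q (s, t) := by
    intro s₀ s₁
    have := le_integral_planeForm hp g hθ hC hq hper hq' hpq s₀ s₁ (hcs s₁)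
      (fun t => by simp only [planeSpeed_periodic g hq hper]) (fun t => (abs_le.1 (hb _ _)).1)
    rw [intervalIntegral.integral_neg, intervalIntegral.integral_const_mul] at this
    linarith
  rw [abs_le]
  refine ⟨hlow s₀ s₁, ?_⟩
  have h := hlow s₁ s₀
  rw [intervalIntegral.integral_symm s₀ s₁] at h
  linarith

end StripForms

end RabinowitzFloer
end

noncomputable section

namespace RabinowitzFloer

set_option linter.unusedSectionVars false

/-! ### Radial primitives -/

section Radial

variable {E : Type*} [NormedAddCommGroup E] [NormedSpace ℝ E] [FiniteDimensional ℝ E]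

theorem hasFDerivAt_integral_unit {Ω : Set (E × ℝ)} (hΩ : IsOpen Ω) {F : E × ℝ → ℝ}
    (hF : ContDiffOn ℝ 1 F Ω) {y : E} (hy : ∀ t ∈ Set.Icc (0 : ℝ) 1, (y, t) ∈ Ω) :
    HasFDerivAt (fun y => ∫ t in (0 : ℝ)..1, F (y, t))
      (∫ t in (0 : ℝ)..1, (fderiv ℝ F (y, t)).comp (ContinuousLinearMap.inl ℝ E ℝ)) y := by
  have hd : ContinuousOn (fderiv ℝ F) Ω := hF.continuousOn_fderiv_of_isOpen hΩ (by simp)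
  have hsub : ({y} : Set E) ×ˢ Set.Icc (0 : ℝ) 1 ⊆ Ω := by
    rintro ⟨y', t⟩ ⟨hy', ht⟩
    rw [Set.mem_singleton_iff] at hy'
    subst hy'
    exact hy t ht
  -- By the tube lemma a whole neighbourhood of `y` times the unit interval stays in `Ω`. A smaller
  -- closed ball then gives a compact set and a uniform bound for differentiation under the
  -- integral.
  obtain ⟨u, v, hu, hv, hyu, hIv, huv⟩ := generalized_tube_lemma isCompact_singleton
    isCompact_Icc hΩ hsub
  obtain ⟨ε, hε, hεu⟩ := Metric.isOpen_iff.1 hu y (hyu rfl)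
  have hKΩ : Metric.closedBall y (ε / 2) ×ˢ Set.Icc (0 : ℝ) 1 ⊆ Ω := fun q hq =>
    huv ⟨hεu (Metric.closedBall_subset_ball (by linarith) hq.1), hIv hq.2⟩
  obtain ⟨C, hC⟩ := ((isCompact_closedBall y (ε / 2)).prod isCompact_Icc).exists_bound_of_continuousOn
    (hd.mono hKΩ)
  have hcI : ∀ y' ∈ Metric.closedBall y (ε / 2), ContinuousOn (fun t => F (y', t)) (Set.uIcc 0 1) := by
    intro y' hy'
    rw [Set.uIcc_of_le zero_le_one]
    exact hF.continuousOn.comp (by fun_prop) fun t ht => hKΩ ⟨hy', ht⟩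
  have hyb : y ∈ Metric.closedBall y (ε / 2) := Metric.mem_closedBall_self (by linarith)
  refine intervalIntegral.hasFDerivAt_integral_of_dominated_of_fderiv_le
    (F := fun y t => F (y, t))
    (F' := fun y t => (fderiv ℝ F (y, t)).comp (ContinuousLinearMap.inl ℝ E ℝ))
    (bound := fun _ => C * ‖ContinuousLinearMap.inl ℝ E ℝ‖)
    (Metric.closedBall_mem_nhds y (half_pos hε)) ?_ ?_ ?_ ?_ ?_ ?_
  · filter_upwards [Metric.closedBall_mem_nhds y (half_pos hε)] with y' hy'
    exact (hcI y' hy').intervalIntegrable.def'.aestronglyMeasurable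
  · exact (hcI y hyb).intervalIntegrable
  · have : ContinuousOn (fun t => (fderiv ℝ F (y, t)).comp (ContinuousLinearMap.inl ℝ E ℝ))
        (Set.uIcc 0 1) := by
      rw [Set.uIcc_of_le zero_le_one]
      exact (hd.comp (by fun_prop) fun t ht => hKΩ ⟨hyb, ht⟩).clm_comp continuousOn_const
    exact this.intervalIntegrable.def'.aestronglyMeasurable
  · refine Eventually.of_forall fun t ht y' hy' => ?_
    rw [Set.uIoc_of_le zero_le_one] at ht
    exact (ContinuousLinearMap.opNorm_comp_le _ _).trans
      (mul_le_mul_of_nonneg_right (hC (y', t) ⟨hy', Set.Ioc_subset_Icc_self ht⟩) (norm_nonneg _))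
  · exact intervalIntegrable_const
  · refine Eventually.of_forall fun t ht y' hy' => ?_
    rw [Set.uIoc_of_le zero_le_one] at ht
    have hm : (y', t) ∈ Ω := hKΩ (Set.mk_mem_prod hy' (Set.Ioc_subset_Icc_self ht))
    have h1 := ((hF.contDiffAt (hΩ.mem_nhds hm)).differentiableAt (by simp)).hasFDerivAt
    exact h1.comp y' (hasFDerivAt_prodMk_left y' t)

theorem fderiv_integral_unit_apply {Ω : Set (E × ℝ)} (hΩ : IsOpen Ω) {F : E × ℝ → ℝ}
    (hF : ContDiffOn ℝ 1 F Ω) {y : E} (hy : ∀ t ∈ Set.Icc (0 : ℝ) 1, (y, t) ∈ Ω) (e : E) :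
    fderiv ℝ (fun y => ∫ t in (0 : ℝ)..1, F (y, t)) y e =
      ∫ t in (0 : ℝ)..1, fderiv ℝ F (y, t) (e, 0) := by
  rw [(hasFDerivAt_integral_unit hΩ hF hy).fderiv]
  have hd : ContinuousOn (fun t => (fderiv ℝ F (y, t)).comp (ContinuousLinearMap.inl ℝ E ℝ))
      (Set.uIcc (0 : ℝ) 1) := by
    rw [Set.uIcc_of_le zero_le_one]
    exact ((hF.continuousOn_fderiv_of_isOpen hΩ (by simp)).comp (by fun_prop)
      fun t ht => hy t ht).clm_comp continuousOn_const
  rw [ContinuousLinearMap.intervalIntegral_apply hd.intervalIntegrable]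
  rfl

/-- Induction on the order: the partial derivatives are integrals of the same type with smooth
integrands. -/
theorem contDiffOn_integral_unit {Ω : Set (E × ℝ)} (hΩ : IsOpen Ω) {S : Set E} (hS : IsOpen S)
    (hSΩ : ∀ y ∈ S, ∀ t ∈ Set.Icc (0 : ℝ) 1, (y, t) ∈ Ω) (m : ℕ) :
    ∀ F : E × ℝ → ℝ, ContDiffOn ℝ ∞ F Ω →
      ContDiffOn ℝ m (fun y => ∫ t in (0 : ℝ)..1, F (y, t)) S := by
  induction m with
  | zero =>
    intro F hF
    refine contDiffOn_zero.2 fun y hy => ?_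
    exact (hasFDerivAt_integral_unit hΩ (hF.of_le (by simp)) (hSΩ y hy)).continuousAt.continuousWithinAt
  | succ m ih =>
    intro F hF
    have hF1 : ContDiffOn ℝ 1 F Ω := hF.of_le (by simp)
    rw [Nat.cast_succ, contDiffOn_succ_iff_fderiv_of_isOpen hS]
    refine ⟨fun y hy => (hasFDerivAt_integral_unit hΩ hF1
      (hSΩ y hy)).differentiableAt.differentiableWithinAt, by simp, ?_⟩
    rw [contDiffOn_clm_apply]
    intro e
    have h2 : ContDiffOn ℝ ∞ (fun q => fderiv ℝ F q (e, 0)) Ω :=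
      (hF.fderiv_of_isOpen hΩ (by simp)).clm_apply contDiffOn_const
    exact (ih _ h2).congr fun y hy => fderiv_integral_unit_apply hΩ hF1 (hSΩ y hy) e

/-- The radial primitive of a one-form on a star-shaped set. -/
def radialPrimitive (Θ : E → E →L[ℝ] ℝ) (c y : E) : ℝ :=
  ∫ t in (0 : ℝ)..1, Θ (c + t • (y - c)) (y - c)

theorem radialPrimitive_self (Θ : E → E →L[ℝ] ℝ) (c : E) : radialPrimitive Θ c c = 0 := by
  simp [radialPrimitive]

variable {Θ : E → E →L[ℝ] ℝ} {S : Set E} {c : E}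

theorem segment_mem (hSc : Convex ℝ S) (hc : c ∈ S) {y : E} (hy : y ∈ S) {t : ℝ}
    (ht : t ∈ Set.Icc (0 : ℝ) 1) : c + t • (y - c) ∈ S :=
  hSc.add_smul_sub_mem hc hy ht

theorem continuousOn_radialIntegrand (hSc : Convex ℝ S) (hc : c ∈ S) (hΘ : ContinuousOn Θ S)
    {y : E} (hy : y ∈ S) :
    ContinuousOn (fun t : ℝ => Θ (c + t • (y - c)) (y - c)) (Set.uIcc 0 1) := by
  rw [Set.uIcc_of_le zero_le_one]
  exact (hΘ.comp (by fun_prop) fun t ht => segment_mem hSc hc hy ht).clm_apply continuousOn_const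

theorem radialPrimitive_add (hSc : Convex ℝ S) (hc : c ∈ S) {Θ' : E → E →L[ℝ] ℝ}
    (hΘ : ContinuousOn Θ S) (hΘ' : ContinuousOn Θ' S) {y : E} (hy : y ∈ S) :
    radialPrimitive (Θ + Θ') c y = radialPrimitive Θ c y + radialPrimitive Θ' c y :=
  intervalIntegral.integral_add (continuousOn_radialIntegrand hSc hc hΘ hy).intervalIntegrable
    (continuousOn_radialIntegrand hSc hc hΘ' hy).intervalIntegrable

theorem radialPrimitive_smul (a : ℝ) (y : E) :
    radialPrimitive (a • Θ) c y = a * radialPrimitive Θ c y :=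
  intervalIntegral.integral_const_mul _ _

theorem radialPrimitive_sub (hSc : Convex ℝ S) (hc : c ∈ S) {Θ' : E → E →L[ℝ] ℝ}
    (hΘ : ContinuousOn Θ S) (hΘ' : ContinuousOn Θ' S) {y : E} (hy : y ∈ S) :
    radialPrimitive (Θ - Θ') c y = radialPrimitive Θ c y - radialPrimitive Θ' c y :=
  intervalIntegral.integral_sub (continuousOn_radialIntegrand hSc hc hΘ hy).intervalIntegrable
    (continuousOn_radialIntegrand hSc hc hΘ' hy).intervalIntegrable

theorem radialPrimitive_domain (hS : IsOpen S) (hΘ : ContDiffOn ℝ ∞ Θ S) :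
    IsOpen {q : E × ℝ | c + q.2 • (q.1 - c) ∈ S} ∧
      ContDiffOn ℝ ∞ (fun q : E × ℝ => Θ (c + q.2 • (q.1 - c)) (q.1 - c))
        {q : E × ℝ | c + q.2 • (q.1 - c) ∈ S} := by
  refine ⟨hS.preimage (by fun_prop), ContDiffOn.clm_apply (hΘ.comp ?_ fun q hq => hq) ?_⟩
  · exact ContDiff.contDiffOn (by fun_prop)
  · exact ContDiff.contDiffOn (by fun_prop)

theorem contDiffOn_radialPrimitive (hS : IsOpen S) (hSc : Convex ℝ S) (hc : c ∈ S)
    (hΘ : ContDiffOn ℝ ∞ Θ S) (m : ℕ) : ContDiffOn ℝ m (radialPrimitive Θ c) S :=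
  contDiffOn_integral_unit (radialPrimitive_domain hS hΘ).1 hS
    (fun _ hy _ ht => segment_mem hSc hc hy ht) m _ (radialPrimitive_domain hS hΘ).2

theorem hasDerivAt_segment (c e : E) (t : ℝ) : HasDerivAt (fun t : ℝ => c + t • e) e t := by
  have h := ((hasDerivAt_id t).smul_const e).const_add c
  rw [one_smul] at h
  exact h

/-- The Poincaré lemma in quantitative form. -/
theorem sub_fderiv_radialPrimitive (hS : IsOpen S) (hSc : Convex ℝ S) (hc : c ∈ S)
    (hΘ : ContDiffOn ℝ ∞ Θ S) {y : E} (hy : y ∈ S) (w : E) :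
    Θ y w - fderiv ℝ (radialPrimitive Θ c) y w =
      ∫ t in (0 : ℝ)..1, t * curl Θ (c + t • (y - c)) (y - c) w := by
  have hmem : ∀ t ∈ Set.uIcc (0 : ℝ) 1, c + t • (y - c) ∈ S := by
    intro t ht
    rw [Set.uIcc_of_le zero_le_one] at ht
    exact segment_mem hSc hc hy ht
  have hseg : ContinuousOn (fun t : ℝ => c + t • (y - c)) (Set.uIcc 0 1) := by fun_prop
  have hcΘ : ContinuousOn (fun t : ℝ => Θ (c + t • (y - c))) (Set.uIcc 0 1) :=
    hΘ.continuousOn.comp hseg hmem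
  have hcD : ContinuousOn (fun t : ℝ => fderiv ℝ Θ (c + t • (y - c))) (Set.uIcc 0 1) :=
    (hΘ.continuousOn_fderiv_of_isOpen hS (by simp)).comp hseg hmem
  have hdiff : ∀ t ∈ Set.uIcc (0 : ℝ) 1, HasFDerivAt Θ (fderiv ℝ Θ (c + t • (y - c)))
      (c + t • (y - c)) := fun t ht =>
    ((hΘ.contDiffAt (hS.mem_nhds (hmem t ht))).differentiableAt (by simp)).hasFDerivAt
  -- This integrates the derivative of `t Θ(c + t (y - c)) w`. The derivative of the radial
  -- primitive has the same integrand except that the two arguments of the derivative of `Θ` are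
  -- exchanged, so the difference is a curl.
  have h1 : Θ y w = ∫ t in (0 : ℝ)..1,
      (Θ (c + t • (y - c)) w + t * fderiv ℝ Θ (c + t • (y - c)) (y - c) w) := by
    have hder : ∀ t ∈ Set.uIcc (0 : ℝ) 1, HasDerivAt (fun t : ℝ => t * Θ (c + t • (y - c)) w)
        (Θ (c + t • (y - c)) w + t * fderiv ℝ Θ (c + t • (y - c)) (y - c) w) t := by
      intro t ht
      have h2 : HasDerivAt (fun t : ℝ => Θ (c + t • (y - c)) w)
          (fderiv ℝ Θ (c + t • (y - c)) (y - c) w) t :=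
        (ContinuousLinearMap.apply ℝ ℝ w).hasFDerivAt.comp_hasDerivAt t
          ((hdiff t ht).comp_hasDerivAt t (hasDerivAt_segment c (y - c) t))
      have h3 := (hasDerivAt_id' t).mul h2
      rw [one_mul] at h3
      exact h3
    have := intervalIntegral.integral_eq_sub_of_hasDerivAt hder
      (((hcΘ.clm_apply continuousOn_const).add (continuousOn_id.mul
        ((hcD.clm_apply continuousOn_const).clm_apply continuousOn_const))).intervalIntegrable)
    rw [this, one_mul, zero_mul, sub_zero, one_smul, add_sub_cancel]
  have h2 : fderiv ℝ (radialPrimitive Θ c) y w = ∫ t in (0 : ℝ)..1,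
      (Θ (c + t • (y - c)) w + t * fderiv ℝ Θ (c + t • (y - c)) w (y - c)) := by
    refine (fderiv_integral_unit_apply (radialPrimitive_domain (c := c) hS hΘ).1
      ((radialPrimitive_domain hS hΘ).2.of_le (by simp))
      (fun t ht => segment_mem hSc hc hy ht) w).trans ?_
    refine intervalIntegral.integral_congr fun t ht => ?_
    have hl : HasFDerivAt (fun q : E × ℝ => c + q.2 • (q.1 - c))
        (t • ContinuousLinearMap.fst ℝ E ℝ + (ContinuousLinearMap.snd ℝ E ℝ).smulRight (y - c))
        (y, t) := by
      have := ((hasFDerivAt_snd (𝕜 := ℝ) (p := (y, t))).smul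
        ((hasFDerivAt_fst (𝕜 := ℝ) (p := (y, t))).sub_const c)).const_add c
      exact this
    have h3 := ((hdiff t ht).comp (y, t) hl).clm_apply
      ((hasFDerivAt_fst (𝕜 := ℝ) (p := (y, t))).sub_const c)
    have h4 : fderiv ℝ (fun q : E × ℝ => Θ (c + q.2 • (q.1 - c)) (q.1 - c)) (y, t) = _ := h3.fderiv
    change fderiv ℝ (fun q : E × ℝ => Θ (c + q.2 • (q.1 - c)) (q.1 - c)) (y, t) (w, 0) = _
    rw [h4]
    simp
  rw [h1, h2, ← intervalIntegral.integral_sub]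
  · refine intervalIntegral.integral_congr fun t _ => ?_
    simp only [curl]
    ring
  · exact ((hcΘ.clm_apply continuousOn_const).add (continuousOn_id.mul
        ((hcD.clm_apply continuousOn_const).clm_apply continuousOn_const))).intervalIntegrable
  · exact ((hcΘ.clm_apply continuousOn_const).add (continuousOn_id.mul
        ((hcD.clm_apply continuousOn_const).clm_apply continuousOn_const))).intervalIntegrable

/-- Only the curl of `Θ` and the distance to the base point enter the Poincaré formula, not the size
of `Θ`. This is the source of constants proportional to the norm of the two-form. -/
theorem abs_sub_fderiv_radialPrimitive_le (hS : IsOpen S) (hSc : Convex ℝ S) (hc : c ∈ S)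
    (hΘ : ContDiffOn ℝ ∞ Θ S) {M : ℝ} (hM : ∀ y ∈ S, ∀ u w, |curl Θ y u w| ≤ M * ‖u‖ * ‖w‖)
    {y : E} (hy : y ∈ S) (w : E) :
    |Θ y w - fderiv ℝ (radialPrimitive Θ c) y w| ≤ M * ‖y - c‖ * ‖w‖ := by
  rw [sub_fderiv_radialPrimitive hS hSc hc hΘ hy w]
  have h := intervalIntegral.norm_integral_le_of_norm_le_const (a := 0) (b := 1)
    (C := M * ‖y - c‖ * ‖w‖) (f := fun t => t * curl Θ (c + t • (y - c)) (y - c) w) ?_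
  · simpa using h
  · intro t ht
    rw [Set.uIoc_of_le zero_le_one] at ht
    rw [Real.norm_eq_abs, abs_mul, abs_of_pos ht.1]
    have h1 := hM _ (segment_mem hSc hc hy (Set.Ioc_subset_Icc_self ht)) (y - c) w
    exact (mul_le_of_le_one_left (abs_nonneg _) ht.2).trans h1

end Radial

end RabinowitzFloer
end

noncomputable section

namespace RabinowitzFloer

set_option linter.unusedSectionVars false

/-! ### Charts with lifts to the covering -/

section QuadraticForms

variable {E : Type*} [NormedAddCommGroup E] [NormedSpace ℝ E] [FiniteDimensional ℝ E]

/-- A continuous family of positive definite forms over a compact set is uniformly equivalent to the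
norm. -/
theorem exists_uniform_posDef_bounds {K : Set E} (hK : IsCompact K) {B : E → E →L[ℝ] E →L[ℝ] ℝ}
    (hB : ContinuousOn B K) (hpos : ∀ y ∈ K, ∀ e, e ≠ 0 → 0 < B y e e) :
    ∃ C > 0, ∀ y ∈ K, ∀ e, B y e e ≤ C ^ 2 * ‖e‖ ^ 2 ∧ ‖e‖ ^ 2 ≤ C ^ 2 * B y e e := by
  have hS : IsCompact (Metric.sphere (0 : E) 1) := isCompact_sphere 0 1
  have hcont : ContinuousOn (fun q : E × E => B q.1 q.2 q.2) (K ×ˢ Metric.sphere (0 : E) 1) :=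
    ((hB.comp continuousOn_fst fun q hq => hq.1).clm_apply continuousOn_snd).clm_apply
      continuousOn_snd
  obtain ⟨m, hm, hmK⟩ := (hK.prod hS).exists_forall_le' hcont (a := 0) (by
    rintro ⟨y, e⟩ ⟨hy, he⟩
    refine hpos y hy e fun h0 => ?_
    rw [mem_sphere_zero_iff_norm] at he
    simp only at he h0
    rw [h0, norm_zero] at he
    exact zero_ne_one he)
  obtain ⟨C, hC⟩ := (hK.prod hS).exists_bound_of_continuousOn hcont
  -- A single constant dominating the upper bound `C` and the inverse of the lower bound `m` on the
  -- unit sphere; being at least one, it does not decrease when squared.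
  set D := 1 + |C| + m⁻¹ with hD
  have hD1 : 1 ≤ D := by have := inv_pos.2 hm; have := abs_nonneg C; linarith
  have hCD : C ≤ D ^ 2 := by
    have := inv_pos.2 hm; have := abs_nonneg C; have := le_abs_self C
    nlinarith
  have hmD : 1 ≤ D ^ 2 * m := by
    have h1 : 1 = m⁻¹ * m := (inv_mul_cancel₀ hm.ne').symm
    have h2 : m⁻¹ ≤ D := by have := abs_nonneg C; linarith
    have h3 : m⁻¹ ≤ D ^ 2 := by nlinarith
    nlinarith
  refine ⟨D, by linarith, fun y hy e => ?_⟩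
  by_cases he : e = 0
  · simp [he]
  have hn : 0 < ‖e‖ := norm_pos_iff.2 he
  have hu : ‖e‖⁻¹ • e ∈ Metric.sphere (0 : E) 1 := by
    rw [mem_sphere_zero_iff_norm, norm_smul, norm_inv, norm_norm, inv_mul_cancel₀ hn.ne']
  have h1 := hmK (y, ‖e‖⁻¹ • e) ⟨hy, hu⟩
  have h2 := (le_abs_self _).trans (hC (y, ‖e‖⁻¹ • e) ⟨hy, hu⟩)
  have h3 : B y e e = ‖e‖ ^ 2 * B y (‖e‖⁻¹ • e) (‖e‖⁻¹ • e) := by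
    simp only [map_smul, smul_apply, smul_eq_mul]
    field_simp
  have hsq : 0 < ‖e‖ ^ 2 := by positivity
  simp only at h1 h2
  constructor
  · rw [h3]
    nlinarith
  · rw [h3]
    have h4 : 1 ≤ D ^ 2 * B y (‖e‖⁻¹ • e) (‖e‖⁻¹ • e) :=
      hmD.trans (mul_le_mul_of_nonneg_left h1 (by positivity))
    nlinarith

end QuadraticForms

section LiftedCharts

variable {n : ℕ} {N : Type*} [TopologicalSpace N] [ChartedSpace (EuclideanSpace ℝ (Fin n)) N]
  [IsManifold (𝓡 n) ∞ N]
  {N' : Type*} [TopologicalSpace N'] [ChartedSpace (EuclideanSpace ℝ (Fin n)) N']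
  [IsManifold (𝓡 n) ∞ N']

local notation "𝔼" => EuclideanSpace ℝ (Fin n)

/-- A chart of the base over a ball, together with a lift of its inverse to the covering, and such
that the metric is uniformly equivalent to the Euclidean one. -/
structure LiftedChart (g : Metric n N) (p : N' → N) where
  /-- the center of the ball -/
  center : EuclideanSpace ℝ (Fin n)
  /-- the radius of the ball -/
  radius : ℝ
  /-- the lift of the inverse of the chart -/
  lift : EuclideanSpace ℝ (Fin n) → N'
  /-- the chart -/
  chart : N → EuclideanSpace ℝ (Fin n)
  /-- the domain of the chart -/
  dom : Set N
  isOpen_dom : IsOpen dom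
  contMDiffOn_lift : ContMDiffOn (𝓡 n) (𝓡 n) ∞ lift (Metric.ball center radius)
  contMDiffOn_chart : ContMDiffOn (𝓡 n) (𝓡 n) ∞ chart dom
  chart_mem : ∀ z ∈ dom, chart z ∈ Metric.ball center radius
  lift_mem : ∀ y ∈ Metric.ball center radius, p (lift y) ∈ dom
  chart_lift : ∀ y ∈ Metric.ball center radius, chart (p (lift y)) = y
  lift_chart : ∀ z ∈ dom, p (lift (chart z)) = z
  /-- the distortion of the chart -/
  bound : ℝ
  bound_pos : 0 < bound
  norm_le : ∀ y ∈ Metric.ball center radius, ∀ e : EuclideanSpace ℝ (Fin n),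
    tangentNorm g (p (lift y)) (mfderiv (𝓡 n) (𝓡 n) (p ∘ lift) y e) ≤ bound * ‖e‖ ∧
    ‖e‖ ≤ bound * tangentNorm g (p (lift y)) (mfderiv (𝓡 n) (𝓡 n) (p ∘ lift) y e)

/-- The pull-back of the metric to a normed space. -/
def pullMetric (g : Metric n N) (f : 𝔼 → N) (y : 𝔼) : 𝔼 →L[ℝ] 𝔼 →L[ℝ] ℝ :=
  let B : 𝔼 →L[ℝ] 𝔼 →L[ℝ] ℝ := g.inner (f y)
  let D : 𝔼 →L[ℝ] 𝔼 := mfderiv (𝓡 n) (𝓡 n) f y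
  B.bilinearComp D D

theorem pullMetric_apply (g : Metric n N) (f : 𝔼 → N) (y u w : 𝔼) :
    pullMetric g f y u w = g.inner (f y) (mfderiv (𝓡 n) (𝓡 n) f y u)
      (mfderiv (𝓡 n) (𝓡 n) f y w) := rfl

theorem pullMetric_self (g : Metric n N) (f : 𝔼 → N) (y u : 𝔼) :
    pullMetric g f y u u = tangentNorm g (f y) (mfderiv (𝓡 n) (𝓡 n) f y u) ^ 2 :=
  (pullMetric_apply g f y u u).trans (tangentNorm_sq g (f y) _).symm

theorem contDiffAt_pullMetric (g : Metric n N) {f : 𝔼 → N} {y : 𝔼}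
    (hf : ContMDiffAt (𝓡 n) (𝓡 n) ∞ f y) : ContDiffAt ℝ ∞ (pullMetric g f) y := by
  refine contDiffAt_of_clm_apply fun u => contDiffAt_of_clm_apply fun w => ?_
  have h2 := ContMDiffAt.clm_bundle_apply₂ (F₃ := ℝ) (E₃ := fun _ : N => ℝ)
    ((g.contMDiff (f y)).comp y hf) (contMDiffAt_mfderiv_apply hf u)
    (contMDiffAt_mfderiv_apply hf w)
  rw [contMDiffAt_totalSpace] at h2
  exact contMDiffAt_iff_contDiffAt.1 h2.2

set_option maxHeartbeats 1000000 in
-- A chart of the covering at a preimage is composed with the local diffeomorphism `p`. The radius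
-- is halved so that the closed ball still lies in the region of smoothness; compactness then makes
-- the metric uniformly comparable with the Euclidean norm.
theorem exists_liftedChart {p : N' → N} (hp : IsUniversalCovering n p) (g : Metric n N) (x : N) :
    ∃ L : LiftedChart g p, x ∈ L.dom := by
  obtain ⟨x', rfl⟩ := hp.surjective x
  obtain ⟨Φ, hx', hΦ⟩ := hp.localDiffeo x'
  set e := extChartAt (𝓡 n) x' with he
  have hcs : ContinuousOn e.symm e.target := continuousOn_extChartAt_symm x'
  have hW : IsOpen (e.target ∩ e.symm ⁻¹' Φ.source) :=
    hcs.isOpen_inter_preimage (isOpen_extChartAt_target x') Φ.open_source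
  have hcW : e x' ∈ e.target ∩ e.symm ⁻¹' Φ.source := by
    refine ⟨mem_extChartAt_target x', ?_⟩
    rw [Set.mem_preimage, he, extChartAt_to_inv]
    exact hx'
  obtain ⟨ε, hε, hεW⟩ := Metric.isOpen_iff.1 hW _ hcW
  have hr : 0 < ε / 2 := by linarith
  have hKW : Metric.closedBall (e x') (ε / 2) ⊆ e.target ∩ e.symm ⁻¹' Φ.source :=
    (Metric.closedBall_subset_ball (by linarith)).trans hεW
  have hBW := Metric.ball_subset_closedBall.trans hKW
  have hsmooth : ∀ y ∈ e.target ∩ e.symm ⁻¹' Φ.source, ContMDiffAt (𝓡 n) (𝓡 n) ∞ e.symm y :=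
    fun y hy => (contMDiffOn_extChartAt_symm (n := ∞) x').contMDiffAt
      ((isOpen_extChartAt_target x').mem_nhds hy.1)
  have hpsmooth : ∀ y ∈ e.target ∩ e.symm ⁻¹' Φ.source,
      ContMDiffAt (𝓡 n) (𝓡 n) ∞ (p ∘ e.symm) y := fun y hy =>
    (hp.contMDiff _).comp y (hsmooth y hy)
  have hinv : ∀ y ∈ e.target ∩ e.symm ⁻¹' Φ.source, e (Φ.symm (p (e.symm y))) = y := by
    intro y hy
    have h1 : p (e.symm y) = Φ (e.symm y) := hΦ hy.2
    have h2 : Φ.symm (Φ (e.symm y)) = e.symm y := Φ.left_inv hy.2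
    rw [h1, h2]
    exact e.right_inv hy.1
  have htarget : ∀ y ∈ e.target ∩ e.symm ⁻¹' Φ.source, p (e.symm y) ∈ Φ.target := by
    intro y hy
    have h1 : p (e.symm y) = Φ (e.symm y) := hΦ hy.2
    rw [h1]
    exact Φ.map_source hy.2
  have hchart : ∀ z ∈ Φ.target, Φ.symm z ∈ e.source →
      ContMDiffAt (𝓡 n) (𝓡 n) ∞ (e ∘ Φ.symm) z := by
    intro z hz hz'
    refine ContMDiffAt.comp z (I' := 𝓡 n) ?_
      (Φ.contMDiffOn_invFun.contMDiffAt (Φ.open_target.mem_nhds hz))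
    refine contMDiffOn_extChartAt.contMDiffAt ((chartAt 𝔼 x').open_source.mem_nhds ?_)
    rwa [he, extChartAt_source] at hz'
  -- The map `p ∘ e.symm` has the smooth local left inverse `e ∘ Φ.symm`, hence an injective
  -- derivative, so the pulled-back metric is positive definite.
  have hinj : ∀ y ∈ e.target ∩ e.symm ⁻¹' Φ.source, ∀ u : 𝔼, u ≠ 0 →
      (mfderiv (𝓡 n) (𝓡 n) (p ∘ e.symm) y u : 𝔼) ≠ 0 := by
    intro y hy u hu h0
    have hmem : Φ.symm (p (e.symm y)) ∈ e.source := by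
      have h1 : p (e.symm y) = Φ (e.symm y) := hΦ hy.2
      have h2 : Φ.symm (Φ (e.symm y)) = e.symm y := Φ.left_inv hy.2
      rw [h1, h2]
      exact e.map_target hy.1
    have h1 : mfderiv (𝓡 n) (𝓡 n) ((e ∘ Φ.symm) ∘ (p ∘ e.symm)) y = _ :=
      mfderiv_comp (I' := 𝓡 n) y
        ((hchart _ (htarget y hy) hmem).mdifferentiableAt (by simp))
        ((hpsmooth y hy).mdifferentiableAt (by simp))
    have h2 : (e ∘ Φ.symm) ∘ (p ∘ e.symm) =ᶠ[𝓝 y] id := by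
      filter_upwards [hW.mem_nhds hy] with y' hy'
      exact hinv y' hy'
    have h3 : (mfderiv (𝓡 n) (𝓡 n) ((e ∘ Φ.symm) ∘ (p ∘ e.symm)) y : 𝔼 →L[ℝ] 𝔼) =
        ContinuousLinearMap.id ℝ 𝔼 := h2.mfderiv_eq.trans mfderiv_id
    have h4 := congrArg (fun T : 𝔼 →L[ℝ] 𝔼 => T u) (h3.symm.trans h1)
    have h5 : u = (mfderiv (𝓡 n) (𝓡 n) (e ∘ Φ.symm) ((p ∘ e.symm) y) : 𝔼 →L[ℝ] 𝔼)
      (mfderiv (𝓡 n) (𝓡 n) (p ∘ e.symm) y u : 𝔼) := h4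
    rw [h0, map_zero] at h5
    exact hu h5
  obtain ⟨C, hC, hCK⟩ := exists_uniform_posDef_bounds (isCompact_closedBall (e x') (ε / 2))
    (B := pullMetric g (p ∘ e.symm))
    (fun y hy => (contDiffAt_pullMetric g (hpsmooth y (hKW hy))).continuousAt.continuousWithinAt)
    (fun y hy u hu => g.pos _ _ (hinj y (hKW hy) u hu))
  have hnorm : ∀ y ∈ Metric.ball (e x') (ε / 2), ∀ u : 𝔼,
      tangentNorm g (p (e.symm y)) (mfderiv (𝓡 n) (𝓡 n) (p ∘ e.symm) y u) ≤ C * ‖u‖ ∧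
      ‖u‖ ≤ C * tangentNorm g (p (e.symm y)) (mfderiv (𝓡 n) (𝓡 n) (p ∘ e.symm) y u) := by
    intro y hy u
    have h := hCK y (Metric.ball_subset_closedBall hy) u
    have h2 : pullMetric g (p ∘ e.symm) y u u = tangentNorm g (p (e.symm y))
      (mfderiv (𝓡 n) (𝓡 n) (p ∘ e.symm) y u) ^ 2 := pullMetric_self g (p ∘ e.symm) y u
    rw [h2, ← mul_pow, ← mul_pow] at h
    exact ⟨(sq_le_sq₀ (tangentNorm_nonneg _ _ _) (by positivity)).1 h.1,
      (sq_le_sq₀ (norm_nonneg _) (mul_nonneg hC.le (tangentNorm_nonneg _ _ _))).1 h.2⟩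
  have hdom : IsOpen (Φ.target ∩ Φ.symm ⁻¹' (e.source ∩ e ⁻¹' Metric.ball (e x') (ε / 2))) := by
    refine Φ.contMDiffOn_invFun.continuousOn.isOpen_inter_preimage Φ.open_target ?_
    exact (continuousOn_extChartAt x').isOpen_inter_preimage (isOpen_extChartAt_source x')
      Metric.isOpen_ball
  refine ⟨{ center := e x', radius := ε / 2, lift := e.symm, chart := e ∘ Φ.symm
            dom := Φ.target ∩ Φ.symm ⁻¹' (e.source ∩ e ⁻¹' Metric.ball (e x') (ε / 2))
            isOpen_dom := hdom
            contMDiffOn_lift := fun y hy => (hsmooth y (hBW hy)).contMDiffWithinAt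
            contMDiffOn_chart := fun z hz => (hchart z hz.1 hz.2.1).contMDiffWithinAt
            chart_mem := fun z hz => hz.2.2
            lift_mem := ?_
            chart_lift := fun y hy => hinv y (hBW hy)
            lift_chart := ?_
            bound := C
            bound_pos := hC
            norm_le := hnorm }, ?_⟩
  · intro y hy
    have h1 : p (e.symm y) = Φ (e.symm y) := hΦ (hBW hy).2
    have h2 : Φ.symm (Φ (e.symm y)) = e.symm y := Φ.left_inv (hBW hy).2
    refine ⟨htarget y (hBW hy), ?_⟩
    rw [Set.mem_preimage, h1, h2]
    refine ⟨e.map_target (hBW hy).1, ?_⟩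
    rw [Set.mem_preimage, e.right_inv (hBW hy).1]
    exact hy
  · intro z hz
    have h1 : e.symm (e (Φ.symm z)) = Φ.symm z := e.left_inv hz.2.1
    have h2 : p (Φ.symm z) = Φ (Φ.symm z) := hΦ (Φ.map_target hz.1)
    have h3 : Φ (Φ.symm z) = z := Φ.right_inv hz.1
    rw [Function.comp_apply, h1, h2, h3]
  · have h1 : p x' = Φ x' := hΦ hx'
    have h2 : Φ.symm (Φ x') = x' := Φ.left_inv hx'
    refine ⟨by rw [h1]; exact Φ.map_source hx', ?_⟩
    rw [Set.mem_preimage, h1, h2]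
    exact ⟨mem_extChartAt_source x', Metric.mem_ball_self hr⟩

end LiftedCharts

end RabinowitzFloer
end

noncomputable section

namespace RabinowitzFloer

set_option linter.unusedSectionVars false

/-! ### Nested covers -/

/-- With a Lebesgue number `δ`, balls of radius `δ/4` work: if two of them meet, the second lies
within distance `3δ/4` of the center of the first. -/
theorem exists_starRefinement {X : Type*} [TopologicalSpace X] [CompactSpace X]
    [TopologicalSpace.MetrizableSpace X] (V : X → Set X) (hV : ∀ x, IsOpen (V x))
    (hx : ∀ x, x ∈ V x) :
    ∃ (W : X → Set X) (k : X → X), (∀ z, IsOpen (W z)) ∧ (∀ z, z ∈ W z) ∧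
      ∀ z z', (W z ∩ W z').Nonempty → W z' ⊆ V (k z) := by
  let := TopologicalSpace.metrizableSpaceMetric X
  obtain ⟨δ, hδ, h⟩ := lebesgue_number_lemma_of_metric (isCompact_univ (X := X)) hV
    fun x _ => Set.mem_iUnion.2 ⟨x, hx x⟩
  choose k hk using fun x => h x (Set.mem_univ x)
  refine ⟨fun z => Metric.ball z (δ / 4), k, fun z => Metric.isOpen_ball,
    fun z => Metric.mem_ball_self (by linarith), ?_⟩
  rintro z z' ⟨y, hy, hy'⟩ x hx'
  refine hk z ?_
  rw [Metric.mem_ball] at *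
  have h1 := dist_triangle x z' y
  have h2 := dist_triangle x y z
  rw [dist_comm] at hy'
  linarith

section NestedCovers

variable {n : ℕ} {N : Type*} [TopologicalSpace N] [ChartedSpace (EuclideanSpace ℝ (Fin n)) N]
  [IsManifold (𝓡 n) ∞ N]
  {N' : Type*} [TopologicalSpace N'] [ChartedSpace (EuclideanSpace ℝ (Fin n)) N']
  [IsManifold (𝓡 n) ∞ N'] {g : Metric n N} {p : N' → N}

local notation "𝔼" => EuclideanSpace ℝ (Fin n)

namespace LiftedChart

/-- The ball over which a chart is defined. -/
def ball (L : LiftedChart g p) : Set 𝔼 := Metric.ball L.center L.radius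

/-- The part of the domain of a chart over a smaller ball. -/
def region (L : LiftedChart g p) (c : 𝔼) (r : ℝ) : Set N :=
  {z ∈ L.dom | L.chart z ∈ Metric.ball c r}

theorem isOpen_region (L : LiftedChart g p) (c : 𝔼) (r : ℝ) : IsOpen (L.region c r) :=
  L.contMDiffOn_chart.continuousOn.isOpen_inter_preimage L.isOpen_dom Metric.isOpen_ball

theorem contMDiffAt_lift (L : LiftedChart g p) {y : 𝔼} (hy : y ∈ L.ball) :
    ContMDiffAt (𝓡 n) (𝓡 n) ∞ L.lift y :=
  L.contMDiffOn_lift.contMDiffAt (Metric.isOpen_ball.mem_nhds hy)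

theorem contMDiffAt_chart (L : LiftedChart g p) {z : N} (hz : z ∈ L.dom) :
    ContMDiffAt (𝓡 n) (𝓡 n) ∞ L.chart z :=
  L.contMDiffOn_chart.contMDiffAt (L.isOpen_dom.mem_nhds hz)

theorem exists_region_subset (hp : IsUniversalCovering n p) (L : LiftedChart g p) {S : Set 𝔼}
    (hS : IsOpen S) (hSL : S ⊆ L.ball) {W : Set N} (hW : IsOpen W) {z : N} (hz : z ∈ W)
    (hzL : z ∈ L.dom) (hzS : L.chart z ∈ S) :
    ∃ r > 0, Metric.ball (L.chart z) r ⊆ S ∧ L.region (L.chart z) r ⊆ W := by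
  have hcont : ContinuousOn (p ∘ L.lift) S := fun y hy =>
    ((hp.contMDiff _).comp y (L.contMDiffAt_lift (hSL hy))).continuousAt.continuousWithinAt
  have hopen : IsOpen (S ∩ (p ∘ L.lift) ⁻¹' W) := hcont.isOpen_inter_preimage hS hW
  have hmem : L.chart z ∈ S ∩ (p ∘ L.lift) ⁻¹' W := by
    refine ⟨hzS, ?_⟩
    rw [Set.mem_preimage, Function.comp_apply, L.lift_chart z hzL]
    exact hz
  obtain ⟨r, hr, hrS⟩ := Metric.isOpen_iff.1 hopen _ hmem
  refine ⟨r, hr, fun y hy => (hrS hy).1, fun z' hz' => ?_⟩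
  have h := (hrS hz'.2).2
  rwa [Set.mem_preimage, Function.comp_apply, L.lift_chart z' hz'.1] at h

end LiftedChart

/-- A finite cover of the base by charts over balls, at three levels of size, such that
intersecting charts of one level are contained in each other at the next level. -/
structure NestedCover (g : Metric n N) (p : N' → N) (ι : Type*) where
  /-- the charts -/
  charts : ι → LiftedChart g p
  /-- the centers of the small balls -/
  small : ι → EuclideanSpace ℝ (Fin n)
  /-- the radii of the small balls -/
  smallRadius : ι → ℝ
  /-- the centers of the middle balls -/
  middle : ι → EuclideanSpace ℝ (Fin n)
  /-- the radii of the middle balls -/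
  middleRadius : ι → ℝ
  small_pos : ∀ i, 0 < smallRadius i
  small_subset : ∀ i, Metric.ball (small i) (smallRadius i) ⊆
    Metric.ball (middle i) (middleRadius i)
  middle_subset : ∀ i, Metric.ball (middle i) (middleRadius i) ⊆ (charts i).ball
  exists_mem : ∀ z, ∃ i, z ∈ (charts i).region (small i) (smallRadius i)
  subset_middle : ∀ i j, ((charts i).region (small i) (smallRadius i) ∩
    (charts j).region (small j) (smallRadius j)).Nonempty →
    (charts j).region (small j) (smallRadius j) ⊆ (charts i).region (middle i) (middleRadius i)
  subset_dom : ∀ i j, ((charts i).region (small i) (smallRadius i) ∩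
    (charts j).region (small j) (smallRadius j)).Nonempty →
    (charts j).region (middle j) (middleRadius j) ⊆ (charts i).dom

/-- Two successive star refinements of the chart domains produce the middle and the small sets. For
a point `w` all three levels are read in the chart at `k₁ (k₂ w)`, whose domain contains both
refined sets, and each level is shrunk to the preimage of a ball so that radial primitives are
available. -/
theorem exists_nestedCover [CompactSpace N] [T2Space N] (hp : IsUniversalCovering n p)
    (g : Metric n N) : ∃ s : Finset N, Nonempty (NestedCover g p s) := by
  have : SecondCountableTopology N := ChartedSpace.secondCountable_of_sigmaCompact 𝔼 N
  have : TopologicalSpace.MetrizableSpace N :=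
    TopologicalSpace.metrizableSpace_of_t3_secondCountable N
  choose L hL using exists_liftedChart hp g
  obtain ⟨W₁, k₁, hW₁, hzW₁, hWk₁⟩ := exists_starRefinement (fun x => (L x).dom)
    (fun x => (L x).isOpen_dom) hL
  have hd₁ : ∀ z, z ∈ (L (k₁ z)).dom := fun z => hWk₁ z z ⟨z, hzW₁ z, hzW₁ z⟩ (hzW₁ z)
  choose r' hr' hr'S hr'W using fun z => (L (k₁ z)).exists_region_subset hp
    (S := (L (k₁ z)).ball) Metric.isOpen_ball subset_rfl (hW₁ z) (hzW₁ z) (hd₁ z)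
    ((L (k₁ z)).chart_mem z (hd₁ z))
  obtain ⟨W₂, k₂, hW₂, hzW₂, hWk₂⟩ := exists_starRefinement
    (fun z => (L (k₁ z)).region ((L (k₁ z)).chart z) (r' z))
    (fun z => (L (k₁ z)).isOpen_region _ _)
    (fun z => ⟨hd₁ z, Metric.mem_ball_self (hr' z)⟩)
  have hd₂ := fun z => hWk₂ z z ⟨z, hzW₂ z, hzW₂ z⟩ (hzW₂ z)
  choose r hr hrS hrW using fun w => (L (k₁ (k₂ w))).exists_region_subset hp
    Metric.isOpen_ball (hr'S (k₂ w)) (hW₂ w) (hzW₂ w) (hd₂ w).1 (hd₂ w).2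
  obtain ⟨s, hs⟩ := isCompact_univ.elim_finite_subcover
    (fun w => (L (k₁ (k₂ w))).region ((L (k₁ (k₂ w))).chart w) (r w))
    (fun w => (L (k₁ (k₂ w))).isOpen_region _ _)
    (fun w _ => Set.mem_iUnion.2 ⟨w, (hd₂ w).1, Metric.mem_ball_self (hr w)⟩)
  have hsub : ∀ w, (L (k₁ (k₂ w))).region ((L (k₁ (k₂ w))).chart w) (r w) ⊆
      (L (k₁ (k₂ w))).region ((L (k₁ (k₂ w))).chart (k₂ w)) (r' (k₂ w)) :=
    fun w z hz => ⟨hz.1, hrS w hz.2⟩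
  refine ⟨s, ⟨{ charts := fun i => L (k₁ (k₂ i))
                small := fun i => (L (k₁ (k₂ i))).chart i
                smallRadius := fun i => r i
                middle := fun i => (L (k₁ (k₂ i))).chart (k₂ i)
                middleRadius := fun i => r' (k₂ i)
                small_pos := fun i => hr i
                small_subset := fun i => hrS i
                middle_subset := fun i => hr'S (k₂ i)
                exists_mem := ?_
                subset_middle := ?_
                subset_dom := ?_ }⟩⟩
  · intro z
    obtain ⟨w, hw, hz⟩ := Set.mem_iUnion₂.1 (hs (Set.mem_univ z))
    exact ⟨⟨w, hw⟩, hz⟩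
  · rintro i j ⟨z, hzi, hzj⟩
    exact (hrW j).trans (hWk₂ i j ⟨z, hrW i hzi, hrW j hzj⟩)
  · rintro i j ⟨z, hzi, hzj⟩
    exact (hr'W (k₂ j)).trans (hWk₁ (k₂ i) (k₂ j)
      ⟨z, hr'W _ (hsub i hzi), hr'W _ (hsub j hzj)⟩)

end NestedCovers

end RabinowitzFloer
end

noncomputable section

namespace RabinowitzFloer

set_option linter.unusedSectionVars false

/-! ### Comparison of primitives in different charts -/

section PullBackComparison

variable {E : Type*} [NormedAddCommGroup E] [NormedSpace ℝ E]
  {H : Type*} [TopologicalSpace H] {I : ModelWithCorners ℝ E H}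
  {M : Type*} [TopologicalSpace M] [ChartedSpace H M]
  {F F' : Type*} [NormedAddCommGroup F] [NormedSpace ℝ F] [NormedAddCommGroup F'] [NormedSpace ℝ F']

theorem pullOneForm_comp (α : (x : M) → TangentSpace I x →L[ℝ] ℝ) {f : F' → M} {h : F → F'} {y : F}
    (hf : MDifferentiableAt 𝓘(ℝ, F') I f (h y)) (hh : DifferentiableAt ℝ h y) (e : F) :
    pullOneForm I α (f ∘ h) y e = pullOneForm I α f (h y) (fderiv ℝ h y e) := by
  have h1 : mfderiv 𝓘(ℝ, F) I (f ∘ h) y = _ :=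
    mfderiv_comp (I' := 𝓘(ℝ, F')) y hf hh.mdifferentiableAt
  rw [mfderiv_eq_fderiv] at h1
  exact congrArg (fun T : F →L[ℝ] E => (α (f (h y)) : E →L[ℝ] ℝ) (T e)) h1

theorem pullOneForm_congr (α : (x : M) → TangentSpace I x →L[ℝ] ℝ) {f f' : F → M} {y : F}
    (h : f =ᶠ[𝓝 y] f') : pullOneForm I α f y = pullOneForm I α f' y := by
  have key : ∀ (x x' : M) (T T' : F →L[ℝ] E), x = x' → T = T' →
      ContinuousLinearMap.comp (α x : E →L[ℝ] ℝ) T =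
      ContinuousLinearMap.comp (α x' : E →L[ℝ] ℝ) T' := by
    rintro x _ T _ rfl rfl; rfl
  exact key _ _ _ _ h.eq_of_nhds (h.mfderiv_eq (I := 𝓘(ℝ, F)) (I' := I))

theorem curl_sub {Θ Θ' : F → F →L[ℝ] ℝ} {y : F} (hΘ : DifferentiableAt ℝ Θ y)
    (hΘ' : DifferentiableAt ℝ Θ' y) (u w : F) :
    curl (Θ - Θ') y u w = curl Θ y u w - curl Θ' y u w := by
  simp only [curl, fderiv_sub hΘ hΘ', sub_apply]
  ring

end PullBackComparison

/-! ### Pull-backs of a primitive along different sheets of the covering -/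

section Comparison

variable {n : ℕ} {N : Type*} [TopologicalSpace N] [ChartedSpace (EuclideanSpace ℝ (Fin n)) N]
  [IsManifold (𝓡 n) ∞ N]
  {N' : Type*} [TopologicalSpace N'] [ChartedSpace (EuclideanSpace ℝ (Fin n)) N']
  [IsManifold (𝓡 n) ∞ N'] {g : Metric n N} {p : N' → N}
  {F : Type*} [NormedAddCommGroup F] [NormedSpace ℝ F]

local notation "𝔼" => EuclideanSpace ℝ (Fin n)

/-- The pull-back of a two-form to a normed space. -/
def pullTwoForm (σ : FormField n N) (f : F → N) (y u w : F) : ℝ :=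
  σ (f y) (mfderiv 𝓘(ℝ, F) (𝓡 n) f y u) (mfderiv 𝓘(ℝ, F) (𝓡 n) f y w)

theorem pullTwoForm_congr (σ : FormField n N) {f f' : F → N} {y : F} (h : f =ᶠ[𝓝 y] f') (u w : F) :
    pullTwoForm σ f y u w = pullTwoForm σ f' y u w := by
  have key : ∀ (x x' : N) (T T' : F →L[ℝ] 𝔼), x = x' → T = T' →
      (σ x : 𝔼 →L[ℝ] 𝔼 →L[ℝ] ℝ) (T u) (T w) = (σ x' : 𝔼 →L[ℝ] 𝔼 →L[ℝ] ℝ) (T' u) (T' w) := by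
    rintro x _ T _ rfl rfl; rfl
  exact key _ _ _ _ h.eq_of_nhds (h.mfderiv_eq (I := 𝓘(ℝ, F)) (I' := 𝓡 n))

theorem contDiffOn_pullOneForm [FiniteDimensional ℝ F]
    {θ : (x : N') → TangentSpace (𝓡 n) x →L[ℝ] ℝ}
    (hθ : IsSmoothOneForm (𝓡 n) θ) {S : Set F} {f : F → N'}
    (hf : ∀ y ∈ S, ContMDiffAt 𝓘(ℝ, F) (𝓡 n) ∞ f y) :
    ContDiffOn ℝ ∞ (pullOneForm (𝓡 n) θ f) S := fun y hy =>
  (contDiffAt_pullOneForm hθ (hf y hy)).contDiffWithinAt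

/-- Both curls are pull-backs of `σ` by the same map to the base. Thus the pull-backs of `θ` along
two sheets differ by a closed form, although `θ` is not assumed invariant under deck
transformations. -/
theorem IsPrimitive.curl_pullOneForm_congr (hp : IsUniversalCovering n p) {σ : FormField n N}
    {θ : (x : N') → TangentSpace (𝓡 n) x →L[ℝ] ℝ} (hθ : IsPrimitive p σ θ) {S : Set F}
    (hS : IsOpen S) {f₁ f₂ : F → N'} (hf₁ : ∀ y ∈ S, ContMDiffAt 𝓘(ℝ, F) (𝓡 n) ∞ f₁ y)
    (hf₂ : ∀ y ∈ S, ContMDiffAt 𝓘(ℝ, F) (𝓡 n) ∞ f₂ y) (h : ∀ y ∈ S, p (f₁ y) = p (f₂ y))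
    {y : F} (hy : y ∈ S) (u w : F) :
    curl (pullOneForm (𝓡 n) θ f₁) y u w = curl (pullOneForm (𝓡 n) θ f₂) y u w := by
  have h1 : curl (pullOneForm (𝓡 n) θ f₁) y u w = pullTwoForm σ (p ∘ f₁) y u w :=
    hθ.curl_eq hp (hf₁ y hy) u w
  have h2 : curl (pullOneForm (𝓡 n) θ f₂) y u w = pullTwoForm σ (p ∘ f₂) y u w :=
    hθ.curl_eq hp (hf₂ y hy) u w
  rw [h1, h2]
  refine pullTwoForm_congr σ ?_ u w
  filter_upwards [hS.mem_nhds hy] with y' hy'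
  exact h y' hy'

/-- The difference of the two pull-backs is closed, so the quantitative Poincaré lemma applies to it
with zero error. -/
theorem hasFDerivAt_radialPrimitive_sub (hp : IsUniversalCovering n p) {σ : FormField n N}
    {θ : (x : N') → TangentSpace (𝓡 n) x →L[ℝ] ℝ} (hθ : IsPrimitive p σ θ) {S : Set 𝔼}
    (hS : IsOpen S) (hSc : Convex ℝ S) {x : 𝔼} (hx : x ∈ S) {f₁ f₂ : 𝔼 → N'}
    (hf₁ : ∀ y ∈ S, ContMDiffAt (𝓡 n) (𝓡 n) ∞ f₁ y)
    (hf₂ : ∀ y ∈ S, ContMDiffAt (𝓡 n) (𝓡 n) ∞ f₂ y) (h : ∀ y ∈ S, p (f₁ y) = p (f₂ y))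
    {y : 𝔼} (hy : y ∈ S) :
    HasFDerivAt (fun y => radialPrimitive (pullOneForm (𝓡 n) θ f₁) x y -
      radialPrimitive (pullOneForm (𝓡 n) θ f₂) x y)
      (pullOneForm (𝓡 n) θ f₁ y - pullOneForm (𝓡 n) θ f₂ y) y := by
  have h1 := contDiffOn_pullOneForm hθ.smooth hf₁
  have h2 := contDiffOn_pullOneForm hθ.smooth hf₂
  have h3 : ContDiffOn ℝ ∞ (pullOneForm (𝓡 n) θ f₁ - pullOneForm (𝓡 n) θ f₂) S := h1.sub h2
  have hd : ∀ {Θ : 𝔼 → 𝔼 →L[ℝ] ℝ}, ContDiffOn ℝ ∞ Θ S → ∀ y ∈ S, DifferentiableAt ℝ Θ y :=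
    fun hΘ y hy => (hΘ.contDiffAt (hS.mem_nhds hy)).differentiableAt (by simp)
  have hcurl : ∀ y ∈ S, ∀ u w, |curl (pullOneForm (𝓡 n) θ f₁ - pullOneForm (𝓡 n) θ f₂) y u w| ≤
      0 * ‖u‖ * ‖w‖ := by
    intro y hy u w
    rw [curl_sub (hd h1 y hy) (hd h2 y hy),
      hθ.curl_pullOneForm_congr hp hS hf₁ hf₂ h hy u w]
    simp
  have hdiff : DifferentiableAt ℝ
      (radialPrimitive (pullOneForm (𝓡 n) θ f₁ - pullOneForm (𝓡 n) θ f₂) x) y :=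
    ((contDiffOn_radialPrimitive hS hSc hx h3 1).contDiffAt (hS.mem_nhds hy)).differentiableAt
      (by simp)
  have hval : fderiv ℝ (radialPrimitive (pullOneForm (𝓡 n) θ f₁ - pullOneForm (𝓡 n) θ f₂) x) y =
      pullOneForm (𝓡 n) θ f₁ y - pullOneForm (𝓡 n) θ f₂ y := by
    ext w
    have h4 := abs_sub_fderiv_radialPrimitive_le hS hSc hx h3 hcurl hy w
    rw [zero_mul, zero_mul, abs_nonpos_iff, sub_eq_zero] at h4
    exact h4.symm
  have h5 := hdiff.hasFDerivAt
  rw [hval] at h5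
  refine h5.congr_of_eventuallyEq ?_
  filter_upwards [hS.mem_nhds hy] with y' hy'
  exact (radialPrimitive_sub hSc hx h1.continuousOn h2.continuousOn hy').symm

namespace LiftedChart

theorem fderiv_lift_chart_comp (hp : IsUniversalCovering n p) (L : LiftedChart g p) {q : F → N}
    {y : F} (hq : ContMDiffAt 𝓘(ℝ, F) (𝓡 n) ∞ q y) (hy : q y ∈ L.dom) (e : F) :
    (mfderiv 𝓘(ℝ, F) (𝓡 n) q y e : 𝔼) =
      mfderiv (𝓡 n) (𝓡 n) (p ∘ L.lift) (L.chart (q y)) (fderiv ℝ (L.chart ∘ q) y e) := by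
  have h1 : ContMDiffAt 𝓘(ℝ, F) (𝓡 n) ∞ (L.chart ∘ q) y := (L.contMDiffAt_chart hy).comp y hq
  have h2 : ContMDiffAt (𝓡 n) (𝓡 n) ∞ (p ∘ L.lift) ((L.chart ∘ q) y) :=
    (hp.contMDiff _).comp _ (L.contMDiffAt_lift (L.chart_mem _ hy))
  have h3 : mfderiv 𝓘(ℝ, F) (𝓡 n) ((p ∘ L.lift) ∘ (L.chart ∘ q)) y = _ :=
    mfderiv_comp (I' := 𝓡 n) y (h2.mdifferentiableAt (by simp)) (h1.mdifferentiableAt (by simp))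
  have h4 : (p ∘ L.lift) ∘ (L.chart ∘ q) =ᶠ[𝓝 y] q := by
    filter_upwards [hq.continuousAt.preimage_mem_nhds (L.isOpen_dom.mem_nhds hy)] with y' hy'
    exact L.lift_chart _ hy'
  have h5 : (mfderiv 𝓘(ℝ, F) (𝓡 n) ((p ∘ L.lift) ∘ (L.chart ∘ q)) y : F →L[ℝ] 𝔼) =
    mfderiv 𝓘(ℝ, F) (𝓡 n) q y := h4.mfderiv_eq
  have h6 : mfderiv 𝓘(ℝ, F) (𝓡 n) (L.chart ∘ q) y = fderiv ℝ (L.chart ∘ q) y := mfderiv_eq_fderiv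
  have h7 := congrArg (fun T : F →L[ℝ] 𝔼 => T e) (h5.symm.trans h3)
  refine h7.trans ?_
  exact congrArg (fun T : F →L[ℝ] 𝔼 => (mfderiv (𝓡 n) (𝓡 n) (p ∘ L.lift) (L.chart (q y)) :
    𝔼 →L[ℝ] 𝔼) (T e)) h6

theorem contDiffAt_chart_comp (L : LiftedChart g p) {q : F → N}
    {y : F} (hq : ContMDiffAt 𝓘(ℝ, F) (𝓡 n) ∞ q y) (hy : q y ∈ L.dom) :
    ContDiffAt ℝ ∞ (L.chart ∘ q) y :=
  contMDiffAt_iff_contDiffAt.1 ((L.contMDiffAt_chart hy).comp y hq)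

theorem norm_fderiv_chart_comp_le (hp : IsUniversalCovering n p) (L : LiftedChart g p) {q : F → N}
    {y : F} (hq : ContMDiffAt 𝓘(ℝ, F) (𝓡 n) ∞ q y) (hy : q y ∈ L.dom) (e : F) :
    ‖fderiv ℝ (L.chart ∘ q) y e‖ ≤
      L.bound * tangentNorm g (q y) (mfderiv 𝓘(ℝ, F) (𝓡 n) q y e) := by
  have h := (L.norm_le _ (L.chart_mem _ hy) (fderiv ℝ (L.chart ∘ q) y e)).2
  refine h.trans_eq ?_
  have key : ∀ (x x' : N) (u u' : 𝔼), x = x' → u = u' →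
      tangentNorm g x u = tangentNorm g x' u' := by
    rintro x _ u _ rfl rfl; rfl
  exact congrArg (L.bound * ·) (key _ _ _ _ (L.lift_chart _ hy)
    (L.fderiv_lift_chart_comp hp hq hy e).symm)

theorem contMDiffAt_base (hp : IsUniversalCovering n p) (L : LiftedChart g p) {y : 𝔼}
    (hy : y ∈ L.ball) : ContMDiffAt (𝓡 n) (𝓡 n) ∞ (p ∘ L.lift) y :=
  (hp.contMDiff _).comp y (L.contMDiffAt_lift hy)

theorem isOpen_ball (L : LiftedChart g p) : IsOpen L.ball := Metric.isOpen_ball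

theorem norm_sub_le (L : LiftedChart g p) {x y : 𝔼} (hx : x ∈ L.ball) (hy : y ∈ L.ball) :
    ‖y - x‖ ≤ 2 * L.radius := by
  have h1 := dist_triangle y L.center x
  have h2 := Metric.mem_ball.1 hx
  have h3 := Metric.mem_ball.1 hy
  rw [dist_comm] at h2
  rw [← dist_eq_norm]
  linarith

theorem abs_curl_le (hp : IsUniversalCovering n p) (L : LiftedChart g p) {σ : FormField n N}
    {θ : (x : N') → TangentSpace (𝓡 n) x →L[ℝ] ℝ} (hθ : IsPrimitive p σ θ) {M : ℝ} (hM0 : 0 ≤ M)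
    (hM : TwoFormNormLE g σ M) {S : Set 𝔼} (hS : IsOpen S) (hSL : S ⊆ L.ball) {f : 𝔼 → N'}
    (hf : ∀ y ∈ S, ContMDiffAt (𝓡 n) (𝓡 n) ∞ f y) (h : ∀ y ∈ S, p (f y) = p (L.lift y))
    {y : 𝔼} (hy : y ∈ S) (u w : 𝔼) :
    |curl (pullOneForm (𝓡 n) θ f) y u w| ≤ M * L.bound ^ 2 * ‖u‖ * ‖w‖ := by
  rw [hθ.curl_pullOneForm_congr hp hS hf (fun y hy => L.contMDiffAt_lift (hSL hy)) h hy,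
    hθ.curl_eq hp (L.contMDiffAt_lift (hSL hy))]
  have hu := (L.norm_le y (hSL hy) u).1
  have hw := (L.norm_le y (hSL hy) w).1
  refine (hM _ _ _).trans ?_
  have hb := L.bound_pos
  calc M * tangentNorm g (p (L.lift y)) (mfderiv (𝓡 n) (𝓡 n) (p ∘ L.lift) y u) *
        tangentNorm g (p (L.lift y)) (mfderiv (𝓡 n) (𝓡 n) (p ∘ L.lift) y w)
      ≤ M * (L.bound * ‖u‖) * (L.bound * ‖w‖) :=
        mul_le_mul (mul_le_mul_of_nonneg_left hu hM0) hw (tangentNorm_nonneg _ _ _) (by positivity)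
    _ = M * L.bound ^ 2 * ‖u‖ * ‖w‖ := by ring

theorem abs_sub_fderiv_radialPrimitive_le (hp : IsUniversalCovering n p) (L : LiftedChart g p)
    {σ : FormField n N} {θ : (x : N') → TangentSpace (𝓡 n) x →L[ℝ] ℝ} (hθ : IsPrimitive p σ θ)
    {M b R : ℝ} (hM0 : 0 ≤ M) (hM : TwoFormNormLE g σ M) (hb : L.bound ≤ b) (hR : L.radius ≤ R)
    {S : Set 𝔼} (hS : IsOpen S) (hSc : Convex ℝ S) (hSL : S ⊆ L.ball) {f : 𝔼 → N'}
    (hf : ∀ y ∈ S, ContMDiffAt (𝓡 n) (𝓡 n) ∞ f y) (h : ∀ y ∈ S, p (f y) = p (L.lift y))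
    {x y : 𝔼} (hx : x ∈ S) (hy : y ∈ S) (w : 𝔼) :
    |pullOneForm (𝓡 n) θ f y w - fderiv ℝ (radialPrimitive (pullOneForm (𝓡 n) θ f) x) y w| ≤
      2 * M * b ^ 2 * R * ‖w‖ := by
  have h1 := RabinowitzFloer.abs_sub_fderiv_radialPrimitive_le hS hSc hx
    (contDiffOn_pullOneForm hθ.smooth hf)
    (fun y hy u w => L.abs_curl_le hp hθ hM0 hM hS hSL hf h hy u w) hy w
  have h2 := L.norm_sub_le (hSL hx) (hSL hy)
  have h3 := L.bound_pos
  have h4 : L.bound ^ 2 ≤ b ^ 2 := pow_le_pow_left₀ h3.le hb 2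
  calc _ ≤ M * L.bound ^ 2 * ‖y - x‖ * ‖w‖ := h1
    _ ≤ M * b ^ 2 * (2 * R) * ‖w‖ := by
      refine mul_le_mul_of_nonneg_right (mul_le_mul (mul_le_mul_of_nonneg_left h4 hM0)
        (h2.trans (by linarith)) (norm_nonneg _) (by positivity)) (norm_nonneg _)
    _ = _ := by ring

end LiftedChart

end Comparison

end RabinowitzFloer
end

noncomputable section

namespace RabinowitzFloer

set_option linter.unusedSectionVars false

/-! ### Potentials on a nested cover -/

namespace NestedCover

variable {n : ℕ} {N : Type*} [TopologicalSpace N] [ChartedSpace (EuclideanSpace ℝ (Fin n)) N]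
  [IsManifold (𝓡 n) ∞ N]
  {N' : Type*} [TopologicalSpace N'] [ChartedSpace (EuclideanSpace ℝ (Fin n)) N']
  [IsManifold (𝓡 n) ∞ N'] {g : Metric n N} {p : N' → N} {ι : Type*}

local notation "𝔼" => EuclideanSpace ℝ (Fin n)

variable (c : NestedCover g p ι)

/-- The small ball of a chart. -/
def smallBall (i : ι) : Set 𝔼 := Metric.ball (c.small i) (c.smallRadius i)

/-- The middle ball of a chart. -/
def middleBall (i : ι) : Set 𝔼 := Metric.ball (c.middle i) (c.middleRadius i)

/-- The part of the base over the small ball. -/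
def smallSet (i : ι) : Set N := (c.charts i).region (c.small i) (c.smallRadius i)

/-- Two charts are adjacent if their small parts intersect. -/
def Adjacent (i j : ι) : Prop := (c.smallSet i ∩ c.smallSet j).Nonempty

theorem isOpen_smallSet (i : ι) : IsOpen (c.smallSet i) := (c.charts i).isOpen_region _ _

theorem small_mem (i : ι) : c.small i ∈ c.smallBall i := Metric.mem_ball_self (c.small_pos i)

theorem smallBall_subset (i : ι) : c.smallBall i ⊆ c.middleBall i := c.small_subset i

theorem middleBall_subset (i : ι) : c.middleBall i ⊆ (c.charts i).ball := c.middle_subset i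

theorem isOpen_middleBall (i : ι) : IsOpen (c.middleBall i) := Metric.isOpen_ball

theorem isOpen_smallBall (i : ι) : IsOpen (c.smallBall i) := Metric.isOpen_ball

theorem convex_middleBall (i : ι) : Convex ℝ (c.middleBall i) := convex_ball _ _

theorem convex_smallBall (i : ι) : Convex ℝ (c.smallBall i) := convex_ball _ _

theorem convex_ball (i : ι) : Convex ℝ (c.charts i).ball := _root_.convex_ball _ _

theorem small_mem_middle (i : ι) : c.small i ∈ c.middleBall i := c.smallBall_subset i (c.small_mem i)

theorem small_mem_ball (i : ι) : c.small i ∈ (c.charts i).ball :=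
  c.middleBall_subset i (c.small_mem_middle i)

/-- The change of coordinates from the chart `j` to the chart `i`. -/
def change (i j : ι) (y : 𝔼) : 𝔼 := (c.charts i).chart (p ((c.charts j).lift y))

/-- The lift over the chart `j` to the sheet of the chart `i`. -/
def transfer (i j : ι) : 𝔼 → N' := (c.charts i).lift ∘ c.change i j

variable {c} {i j m : ι}

theorem Adjacent.mem_dom (h : c.Adjacent i j) {y : 𝔼} (hy : y ∈ c.middleBall j) :
    p ((c.charts j).lift y) ∈ (c.charts i).dom := by
  have hL := c.middleBall_subset j hy
  refine c.subset_dom i j h ⟨(c.charts j).lift_mem y hL, ?_⟩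
  rw [(c.charts j).chart_lift y hL]
  exact hy

theorem Adjacent.change_mem (h : c.Adjacent i j) {y : 𝔼} (hy : y ∈ c.middleBall j) :
    c.change i j y ∈ (c.charts i).ball := (c.charts i).chart_mem _ (h.mem_dom hy)

theorem Adjacent.change_mem_middle (h : c.Adjacent i j) {y : 𝔼} (hy : y ∈ c.smallBall j) :
    c.change i j y ∈ c.middleBall i := by
  have hL := c.middleBall_subset j (c.smallBall_subset j hy)
  refine (c.subset_middle i j h ⟨(c.charts j).lift_mem y hL, ?_⟩).2
  rw [(c.charts j).chart_lift y hL]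
  exact hy

theorem Adjacent.contDiffAt_change (hp : IsUniversalCovering n p) (h : c.Adjacent i j) {y : 𝔼}
    (hy : y ∈ c.middleBall j) : ContDiffAt ℝ ∞ (c.change i j) y :=
  (c.charts i).contDiffAt_chart_comp (q := p ∘ (c.charts j).lift)
    ((c.charts j).contMDiffAt_base hp (c.middleBall_subset j hy)) (h.mem_dom hy)

theorem Adjacent.norm_fderiv_change_le (hp : IsUniversalCovering n p) (h : c.Adjacent i j) {y : 𝔼}
    (hy : y ∈ c.middleBall j) {b : ℝ} (hb : ∀ i, (c.charts i).bound ≤ b) (e : 𝔼) :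
    ‖fderiv ℝ (c.change i j) y e‖ ≤ b ^ 2 * ‖e‖ := by
  have h1 := (c.charts i).norm_fderiv_chart_comp_le hp (q := p ∘ (c.charts j).lift)
    ((c.charts j).contMDiffAt_base hp (c.middleBall_subset j hy)) (h.mem_dom hy) e
  have h2 := ((c.charts j).norm_le y (c.middleBall_subset j hy) e).1
  have hb0 : 0 < b := (c.charts i).bound_pos.trans_le (hb i)
  calc _ ≤ (c.charts i).bound * tangentNorm g (p ((c.charts j).lift y))
        (mfderiv (𝓡 n) (𝓡 n) (p ∘ (c.charts j).lift) y e) := h1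
    _ ≤ b * (b * ‖e‖) := by
      refine mul_le_mul (hb i) (h2.trans ?_) (tangentNorm_nonneg _ _ _) hb0.le
      exact mul_le_mul_of_nonneg_right (hb j) (norm_nonneg _)
    _ = b ^ 2 * ‖e‖ := by ring

theorem Adjacent.contMDiffAt_transfer (hp : IsUniversalCovering n p) (h : c.Adjacent i j) {y : 𝔼}
    (hy : y ∈ c.middleBall j) : ContMDiffAt (𝓡 n) (𝓡 n) ∞ (c.transfer i j) y :=
  ((c.charts i).contMDiffAt_lift (h.change_mem hy)).comp y (h.contDiffAt_change hp hy).contMDiffAt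

theorem Adjacent.proj_transfer (h : c.Adjacent i j) {y : 𝔼} (hy : y ∈ c.middleBall j) :
    p (c.transfer i j y) = p ((c.charts j).lift y) := (c.charts i).lift_chart _ (h.mem_dom hy)

theorem Adjacent.change_change (h : c.Adjacent m j) {y : 𝔼} (hy : y ∈ c.middleBall j) :
    c.change i m (c.change m j y) = c.change i j y :=
  congrArg (c.charts i).chart (h.proj_transfer hy)

variable (c) (θ : (x : N') → TangentSpace (𝓡 n) x →L[ℝ] ℝ)

/-- The radial primitive in the chart `i`. -/
def pot (i : ι) : 𝔼 → ℝ := radialPrimitive (pullOneForm (𝓡 n) θ (c.charts i).lift) (c.small i)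

/-- The continuation of the primitive in the chart `i` to the chart `j`. -/
def transferPot (i j : ι) (y : 𝔼) : ℝ :=
  c.pot θ i (c.change i j (c.small j)) +
    radialPrimitive (pullOneForm (𝓡 n) θ (c.transfer i j)) (c.small j) y

/-- The difference of the two primitives on the overlap. -/
def defect (i j : ι) (y : 𝔼) : ℝ := c.transferPot θ i j y - c.pot θ i (c.change i j y)

/-- The failure of the cocycle condition along a triangle. -/
def holonomy (i m j : ι) : ℝ :=
  c.pot θ i (c.change i j (c.small j)) - c.transferPot θ i m (c.change m j (c.small j))

variable {c} {θ} {σ : FormField n N}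

/-- Changes of coordinates compose, so the failure along a triangle is the defect of one edge
evaluated at the center of the third chart. It thereby inherits the bound for defects. -/
theorem holonomy_eq (h : c.Adjacent m j) :
    c.holonomy θ i m j = - c.defect θ i m (c.change m j (c.small j)) := by
  rw [holonomy, defect, h.change_change (c.small_mem_middle j)]
  ring

theorem contDiffAt_pot (hθ : IsSmoothOneForm (𝓡 n) θ) {y : 𝔼} (hy : y ∈ (c.charts i).ball)
    (k : ℕ) : ContDiffAt ℝ k (c.pot θ i) y :=
  (contDiffOn_radialPrimitive (c.charts i).isOpen_ball (c.convex_ball i) (c.small_mem_ball i)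
    (contDiffOn_pullOneForm hθ fun _ h => (c.charts i).contMDiffAt_lift h) k).contDiffAt
    ((c.charts i).isOpen_ball.mem_nhds hy)

theorem contDiffAt_transferPot (hp : IsUniversalCovering n p) (hθ : IsSmoothOneForm (𝓡 n) θ)
    (h : c.Adjacent i j) {y : 𝔼} (hy : y ∈ c.middleBall j)
    (k : ℕ) : ContDiffAt ℝ k (c.transferPot θ i j) y :=
  contDiffAt_const.add ((contDiffOn_radialPrimitive (c.isOpen_middleBall j) (c.convex_middleBall j)
    (c.small_mem_middle j) (contDiffOn_pullOneForm hθ fun _ => h.contMDiffAt_transfer hp)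
    k).contDiffAt ((c.isOpen_middleBall j).mem_nhds hy))

theorem contDiffAt_defect (hp : IsUniversalCovering n p) (hθ : IsSmoothOneForm (𝓡 n) θ)
    (h : c.Adjacent i j) {y : 𝔼} (hy : y ∈ c.middleBall j)
    (k : ℕ) : ContDiffAt ℝ k (c.defect θ i j) y :=
  (contDiffAt_transferPot hp hθ h hy k).sub ((contDiffAt_pot hθ (h.change_mem hy) k).comp y
    ((h.contDiffAt_change hp hy).of_le (by exact_mod_cast le_top)))

theorem defect_small (c : NestedCover g p ι) (i j : ι) : c.defect θ i j (c.small j) = 0 := by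
  rw [defect, transferPot, radialPrimitive_self]
  ring

section Bounds

variable {M b R : ℝ}

theorem abs_sub_fderiv_pot_le (hp : IsUniversalCovering n p) (hθ : IsPrimitive p σ θ)
    (hM0 : 0 ≤ M) (hM : TwoFormNormLE g σ M) (hb : ∀ i, (c.charts i).bound ≤ b)
    (hR : ∀ i, (c.charts i).radius ≤ R) {y : 𝔼} (hy : y ∈ (c.charts i).ball) (w : 𝔼) :
    |pullOneForm (𝓡 n) θ (c.charts i).lift y w - fderiv ℝ (c.pot θ i) y w| ≤
      2 * M * b ^ 2 * R * ‖w‖ :=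
  (c.charts i).abs_sub_fderiv_radialPrimitive_le hp hθ hM0 hM (hb i) (hR i)
    (c.charts i).isOpen_ball (c.convex_ball i) subset_rfl
    (fun _ h => (c.charts i).contMDiffAt_lift h) (fun _ _ => rfl) (c.small_mem_ball i) hy w

theorem fderiv_transferPot (c : NestedCover g p ι) (i j : ι) (y : 𝔼) :
    fderiv ℝ (c.transferPot θ i j) y =
      fderiv ℝ (radialPrimitive (pullOneForm (𝓡 n) θ (c.transfer i j)) (c.small j)) y :=
  fderiv_const_add _

theorem abs_sub_fderiv_transferPot_le (hp : IsUniversalCovering n p) (hθ : IsPrimitive p σ θ)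
    (hM0 : 0 ≤ M) (hM : TwoFormNormLE g σ M) (hb : ∀ i, (c.charts i).bound ≤ b)
    (hR : ∀ i, (c.charts i).radius ≤ R) (h : c.Adjacent i j) {y : 𝔼} (hy : y ∈ c.middleBall j)
    (w : 𝔼) :
    |pullOneForm (𝓡 n) θ (c.transfer i j) y w - fderiv ℝ (c.transferPot θ i j) y w| ≤
      2 * M * b ^ 2 * R * ‖w‖ := by
  rw [fderiv_transferPot]
  exact (c.charts j).abs_sub_fderiv_radialPrimitive_le hp hθ hM0 hM (hb j) (hR j)
    (c.isOpen_middleBall j) (c.convex_middleBall j) (c.middleBall_subset j)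
    (fun _ => h.contMDiffAt_transfer hp) (fun _ => h.proj_transfer) (c.small_mem_middle j) hy w

/-- The constant in the estimate of the derivative of the defect. -/
def defectConst (b R : ℝ) : ℝ := 2 * b ^ 2 * R * (1 + b ^ 2)

/-- Both terms of the defect are approximate primitives of one and the same form: `θ` on the sheet
of `i`, read in the chart `j`. Each derivative misses this form by `O(M)`. The second error is
transported by the change of coordinates, whose derivative is at most `b ^ 2`, hence the factor `1 +
b ^ 2` in `defectConst`. -/
theorem abs_fderiv_defect_le (hp : IsUniversalCovering n p) (hθ : IsPrimitive p σ θ)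
    (hM0 : 0 ≤ M) (hM : TwoFormNormLE g σ M) (hb : ∀ i, (c.charts i).bound ≤ b)
    (hR0 : 0 ≤ R) (hR : ∀ i, (c.charts i).radius ≤ R) (h : c.Adjacent i j) {y : 𝔼}
    (hy : y ∈ c.middleBall j) (w : 𝔼) :
    |fderiv ℝ (c.defect θ i j) y w| ≤ defectConst b R * M * ‖w‖ := by
  have hchange : DifferentiableAt ℝ (c.change i j) y :=
    (h.contDiffAt_change hp hy).differentiableAt (by simp)
  have hpot : DifferentiableAt ℝ (c.pot θ i) (c.change i j y) :=
    (contDiffAt_pot hθ.smooth (h.change_mem hy) 1).differentiableAt (by simp)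
  have hder : fderiv ℝ (c.defect θ i j) y w = fderiv ℝ (c.transferPot θ i j) y w -
      fderiv ℝ (c.pot θ i) (c.change i j y) (fderiv ℝ (c.change i j) y w) := by
    have h1 := ((contDiffAt_transferPot hp hθ.smooth h hy 1).differentiableAt
      (by simp)).hasFDerivAt.sub (hpot.hasFDerivAt.comp y hchange.hasFDerivAt)
    exact congrArg (fun T : 𝔼 →L[ℝ] ℝ => T w) h1.fderiv
  have hpull : pullOneForm (𝓡 n) θ (c.transfer i j) y w = pullOneForm (𝓡 n) θ (c.charts i).lift
      (c.change i j y) (fderiv ℝ (c.change i j) y w) :=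
    pullOneForm_comp θ (((c.charts i).contMDiffAt_lift (h.change_mem hy)).mdifferentiableAt
      (by simp)) hchange w
  have h1 := abs_sub_fderiv_transferPot_le hp hθ hM0 hM hb hR h hy w
  have h2 := abs_sub_fderiv_pot_le hp hθ hM0 hM hb hR (h.change_mem hy)
    (fderiv ℝ (c.change i j) y w)
  have h3 := h.norm_fderiv_change_le hp hy hb w
  have h4 : 2 * M * b ^ 2 * R * ‖fderiv ℝ (c.change i j) y w‖ ≤
      2 * M * b ^ 2 * R * (b ^ 2 * ‖w‖) := mul_le_mul_of_nonneg_left h3 (by positivity)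
  rw [hder]
  rw [hpull] at h1
  have h5 := abs_le.1 h1
  have h6 := abs_le.1 (h2.trans h4)
  have h7 : defectConst b R * M * ‖w‖ = 2 * M * b ^ 2 * R * ‖w‖ +
      2 * M * b ^ 2 * R * (b ^ 2 * ‖w‖) := by rw [defectConst]; ring
  rw [h7, abs_le]
  constructor <;> linarith [h5.1, h5.2, h6.1, h6.2]

/-- The defect vanishes at the center of the small ball, so the mean value inequality over a
distance of at most `2 * R` suffices. -/
theorem abs_defect_le (hp : IsUniversalCovering n p) (hθ : IsPrimitive p σ θ)
    (hM0 : 0 ≤ M) (hM : TwoFormNormLE g σ M) (hb : ∀ i, (c.charts i).bound ≤ b)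
    (hR0 : 0 ≤ R) (hR : ∀ i, (c.charts i).radius ≤ R) (h : c.Adjacent i j) {y : 𝔼}
    (hy : y ∈ c.middleBall j) :
    |c.defect θ i j y| ≤ 2 * R * defectConst b R * M := by
  have hK : 0 ≤ defectConst b R * M := by
    rw [defectConst]; positivity
  have h1 := (c.convex_middleBall j).norm_image_sub_le_of_norm_fderiv_le (𝕜 := ℝ)
    (f := c.defect θ i j) (C := defectConst b R * M)
    (fun y hy => (contDiffAt_defect hp hθ.smooth h hy 1).differentiableAt (by simp))
    (fun y hy => ContinuousLinearMap.opNorm_le_bound _ hK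
      (abs_fderiv_defect_le hp hθ hM0 hM hb hR0 hR h hy)) (c.small_mem_middle j) hy
  rw [defect_small, sub_zero, Real.norm_eq_abs] at h1
  have h2 := (c.charts j).norm_sub_le (c.small_mem_ball j) (c.middleBall_subset j hy)
  calc _ ≤ defectConst b R * M * ‖y - c.small j‖ := h1
    _ ≤ defectConst b R * M * (2 * R) :=
      mul_le_mul_of_nonneg_left (h2.trans (by linarith [hR j])) hK
    _ = _ := by ring

theorem abs_holonomy_le (hp : IsUniversalCovering n p) (hθ : IsPrimitive p σ θ)
    (hM0 : 0 ≤ M) (hM : TwoFormNormLE g σ M) (hb : ∀ i, (c.charts i).bound ≤ b)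
    (hR0 : 0 ≤ R) (hR : ∀ i, (c.charts i).radius ≤ R) (him : c.Adjacent i m)
    (hmj : c.Adjacent m j) :
    |c.holonomy θ i m j| ≤ 2 * R * defectConst b R * M := by
  rw [holonomy_eq hmj, abs_neg]
  exact abs_defect_le hp hθ hM0 hM hb hR0 hR him (hmj.change_mem_middle (c.small_mem j))

end Bounds

theorem hasFDerivAt_transferPot_sub_pot (hp : IsUniversalCovering n p) (hθ : IsPrimitive p σ θ)
    (him : c.Adjacent i m) {y : 𝔼} (hy : y ∈ c.middleBall m) :
    HasFDerivAt (fun y => c.transferPot θ i m y - c.pot θ m y)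
      (pullOneForm (𝓡 n) θ (c.transfer i m) y - pullOneForm (𝓡 n) θ (c.charts m).lift y) y := by
  have h1 := (hasFDerivAt_radialPrimitive_sub hp hθ (c.isOpen_middleBall m)
    (c.convex_middleBall m) (c.small_mem_middle m) (fun _ => him.contMDiffAt_transfer hp)
    (fun _ h => (c.charts m).contMDiffAt_lift (c.middleBall_subset m h))
    (fun _ h => him.proj_transfer h) hy).const_add (c.pot θ i (c.change i m (c.small m)))
  refine h1.congr_of_eventuallyEq (Eventually.of_forall fun y => ?_)
  simp only [transferPot, pot]
  ring

/-- If the holonomy vanishes, then the continuations of the primitives differ by a function which is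
independent of the chart. -/
theorem transferPot_sub (hp : IsUniversalCovering n p) (hθ : IsPrimitive p σ θ)
    (him : c.Adjacent i m) (hij : c.Adjacent i j) (hmj : c.Adjacent m j)
    (h0 : c.holonomy θ i m j = 0) {y : 𝔼} (hy : y ∈ c.smallBall j) :
    c.transferPot θ i j y - c.transferPot θ m j y =
      c.transferPot θ i m (c.change m j y) - c.pot θ m (c.change m j y) := by
  -- On the convex small ball both sides have the same derivative, namely the difference of `θ` on
  -- the sheets of `i` and `m`. Vanishing of the holonomy is equality at the center.
  have hd1 : ∀ y ∈ c.smallBall j, HasFDerivAt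
      (fun y => c.transferPot θ i j y - c.transferPot θ m j y)
      (pullOneForm (𝓡 n) θ (c.transfer i j) y - pullOneForm (𝓡 n) θ (c.transfer m j) y) y := by
    intro y hy
    have h1 := (hasFDerivAt_radialPrimitive_sub hp hθ (c.isOpen_middleBall j)
      (c.convex_middleBall j) (c.small_mem_middle j) (fun _ => hij.contMDiffAt_transfer hp)
      (fun _ => hmj.contMDiffAt_transfer hp)
      (fun _ h => (hij.proj_transfer h).trans (hmj.proj_transfer h).symm)
      (c.smallBall_subset j hy)).const_add
        (c.pot θ i (c.change i j (c.small j)) - c.pot θ m (c.change m j (c.small j)))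
    refine h1.congr_of_eventuallyEq (Eventually.of_forall fun y => ?_)
    simp only [transferPot]
    ring
  have hd3 : ∀ y ∈ c.smallBall j, HasFDerivAt
      (fun y => c.transferPot θ i m (c.change m j y) - c.pot θ m (c.change m j y))
      (pullOneForm (𝓡 n) θ (c.transfer i j) y - pullOneForm (𝓡 n) θ (c.transfer m j) y) y := by
    intro y hy
    have hyj := c.smallBall_subset j hy
    have hch : DifferentiableAt ℝ (c.change m j) y :=
      (hmj.contDiffAt_change hp hyj).differentiableAt (by simp)
    have h1 := (hasFDerivAt_transferPot_sub_pot hp hθ him (hmj.change_mem_middle hy)).comp y hch.hasFDerivAt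
    refine h1.congr_fderiv ?_
    ext w
    have h2 : c.transfer i m ∘ c.change m j =ᶠ[𝓝 y] c.transfer i j := by
      filter_upwards [(c.isOpen_middleBall j).mem_nhds hyj] with y' hy'
      exact congrArg (c.charts i).lift (hmj.change_change hy')
    have h3 := pullOneForm_comp θ (f := c.transfer i m) (h := c.change m j) (y := y)
      ((him.contMDiffAt_transfer hp (hmj.change_mem_middle hy)).mdifferentiableAt (by simp)) hch w
    have h4 := pullOneForm_comp θ (f := (c.charts m).lift) (h := c.change m j) (y := y)
      (((c.charts m).contMDiffAt_lift (hmj.change_mem hyj)).mdifferentiableAt (by simp)) hch w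
    rw [pullOneForm_congr θ h2] at h3
    simp only [ContinuousLinearMap.comp_apply, sub_apply]
    rw [← h3, ← h4]
    rfl
  have hconst := (c.convex_smallBall j).is_const_of_fderivWithin_eq_zero (𝕜 := ℝ)
    (f := fun y => (c.transferPot θ i j y - c.transferPot θ m j y) -
      (c.transferPot θ i m (c.change m j y) - c.pot θ m (c.change m j y)))
    (fun y hy => ((hd1 y hy).sub (hd3 y hy)).differentiableAt.differentiableWithinAt)
    (fun y hy => by
      rw [fderivWithin_of_isOpen (c.isOpen_smallBall j) hy]
      exact ((hd1 y hy).sub (hd3 y hy)).fderiv.trans (sub_self _)) (c.small_mem j) hy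
  have h0' : c.transferPot θ i j (c.small j) - c.transferPot θ m j (c.small j) =
      c.transferPot θ i m (c.change m j (c.small j)) - c.pot θ m (c.change m j (c.small j)) := by
    rw [holonomy, sub_eq_zero] at h0
    rw [← h0, transferPot, transferPot, radialPrimitive_self, radialPrimitive_self]
    ring
  simp only [h0', sub_self] at hconst
  linarith

end NestedCover

end RabinowitzFloer
end

noncomputable section

namespace RabinowitzFloer

set_option linter.unusedSectionVars false

/-! ### Gluing the primitives if the holonomy vanishes -/

namespace NestedCover

variable {n : ℕ} {N : Type*} [TopologicalSpace N] [ChartedSpace (EuclideanSpace ℝ (Fin n)) N]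
  [IsManifold (𝓡 n) ∞ N]
  {N' : Type*} [TopologicalSpace N'] [ChartedSpace (EuclideanSpace ℝ (Fin n)) N']
  [IsManifold (𝓡 n) ∞ N'] {g : Metric n N} {p : N' → N} {ι : Type*}

local notation "𝔼" => EuclideanSpace ℝ (Fin n)

/-- Off its support the bump function has zero derivative, and on the compact support it is read in
one chart. The constant is independent of the map `q`, as the cylinder estimate requires. -/
theorem exists_bump_bound [CompactSpace N] (hp : IsUniversalCovering n p) (c : NestedCover g p ι)
    (ρ : SmoothPartitionOfUnity ι (𝓡 n) N) (hρ : ρ.IsSubordinate c.smallSet) (j : ι) :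
    ∃ D, 0 ≤ D ∧ ∀ (q : ℝ × ℝ → N) (z : ℝ × ℝ), ContMDiffAt 𝓘(ℝ, ℝ × ℝ) (𝓡 n) ∞ q z →
      ∀ e, |fderiv ℝ (fun z => ρ j (q z)) z e| ≤ D * planeSpeed g q e z := by
  set L := c.charts j with hL
  have hsub : tsupport (ρ j) ⊆ L.dom := fun x hx => (hρ j hx).1
  have hcont : ContinuousOn L.chart (tsupport (ρ j)) :=
    L.contMDiffOn_chart.continuousOn.mono hsub
  have hK : IsCompact (L.chart '' tsupport (ρ j)) :=
    (isClosed_tsupport _).isCompact.image_of_continuousOn hcont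
  have hKb : L.chart '' tsupport (ρ j) ⊆ L.ball := by
    rintro _ ⟨x, hx, rfl⟩
    exact L.chart_mem x (hsub hx)
  have hh : ContDiffOn ℝ ∞ (fun y => ρ j (p (L.lift y))) L.ball := fun y hy =>
    (contMDiffAt_iff_contDiffAt.1 (((ρ j).contMDiff (p (L.lift y))).comp y
      (L.contMDiffAt_base hp hy))).contDiffWithinAt
  obtain ⟨D, hD⟩ := hK.exists_bound_of_continuousOn
    ((hh.continuousOn_fderiv_of_isOpen L.isOpen_ball (by simp)).mono hKb)
  have hLb := L.bound_pos
  refine ⟨|D| * L.bound, by positivity, fun q z hq e => ?_⟩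
  by_cases hz : q z ∈ tsupport (ρ j)
  · have hzL := hsub hz
    have h1 : (fun z => ρ j (q z)) =ᶠ[𝓝 z] (fun y => ρ j (p (L.lift y))) ∘ (L.chart ∘ q) := by
      filter_upwards [hq.continuousAt.preimage_mem_nhds (L.isOpen_dom.mem_nhds hzL)] with z' hz'
      simp only [Function.comp_apply]
      rw [L.lift_chart _ hz']
    have h2 := ((hh.contDiffAt (L.isOpen_ball.mem_nhds (L.chart_mem _ hzL))).differentiableAt
      (by simp)).hasFDerivAt.comp (f := L.chart ∘ q) z
        ((L.contDiffAt_chart_comp hq hzL).differentiableAt (by simp)).hasFDerivAt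
    rw [h1.fderiv_eq, h2.fderiv, ContinuousLinearMap.comp_apply, ← Real.norm_eq_abs]
    refine (ContinuousLinearMap.le_opNorm _ _).trans ?_
    rw [mul_assoc]
    refine mul_le_mul ((hD _ ⟨q z, hz, rfl⟩).trans (le_abs_self D))
      (L.norm_fderiv_chart_comp_le hp hq hzL e) (norm_nonneg _) (abs_nonneg _)
  · have h1 : (fun z => ρ j (q z)) =ᶠ[𝓝 z] fun _ => 0 := by
      filter_upwards [hq.continuousAt.preimage_mem_nhds
        ((isClosed_tsupport (ρ j)).isOpen_compl.mem_nhds hz)] with z' hz'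
      exact image_eq_zero_of_notMem_tsupport hz'
    rw [h1.fderiv_eq]
    have := planeSpeed_nonneg g q e z
    simpa using by positivity

variable (c : NestedCover g p ι) (θ : (x : N') → TangentSpace (𝓡 n) x →L[ℝ] ℝ)
  (ρ : SmoothPartitionOfUnity ι (𝓡 n) N) (q : ℝ × ℝ → N)

/-- One summand of the correction to the radial primitive. -/
def correctionTerm (i j : ι) (z : ℝ × ℝ) : ℝ :=
  ρ j (q z) * c.defect θ i j ((c.charts j).chart (q z))

/-- The corrected primitive. -/
def correctedPot [Fintype ι] (i : ι) (z : ℝ × ℝ) : ℝ :=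
  c.pot θ i ((c.charts i).chart (q z)) + ∑ j, c.correctionTerm θ ρ q i j z

/-- The one-form in the plane, from which the derivative of the corrected primitive is removed. -/
def reducedForm [Fintype ι] (i : ι) (z : ℝ × ℝ) : ℝ × ℝ →L[ℝ] ℝ :=
  pullOneForm (𝓡 n) θ ((c.charts i).lift ∘ (c.charts i).chart ∘ q) z -
    fderiv ℝ (c.correctedPot θ ρ q i) z

variable {c θ ρ q} {σ : FormField n N} {i j m : ι} {z : ℝ × ℝ}

theorem mem_middleBall_of_mem (hz : q z ∈ c.smallSet j) :
    (c.charts j).chart (q z) ∈ c.middleBall j := c.smallBall_subset j hz.2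

theorem correctionTerm_cases (hρ : ρ.IsSubordinate c.smallSet)
    (hq : ContMDiffAt 𝓘(ℝ, ℝ × ℝ) (𝓡 n) ∞ q z) (hz : q z ∈ c.smallSet i) (j : ι) :
    (q z ∈ c.smallSet j ∧ c.Adjacent i j) ∨ c.correctionTerm θ ρ q i j =ᶠ[𝓝 z] fun _ => 0 := by
  by_cases h : q z ∈ tsupport (ρ j)
  · exact Or.inl ⟨hρ j h, ⟨q z, hz, hρ j h⟩⟩
  · right
    filter_upwards [hq.continuousAt.preimage_mem_nhds
      ((isClosed_tsupport (ρ j)).isOpen_compl.mem_nhds h)] with z' hz'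
    rw [correctionTerm, image_eq_zero_of_notMem_tsupport hz', zero_mul]

theorem contDiffAt_chart (hq : ContMDiffAt 𝓘(ℝ, ℝ × ℝ) (𝓡 n) ∞ q z) (hz : q z ∈ c.smallSet j) :
    ContDiffAt ℝ ∞ (fun z => (c.charts j).chart (q z)) z :=
  (c.charts j).contDiffAt_chart_comp hq hz.1

theorem contDiffAt_bump (hq : ContMDiffAt 𝓘(ℝ, ℝ × ℝ) (𝓡 n) ∞ q z) (j : ι) :
    ContDiffAt ℝ ∞ (fun z => ρ j (q z)) z :=
  contMDiffAt_iff_contDiffAt.1 (((ρ j).contMDiff (q z)).comp z hq)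

theorem contDiffAt_correctionTerm (hp : IsUniversalCovering n p) (hθ : IsPrimitive p σ θ)
    (hρ : ρ.IsSubordinate c.smallSet) (hq : ContMDiffAt 𝓘(ℝ, ℝ × ℝ) (𝓡 n) ∞ q z)
    (hz : q z ∈ c.smallSet i) (j : ι) (k : ℕ) :
    ContDiffAt ℝ k (c.correctionTerm θ ρ q i j) z := by
  rcases correctionTerm_cases (θ := θ) hρ hq hz j with ⟨hj, hij⟩ | h
  · exact ((contDiffAt_bump hq j).of_le (by exact_mod_cast le_top)).mul
      ((contDiffAt_defect hp hθ.smooth hij (mem_middleBall_of_mem hj) k).comp z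
        ((contDiffAt_chart hq hj).of_le (by exact_mod_cast le_top)))
  · exact contDiffAt_const.congr_of_eventuallyEq h

theorem contDiffAt_pot_chart (hθ : IsPrimitive p σ θ)
    (hq : ContMDiffAt 𝓘(ℝ, ℝ × ℝ) (𝓡 n) ∞ q z) (hz : q z ∈ c.smallSet i) (k : ℕ) :
    ContDiffAt ℝ k (fun z => c.pot θ i ((c.charts i).chart (q z))) z :=
  (contDiffAt_pot hθ.smooth ((c.charts i).chart_mem _ hz.1) k).comp z
    ((contDiffAt_chart hq hz).of_le (by exact_mod_cast le_top))

theorem contDiffAt_correctedPot [Fintype ι] (hp : IsUniversalCovering n p)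
    (hθ : IsPrimitive p σ θ) (hρ : ρ.IsSubordinate c.smallSet)
    (hq : ContMDiffAt 𝓘(ℝ, ℝ × ℝ) (𝓡 n) ∞ q z) (hz : q z ∈ c.smallSet i) (k : ℕ) :
    ContDiffAt ℝ k (c.correctedPot θ ρ q i) z :=
  (contDiffAt_pot_chart hθ hq hz k).add
    (ContDiffAt.sum fun j _ => contDiffAt_correctionTerm hp hθ hρ hq hz j k)

theorem contMDiffAt_lift_chart (hq : ContMDiffAt 𝓘(ℝ, ℝ × ℝ) (𝓡 n) ∞ q z)
    (hz : q z ∈ c.smallSet i) :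
    ContMDiffAt 𝓘(ℝ, ℝ × ℝ) (𝓡 n) ∞ ((c.charts i).lift ∘ (c.charts i).chart ∘ q) z :=
  ((c.charts i).contMDiffAt_lift ((c.charts i).chart_mem _ hz.1)).comp z
    (contDiffAt_chart hq hz).contMDiffAt

theorem contDiffAt_reducedForm [Fintype ι] (hp : IsUniversalCovering n p)
    (hθ : IsPrimitive p σ θ) (hρ : ρ.IsSubordinate c.smallSet)
    (hq : ContMDiffAt 𝓘(ℝ, ℝ × ℝ) (𝓡 n) ∞ q z) (hz : q z ∈ c.smallSet i) :
    ContDiffAt ℝ 1 (c.reducedForm θ ρ q i) z :=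
  ((contDiffAt_pullOneForm hθ.smooth (contMDiffAt_lift_chart hq hz)).of_le (by simp)).sub
    ((contDiffAt_correctedPot hp hθ hρ hq hz 2).fderiv_right (by norm_num))

theorem curl_reducedForm [Fintype ι] (hp : IsUniversalCovering n p)
    (hθ : IsPrimitive p σ θ) (hρ : ρ.IsSubordinate c.smallSet)
    (hq : ContMDiffAt 𝓘(ℝ, ℝ × ℝ) (𝓡 n) ∞ q z) (hz : q z ∈ c.smallSet i) :
    curl (c.reducedForm θ ρ q i) z (1, 0) (0, 1) = planeForm σ q z := by
  have h1 := contDiffAt_pullOneForm hθ.smooth (contMDiffAt_lift_chart hq hz)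
  have h2 := contDiffAt_correctedPot hp hθ hρ hq hz 2
  have h3 : ContDiffAt ℝ 1 (fderiv ℝ (c.correctedPot θ ρ q i)) z := h2.fderiv_right (by norm_num)
  have h4 : curl (c.reducedForm θ ρ q i) z (1, 0) (0, 1) = _ :=
    curl_sub (h1.differentiableAt (by simp)) (h3.differentiableAt (by simp)) (1, 0) (0, 1)
  have h5 : curl (fderiv ℝ (c.correctedPot θ ρ q i)) z (1, 0) (0, 1) = 0 :=
    sub_eq_zero.2 ((h2.isSymmSndFDerivAt (by simp)).eq _ _)
  have h6 : curl (pullOneForm (𝓡 n) θ ((c.charts i).lift ∘ (c.charts i).chart ∘ q)) z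
      (1, 0) (0, 1) = pullTwoForm σ (p ∘ (c.charts i).lift ∘ (c.charts i).chart ∘ q) z
        (1, 0) (0, 1) := hθ.curl_eq hp (contMDiffAt_lift_chart hq hz) _ _
  rw [h4, h5, sub_zero, h6]
  refine pullTwoForm_congr σ ?_ _ _
  filter_upwards [hq.continuousAt.preimage_mem_nhds
    ((c.isOpen_smallSet i).mem_nhds hz)] with z' hz'
  exact (c.charts i).lift_chart _ hz'.1

/-- By `transferPot_sub` the `j`-th correction terms for `i` and `m` differ by `ρ j (Φ - δ)`, where
`Φ` and `δ` do not depend on `j`. Since the partition sums to one, the corrections replace the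
difference `δ` of radial primitives by `Φ`, an exact primitive of the difference of the sheets. -/
theorem correctedPot_sub [Fintype ι] (hp : IsUniversalCovering n p) (hθ : IsPrimitive p σ θ)
    (hρ : ρ.IsSubordinate c.smallSet)
    (h0 : ∀ i m j, c.Adjacent i m → c.Adjacent i j → c.Adjacent m j → c.holonomy θ i m j = 0)
    (hi : q z ∈ c.smallSet i) (hm : q z ∈ c.smallSet m) :
    c.correctedPot θ ρ q i z - c.correctedPot θ ρ q m z =
      c.transferPot θ i m ((c.charts m).chart (q z)) - c.pot θ m ((c.charts m).chart (q z)) := by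
  set Φ := c.transferPot θ i m ((c.charts m).chart (q z)) - c.pot θ m ((c.charts m).chart (q z))
    with hΦ
  set δ := c.pot θ i ((c.charts i).chart (q z)) - c.pot θ m ((c.charts m).chart (q z)) with hδ
  have hterm : ∀ j, c.correctionTerm θ ρ q i j z - c.correctionTerm θ ρ q m j z =
      ρ j (q z) * (Φ - δ) := by
    intro j
    by_cases hj0 : ρ j (q z) = 0
    · simp [correctionTerm, hj0]
    have hj : q z ∈ c.smallSet j := hρ j (subset_tsupport _ hj0)
    have h1 := transferPot_sub hp hθ (θ := θ) (i := i) (m := m) (j := j) ⟨q z, hi, hm⟩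
      ⟨q z, hi, hj⟩ ⟨q z, hm, hj⟩
      (h0 i m j ⟨q z, hi, hm⟩ ⟨q z, hi, hj⟩ ⟨q z, hm, hj⟩) hj.2
    have h2 : ∀ l, c.change l j ((c.charts j).chart (q z)) = (c.charts l).chart (q z) := fun l =>
      congrArg (c.charts l).chart ((c.charts j).lift_chart _ hj.1)
    rw [h2 m] at h1
    simp only [correctionTerm, defect, h2]
    rw [hΦ, hδ, ← h1]
    ring
  have hsum : ∑ j, ρ j (q z) = 1 := by
    rw [← finsum_eq_sum_of_fintype]
    exact ρ.sum_eq_one (Set.mem_univ _)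
  have h3 : ∑ j, c.correctionTerm θ ρ q i j z - ∑ j, c.correctionTerm θ ρ q m j z = Φ - δ := by
    rw [← Finset.sum_sub_distrib, Finset.sum_congr rfl fun j _ => hterm j, ← Finset.sum_mul, hsum,
      one_mul]
  simp only [correctedPot]
  linarith

/-- The difference of `θ` on two sheets is exactly the derivative of the difference of the corrected
primitives. The local forms therefore agree on overlaps. -/
theorem reducedForm_eq [Fintype ι] (hp : IsUniversalCovering n p) (hθ : IsPrimitive p σ θ)
    (hρ : ρ.IsSubordinate c.smallSet)
    (h0 : ∀ i m j, c.Adjacent i m → c.Adjacent i j → c.Adjacent m j → c.holonomy θ i m j = 0)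
    (hq : ContMDiffAt 𝓘(ℝ, ℝ × ℝ) (𝓡 n) ∞ q z)
    (hi : q z ∈ c.smallSet i) (hm : q z ∈ c.smallSet m) :
    c.reducedForm θ ρ q i z = c.reducedForm θ ρ q m z := by
  have him : c.Adjacent i m := ⟨q z, hi, hm⟩
  have h1 : (fun z => c.correctedPot θ ρ q i z - c.correctedPot θ ρ q m z) =ᶠ[𝓝 z]
      (fun y => c.transferPot θ i m y - c.pot θ m y) ∘ ((c.charts m).chart ∘ q) := by
    filter_upwards [hq.continuousAt.preimage_mem_nhds ((c.isOpen_smallSet i).mem_nhds hi),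
      hq.continuousAt.preimage_mem_nhds ((c.isOpen_smallSet m).mem_nhds hm)] with z' hzi hzm
    exact correctedPot_sub hp hθ hρ h0 hzi hzm
  have hch : DifferentiableAt ℝ ((c.charts m).chart ∘ q) z :=
    (contDiffAt_chart hq hm).differentiableAt (by simp)
  have hmid := mem_middleBall_of_mem hm
  have h2 := (hasFDerivAt_transferPot_sub_pot hp hθ him hmid).comp (f := (c.charts m).chart ∘ q) z
    hch.hasFDerivAt
  have h3 := (h2.congr_of_eventuallyEq h1).fderiv
  have hGi := (contDiffAt_correctedPot hp hθ hρ hq hi 1).differentiableAt (by simp)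
  have hGm := (contDiffAt_correctedPot hp hθ hρ hq hm 1).differentiableAt (by simp)
  rw [fderiv_fun_sub hGi hGm] at h3
  have h4 : c.transfer i m ∘ ((c.charts m).chart ∘ q) =ᶠ[𝓝 z]
      (c.charts i).lift ∘ (c.charts i).chart ∘ q := by
    filter_upwards [hq.continuousAt.preimage_mem_nhds ((c.isOpen_smallSet m).mem_nhds hm)]
      with z' hz'
    exact congrArg (fun x => (c.charts i).lift ((c.charts i).chart x))
      ((c.charts m).lift_chart _ hz'.1)
  refine ContinuousLinearMap.ext fun e => ?_
  have h5 := congrArg (fun T : ℝ × ℝ →L[ℝ] ℝ => T e) h3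
  have h6 := pullOneForm_comp θ (f := c.transfer i m) (h := (c.charts m).chart ∘ q) (y := z)
    ((him.contMDiffAt_transfer hp hmid).mdifferentiableAt (by simp)) hch e
  have h7 := pullOneForm_comp θ (f := (c.charts m).lift) (h := (c.charts m).chart ∘ q) (y := z)
    (((c.charts m).contMDiffAt_lift (c.middleBall_subset m hmid)).mdifferentiableAt (by simp)) hch e
  rw [pullOneForm_congr θ h4] at h6
  simp only [ContinuousLinearMap.comp_apply, sub_apply] at h5
  have h8 : fderiv ℝ (c.correctedPot θ ρ q i) z e - fderiv ℝ (c.correctedPot θ ρ q m) z e =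
      pullOneForm (𝓡 n) θ ((c.charts i).lift ∘ (c.charts i).chart ∘ q) z e -
      pullOneForm (𝓡 n) θ ((c.charts m).lift ∘ (c.charts m).chart ∘ q) z e := by
    rw [h6, h7]
    exact h5
  simp only [reducedForm, sub_apply]
  linarith

/-- In the product rule the derivative of the bump function meets the defect, and the bump function,
which is at most one, meets the derivative of the defect. Both defect factors are `O(M)`. -/
theorem abs_fderiv_correctionTerm_le (hp : IsUniversalCovering n p) (hθ : IsPrimitive p σ θ)
    (hρ : ρ.IsSubordinate c.smallSet) {M b R D : ℝ} (hM0 : 0 ≤ M) (hM : TwoFormNormLE g σ M)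
    (hb0 : 0 ≤ b) (hb : ∀ i, (c.charts i).bound ≤ b) (hR0 : 0 ≤ R)
    (hR : ∀ i, (c.charts i).radius ≤ R) (hD0 : 0 ≤ D) {e : ℝ × ℝ}
    (hD : |fderiv ℝ (fun z => ρ j (q z)) z e| ≤ D * planeSpeed g q e z)
    (hq : ContMDiffAt 𝓘(ℝ, ℝ × ℝ) (𝓡 n) ∞ q z) (hz : q z ∈ c.smallSet i) :
    |fderiv ℝ (c.correctionTerm θ ρ q i j) z e| ≤
      (D * (2 * R * defectConst b R) + defectConst b R * b) * M * planeSpeed g q e z := by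
  have hs := planeSpeed_nonneg g q e z
  have hdC : 0 ≤ defectConst b R := by rw [defectConst]; positivity
  rcases correctionTerm_cases (θ := θ) hρ hq hz j with ⟨hj, hij⟩ | h
  · have hmid := mem_middleBall_of_mem hj
    have hρd := (contDiffAt_bump (ρ := ρ) hq j).differentiableAt (by simp)
    have hch : DifferentiableAt ℝ ((c.charts j).chart ∘ q) z :=
      (contDiffAt_chart hq hj).differentiableAt (by simp)
    have hdef := (contDiffAt_defect hp hθ.smooth hij hmid 1).differentiableAt (by simp)
    have h1 := hρd.hasFDerivAt.mul (hdef.hasFDerivAt.comp (f := (c.charts j).chart ∘ q) z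
      hch.hasFDerivAt)
    have h2 : fderiv ℝ (c.correctionTerm θ ρ q i j) z e =
        ρ j (q z) * fderiv ℝ (c.defect θ i j) ((c.charts j).chart (q z))
          (fderiv ℝ ((c.charts j).chart ∘ q) z e) +
        c.defect θ i j ((c.charts j).chart (q z)) * fderiv ℝ (fun z => ρ j (q z)) z e :=
      congrArg (fun T : ℝ × ℝ →L[ℝ] ℝ => T e) h1.fderiv
    have h3 := abs_fderiv_defect_le hp hθ hM0 hM hb hR0 hR hij hmid
      (fderiv ℝ ((c.charts j).chart ∘ q) z e)
    have h4 := abs_defect_le hp hθ hM0 hM hb hR0 hR hij hmid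
    have h5 : ‖fderiv ℝ ((c.charts j).chart ∘ q) z e‖ ≤ b * planeSpeed g q e z :=
      ((c.charts j).norm_fderiv_chart_comp_le hp hq hj.1 e).trans
        (mul_le_mul_of_nonneg_right (hb j) hs)
    rw [h2]
    refine (abs_add_le _ _).trans ?_
    rw [abs_mul, abs_mul, abs_of_nonneg (ρ.nonneg j _)]
    have h6 : ρ j (q z) * |fderiv ℝ (c.defect θ i j) ((c.charts j).chart (q z))
          (fderiv ℝ ((c.charts j).chart ∘ q) z e)| ≤
        1 * (defectConst b R * M * (b * planeSpeed g q e z)) :=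
      mul_le_mul (ρ.le_one j _) (h3.trans (mul_le_mul_of_nonneg_left h5 (by positivity)))
        (abs_nonneg _) zero_le_one
    have h7 : |c.defect θ i j ((c.charts j).chart (q z))| * |fderiv ℝ (fun z => ρ j (q z)) z e| ≤
        2 * R * defectConst b R * M * (D * planeSpeed g q e z) :=
      mul_le_mul h4 hD (abs_nonneg _) (by positivity)
    calc _ ≤ _ := add_le_add h6 h7
      _ = _ := by ring
  · rw [h.fderiv_eq]
    simp only [fderiv_fun_const, Pi.zero_apply, zero_apply, abs_zero]
    positivity

/-- The supremum of `θ` does not enter: `θ` occurs only together with the derivative of its radial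
primitive, with difference `O(M)`, and each correction term is `O(M)` as well. -/
theorem abs_reducedForm_le [Fintype ι] (hp : IsUniversalCovering n p) (hθ : IsPrimitive p σ θ)
    (hρ : ρ.IsSubordinate c.smallSet) {M b R : ℝ} {D : ι → ℝ} (hM0 : 0 ≤ M)
    (hM : TwoFormNormLE g σ M) (hb0 : 0 ≤ b) (hb : ∀ i, (c.charts i).bound ≤ b) (hR0 : 0 ≤ R)
    (hR : ∀ i, (c.charts i).radius ≤ R) (hD0 : ∀ j, 0 ≤ D j) {e : ℝ × ℝ}
    (hD : ∀ j, |fderiv ℝ (fun z => ρ j (q z)) z e| ≤ D j * planeSpeed g q e z)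
    (hq : ContMDiffAt 𝓘(ℝ, ℝ × ℝ) (𝓡 n) ∞ q z) (hz : q z ∈ c.smallSet i) :
    |c.reducedForm θ ρ q i z e| ≤ (2 * b ^ 3 * R + ∑ j, (D j * (2 * R * defectConst b R) +
      defectConst b R * b)) * M * planeSpeed g q e z := by
  have hs := planeSpeed_nonneg g q e z
  have hch : DifferentiableAt ℝ ((c.charts i).chart ∘ q) z :=
    (contDiffAt_chart hq hz).differentiableAt (by simp)
  have hball := (c.charts i).chart_mem _ hz.1
  have hpot := (contDiffAt_pot (c := c) hθ.smooth hball 1).differentiableAt (by simp)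
  have h1 := pullOneForm_comp θ (f := (c.charts i).lift) (h := (c.charts i).chart ∘ q) (y := z)
    (((c.charts i).contMDiffAt_lift hball).mdifferentiableAt (by simp)) hch e
  have h2 := abs_sub_fderiv_pot_le hp hθ hM0 hM hb hR hball
    (fderiv ℝ ((c.charts i).chart ∘ q) z e)
  have h3 : ‖fderiv ℝ ((c.charts i).chart ∘ q) z e‖ ≤ b * planeSpeed g q e z :=
    ((c.charts i).norm_fderiv_chart_comp_le hp hq hz.1 e).trans
      (mul_le_mul_of_nonneg_right (hb i) hs)
  have h4 := (hpot.hasFDerivAt.comp (f := (c.charts i).chart ∘ q) z hch.hasFDerivAt).add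
    (HasFDerivAt.fun_sum (u := Finset.univ) fun j _ => ((contDiffAt_correctionTerm hp hθ hρ hq hz j
      1).differentiableAt (by simp)).hasFDerivAt)
  have h5 : fderiv ℝ (c.correctedPot θ ρ q i) z e =
      fderiv ℝ (c.pot θ i) ((c.charts i).chart (q z)) (fderiv ℝ ((c.charts i).chart ∘ q) z e) +
      ∑ j, fderiv ℝ (c.correctionTerm θ ρ q i j) z e := by
    refine (congrArg (fun T : ℝ × ℝ →L[ℝ] ℝ => T e) h4.fderiv).trans ?_
    simp only [add_apply, ContinuousLinearMap.comp_apply, sum_apply]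
  have h6 : |∑ j, fderiv ℝ (c.correctionTerm θ ρ q i j) z e| ≤
      ∑ j, (D j * (2 * R * defectConst b R) + defectConst b R * b) * M * planeSpeed g q e z :=
    (Finset.abs_sum_le_sum_abs _ _).trans (Finset.sum_le_sum fun j _ =>
      abs_fderiv_correctionTerm_le hp hθ hρ hM0 hM hb0 hb hR0 hR (hD0 j) (hD j) hq hz)
  have h7 : c.reducedForm θ ρ q i z e = (pullOneForm (𝓡 n) θ (c.charts i).lift
      ((c.charts i).chart (q z)) (fderiv ℝ ((c.charts i).chart ∘ q) z e) -
      fderiv ℝ (c.pot θ i) ((c.charts i).chart (q z)) (fderiv ℝ ((c.charts i).chart ∘ q) z e)) -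
      ∑ j, fderiv ℝ (c.correctionTerm θ ρ q i j) z e := by
    simp only [reducedForm, sub_apply, h5]
    rw [h1]
    simp only [Function.comp_apply]
    ring
  rw [h7]
  refine (abs_sub _ _).trans ?_
  rw [add_mul, add_mul, Finset.sum_mul, Finset.sum_mul]
  refine add_le_add ((h2.trans (mul_le_mul_of_nonneg_left h3 (by positivity))).trans_eq ?_) h6
  ring

/-- The cylinder estimate for two-forms without holonomy. -/
theorem exists_bound_of_holonomy_eq_zero [CompactSpace N] [T2Space N] [Finite ι]
    (hp : IsUniversalCovering n p) (c : NestedCover g p ι) :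
    ∃ C, 0 ≤ C ∧ ∀ (σ : FormField n N) (θ : (x : N') → TangentSpace (𝓡 n) x →L[ℝ] ℝ) (M : ℝ),
      IsPrimitive p σ θ → 0 ≤ M → TwoFormNormLE g σ M →
      (∀ i m j, c.Adjacent i m → c.Adjacent i j → c.Adjacent m j → c.holonomy θ i m j = 0) →
      ∀ q : ℝ × ℝ → N, ContMDiff 𝓘(ℝ, ℝ × ℝ) (𝓡 n) ∞ q → (∀ s t, q (s, t + 1) = q (s, t)) →
      ∀ s₀ s₁ : ℝ, |∫ s in s₀..s₁, ∫ t in (0 : ℝ)..1, planeForm σ q (s, t)| ≤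
        C * M * ((∫ t in (0 : ℝ)..1, planeSpeed g q (0, 1) (s₀, t)) +
          ∫ t in (0 : ℝ)..1, planeSpeed g q (0, 1) (s₁, t)) := by
  classical
  have := Fintype.ofFinite ι
  obtain ⟨ρ, hρ⟩ := SmoothPartitionOfUnity.exists_isSubordinate (𝓡 n) isClosed_univ c.smallSet
    c.isOpen_smallSet (fun z _ => Set.mem_iUnion.2 (c.exists_mem z))
  choose D hD0 hD using exists_bump_bound hp c ρ hρ
  set b := ∑ i, (c.charts i).bound with hb
  set R := ∑ i, |(c.charts i).radius| with hR
  have hb' : ∀ i, (c.charts i).bound ≤ b := fun i =>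
    Finset.single_le_sum (f := fun i => (c.charts i).bound) (fun i _ => (c.charts i).bound_pos.le)
      (Finset.mem_univ i)
  have hR' : ∀ i, (c.charts i).radius ≤ R := fun i => (le_abs_self _).trans
    (Finset.single_le_sum (f := fun i => |(c.charts i).radius|) (fun i _ => abs_nonneg _)
      (Finset.mem_univ i))
  have hb0 : 0 ≤ b := Finset.sum_nonneg fun i _ => (c.charts i).bound_pos.le
  have hR0 : 0 ≤ R := Finset.sum_nonneg fun i _ => abs_nonneg _
  have hdC : 0 ≤ defectConst b R := by rw [defectConst]; positivity
  set C := 2 * b ^ 3 * R + ∑ j, (D j * (2 * R * defectConst b R) + defectConst b R * b) with hC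
  have hC0 : 0 ≤ C := add_nonneg (by positivity) (Finset.sum_nonneg fun j _ =>
    add_nonneg (mul_nonneg (hD0 j) (by positivity)) (by positivity))
  refine ⟨C, hC0, fun σ θ M hθ hM0 hM h0 q hq hper => ?_⟩
  choose i hi using fun z => c.exists_mem (q z)
  -- The chosen index `i z` may jump with `z`, but by `reducedForm_eq` the value does not depend on
  -- the choice, so `Θ` is locally one of the reduced forms and hence of class `C¹`.
  set Θ : ℝ × ℝ → ℝ × ℝ →L[ℝ] ℝ := fun z => c.reducedForm θ ρ q (i z) z with hΘ
  have hloc : ∀ z, Θ =ᶠ[𝓝 z] c.reducedForm θ ρ q (i z) := by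
    intro z
    filter_upwards [hq.continuous.continuousAt.preimage_mem_nhds
      ((c.isOpen_smallSet (i z)).mem_nhds (hi z))] with z' hz'
    exact reducedForm_eq hp hθ hρ h0 (hq z') (hi z') hz'
  have hΘd : ContDiff ℝ 1 Θ := contDiff_iff_contDiffAt.2 fun z =>
    (contDiffAt_reducedForm hp hθ hρ (hq z) (hi z)).congr_of_eventuallyEq (hloc z)
  have hcurl : ∀ z, curl Θ z (1, 0) (0, 1) = planeForm σ q z := by
    intro z
    rw [← curl_reducedForm hp hθ hρ (hq z) (hi z), curl, curl, (hloc z).fderiv_eq]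
  have hbound : ∀ e z, |Θ z e| ≤ C * M * planeSpeed g q e z := fun e z =>
    abs_reducedForm_le hp hθ hρ hM0 hM hb0 hb' hR0 hR' hD0 (fun j => hD j q z (hq z) e) (hq z) (hi z)
  have hcs : ∀ e, Continuous (planeSpeed g q e) := continuous_planeSpeed g hq
  have hct : ∀ s, Continuous fun t => C * M * planeSpeed g q (0, 1) (s, t) := fun s =>
    continuous_const.mul ((hcs _).comp (by fun_prop))
  have hlow : ∀ s₀ s₁, -(C * M * ((∫ t in (0 : ℝ)..1, planeSpeed g q (0, 1) (s₀, t)) +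
        ∫ t in (0 : ℝ)..1, planeSpeed g q (0, 1) (s₁, t))) ≤
      ∫ s in s₀..s₁, ∫ t in (0 : ℝ)..1, planeForm σ q (s, t) := by
    intro s₀ s₁
    have key := le_integral_curl_of_periodic hΘd
      (a := fun s t => C * M * planeSpeed g q (1, 0) (s, t))
      (B := fun t => C * M * planeSpeed g q (0, 1) (s₀, t))
      (f := fun t => -(C * M * planeSpeed g q (0, 1) (s₁, t))) (s₀ := s₀) (s₁ := s₁)
      (fun s t => by rw [hcurl, hcurl, planeForm_periodic σ hq hper])
      (fun t => continuous_const.mul ((hcs _).comp (by fun_prop)))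
      (fun s t => by simp only [planeSpeed_periodic g hq hper])
      (fun s t => hbound _ _) (hct s₀)
      (fun t => by simp only [planeSpeed_periodic g hq hper])
      (fun t => hbound _ _) (hct s₁).neg
      (fun t => by simp only [planeSpeed_periodic g hq hper])
      (fun t => (abs_le.1 (hbound _ _)).1)
    rw [intervalIntegral.integral_neg, intervalIntegral.integral_const_mul,
      intervalIntegral.integral_const_mul] at key
    simp only [hcurl] at key
    linarith
  intro s₀ s₁
  rw [abs_le]
  refine ⟨hlow s₀ s₁, ?_⟩
  have h := hlow s₁ s₀
  rw [intervalIntegral.integral_symm s₀ s₁] at h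
  linarith

end NestedCover

end RabinowitzFloer
end

noncomputable section

namespace RabinowitzFloer

set_option linter.unusedSectionVars false

/-! ### Gauges and finite-rank corrections -/

section Gauges

variable {W : Type*} [AddCommGroup W] [Module ℝ W]

/-- A relation `P w c` which behaves like `‖w‖ ≤ c` for a seminorm. -/
structure IsGauge (P : W → ℝ → Prop) : Prop where
  exists_bound : ∀ w, ∃ c, 0 ≤ c ∧ P w c
  mono : ∀ w c c', c ≤ c' → P w c → P w c'
  add : ∀ w w' c c', P w c → P w' c' → P (w + w') (c + c')
  smul : ∀ (a : ℝ) w c, P w c → P (a • w) (|a| * c)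

theorem IsGauge.zero {P : W → ℝ → Prop} (hP : IsGauge P) : P 0 0 := by
  obtain ⟨c, -, hc⟩ := hP.exists_bound 0
  have := hP.smul 0 0 c hc
  rwa [zero_smul, abs_zero, zero_mul] at this

theorem IsGauge.sum {P : W → ℝ → Prop} (hP : IsGauge P) {T : Type*} (s : Finset T) {w : T → W}
    {c : T → ℝ} (h : ∀ t, P (w t) (c t)) : P (∑ t ∈ s, w t) (∑ t ∈ s, c t) := by
  classical
  induction s using Finset.induction_on with
  | empty => simpa using hP.zero
  | insert a s ha ih =>
    rw [Finset.sum_insert ha, Finset.sum_insert ha]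
    exact hP.add _ _ _ _ (h a) ih

theorem IsGauge.exists_bound_linear {P : W → ℝ → Prop} (hP : IsGauge P) {T : Type*} [Fintype T]
    (r : (T → ℝ) →ₗ[ℝ] W) : ∃ K, 0 ≤ K ∧ ∀ y : T → ℝ, P (r y) (K * ‖y‖) := by
  classical
  choose c hc0 hc using fun t => hP.exists_bound (r (Pi.single t 1))
  refine ⟨∑ t, c t, Finset.sum_nonneg fun t _ => hc0 t, fun y => ?_⟩
  have h1 : r y = ∑ t, y t • r (Pi.single t 1) := by
    conv_lhs => rw [pi_eq_sum_univ' y]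
    rw [map_sum]
    refine Finset.sum_congr rfl fun t _ => ?_
    rw [map_smul]
  rw [h1]
  refine hP.mono _ _ _ ?_ (hP.sum Finset.univ fun t => hP.smul (y t) _ _ (hc t))
  rw [Finset.sum_mul]
  refine Finset.sum_le_sum fun t _ => ?_
  rw [mul_comm]
  exact mul_le_mul_of_nonneg_left (norm_le_pi_norm y t) (hc0 t)

/-- If a gauge is dominated by another one on the common kernel of finitely many bounded
functionals, then it is dominated everywhere. -/
theorem IsGauge.exists_domination {P Q : W → ℝ → Prop} (hP : IsGauge P) (hQ : IsGauge Q)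
    {T : Type*} [Fintype T] (l : W →ₗ[ℝ] T → ℝ) {K : ℝ} (hK0 : 0 ≤ K)
    (hl : ∀ w M, 0 ≤ M → P w M → ∀ t, |l w t| ≤ K * M) {C : ℝ} (hC0 : 0 ≤ C)
    (hker : ∀ w M, 0 ≤ M → P w M → l w = 0 → Q w (C * M)) :
    ∃ C', 0 ≤ C' ∧ ∀ w M, 0 ≤ M → P w M → Q w (C' * M) := by
  -- The map `r` extends a linear section of `l` over its range. Then `w - r (l w)` lies in the
  -- kernel, while `r (l w)` ranges over a finite-dimensional space, where both gauges are bounded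
  -- by multiples of `‖l w‖ ≤ K * M`.
  obtain ⟨s, hs⟩ := l.rangeRestrict.exists_rightInverse_of_surjective l.range_rangeRestrict
  obtain ⟨r, hr⟩ := LinearMap.exists_extend s
  have hlr : ∀ w, l (r (l w)) = l w := by
    intro w
    have h1 : r (l w) = s (l.rangeRestrict w) :=
      congrArg (fun f : LinearMap.range l →ₗ[ℝ] W => f (l.rangeRestrict w)) hr
    have h2 : l.rangeRestrict (s (l.rangeRestrict w)) = l.rangeRestrict w :=
      congrArg (fun f => f (l.rangeRestrict w)) hs
    rw [h1]
    exact congrArg Subtype.val h2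
  obtain ⟨K₁, hK₁, h1⟩ := hP.exists_bound_linear r
  obtain ⟨K₂, hK₂, h2⟩ := hQ.exists_bound_linear r
  refine ⟨C * (1 + K₁ * K) + K₂ * K, by positivity, fun w M hM hw => ?_⟩
  have hn : ‖l w‖ ≤ K * M := (pi_norm_le_iff_of_nonneg (by positivity)).2 fun t => hl w M hM hw t
  have h3 : P (w + (-1 : ℝ) • r (l w)) (M * (1 + K₁ * K)) := by
    refine hP.mono _ _ _ ?_ (hP.add _ _ _ _ hw (hP.smul (-1) _ _ (h1 (l w))))
    rw [abs_neg, abs_one, one_mul]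
    nlinarith [mul_le_mul_of_nonneg_left hn hK₁]
  have h4 := hker _ _ (by positivity) h3 (by rw [map_add, map_smul, hlr]; simp)
  have h5 := hQ.add _ _ _ _ h4 (h2 (l w))
  rw [add_assoc, neg_one_smul, neg_add_cancel, add_zero] at h5
  refine hQ.mono _ _ _ ?_ h5
  nlinarith [mul_le_mul_of_nonneg_left hn hK₂]

end Gauges

/-! ### The space of two-forms with a bounded primitive -/

section FormPairs

/-- Pairs of a field of bilinear forms on the base and a field of covectors on the covering. -/
def FormPairs (n : ℕ) (N N' : Type*) : Type _ :=
  (N → EuclideanSpace ℝ (Fin n) →L[ℝ] EuclideanSpace ℝ (Fin n) →L[ℝ] ℝ) ×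
    (N' → EuclideanSpace ℝ (Fin n) →L[ℝ] ℝ)

instance (n : ℕ) (N N' : Type*) : AddCommGroup (FormPairs n N N') :=
  inferInstanceAs (AddCommGroup ((N → EuclideanSpace ℝ (Fin n) →L[ℝ] EuclideanSpace ℝ (Fin n) →L[ℝ] ℝ) ×
    (N' → EuclideanSpace ℝ (Fin n) →L[ℝ] ℝ)))

instance (n : ℕ) (N N' : Type*) : Module ℝ (FormPairs n N N') :=
  inferInstanceAs (Module ℝ ((N → EuclideanSpace ℝ (Fin n) →L[ℝ] EuclideanSpace ℝ (Fin n) →L[ℝ] ℝ) ×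
    (N' → EuclideanSpace ℝ (Fin n) →L[ℝ] ℝ)))

theorem eventually_norm_fderiv_lt {E : Type*} [NormedAddCommGroup E] [NormedSpace ℝ E]
    {Θ : E → E →L[ℝ] ℝ} {S : Set E} (hS : IsOpen S) (hΘ : ContDiffOn ℝ ∞ Θ S) {y : E} (hy : y ∈ S) :
    ∀ᶠ y' in 𝓝 y, ‖fderiv ℝ Θ y'‖ < ‖fderiv ℝ Θ y‖ + 1 :=
  ((hΘ.continuousOn_fderiv_of_isOpen hS (by simp)).continuousAt
    (hS.mem_nhds hy)).norm.eventually_lt_const (by linarith)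

end FormPairs

/-! ### The space of bounded primitives and the cylinder estimate -/

section BoundedPrimitives

variable {n : ℕ} {N : Type*} [TopologicalSpace N] [ChartedSpace (EuclideanSpace ℝ (Fin n)) N]
  [IsManifold (𝓡 n) ∞ N]
  {N' : Type*} [TopologicalSpace N'] [ChartedSpace (EuclideanSpace ℝ (Fin n)) N']
  [IsManifold (𝓡 n) ∞ N'] {g : Metric n N} {p : N' → N}

local notation "𝔼" => EuclideanSpace ℝ (Fin n)

/-- One-forms on the covering. -/
abbrev CovectorField (n : ℕ) (N' : Type*) [TopologicalSpace N']
    [ChartedSpace (EuclideanSpace ℝ (Fin n)) N'] : Type _ :=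
  (x : N') → TangentSpace (𝓡 n) x →L[ℝ] ℝ

theorem IsSmoothOneForm.add {θ θ' : CovectorField n N'} (hθ : IsSmoothOneForm (𝓡 n) θ)
    (hθ' : IsSmoothOneForm (𝓡 n) θ') : IsSmoothOneForm (𝓡 n) (θ + θ') :=
  ContMDiff.add_section hθ hθ'

theorem IsSmoothOneForm.const_smul {θ : CovectorField n N'} (hθ : IsSmoothOneForm (𝓡 n) θ) (a : ℝ) :
    IsSmoothOneForm (𝓡 n) (a • θ) :=
  ContMDiff.const_smul_section hθ

theorem pullOneForm_add {F : Type*} [NormedAddCommGroup F] [NormedSpace ℝ F]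
    (θ θ' : CovectorField n N') (f : F → N') :
    pullOneForm (𝓡 n) (θ + θ') f = pullOneForm (𝓡 n) θ f + pullOneForm (𝓡 n) θ' f := rfl

theorem pullOneForm_smul {F : Type*} [NormedAddCommGroup F] [NormedSpace ℝ F]
    (a : ℝ) (θ : CovectorField n N') (f : F → N') :
    pullOneForm (𝓡 n) (a • θ) f = a • pullOneForm (𝓡 n) θ f := rfl

theorem extDerivOneForm_eq_curl (θ : CovectorField n N') (x : N') (u w : TangentSpace (𝓡 n) x) :
    extDerivOneForm (𝓡 n) θ x u w = curl (oneFormInChart (𝓡 n) θ x) (extChartAt (𝓡 n) x x)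
      (mfderiv (𝓡 n) (𝓡 n) (extChartAt (𝓡 n) x) x u : 𝔼)
      (mfderiv (𝓡 n) (𝓡 n) (extChartAt (𝓡 n) x) x w : 𝔼) := rfl

theorem curl_add {F : Type*} [NormedAddCommGroup F] [NormedSpace ℝ F] {Θ Θ' : F → F →L[ℝ] ℝ} {y : F}
    (hΘ : DifferentiableAt ℝ Θ y) (hΘ' : DifferentiableAt ℝ Θ' y) (u w : F) :
    curl (Θ + Θ') y u w = curl Θ y u w + curl Θ' y u w := by
  simp only [curl, fderiv_add hΘ hΘ', add_apply]
  ring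

theorem curl_const_smul {F : Type*} [NormedAddCommGroup F] [NormedSpace ℝ F] {Θ : F → F →L[ℝ] ℝ}
    {y : F} (hΘ : DifferentiableAt ℝ Θ y) (a : ℝ) (u w : F) :
    curl (a • Θ) y u w = a * curl Θ y u w := by
  simp only [curl, fderiv_const_smul hΘ, smul_apply, smul_eq_mul]
  ring

theorem IsPrimitive.add {σ σ' : FormField n N} {θ θ' : CovectorField n N'}
    (h : IsPrimitive p σ θ) (h' : IsPrimitive p σ' θ') : IsPrimitive p (σ + σ') (θ + θ') := by
  refine ⟨h.smooth.add h'.smooth, fun x u w => ?_⟩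
  rw [extDerivOneForm_eq_curl]
  refine (curl_add ((contDiffAt_oneFormInChart h.smooth x).differentiableAt (by simp))
    ((contDiffAt_oneFormInChart h'.smooth x).differentiableAt (by simp)) _ _).trans ?_
  exact congrArg₂ (· + ·) (h.deriv_eq x u w) (h'.deriv_eq x u w)

theorem IsPrimitive.const_smul {σ : FormField n N} {θ : CovectorField n N'}
    (h : IsPrimitive p σ θ) (a : ℝ) : IsPrimitive p (a • σ) (a • θ) := by
  refine ⟨h.smooth.const_smul a, fun x u w => ?_⟩
  rw [extDerivOneForm_eq_curl]
  refine (curl_const_smul ((contDiffAt_oneFormInChart h.smooth x).differentiableAt (by simp))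
    a _ _).trans ?_
  exact congrArg (a * ·) (h.deriv_eq x u w)

theorem sharp_add (g : Metric n N) (x : N) (a b : TangentSpace (𝓡 n) x →L[ℝ] ℝ) :
    sharp g x (a + b) = sharp g x a + sharp g x b :=
  map_add ((g.inner x).inverse : (𝔼 →L[ℝ] ℝ) →L[ℝ] 𝔼) a b

theorem sharp_smul (g : Metric n N) (x : N) (c : ℝ) (a : TangentSpace (𝓡 n) x →L[ℝ] ℝ) :
    sharp g x (c • a) = c • sharp g x a :=
  map_smul ((g.inner x).inverse : (𝔼 →L[ℝ] ℝ) →L[ℝ] 𝔼) c a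

theorem liftedDualNormSq_add_le (g : Metric n N) (p : N' → N) (x : N')
    (a b : TangentSpace (𝓡 n) x →L[ℝ] ℝ) :
    liftedDualNormSq g p x (a + b) ≤
      2 * (liftedDualNormSq g p x a + liftedDualNormSq g p x b) := by
  have h : sharp g (p x) (pushCovector p x (a + b)) =
      sharp g (p x) (pushCovector p x a) + sharp g (p x) (pushCovector p x b) :=
    sharp_add g (p x) (pushCovector p x a) (pushCovector p x b)
  simp only [liftedDualNormSq_eq, dualNormSq_eq]
  rw [h]
  have h1 := tangentNorm_add_le g (p x) (sharp g (p x) (pushCovector p x a))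
    (sharp g (p x) (pushCovector p x b))
  have h2 := tangentNorm_nonneg g (p x) (sharp g (p x) (pushCovector p x a) +
    sharp g (p x) (pushCovector p x b))
  have h3 := pow_le_pow_left₀ h2 h1 2
  nlinarith [sq_nonneg (tangentNorm g (p x) (sharp g (p x) (pushCovector p x a)) -
    tangentNorm g (p x) (sharp g (p x) (pushCovector p x b)))]

theorem liftedDualNormSq_smul (g : Metric n N) (p : N' → N) (x : N') (c : ℝ)
    (a : TangentSpace (𝓡 n) x →L[ℝ] ℝ) :
    liftedDualNormSq g p x (c • a) = c ^ 2 * liftedDualNormSq g p x a := by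
  have h : sharp g (p x) (pushCovector p x (c • a)) = c • sharp g (p x) (pushCovector p x a) :=
    sharp_smul g (p x) c (pushCovector p x a)
  simp only [liftedDualNormSq_eq, dualNormSq_eq]
  rw [h, tangentNorm_smul, mul_pow, sq_abs]

theorem liftedDualNormSq_zero (g : Metric n N) (p : N' → N) (x : N') :
    liftedDualNormSq g p x 0 = 0 := by
  have h := liftedDualNormSq_smul g p x 0 0
  rwa [zero_smul, zero_pow two_ne_zero, zero_mul] at h

theorem isPrimitive_zero (p : N' → N) :
    IsPrimitive p (fun _ => 0 : FormField n N) (fun _ => 0 : CovectorField n N') := by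
  refine ⟨contMDiff_zeroSection ℝ (fun x : N' => TangentSpace (𝓡 n) x →L[ℝ] ℝ), fun x u w => ?_⟩
  have h : oneFormInChart (𝓡 n) (fun _ => 0 : CovectorField n N') x = fun _ => 0 := by
    ext y e
    rfl
  rw [extDerivOneForm_eq_curl, h]
  have h0 : ∀ y u w : 𝔼, curl (fun _ : 𝔼 => (0 : 𝔼 →L[ℝ] ℝ)) y u w = 0 := by simp [curl]
  exact h0 _ _ _

/-- The space of two-forms together with a bounded primitive of their pull-back. -/
def boundedPrimitives (g : Metric n N) (p : N' → N) :
    Submodule ℝ (FormPairs n N N') where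
  carrier := {w | IsPrimitive (n := n) p w.1 w.2 ∧ ∃ C, ∀ x, liftedDualNormSq g p x (w.2 x) ≤ C}
  add_mem' := by
    rintro w w' ⟨h, C, hC⟩ ⟨h', C', hC'⟩
    exact ⟨h.add h', 2 * (C + C'), fun x => (liftedDualNormSq_add_le g p x _ _).trans
      (by linarith [hC x, hC' x])⟩
  zero_mem' := ⟨isPrimitive_zero p, 0, fun x => (liftedDualNormSq_zero g p x).le⟩
  smul_mem' := by
    rintro a w ⟨h, C, hC⟩
    refine ⟨h.const_smul a, a ^ 2 * C, fun x => ?_⟩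
    have := liftedDualNormSq_smul g p x a (w.2 x)
    exact this.trans_le (mul_le_mul_of_nonneg_left (hC x) (sq_nonneg a))

theorem tangentNorm_zero (g : Metric n N) (x : N) : tangentNorm g x 0 = 0 := by
  have h := tangentNorm_smul g x 0 0
  rwa [zero_smul, abs_zero, zero_mul] at h

/-- In equal finite dimension the injective derivative of the chart inverse is onto, so every pair
of tangent vectors comes from coordinate vectors of comparable length, on which `σ` is the curl of
the pulled-back primitive. -/
theorem LiftedChart.abs_apply_le (hp : IsUniversalCovering n p) (L : LiftedChart g p)
    {σ : FormField n N} {θ : CovectorField n N'} (hθ : IsPrimitive p σ θ) {y : 𝔼} (hy : y ∈ L.ball)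
    (u w : TangentSpace (𝓡 n) (p (L.lift y))) :
    |σ (p (L.lift y)) u w| ≤ 2 * ‖fderiv ℝ (pullOneForm (𝓡 n) θ L.lift) y‖ * L.bound ^ 2 *
      tangentNorm g _ u * tangentNorm g _ w := by
  set D : 𝔼 →L[ℝ] 𝔼 := mfderiv (𝓡 n) (𝓡 n) (p ∘ L.lift) y with hD
  have hinj : Function.Injective (D : 𝔼 →ₗ[ℝ] 𝔼) := by
    rw [← LinearMap.ker_eq_bot, LinearMap.ker_eq_bot']
    intro e he
    have h1 := (L.norm_le y hy e).2
    have h2 : (mfderiv (𝓡 n) (𝓡 n) (p ∘ L.lift) y e : 𝔼) = (0 : 𝔼) := he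
    have h3 : tangentNorm g (p (L.lift y)) (mfderiv (𝓡 n) (𝓡 n) (p ∘ L.lift) y e) = 0 := by
      exact (congrArg (fun v : 𝔼 => tangentNorm g (p (L.lift y)) v) h2).trans
        (tangentNorm_zero g _)
    rw [h3, mul_zero] at h1
    exact norm_le_zero_iff.1 h1
  have hsurj := LinearMap.injective_iff_surjective.1 hinj
  obtain ⟨e, he⟩ := hsurj u
  obtain ⟨e', he'⟩ := hsurj w
  have he1 : mfderiv (𝓡 n) (𝓡 n) (p ∘ L.lift) y e = u := he
  have he2 : mfderiv (𝓡 n) (𝓡 n) (p ∘ L.lift) y e' = w := he'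
  have h1 := (L.norm_le y hy e).2
  have h2 := (L.norm_le y hy e').2
  have h3 := hθ.curl_eq hp (L.contMDiffAt_lift hy) e e'
  rw [he1] at h1 h3
  rw [he2] at h2 h3
  rw [← h3, curl]
  set T := fderiv ℝ (pullOneForm (𝓡 n) θ L.lift) y
  have h4 : ∀ a b : 𝔼, |T a b| ≤ ‖T‖ * ‖a‖ * ‖b‖ := fun a b => T.le_opNorm₂ a b
  have hb := L.bound_pos
  calc |T e e' - T e' e| ≤ |T e e'| + |T e' e| := abs_sub _ _
    _ ≤ ‖T‖ * ‖e‖ * ‖e'‖ + ‖T‖ * ‖e'‖ * ‖e‖ := add_le_add (h4 _ _) (h4 _ _)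
    _ = 2 * ‖T‖ * (‖e‖ * ‖e'‖) := by ring
    _ ≤ 2 * ‖T‖ * ((L.bound * tangentNorm g _ u) * (L.bound * tangentNorm g _ w)) := by
      refine mul_le_mul_of_nonneg_left (mul_le_mul h1 h2 (norm_nonneg _) ?_) (by positivity)
      exact mul_nonneg hb.le (tangentNorm_nonneg _ _ _)
    _ = _ := by ring

/-- Finiteness of the norm for each single form, which a gauge must satisfy. The derivative of the
primitive in a lifted chart gives local bounds, and compactness of the base reduces to finitely many
of them. -/
theorem IsPrimitive.exists_twoFormNormLE [CompactSpace N] (hp : IsUniversalCovering n p)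
    (g : Metric n N) {σ : FormField n N} {θ : CovectorField n N'} (hθ : IsPrimitive p σ θ) :
    ∃ M, 0 ≤ M ∧ TwoFormNormLE g σ M := by
  have hloc : ∀ x : N, ∃ M, 0 ≤ M ∧ ∀ᶠ z in 𝓝 x, ∀ u w : TangentSpace (𝓡 n) z,
      |σ z u w| ≤ M * tangentNorm g z u * tangentNorm g z w := by
    intro x
    obtain ⟨L, hx⟩ := exists_liftedChart hp g x
    have hx' := L.chart_mem x hx
    have h1 : ∀ᶠ y in 𝓝 (L.chart x), ‖fderiv ℝ (pullOneForm (𝓡 n) θ L.lift) y‖ <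
        ‖fderiv ℝ (pullOneForm (𝓡 n) θ L.lift) (L.chart x)‖ + 1 :=
      eventually_norm_fderiv_lt L.isOpen_ball
        (contDiffOn_pullOneForm hθ.smooth fun _ h => L.contMDiffAt_lift h) hx'
    have h2 := (L.contMDiffAt_chart hx).continuousAt.eventually h1
    refine ⟨2 * (‖fderiv ℝ (pullOneForm (𝓡 n) θ L.lift) (L.chart x)‖ + 1) * L.bound ^ 2,
      by positivity, ?_⟩
    filter_upwards [h2, L.isOpen_dom.mem_nhds hx] with z hz hzL
    obtain ⟨y, hy, hyz, rfl⟩ : ∃ y ∈ L.ball, ‖fderiv ℝ (pullOneForm (𝓡 n) θ L.lift) y‖ <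
        ‖fderiv ℝ (pullOneForm (𝓡 n) θ L.lift) (L.chart x)‖ + 1 ∧ p (L.lift y) = z :=
      ⟨L.chart z, L.chart_mem z hzL, hz, L.lift_chart z hzL⟩
    intro u w
    refine (L.abs_apply_le hp hθ hy u w).trans ?_
    have hb := L.bound_pos
    refine mul_le_mul_of_nonneg_right (mul_le_mul_of_nonneg_right ?_ (tangentNorm_nonneg _ _ _))
      (tangentNorm_nonneg _ _ _)
    exact mul_le_mul_of_nonneg_right (by linarith) (by positivity)
  choose M hM0 hM using hloc
  obtain ⟨s, -, hs⟩ := isCompact_univ.elim_nhds_subcover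
    (fun x => {z | ∀ u w : TangentSpace (𝓡 n) z,
      |σ z u w| ≤ M x * tangentNorm g z u * tangentNorm g z w}) (fun x _ => hM x)
  refine ⟨∑ x ∈ s, M x, Finset.sum_nonneg fun x _ => hM0 x, fun z u w => ?_⟩
  obtain ⟨x, hx, hz⟩ := Set.mem_iUnion₂.1 (hs (Set.mem_univ z))
  refine (hz u w).trans ?_
  exact mul_le_mul_of_nonneg_right (mul_le_mul_of_nonneg_right
    (Finset.single_le_sum (fun x _ => hM0 x) hx) (tangentNorm_nonneg _ _ _))
    (tangentNorm_nonneg _ _ _)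

theorem NestedCover.holonomy_add {ι : Type*} {c : NestedCover g p ι}
    (hp : IsUniversalCovering n p) {θ θ' : CovectorField n N'} (hθ : IsSmoothOneForm (𝓡 n) θ)
    (hθ' : IsSmoothOneForm (𝓡 n) θ') {i m j : ι} (him : c.Adjacent i m) (hij : c.Adjacent i j)
    (hmj : c.Adjacent m j) :
    c.holonomy (θ + θ') i m j = c.holonomy θ i m j + c.holonomy θ' i m j := by
  have h1 : ∀ y ∈ (c.charts i).ball, c.pot (θ + θ') i y = c.pot θ i y + c.pot θ' i y := by
    intro y hy
    have hs : ∀ y ∈ (c.charts i).ball, ContMDiffAt (𝓡 n) (𝓡 n) ∞ (c.charts i).lift y :=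
      fun _ => (c.charts i).contMDiffAt_lift
    exact radialPrimitive_add (c.convex_ball i) (c.small_mem_ball i)
      (contDiffOn_pullOneForm hθ hs).continuousOn (contDiffOn_pullOneForm hθ' hs).continuousOn hy
  have h2 : ∀ y ∈ c.middleBall m, radialPrimitive (pullOneForm (𝓡 n) (θ + θ') (c.transfer i m))
      (c.small m) y = radialPrimitive (pullOneForm (𝓡 n) θ (c.transfer i m)) (c.small m) y +
        radialPrimitive (pullOneForm (𝓡 n) θ' (c.transfer i m)) (c.small m) y := by
    intro y hy
    have hs : ∀ y ∈ c.middleBall m, ContMDiffAt (𝓡 n) (𝓡 n) ∞ (c.transfer i m) y :=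
      fun _ => him.contMDiffAt_transfer hp
    exact radialPrimitive_add (c.convex_middleBall m) (c.small_mem_middle m)
      (contDiffOn_pullOneForm hθ hs).continuousOn (contDiffOn_pullOneForm hθ' hs).continuousOn hy
  simp only [holonomy, transferPot]
  rw [h1 _ (hij.change_mem (c.small_mem_middle j)), h1 _ (him.change_mem (c.small_mem_middle m)),
    h2 _ (hmj.change_mem_middle (c.small_mem j))]
  ring

theorem NestedCover.holonomy_smul {ι : Type*} (c : NestedCover g p ι) (a : ℝ)
    (θ : CovectorField n N') (i m j : ι) :
    c.holonomy (a • θ) i m j = a * c.holonomy θ i m j := by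
  simp only [holonomy, transferPot, pot, pullOneForm_smul, radialPrimitive_smul]
  ring

/-- The cylinder estimate in terms of the lengths of the boundary loops. -/
def CylinderBound (g : Metric n N) (σ : FormField n N) (C : ℝ) : Prop :=
  ∀ q : ℝ × ℝ → N, ContMDiff 𝓘(ℝ, ℝ × ℝ) (𝓡 n) ∞ q → (∀ s t, q (s, t + 1) = q (s, t)) →
    ∀ s₀ s₁ : ℝ, |∫ s in s₀..s₁, ∫ t in (0 : ℝ)..1, planeForm σ q (s, t)| ≤
      C * ((∫ t in (0 : ℝ)..1, planeSpeed g q (0, 1) (s₀, t)) +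
        ∫ t in (0 : ℝ)..1, planeSpeed g q (0, 1) (s₁, t))

theorem integral_planeSpeed_nonneg (g : Metric n N) (q : ℝ × ℝ → N) (e : ℝ × ℝ) (s : ℝ) :
    0 ≤ ∫ t in (0 : ℝ)..1, planeSpeed g q e (s, t) :=
  intervalIntegral.integral_nonneg zero_le_one fun _ _ => planeSpeed_nonneg _ _ _ _

theorem isGauge_twoFormNormLE [CompactSpace N] (hp : IsUniversalCovering n p) (g : Metric n N) :
    IsGauge fun (w : boundedPrimitives g p) M => TwoFormNormLE g w.1.1 M where
  exists_bound w := w.2.1.exists_twoFormNormLE hp g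
  mono w M M' h hM x u v := (hM x u v).trans (mul_le_mul_of_nonneg_right
    (mul_le_mul_of_nonneg_right h (Real.sqrt_nonneg _)) (Real.sqrt_nonneg _))
  add w w' M M' h h' x u v := by
    have h1 := (abs_add_le (w.1.1 x u v) (w'.1.1 x u v)).trans (add_le_add (h x u v) (h' x u v))
    rw [← add_mul, ← add_mul] at h1
    exact h1
  smul a w M h x u v := by
    have h1 := mul_le_mul_of_nonneg_left (h x u v) (abs_nonneg a)
    rw [← mul_assoc, ← mul_assoc] at h1
    exact (abs_mul a (w.1.1 x u v)).trans_le h1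

/-- Finiteness for each form comes from its bounded primitive, with a constant not related to the
norm of the form; the domination argument supplies that relation afterwards. Subadditivity rests on
linearity of the area in the two-form. -/
theorem isGauge_cylinderBound (hp : IsUniversalCovering n p) (g : Metric n N) :
    IsGauge fun (w : boundedPrimitives g p) C => CylinderBound g w.1.1 C where
  exists_bound w := by
    obtain ⟨C, hC⟩ := w.2.2
    exact ⟨Real.sqrt C, Real.sqrt_nonneg _, fun q hq hper s₀ s₁ =>
      abs_integral_planeForm_le hp g w.2.1 hC hq hper s₀ s₁⟩
  mono w M M' h hM q hq hper s₀ s₁ := (hM q hq hper s₀ s₁).trans (mul_le_mul_of_nonneg_right h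
    (add_nonneg (integral_planeSpeed_nonneg _ _ _ _) (integral_planeSpeed_nonneg _ _ _ _)))
  add w w' M M' h h' q hq hper s₀ s₁ := by
    have hc := continuous_planeForm hp w.2.1 hq
    have hc' := continuous_planeForm hp w'.2.1 hq
    have h1 : ∫ s in s₀..s₁, ∫ t in (0 : ℝ)..1, planeForm (w + w').1.1 q (s, t) =
        (∫ s in s₀..s₁, ∫ t in (0 : ℝ)..1, planeForm w.1.1 q (s, t)) +
          ∫ s in s₀..s₁, ∫ t in (0 : ℝ)..1, planeForm w'.1.1 q (s, t) := by
      rw [← intervalIntegral.integral_add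
        ((continuous_integral_param hc 0 1).intervalIntegrable _ _)
        ((continuous_integral_param hc' 0 1).intervalIntegrable _ _)]
      refine intervalIntegral.integral_congr fun s _ => ?_
      exact intervalIntegral.integral_add
        ((hc.comp (by fun_prop : Continuous fun t : ℝ => (s, t))).intervalIntegrable _ _)
        ((hc'.comp (by fun_prop : Continuous fun t : ℝ => (s, t))).intervalIntegrable _ _)
    rw [h1, add_mul]
    exact (abs_add_le _ _).trans (add_le_add (h q hq hper s₀ s₁) (h' q hq hper s₀ s₁))
  smul a w M h q hq hper s₀ s₁ := by
    have h1 : ∫ s in s₀..s₁, ∫ t in (0 : ℝ)..1, planeForm (a • w).1.1 q (s, t) =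
        a * ∫ s in s₀..s₁, ∫ t in (0 : ℝ)..1, planeForm w.1.1 q (s, t) := by
      rw [← intervalIntegral.integral_const_mul]
      refine intervalIntegral.integral_congr fun s _ => ?_
      exact intervalIntegral.integral_const_mul a fun t => planeForm w.1.1 q (s, t)
    rw [h1, abs_mul, mul_assoc]
    exact mul_le_mul_of_nonneg_left (h q hq hper s₀ s₁) (abs_nonneg a)

/-- The areas of cylinders are bounded by the lengths of the boundary loops, with a constant
proportional to the norm of the two-form. -/
theorem exists_cylinderBound [CompactSpace N] [T2Space N] (hp : IsUniversalCovering n p)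
    (g : Metric n N) : ∃ C, 0 ≤ C ∧ ∀ σ : FormField n N, HasBoundedPrimitive g p σ →
      ∀ M, 0 ≤ M → TwoFormNormLE g σ M → CylinderBound g σ (C * M) := by
  classical
  obtain ⟨s, ⟨c⟩⟩ := exists_nestedCover hp g
  obtain ⟨C, hC0, hC⟩ := NestedCover.exists_bound_of_holonomy_eq_zero hp c
  let T := {t : s × s × s // c.Adjacent t.1 t.2.1 ∧ c.Adjacent t.1 t.2.2 ∧ c.Adjacent t.2.1 t.2.2}
  have : Fintype T := Fintype.ofFinite T
  -- The holonomies of the finitely many triangles of mutually adjacent charts. They are defined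
  -- through `θ` and not through `σ` alone, so linearity is available on pairs.
  let l : boundedPrimitives g p →ₗ[ℝ] T → ℝ :=
    { toFun := fun w t => c.holonomy w.1.2 t.1.1 t.1.2.1 t.1.2.2
      map_add' := fun w w' => funext fun t => NestedCover.holonomy_add hp w.2.1.smooth
        w'.2.1.smooth t.2.1 t.2.2.1 t.2.2.2
      map_smul' := fun a w => funext fun t => c.holonomy_smul a w.1.2 _ _ _ }
  set b := ∑ i, (c.charts i).bound with hb
  set R := ∑ i, |(c.charts i).radius| with hR
  have hb' : ∀ i, (c.charts i).bound ≤ b := fun i =>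
    Finset.single_le_sum (f := fun i => (c.charts i).bound) (fun i _ => (c.charts i).bound_pos.le)
      (Finset.mem_univ i)
  have hR' : ∀ i, (c.charts i).radius ≤ R := fun i => (le_abs_self _).trans
    (Finset.single_le_sum (f := fun i => |(c.charts i).radius|) (fun i _ => abs_nonneg _)
      (Finset.mem_univ i))
  have hR0 : 0 ≤ R := Finset.sum_nonneg fun i _ => abs_nonneg _
  obtain ⟨C', hC'0, hC'⟩ := (isGauge_twoFormNormLE hp g).exists_domination
    (isGauge_cylinderBound hp g) l (K := 2 * R * NestedCover.defectConst b R)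
    (by rw [NestedCover.defectConst]; positivity)
    (fun w M hM0 hM t => NestedCover.abs_holonomy_le hp w.2.1 hM0 hM hb' hR0 hR' t.2.1 t.2.2.2)
    hC0 (fun w M hM0 hM hl q hq hper s₀ s₁ => hC w.1.1 w.1.2 M w.2.1 hM0 hM
      (fun i m j him hij hmj => congrFun hl ⟨(i, m, j), him, hij, hmj⟩) q hq hper s₀ s₁)
  refine ⟨C', hC'0, fun σ hσ M hM0 hM => ?_⟩
  obtain ⟨θ, hθ, hb⟩ := hσ.exists_primitive
  exact hC' ⟨(σ, θ), hθ, hb⟩ M hM0 hM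

end BoundedPrimitives

end RabinowitzFloer
end

noncomputable section

namespace RabinowitzFloer

set_option linter.unusedSectionVars false

/-! ### A priori estimates on a window -/

section Window

/-- A nonnegative function with small integral is small somewhere on each long interval. -/
theorem exists_le_of_integral_le {e : ℝ → ℝ} (he : Continuous e) {s T E c : ℝ} (hT : 0 ≤ T)
    (hE : ∫ r in s..(s + T), e r ≤ E) (hET : E < c * T) : ∃ r ∈ Set.Icc s (s + T), e r ≤ c := by
  by_contra h
  push Not at h
  have h1 : ∫ _ in s..(s + T), c ≤ ∫ r in s..(s + T), e r :=
    intervalIntegral.integral_mono_on (by linarith) (by simp) (he.intervalIntegrable _ _)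
      fun r hr => (h r hr).le
  rw [intervalIntegral.integral_const, smul_eq_mul] at h1
  nlinarith

/-- The constant in the estimate of the multiplier. -/
def multiplierConst (K ξ ε : ℝ) : ℝ := 1 + 2 * K + ξ + ξ / ε ^ 2

/-- A bootstrap. Write `E` for the integral of `e` over the window and `R` for that of `β' |Q|`.
Integrating the derivative of `a` gives `E ≤ 2 * D + R` and `|a| ≤ D + E + R`. Times of small energy
then give `|η| ≤ C (1 + D + E + R)`, and the bounds on `l` and `Q` return `R ≤ κ * O(1 + D + R)`.
For small `κ` this closes up. -/
theorem window_bound {e a Q l η β : ℝ → ℝ} {S₀ S₁ A K ξ ε κ D : ℝ}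
    (hA : 1 ≤ A) (hK : 0 ≤ K) (hξ : 0 ≤ ξ) (hε : 0 < ε) (hκ0 : 0 ≤ κ) (hD : 0 ≤ D)
    (hκ : 12 * κ * A * (1 + multiplierConst K ξ ε) ≤ 1) (hS : S₀ ≤ S₁)
    (he : Continuous e) (he0 : ∀ s, 0 ≤ e s) (hQ : Continuous Q) (hβ : ContDiff ℝ 1 β)
    (hβ01 : ∀ s, β s ∈ Set.Icc (0 : ℝ) 1) (hβ0 : ∀ s, 0 ≤ deriv β s) (hβ2 : ∀ s, deriv β s ≤ 2)
    (ha : ∀ s, HasDerivAt a (e s + deriv β s * Q s) s)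
    (hη : ∀ s r, |η s - η r| ≤ ξ * |s - r|)
    (hl : ∀ s, l s ≤ A * (1 + e s + |η s|)) (hQl : ∀ s, |Q s| ≤ κ * (l s + l S₀))
    (hgood : ∀ s, e s ≤ ε ^ 2 → |η s| ≤ K * (1 + D + |a s|))
    (ha₀ : |a S₀| ≤ D) (ha₁ : |a S₁| ≤ D) (hη₁ : |η S₁| ≤ D) (hl₀ : l S₀ ≤ D) :
    ∫ s in S₀..S₁, e s ≤ (1 + multiplierConst K ξ ε) * (3 + 5 * D) ∧
      ∀ s ∈ Set.Icc S₀ S₁, |η s| ≤ (1 + multiplierConst K ξ ε) * (3 + 5 * D) := by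
  set C := multiplierConst K ξ ε with hC
  have hξε : 0 ≤ ξ / ε ^ 2 := by positivity
  have hC1 : 1 ≤ C := by rw [hC, multiplierConst]; linarith
  have hβd : Continuous (deriv β) := hβ.continuous_deriv (by simp)
  set E := ∫ s in S₀..S₁, e s with hE
  set R := ∫ s in S₀..S₁, deriv β s * |Q s| with hR
  have hE0 : 0 ≤ E := intervalIntegral.integral_nonneg hS fun s _ => he0 s
  have hR0 : 0 ≤ R := intervalIntegral.integral_nonneg hS fun s _ =>
    mul_nonneg (hβ0 s) (abs_nonneg _)
  have hFTC : ∀ r s, a s - a r = (∫ x in r..s, e x) + ∫ x in r..s, deriv β x * Q x := by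
    intro r s
    have hβQ : Continuous fun x => deriv β x * Q x := hβd.mul hQ
    rw [← intervalIntegral.integral_add (he.intervalIntegrable _ _) (hβQ.intervalIntegrable _ _)]
    exact (intervalIntegral.integral_eq_sub_of_hasDerivAt (fun x _ => ha x)
      ((he.add hβQ).intervalIntegrable _ _)).symm
  have hsubE : ∀ r s, S₀ ≤ r → r ≤ s → s ≤ S₁ → ∫ x in r..s, e x ≤ E := fun r s h1 h2 h3 =>
    intervalIntegral.integral_mono_interval h1 h2 h3 (Eventually.of_forall he0)
      (he.intervalIntegrable _ _)
  have hsubR : ∀ r s, S₀ ≤ r → r ≤ s → s ≤ S₁ → |∫ x in r..s, deriv β x * Q x| ≤ R := by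
    intro r s h1 h2 h3
    refine (intervalIntegral.abs_integral_le_integral_abs h2).trans ?_
    have h4 : ∫ x in r..s, |deriv β x * Q x| = ∫ x in r..s, deriv β x * |Q x| :=
      intervalIntegral.integral_congr fun x _ => by simp only [abs_mul, abs_of_nonneg (hβ0 x)]
    rw [h4]
    exact intervalIntegral.integral_mono_interval h1 h2 h3
      (Eventually.of_forall fun x => mul_nonneg (hβ0 x) (abs_nonneg _))
      ((hβd.mul hQ.abs).intervalIntegrable _ _)
  have hER : E ≤ 2 * D + R := by
    have h1 := hFTC S₀ S₁
    have h2 := (abs_le.1 (hsubR S₀ S₁ le_rfl hS le_rfl)).1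
    have h3 := (abs_le.1 ha₀).1
    have h4 := (abs_le.1 ha₁).2
    linarith
  have haR : ∀ s ∈ Set.Icc S₀ S₁, |a s| ≤ D + E + R := by
    intro s hs
    have h1 := hFTC S₀ s
    have h2 := abs_le.1 (hsubR S₀ s le_rfl hs.1 hs.2)
    have h3 := abs_le.1 ha₀
    have h4 := hsubE S₀ s le_rfl hs.1 hs.2
    have h5 : 0 ≤ ∫ x in S₀..s, e x := intervalIntegral.integral_nonneg hs.1 fun s _ => he0 s
    rw [abs_le]
    constructor <;> linarith [h2.1, h2.2, h3.1, h3.2]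
  have hM : ∀ s ∈ Set.Icc S₀ S₁, |η s| ≤ C * (1 + D + E + R) := by
    intro s hs
    -- If `e` exceeded `ε ^ 2` on a whole interval of length `T`, its integral would exceed `E`; the
    -- summand `1` makes this strict. If the window ends before `s + T`, the final time `S₁`
    -- replaces the time of small energy.
    set T := E / ε ^ 2 + 1 with hT
    have hε2 : 0 < ε ^ 2 := by positivity
    have hT0 : 0 ≤ T := by positivity
    have hlip : ∀ r ∈ Set.Icc s (s + T), |η s| ≤ |η r| + ξ * T := by
      intro r hr
      have h1 := hη s r
      have h2 : |s - r| ≤ T := by rw [abs_le]; constructor <;> linarith [hr.1, hr.2]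
      have h3 := mul_le_mul_of_nonneg_left h2 hξ
      have h4 := abs_sub_abs_le_abs_sub (η s) (η r)
      linarith
    have hξT : ξ * T = ξ / ε ^ 2 * E + ξ := by rw [hT]; ring
    have hcase : ∃ r ∈ Set.Icc s (s + T), |η r| ≤ D + K * (1 + D + (D + E + R)) := by
      by_cases hsT : s + T ≤ S₁
      · obtain ⟨r, hr, hre⟩ := exists_le_of_integral_le he hT0
          (hsubE s (s + T) hs.1 (by linarith) hsT) (c := ε ^ 2) (by
            rw [hT, mul_add, mul_div_cancel₀ _ hε2.ne']
            linarith)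
        refine ⟨r, hr, (hgood r hre).trans ?_⟩
        have h1 := haR r ⟨hs.1.trans hr.1, hr.2.trans hsT⟩
        have h2 : K * (1 + D + |a r|) ≤ K * (1 + D + (D + E + R)) :=
          mul_le_mul_of_nonneg_left (by linarith) hK
        linarith
      · refine ⟨S₁, ⟨hs.2, by linarith⟩, hη₁.trans ?_⟩
        have : 0 ≤ K * (1 + D + (D + E + R)) := by positivity
        linarith
    obtain ⟨r, hr, hηr⟩ := hcase
    have h1 := hlip r hr
    have h2 : 0 ≤ ξ * D ∧ 0 ≤ ξ * E ∧ 0 ≤ ξ * R ∧ 0 ≤ K * E ∧ 0 ≤ K * R ∧ 0 ≤ ξ / ε ^ 2 * D ∧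
        0 ≤ ξ / ε ^ 2 * R := by
      refine ⟨?_, ?_, ?_, ?_, ?_, ?_, ?_⟩ <;> positivity
    obtain ⟨h3, h4, h5, h6, h7, h8, h9⟩ := h2
    have h10 : C * (1 + D + E + R) = (1 + D + E + R) + 2 * (K + K * D + K * E + K * R) +
        (ξ + ξ * D + ξ * E + ξ * R) + (ξ / ε ^ 2 + ξ / ε ^ 2 * D + ξ / ε ^ 2 * E + ξ / ε ^ 2 * R) := by
      rw [hC, multiplierConst]; ring
    rw [h10]
    rw [hξT] at h1
    have h11 : K * (1 + D + (D + E + R)) = K + 2 * (K * D) + K * E + K * R := by ring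
    rw [h11] at hηr
    linarith
  set M := C * (1 + D + E + R) with hMdef
  have hM0 : 0 ≤ M := by positivity
  -- For the part of the bound on `|Q|` that is constant in `s`, the total increase of `β` is at
  -- most one. For the part proportional to `e`, the pointwise bound `β' ≤ 2` is used.
  have hRle : R ≤ κ * (A * (1 + M) + D) + 2 * κ * A * E := by
    have h1 : R ≤ ∫ s in S₀..S₁, (deriv β s * (κ * (A * (1 + M) + D)) + e s * (2 * κ * A)) := by
      refine intervalIntegral.integral_mono_on hS ((hβd.mul hQ.abs).intervalIntegrable _ _)
        (((hβd.mul continuous_const).add (he.mul continuous_const)).intervalIntegrable _ _) ?_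
      intro s hs
      have h2 := hl s
      have h3 : |Q s| ≤ κ * (A * (1 + M) + D) + κ * A * e s := by
        refine (hQl s).trans ?_
        have h4 : A * |η s| ≤ A * M := mul_le_mul_of_nonneg_left (hM s hs) (by linarith)
        calc κ * (l s + l S₀) ≤ κ * (A * (1 + M) + D + A * e s) :=
              mul_le_mul_of_nonneg_left (by linarith) hκ0
          _ = _ := by ring
      have h5 := mul_le_mul_of_nonneg_left h3 (hβ0 s)
      have h6 : deriv β s * (κ * A * e s) ≤ 2 * (κ * A * e s) :=
        mul_le_mul_of_nonneg_right (hβ2 s) (mul_nonneg (by positivity) (he0 s))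
      calc deriv β s * |Q s| ≤ _ := h5
        _ = deriv β s * (κ * (A * (1 + M) + D)) + deriv β s * (κ * A * e s) := by ring
        _ ≤ _ := by linarith
    have hβc : Continuous fun s => deriv β s * (κ * (A * (1 + M) + D)) := hβd.mul continuous_const
    have hec : Continuous fun s => e s * (2 * κ * A) := he.mul continuous_const
    rw [intervalIntegral.integral_add (hβc.intervalIntegrable _ _) (hec.intervalIntegrable _ _), intervalIntegral.integral_mul_const,
      intervalIntegral.integral_mul_const,
      intervalIntegral.integral_deriv_eq_sub (fun s _ => hβ.differentiable (by simp) s)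
      (hβd.intervalIntegrable _ _)] at h1
    have h7 : β S₁ - β S₀ ≤ 1 := by linarith [(hβ01 S₁).2, (hβ01 S₀).1]
    have h8 : 0 ≤ κ * (A * (1 + M) + D) := by positivity
    have h9 := mul_le_mul_of_nonneg_right h7 h8
    rw [← hE] at h1
    linarith
  -- All quantities are multiples of `X = 1 + D + R`, and the assumption on `κ` makes the right-hand
  -- side at most `X / 2`. Hence `R ≤ (1 + D + R) / 2`.
  have hR1 : R ≤ 1 + D := by
    set X := 1 + D + R with hX
    have hX0 : 0 ≤ X := by positivity
    have hEX : E ≤ 2 * X := by linarith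
    have hMX : M ≤ 3 * C * X := by
      have : 1 + D + E + R ≤ 3 * X := by linarith
      calc M ≤ C * (3 * X) := mul_le_mul_of_nonneg_left this (by linarith)
        _ = _ := by ring
    have h1 : A * (1 + M) + D ≤ A * (X + 3 * C * X) + 0 := by
      have h2 : D ≤ A * D := le_mul_of_one_le_left hD hA
      have h3 : A * (1 + M) + A * D ≤ A * (X + 3 * C * X) := by
        rw [← mul_add]
        exact mul_le_mul_of_nonneg_left (by linarith) (by linarith)
      linarith
    have h4 : R ≤ κ * (A * (X + 3 * C * X)) + 2 * κ * A * (2 * X) := by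
      have h5 := mul_le_mul_of_nonneg_left h1 hκ0
      have h6 : 2 * κ * A * E ≤ 2 * κ * A * (2 * X) :=
        mul_le_mul_of_nonneg_left hEX (by positivity)
      linarith
    have h7 : κ * (A * (X + 3 * C * X)) + 2 * κ * A * (2 * X) ≤ 6 * κ * A * (1 + C) * X := by
      have h8 : 0 ≤ κ * A * X := by positivity
      have h9 : 0 ≤ κ * A * X * C := by positivity
      have h10 : 6 * κ * A * (1 + C) * X = 6 * (κ * A * X) + 6 * (κ * A * X * C) := by ring
      have h11 : κ * (A * (X + 3 * C * X)) + 2 * κ * A * (2 * X) =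
        5 * (κ * A * X) + 3 * (κ * A * X * C) := by ring
      rw [h10, h11]
      linarith
    have h12 := mul_le_mul_of_nonneg_right hκ hX0
    have h13 : 12 * κ * A * (1 + C) * X = 2 * (6 * κ * A * (1 + C) * X) := by ring
    linarith
  have hfinal : C * (1 + D + E + R) ≤ (1 + C) * (3 + 5 * D) := by
    have h1 : C * (1 + D + E + R) ≤ C * (3 + 5 * D) :=
      mul_le_mul_of_nonneg_left (by linarith) (by linarith)
    linarith
  refine ⟨?_, fun s hs => (hM s hs).trans hfinal⟩
  have : 0 ≤ C * (3 + 5 * D) := by positivity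
  linarith

end Window

end RabinowitzFloer
end

noncomputable section

namespace RabinowitzFloer

set_option linter.unusedSectionVars false

/-! ### Compatible complex structures at a point -/

section Pointwise

variable {n : ℕ} {N : Type*} [TopologicalSpace N] [ChartedSpace (EuclideanSpace ℝ (Fin n)) N]
  [IsManifold (𝓡 n) ∞ N] {σ : FormField n N} {z : CotangentBundle n N}
  {J : TangentSpace (cotangentModel n) z →L[ℝ] TangentSpace (cotangentModel n) z}

theorem endo_map_add (J : TangentSpace (cotangentModel n) z →L[ℝ] TangentSpace (cotangentModel n) z)
    (u w : TangentSpace (cotangentModel n) z) : J (u + w) = J u + J w :=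
  ContinuousLinearMap.map_add (J : CotangentModelSpace n →L[ℝ] CotangentModelSpace n) u w

theorem endo_map_smul (J : TangentSpace (cotangentModel n) z →L[ℝ] TangentSpace (cotangentModel n) z)
    (c : ℝ) (u : TangentSpace (cotangentModel n) z) : J (c • u) = c • J u :=
  ContinuousLinearMap.map_smul (J : CotangentModelSpace n →L[ℝ] CotangentModelSpace n) c u

theorem dProj_add (u w : TangentSpace (cotangentModel n) z) :
    dProj z (u + w) = dProj z u + dProj z w :=
  ContinuousLinearMap.map_add (dProj z : CotangentModelSpace n →L[ℝ] EuclideanSpace ℝ (Fin n)) u w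

theorem dProj_smul (c : ℝ) (u : TangentSpace (cotangentModel n) z) :
    dProj z (c • u) = c • dProj z u :=
  ContinuousLinearMap.map_smul (dProj z : CotangentModelSpace n →L[ℝ] EuclideanSpace ℝ (Fin n)) c u

/-- Weighted Cauchy–Schwarz, from nonnegativity of the quadratic form on `c • X + u` and `c • X -
u`. -/
theorem abs_bilin_le {T : Type*} [NormedAddCommGroup T] [NormedSpace ℝ T] (B : T →ₗ[ℝ] T →ₗ[ℝ] ℝ)
    (J : T →L[ℝ] T) (hpos : ∀ u, 0 ≤ B u (J u)) (hsymm : ∀ u w, B u (J w) = B w (J u)) (X u : T)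
    {c : ℝ} (hc : 0 < c) : |B X (J u)| ≤ (c * B X (J X) + B u (J u) / c) / 2 := by
  have h1 : ∀ r : ℝ, B (c • X + r • u) (J (c • X + r • u)) =
      c ^ 2 * B X (J X) + 2 * c * r * B X (J u) + r ^ 2 * B u (J u) := by
    intro r
    have h2 := hsymm u X
    simp only [map_add, map_smul, LinearMap.add_apply, LinearMap.smul_apply, smul_eq_mul] at h2 ⊢
    rw [h2]
    ring
  have h3 := hpos (c • X + (1 : ℝ) • u)
  have h4 := hpos (c • X + (-1 : ℝ) • u)
  rw [h1] at h3 h4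
  have h5 : (c * B X (J X) + B u (J u) / c) / 2 =
      (c ^ 2 * B X (J X) + B u (J u)) / (2 * c) := by
    field_simp
  rw [h5, le_div_iff₀ (by linarith)]
  cases abs_cases (B X (J u)) <;> nlinarith

/-- A complex structure compatible with the twisted form at a point. -/
structure IsCompatibleAt (σ : FormField n N) (z : CotangentBundle n N)
    (J : TangentSpace (cotangentModel n) z →L[ℝ] TangentSpace (cotangentModel n) z) : Prop where
  alternating : IsAlternating σ
  sq_eq_neg : ∀ u, J (J u) = -u
  symm : ∀ u w, twistedForm σ z u (J w) = twistedForm σ z w (J u)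
  pos : ∀ u, u ≠ 0 → 0 < twistedForm σ z u (J u)

namespace IsCompatibleAt

theorem nonneg (h : IsCompatibleAt σ z J) (u : TangentSpace (cotangentModel n) z) :
    0 ≤ twistedForm σ z u (J u) := by
  by_cases hu : u = 0
  · rw [hu, ← twistedBilin_apply, map_zero, LinearMap.zero_apply]
  · exact (h.pos u hu).le

theorem nondegenerate (h : IsCompatibleAt σ z J) (u : TangentSpace (cotangentModel n) z)
    (hu : u ≠ 0) : ∃ w, twistedForm σ z u w ≠ 0 := ⟨J u, (h.pos u hu).ne'⟩

theorem apply_apply (h : IsCompatibleAt σ z J) (u : TangentSpace (cotangentModel n) z) :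
    twistedForm σ z (J u) (J (J u)) = twistedForm σ z u (J u) := by
  rw [h.sq_eq_neg, ← twistedBilin_apply, map_neg, twistedBilin_apply,
    twistedForm_swap h.alternating z (J u) u, neg_neg]

theorem abs_le (h : IsCompatibleAt σ z J) (X u : TangentSpace (cotangentModel n) z) {c : ℝ}
    (hc : 0 < c) : |twistedForm σ z X (J u)| ≤
      (c * twistedForm σ z X (J X) + twistedForm σ z u (J u) / c) / 2 :=
  abs_bilin_le (T := CotangentModelSpace n) (twistedBilin σ z)
    (J : CotangentModelSpace n →L[ℝ] CotangentModelSpace n) h.nonneg h.symm X u hc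

/-- The map `J` preserves the norm, so `|dτ J u|² ≤ A |u|²`; then `1 ≤ A` and the
arithmetic-geometric mean inequality apply. The weight is `1` when lengths are estimated and `ε` at
times of small energy. -/
theorem tangentNorm_le (h : IsCompatibleAt σ z J) (g : Metric n N) {A : ℝ} (hA : 1 ≤ A)
    (hb : ∀ u, g.inner z.proj (dProj z u) (dProj z u) ≤ A * twistedForm σ z u (J u))
    (u : TangentSpace (cotangentModel n) z) {c : ℝ} (hc : 0 < c) :
    tangentNorm g z.proj (dProj z (J u)) ≤ A * (twistedForm σ z u (J u) / c + c) / 2 := by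
  have h1 := hb (J u)
  rw [h.apply_apply] at h1
  have h0 := h.nonneg u
  have h2 : 0 ≤ twistedForm σ z u (J u) / c := div_nonneg h0 hc.le
  refine Real.sqrt_le_iff.2 ⟨by positivity, ?_⟩
  obtain ⟨x, hx⟩ : ∃ x, x = twistedForm σ z u (J u) / c := ⟨_, rfl⟩
  have h3 : twistedForm σ z u (J u) = x * c := by rw [hx]; field_simp
  rw [h3] at h0 h1
  rw [← hx] at h2 ⊢
  refine h1.trans ?_
  have h4 : A * (x * c) ≤ A ^ 2 * (x * c) :=
    mul_le_mul_of_nonneg_right (by nlinarith) h0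
  nlinarith [mul_nonneg (sq_nonneg A) (sq_nonneg (x - c))]

theorem tangentNorm_self_le (g : Metric n N) {A : ℝ} (hA : 1 ≤ A)
    (hb : ∀ u, g.inner z.proj (dProj z u) (dProj z u) ≤ A * twistedForm σ z u (J u))
    {X : TangentSpace (cotangentModel n) z} (hX : twistedForm σ z X (J X) ≤ A) :
    tangentNorm g z.proj (dProj z X) ≤ A := by
  refine Real.sqrt_le_iff.2 ⟨by linarith, (hb X).trans ?_⟩
  rw [sq]
  exact mul_le_mul_of_nonneg_left hX (by linarith)

end IsCompatibleAt

end Pointwise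

/-! ### Gradient flow lines -/

section Flow

variable {n : ℕ} {N : Type*} [TopologicalSpace N] [ChartedSpace (EuclideanSpace ℝ (Fin n)) N]
  [IsManifold (𝓡 n) ∞ N]

/-- A cylinder as a map of the plane. -/
def cylinderMap (v : ℝ → ℝ → CotangentBundle n N) (z : ℝ × ℝ) : CotangentBundle n N := v z.1 z.2

/-- The projection of a cylinder to the base. -/
def baseMap (v : ℝ → ℝ → CotangentBundle n N) (z : ℝ × ℝ) : N := (v z.1 z.2).proj

variable {v : ℝ → ℝ → CotangentBundle n N} {η : ℝ → ℝ}

theorem IsSmoothCylinder.baseMap (hv : IsSmoothCylinder v) :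
    ContMDiff 𝓘(ℝ, ℝ × ℝ) (𝓡 n) ∞ (baseMap v) := fun z =>
  (contMDiff_proj_cotangent _).comp z (hv.smooth z)

theorem IsSmoothCylinder.baseMap_periodic (hv : IsSmoothCylinder v) (s t : ℝ) :
    RabinowitzFloer.baseMap v (s, t + 1) = RabinowitzFloer.baseMap v (s, t) :=
  congrArg (fun z : CotangentBundle n N => z.proj) (hv.periodic s t)

theorem IsSmoothCylinder.partialS_eq (hv : IsSmoothCylinder v) (s t : ℝ) :
    partialS v s t = mfderiv 𝓘(ℝ, ℝ × ℝ) (cotangentModel n) (cylinderMap v) (s, t) (1, 0) := by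
  have hc : HasDerivAt (fun s' : ℝ => (s', t)) (1, 0) s :=
    (hasDerivAt_id s).prodMk (hasDerivAt_const s t)
  exact mfderiv_comp_curve (I := cotangentModel n) (f := cylinderMap v)
    (c := fun s' : ℝ => (s', t)) ((hv.smooth (s, t)).mdifferentiableAt (by simp)) hc

theorem IsSmoothCylinder.partialT_eq (hv : IsSmoothCylinder v) (s t : ℝ) :
    partialT v s t = mfderiv 𝓘(ℝ, ℝ × ℝ) (cotangentModel n) (cylinderMap v) (s, t) (0, 1) := by
  have hc : HasDerivAt (fun t' : ℝ => (s, t')) (0, 1) t :=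
    (hasDerivAt_const t s).prodMk (hasDerivAt_id t)
  exact mfderiv_comp_curve (I := cotangentModel n) (f := cylinderMap v)
    (c := fun t' : ℝ => (s, t')) ((hv.smooth (s, t)).mdifferentiableAt (by simp)) hc

theorem IsSmoothCylinder.dProj_partialS (hv : IsSmoothCylinder v) (s t : ℝ) :
    dProj (v s t) (partialS v s t) =
      mfderiv 𝓘(ℝ, ℝ × ℝ) (𝓡 n) (RabinowitzFloer.baseMap v) (s, t) (1, 0) := by
  rw [hv.partialS_eq]
  exact dProj_mfderiv ((hv.smooth (s, t)).of_le (by simp)) _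

theorem IsSmoothCylinder.dProj_partialT (hv : IsSmoothCylinder v) (s t : ℝ) :
    dProj (v s t) (partialT v s t) =
      mfderiv 𝓘(ℝ, ℝ × ℝ) (𝓡 n) (RabinowitzFloer.baseMap v) (s, t) (0, 1) := by
  rw [hv.partialT_eq]
  exact dProj_mfderiv ((hv.smooth (s, t)).of_le (by simp)) _

theorem IsSmoothCylinder.planeSpeed_eq (hv : IsSmoothCylinder v) (g : Metric n N) (s t : ℝ) :
    planeSpeed g (RabinowitzFloer.baseMap v) (0, 1) (s, t) =
      tangentNorm g (v s t).proj (dProj (v s t) (partialT v s t)) := by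
  rw [hv.dProj_partialT]
  rfl

/-- The pull-back of the Liouville form by a cylinder. -/
def cylinderLiouville (v : ℝ → ℝ → CotangentBundle n N) : ℝ × ℝ → ℝ × ℝ →L[ℝ] ℝ :=
  pullOneForm (cotangentModel n) liouvilleForm (cylinderMap v)

theorem IsSmoothCylinder.contDiff_cylinderLiouville (hv : IsSmoothCylinder v) :
    ContDiff ℝ ∞ (cylinderLiouville v) :=
  contDiff_iff_contDiffAt.2 fun z => contDiffAt_pullOneForm_liouville (hv.smooth z)

theorem IsSmoothCylinder.cylinderLiouville_partialT (hv : IsSmoothCylinder v) (s t : ℝ) :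
    cylinderLiouville v (s, t) (0, 1) = liouvilleForm (v s t) (partialT v s t) := by
  rw [hv.partialT_eq]
  rfl

theorem IsSmoothCylinder.cylinderLiouville_periodic (hv : IsSmoothCylinder v) (s t : ℝ)
    (e : ℝ × ℝ) : cylinderLiouville v (s, t + 1) e = cylinderLiouville v (s, t) e := by
  have h : cylinderMap v ∘ (fun z : ℝ × ℝ => z + (0, 1)) = cylinderMap v := by
    ext1 ⟨s, t⟩
    simpa [cylinderMap] using hv.periodic s t
  have hd : HasFDerivAt (fun z : ℝ × ℝ => z + (0, 1)) (ContinuousLinearMap.id ℝ (ℝ × ℝ)) (s, t) :=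
    (hasFDerivAt_id (s, t)).add_const _
  have h1 := pullOneForm_comp (I := cotangentModel n) liouvilleForm (f := cylinderMap v)
    (h := fun z : ℝ × ℝ => z + (0, 1)) (y := (s, t))
    ((hv.smooth _).mdifferentiableAt (by simp)) hd.differentiableAt e
  rw [h, hd.fderiv] at h1
  have h4 : (s, t) + ((0 : ℝ), (1 : ℝ)) = (s, t + 1) := by simp
  simp only [h4] at h1
  exact h1.symm

/-- The energy density of a cylinder at a point. -/
def flowDensity (Ω : ℝ → Pairing n N) (J : EndoFamily n N) (v : ℝ → ℝ → CotangentBundle n N)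
    (z : ℝ × ℝ) : ℝ :=
  Ω z.1 (v z.1 z.2) (partialS v z.1 z.2) (J z.2 z.1 (v z.1 z.2) (partialS v z.1 z.2))

/-- The data of a gradient flow line as in the proposition, with a bound `A ≥ 1`. -/
structure IsBoundedFlow (g : Metric n N) (U : N → ℝ) (k ξ : ℝ) (b : ℝ → ℝ) (μ σ : FormField n N)
    (β : ℝ → ℝ) (A : ℝ) (J : EndoFamily n N) (v : ℝ → ℝ → CotangentBundle n N) (η : ℝ → ℝ) :
    Prop where
  potential : ContMDiff (𝓡 n) 𝓘(ℝ, ℝ) ∞ U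
  cutoff : IsLevelCutoff ξ b
  time : IsTimeCutoff β
  alternating_left : IsAlternating μ
  alternating_right : IsAlternating σ
  compatible : IsCompatibleFamily (twistedDeformation μ σ β) J
  bounded : IsBoundedFamily g (twistedDeformation μ σ β) (definingHamiltonian g U k b) J A
  one_le : 1 ≤ A
  flow : IsGradientFlowLine (twistedDeformation μ σ β) (definingHamiltonian g U k b) J v η

namespace IsBoundedFlow

variable {g : Metric n N} {U : N → ℝ} {k ξ : ℝ} {b : ℝ → ℝ} {μ σ : FormField n N}
    {β : ℝ → ℝ} {A : ℝ} {J : EndoFamily n N}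

theorem cylinder (h : IsBoundedFlow g U k ξ b μ σ β A J v η) : IsSmoothCylinder v :=
  h.flow.isSmooth

theorem compatibleAt (h : IsBoundedFlow g U k ξ b μ σ β A J v η) (t s : ℝ)
    (z : CotangentBundle n N) : IsCompatibleAt (fun x => μ x + β s • σ x) z (J t s z) where
  alternating x u := by
    change μ x u u + β s * σ x u u = 0
    rw [h.alternating_left, h.alternating_right]
    ring
  sq_eq_neg := h.compatible.sq_eq_neg t s z
  symm := h.compatible.symm t s z
  pos := h.compatible.pos t s z

theorem smooth_hamiltonian (h : IsBoundedFlow g U k ξ b μ σ β A J v η) :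
    ContMDiff (cotangentModel n) 𝓘(ℝ, ℝ) ∞ (definingHamiltonian g U k b) :=
  contMDiff_definingHamiltonian g h.potential k h.cutoff.smooth

theorem contDiff_hamiltonian (h : IsBoundedFlow g U k ξ b μ σ β A J v η) :
    ContDiff ℝ ∞ fun z : ℝ × ℝ => definingHamiltonian g U k b (v z.1 z.2) :=
  contMDiff_iff_contDiff.1 (h.smooth_hamiltonian.comp h.cylinder.smooth)

/-- The Hamiltonian vector field along the flow line. -/
def ham (_ : IsBoundedFlow g U k ξ b μ σ β A J v η) (s t : ℝ) :
    TangentSpace (cotangentModel n) (v s t) :=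
  hamVectorField (twistedDeformation μ σ β s) (definingHamiltonian g U k b) (v s t)

theorem mfderiv_hamiltonian (h : IsBoundedFlow g U k ξ b μ σ β A J v η) (s t : ℝ)
    (u : TangentSpace (cotangentModel n) (v s t)) :
    (mfderiv (cotangentModel n) 𝓘(ℝ, ℝ) (definingHamiltonian g U k b) (v s t) u : ℝ) =
      - twistedDeformation μ σ β s (v s t) (h.ham s t) u :=
  hamVectorField_spec (h.compatibleAt t s (v s t)).nondegenerate _ u

theorem partialT_eq (h : IsBoundedFlow g U k ξ b μ σ β A J v η) (s t : ℝ) :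
    partialT v s t = J t s (v s t) (partialS v s t) + η s • h.ham s t := by
  have h1 := congrArg (J t s (v s t)) (h.flow.loop_eq s t)
  rw [endo_map_add, h.compatible.sq_eq_neg, ← zero_smul ℝ (partialS v s t), endo_map_smul,
    zero_smul, ← sub_eq_add_neg, sub_eq_zero] at h1
  rw [h1]
  exact (sub_add_cancel _ _).symm

theorem fderiv_hamiltonian (h : IsBoundedFlow g U k ξ b μ σ β A J v η) (z e : ℝ × ℝ) :
    fderiv ℝ (fun z : ℝ × ℝ => definingHamiltonian g U k b (v z.1 z.2)) z e =
      (mfderiv (cotangentModel n) 𝓘(ℝ, ℝ) (definingHamiltonian g U k b) (v z.1 z.2)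
        (mfderiv 𝓘(ℝ, ℝ × ℝ) (cotangentModel n) (cylinderMap v) z e) : ℝ) := by
  have h1 : mfderiv 𝓘(ℝ, ℝ × ℝ) 𝓘(ℝ, ℝ) (definingHamiltonian g U k b ∘ cylinderMap v) z = _ :=
    mfderiv_comp (I' := cotangentModel n) z
      ((h.smooth_hamiltonian _).mdifferentiableAt (by simp))
      ((h.cylinder.smooth z).mdifferentiableAt (by simp))
  rw [mfderiv_eq_fderiv] at h1
  exact congrArg (fun T : ℝ × ℝ →L[ℝ] ℝ => T e) h1

theorem flowDensity_nonneg (h : IsBoundedFlow g U k ξ b μ σ β A J v η) (z : ℝ × ℝ) :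
    0 ≤ flowDensity (twistedDeformation μ σ β) J v z :=
  (h.compatibleAt z.2 z.1 (v z.1 z.2)).nonneg _

/-- By the flow equation `J ∂_s v = ∂_t v - η X_H`, so pairing with `∂_s v` expresses the density
through pull-backs of forms and `dH`. Its continuity can then be deduced from that of these terms.
-/
theorem flowDensity_eq (h : IsBoundedFlow g U k ξ b μ σ β A J v η) (z : ℝ × ℝ) :
    flowDensity (twistedDeformation μ σ β) J v z =
      curl (cylinderLiouville v) z (1, 0) (0, 1) + planeForm μ (baseMap v) z +
        β z.1 * planeForm σ (baseMap v) z -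
        η z.1 * fderiv ℝ (fun z : ℝ × ℝ => definingHamiltonian g U k b (v z.1 z.2)) z (1, 0) := by
  obtain ⟨s, t⟩ := z
  have h1 : J t s (v s t) (partialS v s t) = partialT v s t - η s • h.ham s t := by
    rw [h.partialT_eq]
    exact (add_sub_cancel_right _ _).symm
  have h2 : flowDensity (twistedDeformation μ σ β) J v (s, t) =
      twistedDeformation μ σ β s (v s t) (partialS v s t) (partialT v s t) -
        η s * twistedDeformation μ σ β s (v s t) (partialS v s t) (h.ham s t) := by
    simp only [flowDensity]
    rw [h1]
    simp only [twistedDeformation, ← twistedBilin_apply, LinearMap.map_sub, LinearMap.map_smul,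
      smul_eq_mul]
  have h3 : twistedDeformation μ σ β s (v s t) (partialS v s t) (h.ham s t) =
      fderiv ℝ (fun z : ℝ × ℝ => definingHamiltonian g U k b (v z.1 z.2)) (s, t) (1, 0) := by
    rw [h.fderiv_hamiltonian]
    have h4 := h.mfderiv_hamiltonian s t (partialS v s t)
    rw [h.cylinder.partialS_eq] at h4 ⊢
    refine Eq.trans ?_ h4.symm
    exact twistedForm_swap (h.compatibleAt t s (v s t)).alternating _ _ _
  have h5 : twistedDeformation μ σ β s (v s t) (partialS v s t) (partialT v s t) =
      curl (cylinderLiouville v) (s, t) (1, 0) (0, 1) + planeForm μ (baseMap v) (s, t) +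
        β s * planeForm σ (baseMap v) (s, t) := by
    have h6 := curl_pullOneForm_liouville (h.cylinder.smooth (s, t)) (1, 0) (0, 1)
    simp only [twistedDeformation, twistedForm]
    rw [h.cylinder.dProj_partialS, h.cylinder.dProj_partialT, h.cylinder.partialS_eq,
      h.cylinder.partialT_eq, add_assoc]
    exact congrArg₂ (· + ·) h6.symm rfl
  rw [h2, h3, h5]

theorem planeSpeed_le (h : IsBoundedFlow g U k ξ b μ σ β A J v η) (s t : ℝ) {c : ℝ} (hc : 0 < c) :
    planeSpeed g (baseMap v) (0, 1) (s, t) ≤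
      A * (flowDensity (twistedDeformation μ σ β) J v (s, t) / c + c) / 2 + A * |η s| := by
  rw [h.cylinder.planeSpeed_eq, h.partialT_eq, dProj_add, dProj_smul]
  refine (tangentNorm_add_le _ _ _ _).trans ?_
  rw [tangentNorm_smul, mul_comm A |η s|]
  exact add_le_add ((h.compatibleAt t s (v s t)).tangentNorm_le g h.one_le
    (h.bounded.proj_le t s (v s t)) _ hc) (mul_le_mul_of_nonneg_left
      (IsCompatibleAt.tangentNorm_self_le g h.one_le (h.bounded.proj_le t s (v s t))
        (h.bounded.ham_le t s (v s t))) (abs_nonneg _))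

/-- The Hamiltonian is constant along its own vector field, so only the component `J ∂_s v` of `∂_t
v` changes it, and that component is measured by the energy density. -/
theorem abs_fderiv_hamiltonian_le (h : IsBoundedFlow g U k ξ b μ σ β A J v η) (s t : ℝ) {c : ℝ}
    (hc : 0 < c) :
    |fderiv ℝ (fun z : ℝ × ℝ => definingHamiltonian g U k b (v z.1 z.2)) (s, t) (0, 1)| ≤
      (c * A + flowDensity (twistedDeformation μ σ β) J v (s, t) / c) / 2 := by
  have hcomp := h.compatibleAt t s (v s t)
  have h1 := h.mfderiv_hamiltonian s t (partialT v s t)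
  have h2 : twistedDeformation μ σ β s (v s t) (h.ham s t) (partialT v s t) =
      twistedDeformation μ σ β s (v s t) (h.ham s t) (J t s (v s t) (partialS v s t)) := by
    rw [h.partialT_eq]
    have h0 := twistedForm_self hcomp.alternating (v s t) (h.ham s t)
    simp only [twistedDeformation, ← twistedBilin_apply, LinearMap.map_add, LinearMap.map_smul,
      smul_eq_mul] at h0 ⊢
    rw [h0, mul_zero, add_zero]
  rw [h2, h.cylinder.partialT_eq] at h1
  rw [h.fderiv_hamiltonian]
  refine (congrArg (fun x : ℝ => |x|) h1).trans_le ?_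
  rw [abs_neg]
  have h3 := hcomp.abs_le (h.ham s t) (partialS v s t) hc
  have h4 : c * twistedForm (fun x => μ x + β s • σ x) (v s t) (h.ham s t)
      (J t s (v s t) (h.ham s t)) ≤ c * A :=
    mul_le_mul_of_nonneg_left (h.bounded.ham_le t s (v s t)) hc.le
  refine h3.trans ?_
  change _ ≤ (c * A + twistedForm (fun x => μ x + β s • σ x) (v s t) (partialS v s t)
    (J t s (v s t) (partialS v s t)) / c) / 2
  linarith

end IsBoundedFlow

end Flow

end RabinowitzFloer
end

noncomputable section

namespace RabinowitzFloer

set_option linter.unusedSectionVars false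

/-! ### The action along a gradient flow line -/

section Action

variable {n : ℕ} {N : Type*} [TopologicalSpace N] [ChartedSpace (EuclideanSpace ℝ (Fin n)) N]
  [IsManifold (𝓡 n) ∞ N]

/-- The squared norm of the gradient of the action at time `s`. -/
def energyDensity (Ω : ℝ → Pairing n N) (J : EndoFamily n N) (v : ℝ → ℝ → CotangentBundle n N)
    (η : ℝ → ℝ) (s : ℝ) : ℝ :=
  (∫ t in (0 : ℝ)..1, flowDensity Ω J v (s, t)) + deriv η s ^ 2

/-- The length of the projection to the base of the loop at time `s`. -/
def loopLength (g : Metric n N) (v : ℝ → ℝ → CotangentBundle n N) (s : ℝ) : ℝ :=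
  ∫ t in (0 : ℝ)..1, planeSpeed g (baseMap v) (0, 1) (s, t)

/-- The area of the projection of the cylinder to the base between the times `S` and `s`. -/
def baseArea (σ : FormField n N) (v : ℝ → ℝ → CotangentBundle n N) (S s : ℝ) : ℝ :=
  ∫ r in S..s, ∫ t in (0 : ℝ)..1, planeForm σ (baseMap v) (r, t)

/-- The integral of the Liouville form over the loop at time `s`. -/
def liouvilleAction (v : ℝ → ℝ → CotangentBundle n N) (s : ℝ) : ℝ :=
  ∫ t in (0 : ℝ)..1, cylinderLiouville v (s, t) (0, 1)

/-- The action along a flow line, normalized at time `S`. -/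
def flowAction (μ σ : FormField n N) (β : ℝ → ℝ) (H : CotangentBundle n N → ℝ)
    (v : ℝ → ℝ → CotangentBundle n N) (η : ℝ → ℝ) (S s : ℝ) : ℝ :=
  liouvilleAction v s + baseArea μ v S s + β s * baseArea σ v S s -
    η s * ∫ t in (0 : ℝ)..1, H (v s t)

variable {v : ℝ → ℝ → CotangentBundle n N} {η : ℝ → ℝ} {g : Metric n N} {U : N → ℝ} {k ξ : ℝ}
  {b : ℝ → ℝ} {μ σ : FormField n N} {β : ℝ → ℝ} {A : ℝ} {J : EndoFamily n N}

/-- The energy density of a single curve. -/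
def curveDensity (Ω : Pairing n N)
    (J : (z : CotangentBundle n N) →
      TangentSpace (cotangentModel n) z →L[ℝ] TangentSpace (cotangentModel n) z)
    (c : ℝ → CotangentBundle n N) (s : ℝ) : ℝ :=
  Ω (c s) (velocity c s) (J (c s) (velocity c s))

theorem flowDensity_eq_curveDensity (Ω : ℝ → Pairing n N) (J : EndoFamily n N)
    (v : ℝ → ℝ → CotangentBundle n N) (s t : ℝ) :
    flowDensity Ω J v (s, t) = curveDensity (Ω s) (J t s) (fun s' => v s' t) s := rfl

theorem integral_add_add_mul_sub_mul {f₁ f₂ f₃ f₄ : ℝ → ℝ} (c₁ : Continuous f₁)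
    (c₂ : Continuous f₂) (c₃ : Continuous f₃) (c₄ : Continuous f₄) (c d x y : ℝ) :
    ∫ t in x..y, (f₁ t + f₂ t + c * f₃ t - d * f₄ t) =
      (∫ t in x..y, f₁ t) + (∫ t in x..y, f₂ t) + c * (∫ t in x..y, f₃ t) -
        d * ∫ t in x..y, f₄ t := by
  have i₁ := c₁.intervalIntegrable (μ := volume) x y
  have i₂ := c₂.intervalIntegrable (μ := volume) x y
  have i₃ := (c₃.intervalIntegrable (μ := volume) x y).const_mul c
  have i₄ := (c₄.intervalIntegrable (μ := volume) x y).const_mul d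
  rw [intervalIntegral.integral_sub ((i₁.add i₂).add i₃) i₄,
    intervalIntegral.integral_add (i₁.add i₂) i₃, intervalIntegral.integral_add i₁ i₂,
    intervalIntegral.integral_const_mul, intervalIntegral.integral_const_mul]

theorem integral_mul_add_const {f : ℝ → ℝ} (hf : Continuous f) (c d : ℝ) :
    ∫ t in (0 : ℝ)..1, (c * f t + d) = c * (∫ t in (0 : ℝ)..1, f t) + d := by
  rw [intervalIntegral.integral_add ((hf.intervalIntegrable _ _).const_mul c) (by simp),
    intervalIntegral.integral_const_mul, intervalIntegral.integral_const]
  simp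

theorem loopLength_nonneg (s : ℝ) : 0 ≤ loopLength g v s :=
  intervalIntegral.integral_nonneg zero_le_one fun _ _ => planeSpeed_nonneg _ _ _ _

theorem baseArea_self (S : ℝ) : baseArea σ v S S = 0 := intervalIntegral.integral_same

theorem hasDerivAt_baseArea (hσ : Continuous (planeForm σ (baseMap v))) (S s : ℝ) :
    HasDerivAt (baseArea σ v S) (∫ t in (0 : ℝ)..1, planeForm σ (baseMap v) (s, t)) s :=
  ((continuous_integral_param hσ 0 1).integral_hasStrictDerivAt S s).hasDerivAt

theorem IsLevelCutoff.monotone (hb : IsLevelCutoff ξ b) : Monotone b :=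
  monotone_of_deriv_nonneg (hb.smooth.differentiable (by simp)) hb.deriv_nonneg

theorem IsLevelCutoff.abs_le (hb : IsLevelCutoff ξ b) (y : ℝ) : |b y| ≤ ξ := by
  rw [_root_.abs_le]
  constructor
  · rw [← hb.eq_bot (min y (-(ξ + min (1 / 3) (ξ / 3)))) (by linarith [min_le_right y (-(ξ + min (1 / 3) (ξ / 3)))])]
    exact hb.monotone (min_le_left _ _)
  · rw [← hb.eq_top (max y (ξ + min (1 / 3) (ξ / 3))) (le_max_right _ _)]
    exact hb.monotone (le_max_left _ _)

/-- Monotonicity forces `y` strictly inside the interval where the cutoff is the identity. The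
inequality on `r` is strict so that this persists near `y` and fixes the derivative. -/
theorem IsLevelCutoff.of_abs_le (hb : IsLevelCutoff ξ b) {r y : ℝ}
    (hr : r < ξ - min (1 / 3) (ξ / 3)) (hy : |b y| ≤ r) : |y| ≤ r ∧ deriv b y = 1 := by
  obtain ⟨ρ, hρ⟩ : ∃ ρ, ρ = ξ - min (1 / 3) (ξ / 3) := ⟨_, rfl⟩
  have hself := hb.eq_self
  rw [← hρ] at hr hself
  have hr0 : 0 ≤ r := (abs_nonneg _).trans hy
  have h1 : |y| < ρ := by
    rw [abs_lt]
    constructor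
    · by_contra! h
      have := hb.monotone h
      rw [hself (-ρ) (by rw [abs_neg, abs_of_nonneg (by linarith)])] at this
      linarith [(_root_.abs_le.1 hy).1]
    · by_contra! h
      have := hb.monotone h
      rw [hself ρ (by rw [abs_of_nonneg (by linarith)])] at this
      linarith [(_root_.abs_le.1 hy).2]
  refine ⟨by rwa [hself y h1.le] at hy, ?_⟩
  have h2 : b =ᶠ[𝓝 y] id := by
    filter_upwards [continuous_abs.continuousAt.eventually_lt_const h1] with x hx
    exact hself x hx.le
  rw [h2.deriv_eq, deriv_id]

namespace IsBoundedFlow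

theorem deriv_multiplier (h : IsBoundedFlow g U k ξ b μ σ β A J v η) (s : ℝ) :
    deriv η s = - ∫ t in (0 : ℝ)..1, definingHamiltonian g U k b (v s t) := by
  linarith [h.flow.multiplier_eq s]

theorem abs_integral_hamiltonian_le (h : IsBoundedFlow g U k ξ b μ σ β A J v η) (s : ℝ) :
    |∫ t in (0 : ℝ)..1, definingHamiltonian g U k b (v s t)| ≤ ξ := by
  have := intervalIntegral.norm_integral_le_of_norm_le_const (a := (0 : ℝ)) (b := 1) (C := ξ)
    (f := fun t => definingHamiltonian g U k b (v s t)) fun t _ => h.cutoff.abs_le _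
  simpa using this

theorem abs_multiplier_sub_le (h : IsBoundedFlow g U k ξ b μ σ β A J v η) (s r : ℝ) :
    |η s - η r| ≤ ξ * |s - r| :=
  Convex.norm_image_sub_le_of_norm_deriv_le (𝕜 := ℝ) (s := Set.univ)
    (fun x _ => (h.flow.smooth_multiplier.differentiable (by simp)).differentiableAt)
    (fun x _ => by
      rw [h.deriv_multiplier, norm_neg]
      exact h.abs_integral_hamiltonian_le x) convex_univ trivial trivial

theorem continuous_flowDensity (h : IsBoundedFlow g U k ξ b μ σ β A J v η)
    (hμ : Continuous (planeForm μ (baseMap v))) (hσ : Continuous (planeForm σ (baseMap v))) :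
    Continuous (flowDensity (twistedDeformation μ σ β) J v) := by
  rw [funext h.flowDensity_eq]
  have h1 := continuous_curl (h.cylinder.contDiff_cylinderLiouville.of_le (m := 1) (by simp))
    ((1 : ℝ), (0 : ℝ)) (0, 1)
  have h2 := (h.contDiff_hamiltonian.continuous_fderiv (by simp)).clm_apply
    (continuous_const (y := ((1 : ℝ), (0 : ℝ))))
  have h3 := h.flow.smooth_multiplier.continuous
  have h4 := h.time.smooth.continuous
  fun_prop

theorem flowDensity_periodic (h : IsBoundedFlow g U k ξ b μ σ β A J v η) (s t : ℝ) :
    flowDensity (twistedDeformation μ σ β) J v (s, t + 1) =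
      flowDensity (twistedDeformation μ σ β) J v (s, t) := by
  have h1 : (fun s' => v s' (t + 1)) = fun s' => v s' t :=
    funext fun s' => h.cylinder.periodic s' t
  have h2 : J (t + 1) s = J t s := funext fun z => h.compatible.periodic t s z
  rw [flowDensity_eq_curveDensity, flowDensity_eq_curveDensity, h1, h2]

theorem continuous_energyDensity (h : IsBoundedFlow g U k ξ b μ σ β A J v η)
    (hμ : Continuous (planeForm μ (baseMap v))) (hσ : Continuous (planeForm σ (baseMap v))) :
    Continuous (energyDensity (twistedDeformation μ σ β) J v η) :=
  (continuous_integral_param (h.continuous_flowDensity hμ hσ) 0 1).add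
    ((h.flow.smooth_multiplier.continuous_deriv (by simp)).pow 2)

theorem integral_flowDensity_nonneg (h : IsBoundedFlow g U k ξ b μ σ β A J v η) (s : ℝ) :
    0 ≤ ∫ t in (0 : ℝ)..1, flowDensity (twistedDeformation μ σ β) J v (s, t) :=
  intervalIntegral.integral_nonneg zero_le_one fun _ _ => h.flowDensity_nonneg _

theorem energyDensity_nonneg (h : IsBoundedFlow g U k ξ b μ σ β A J v η) (s : ℝ) :
    0 ≤ energyDensity (twistedDeformation μ σ β) J v η s :=
  add_nonneg (h.integral_flowDensity_nonneg s) (sq_nonneg _)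

/-- Along a flow line the action grows at the rate given by the energy density, up to the change
of the functional with time. -/
theorem hasDerivAt_flowAction (h : IsBoundedFlow g U k ξ b μ σ β A J v η)
    (hμ : Continuous (planeForm μ (baseMap v))) (hσ : Continuous (planeForm σ (baseMap v)))
    (S s : ℝ) :
    HasDerivAt (flowAction μ σ β (definingHamiltonian g U k b) v η S)
      (energyDensity (twistedDeformation μ σ β) J v η s + deriv β s * baseArea σ v S s) s := by
  have hΘ : ContDiff ℝ 1 (cylinderLiouville v) :=
    h.cylinder.contDiff_cylinderLiouville.of_le (by simp)
  have hH : ContDiff ℝ 1 fun z : ℝ × ℝ => definingHamiltonian g U k b (v z.1 z.2) :=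
    h.contDiff_hamiltonian.of_le (by simp)
  have hL := hasDerivAt_integral_oneForm hΘ 0 1 s
  have hh := hasDerivAt_integral_param hH 0 1 s
  have hη : HasDerivAt η (deriv η s) s :=
    (h.flow.smooth_multiplier.differentiable (by simp)).differentiableAt.hasDerivAt
  have hβ : HasDerivAt β (deriv β s) s :=
    (h.time.smooth.differentiable (by simp)).differentiableAt.hasDerivAt
  have key := ((hL.add (hasDerivAt_baseArea hμ S s)).add
    (hβ.mul (hasDerivAt_baseArea hσ S s))).sub (hη.mul hh)
  refine HasDerivAt.congr_deriv (f := flowAction μ σ β (definingHamiltonian g U k b) v η S) key ?_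
  -- The boundary terms of the first variation cancel because the loops close up. Of the remaining
  -- terms, the derivative of `η` times the mean of the Hamiltonian supplies the summand `(deriv η
  -- s) ^ 2` of the energy density.
  have hper : cylinderLiouville v (s, 1) (1, 0) = cylinderLiouville v (s, 0) (1, 0) := by
    have := h.cylinder.cylinderLiouville_periodic s 0 (1, 0)
    rwa [zero_add] at this
  have hcurve : Continuous fun t : ℝ => (s, t) := by fun_prop
  have c1 : Continuous fun t : ℝ => curl (cylinderLiouville v) (s, t) (1, 0) (0, 1) :=
    (continuous_curl hΘ _ _).comp hcurve
  have c2 : Continuous fun t : ℝ => planeForm μ (baseMap v) (s, t) := hμ.comp hcurve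
  have c3 : Continuous fun t : ℝ => planeForm σ (baseMap v) (s, t) := hσ.comp hcurve
  have c4 : Continuous fun t : ℝ =>
      fderiv ℝ (fun z : ℝ × ℝ => definingHamiltonian g U k b (v z.1 z.2)) (s, t) (1, 0) :=
    ((hH.continuous_fderiv (by simp)).comp hcurve).clm_apply continuous_const
  have hint : (∫ t in (0 : ℝ)..1, flowDensity (twistedDeformation μ σ β) J v (s, t)) =
      (∫ t in (0 : ℝ)..1, curl (cylinderLiouville v) (s, t) (1, 0) (0, 1)) +
        (∫ t in (0 : ℝ)..1, planeForm μ (baseMap v) (s, t)) +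
        β s * (∫ t in (0 : ℝ)..1, planeForm σ (baseMap v) (s, t)) -
        η s * ∫ t in (0 : ℝ)..1,
          fderiv ℝ (fun z : ℝ × ℝ => definingHamiltonian g U k b (v z.1 z.2)) (s, t) (1, 0) := by
    simp only [h.flowDensity_eq]
    exact integral_add_add_mul_sub_mul c1 c2 c3 c4 _ _ _ _
  rw [energyDensity, hint, hper, h.deriv_multiplier]
  ring

theorem loopLength_le (h : IsBoundedFlow g U k ξ b μ σ β A J v η)
    (hμ : Continuous (planeForm μ (baseMap v))) (hσ : Continuous (planeForm σ (baseMap v)))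
    (s : ℝ) : loopLength g v s ≤
      A * (1 + energyDensity (twistedDeformation μ σ β) J v η s + |η s|) := by
  have hcurve : Continuous fun t : ℝ => (s, t) := by fun_prop
  have c0 : Continuous fun t : ℝ => flowDensity (twistedDeformation μ σ β) J v (s, t) :=
    (h.continuous_flowDensity hμ hσ).comp hcurve
  have c1 : Continuous fun t : ℝ => planeSpeed g (baseMap v) (0, 1) (s, t) :=
    (continuous_planeSpeed g h.cylinder.baseMap _).comp hcurve
  have c2 : Continuous fun t : ℝ => A / 2 * flowDensity (twistedDeformation μ σ β) J v (s, t) +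
      (A / 2 + A * |η s|) := by fun_prop
  have h1 := intervalIntegral.integral_mono_on (μ := volume) (zero_le_one' ℝ)
    (c1.intervalIntegrable _ _)
    (c2.intervalIntegrable _ _) fun t _ => by
      refine (h.planeSpeed_le s t one_pos).trans_eq ?_
      ring
  rw [integral_mul_add_const c0] at h1
  refine h1.trans ?_
  have h2 := h.integral_flowDensity_nonneg s
  have h3 := h.one_le
  simp only [energyDensity]
  nlinarith [sq_nonneg (deriv η s), mul_nonneg (zero_le_one.trans h3) (sq_nonneg (deriv η s)),
    mul_nonneg (zero_le_one.trans h3) h2]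

end IsBoundedFlow

end Action

end RabinowitzFloer
end

noncomputable section

namespace RabinowitzFloer

set_option linter.unusedSectionVars false

/-! ### Times of small energy -/

section SmallEnergy

/-- A function with small mean and small total variation is small. -/
theorem abs_le_of_integral_le {f f' G : ℝ → ℝ} (hf : ∀ t, HasDerivAt f (f' t) t)
    (hf' : Continuous f') (hG : Continuous G) (hfG : ∀ t, |f' t| ≤ G t) {ε M : ℝ}
    (hε : |∫ t in (0 : ℝ)..1, f t| ≤ ε) (hM : ∫ t in (0 : ℝ)..1, G t ≤ M) {t : ℝ}
    (ht : t ∈ Set.Icc (0 : ℝ) 1) : |f t| ≤ M + ε := by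
  have hfc : Continuous f := continuous_iff_continuousAt.2 fun t => (hf t).continuousAt
  have hG0 : ∀ t, 0 ≤ G t := fun t => (abs_nonneg _).trans (hfG t)
  have h1 : ∀ r ∈ Set.Icc (0 : ℝ) 1, ∀ r' ∈ Set.Icc (0 : ℝ) 1, r ≤ r' → |f r' - f r| ≤ M := by
    intro r hr r' hr' hrr
    rw [← intervalIntegral.integral_eq_sub_of_hasDerivAt (fun x _ => hf x)
      (hf'.intervalIntegrable _ _)]
    refine (intervalIntegral.abs_integral_le_integral_abs hrr).trans (le_trans ?_ hM)
    refine (intervalIntegral.integral_mono_on (μ := volume) hrr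
      (hf'.abs.intervalIntegrable _ _) (hG.intervalIntegrable _ _) fun x _ => hfG x).trans ?_
    exact intervalIntegral.integral_mono_interval hr.1 hrr hr'.2
      (ae_of_all _ hG0) (hG.intervalIntegrable _ _)
  have h2 : ∀ r ∈ Set.Icc (0 : ℝ) 1, |f t - f r| ≤ M := by
    intro r hr
    rcases le_total r t with h | h
    · exact h1 r hr t ht h
    · rw [abs_sub_comm]
      exact h1 t ht r hr h
  have h3 : ∫ r in (0 : ℝ)..1, (f t - f r) = f t - ∫ r in (0 : ℝ)..1, f r := by
    rw [intervalIntegral.integral_sub (by simp) (hfc.intervalIntegrable _ _)]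
    simp
  have h4 : |∫ r in (0 : ℝ)..1, (f t - f r)| ≤ M := by
    have := intervalIntegral.norm_integral_le_of_norm_le_const (a := (0 : ℝ)) (b := 1) (C := M)
      (f := fun r => f t - f r) fun r hr => by
        rw [Set.uIoc_of_le zero_le_one] at hr
        exact h2 r ⟨hr.1.le, hr.2⟩
    simpa using this
  rw [h3] at h4
  have h5 := abs_add_le (f t - ∫ r in (0 : ℝ)..1, f r) (∫ r in (0 : ℝ)..1, f r)
  rw [sub_add_cancel] at h5
  linarith

variable {n : ℕ} {N : Type*} [TopologicalSpace N] [ChartedSpace (EuclideanSpace ℝ (Fin n)) N]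
  [IsManifold (𝓡 n) ∞ N]
  {N' : Type*} [TopologicalSpace N'] [ChartedSpace (EuclideanSpace ℝ (Fin n)) N']
  [IsManifold (𝓡 n) ∞ N'] {p : N' → N}

theorem exists_covector_pullOneForm_eq (hp : IsUniversalCovering n p) (g : Metric n N)
    (θ : CovectorField n N') {q : ℝ × ℝ → N} {q' : ℝ × ℝ → N'}
    (hq' : ContMDiff 𝓘(ℝ, ℝ × ℝ) (𝓡 n) ∞ q') (hpq : ∀ z, p (q' z) = q z) (z : ℝ × ℝ) :
    ∃ a : TangentSpace (𝓡 n) (q z) →L[ℝ] ℝ,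
      dualNormSq g (q z) a = liftedDualNormSq g p (q' z) (θ (q' z)) ∧
        ∀ e, pullOneForm (𝓡 n) θ q' z e = a (mfderiv 𝓘(ℝ, ℝ × ℝ) (𝓡 n) q z e) := by
  have h : q = p ∘ q' := funext fun z => (hpq z).symm
  subst h
  exact ⟨pushCovector p (q' z) (θ (q' z)), (liftedDualNormSq_eq g _ _).symm,
    fun e => pullOneForm_eq_pushCovector hp θ (hq' z) e⟩

/-- The lower bound for `(m + a)(m^♯)`, for covectors `m` on an energy level above the sup of the
mechanical energy of `a`. -/
theorem le_apply_sharp (g : Metric n N) (x : N) (m a : TangentSpace (𝓡 n) x →L[ℝ] ℝ) :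
    dualNormSq g x m / 2 - dualNormSq g x a / 2 ≤ m (sharp g x m) + a (sharp g x m) := by
  have h1 : m (sharp g x m) = dualNormSq g x m := rfl
  have h2 := abs_apply_le g x a (sharp g x m)
  have h3 : tangentNorm g x (sharp g x m) = √(dualNormSq g x m) := by
    rw [tangentNorm, inner_sharp, h1]
  rw [h3] at h2
  have h4 := Real.sq_sqrt (dualNormSq_nonneg g x m)
  have h5 := Real.sq_sqrt (dualNormSq_nonneg g x a)
  rw [h1]
  nlinarith [(abs_le.1 h2).1, sq_nonneg (√(dualNormSq g x m) - √(dualNormSq g x a))]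

/-- The velocity consists of an error `y`, paired crudely with `m` and `a`, and of `η • m^♯`, on
which `m + a` is at least `d` by `le_apply_sharp`. The factor `r` is the sign of `η`, so that the
main term becomes `|η| * d`. -/
theorem le_mul_apply_add (g : Metric n N) (x : N) {m a : TangentSpace (𝓡 n) x →L[ℝ] ℝ}
    {y : TangentSpace (𝓡 n) x} {η r C d : ℝ} (hm : dualNormSq g x m ≤ C)
    (ha : dualNormSq g x a ≤ C) (hd : d ≤ dualNormSq g x m / 2 - dualNormSq g x a / 2)
    (hr : |r| = 1) (hη : r * η = |η|) :
    |η| * d - 2 * √C * tangentNorm g x y ≤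
      r * (m (y + η • sharp g x m) + a (y + η • sharp g x m)) := by
  have h1 := le_apply_sharp g x m a
  have h2 : ∀ b : TangentSpace (𝓡 n) x →L[ℝ] ℝ, dualNormSq g x b ≤ C →
      |r * b y| ≤ √C * tangentNorm g x y := by
    intro b hb
    rw [abs_mul, hr, one_mul]
    exact (abs_apply_le g x b y).trans
      (mul_le_mul_of_nonneg_right (Real.sqrt_le_sqrt hb) (tangentNorm_nonneg _ _ _))
  have h3 : ∀ b : TangentSpace (𝓡 n) x →L[ℝ] ℝ,
      r * b (y + η • sharp g x m) = r * b y + |η| * b (sharp g x m) := by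
    intro b
    rw [map_add, map_smul, smul_eq_mul, ← hη]
    ring
  rw [mul_add, h3, h3]
  have h4 := (abs_le.1 (h2 m hm)).1
  have h5 := (abs_le.1 (h2 a ha)).1
  have h6 := mul_le_mul_of_nonneg_left (hd.trans h1) (abs_nonneg η)
  linarith

variable {v : ℝ → ℝ → CotangentBundle n N} {η : ℝ → ℝ} {g : Metric n N} {U : N → ℝ} {k ξ : ℝ}
  {b : ℝ → ℝ} {μ σ : FormField n N} {β : ℝ → ℝ} {A : ℝ} {J : EndoFamily n N}

namespace IsBoundedFlow

theorem abs_deriv_multiplier_le (h : IsBoundedFlow g U k ξ b μ σ β A J v η) {s ε : ℝ} (hε : 0 < ε)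
    (he : energyDensity (twistedDeformation μ σ β) J v η s ≤ ε ^ 2) :
    |∫ t in (0 : ℝ)..1, definingHamiltonian g U k b (v s t)| ≤ ε := by
  have h1 : deriv η s ^ 2 ≤ ε ^ 2 := by
    have := h.integral_flowDensity_nonneg s
    rw [energyDensity] at he
    linarith
  rw [h.deriv_multiplier, neg_sq] at h1
  exact abs_le_of_sq_le_sq h1 hε.le

theorem integral_flowDensity_le (s : ℝ) {ε : ℝ}
    (he : energyDensity (twistedDeformation μ σ β) J v η s ≤ ε ^ 2) :
    ∫ t in (0 : ℝ)..1, flowDensity (twistedDeformation μ σ β) J v (s, t) ≤ ε ^ 2 := by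
  rw [energyDensity] at he
  linarith [sq_nonneg (deriv η s)]

/-- At a time of small energy the loop is close to the hypersurface. -/
theorem abs_hamiltonian_le (h : IsBoundedFlow g U k ξ b μ σ β A J v η)
    (hμ : Continuous (planeForm μ (baseMap v))) (hσ : Continuous (planeForm σ (baseMap v)))
    {s ε : ℝ} (hε : 0 < ε)
    (he : energyDensity (twistedDeformation μ σ β) J v η s ≤ ε ^ 2) (t : ℝ) :
    |definingHamiltonian g U k b (v s t)| ≤ (1 + A) * ε := by
  have hcurve : Continuous fun t : ℝ => (s, t) := by fun_prop
  have c0 : Continuous fun t : ℝ => flowDensity (twistedDeformation μ σ β) J v (s, t) :=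
    (h.continuous_flowDensity hμ hσ).comp hcurve
  have hH : ContDiff ℝ 1 fun z : ℝ × ℝ => definingHamiltonian g U k b (v z.1 z.2) :=
    h.contDiff_hamiltonian.of_le (by simp)
  have hd : ∀ t, HasDerivAt (fun t => definingHamiltonian g U k b (v s t))
      (fderiv ℝ (fun z : ℝ × ℝ => definingHamiltonian g U k b (v z.1 z.2)) (s, t) (0, 1)) t :=
    fun t => ((hH.differentiable (by simp)) (s, t)).hasFDerivAt.comp_hasDerivAt t
      ((hasDerivAt_const t s).prodMk (hasDerivAt_id t))
  have hd' : Continuous fun t =>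
      fderiv ℝ (fun z : ℝ × ℝ => definingHamiltonian g U k b (v z.1 z.2)) (s, t) (0, 1) :=
    ((hH.continuous_fderiv (by simp)).comp hcurve).clm_apply continuous_const
  have hG : Continuous fun t : ℝ =>
      1 / (2 * ε) * flowDensity (twistedDeformation μ σ β) J v (s, t) + ε * A / 2 := by fun_prop
  have hM : ∫ t in (0 : ℝ)..1,
      (1 / (2 * ε) * flowDensity (twistedDeformation μ σ β) J v (s, t) + ε * A / 2) ≤ A * ε := by
    rw [integral_mul_add_const c0]
    have h1 := mul_le_mul_of_nonneg_left (integral_flowDensity_le s he)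
      (show 0 ≤ 1 / (2 * ε) by positivity)
    have h2 : 1 / (2 * ε) * ε ^ 2 = ε / 2 := by field_simp
    nlinarith [h.one_le]
  have hper : Function.Periodic (fun t => definingHamiltonian g U k b (v s t)) 1 := fun t =>
    congrArg (definingHamiltonian g U k b) (h.cylinder.periodic s t)
  obtain ⟨r, hr, hrt⟩ := hper.exists_mem_Ico₀ one_pos t
  -- The mean of the Hamiltonian over the loop is `-∂_s η`, of size at most `ε`; its variation is at
  -- most `A * ε` by the pointwise bound with weight `ε`.
  have key := abs_le_of_integral_le hd hd' hG (fun t => (h.abs_fderiv_hamiltonian_le s t hε).trans_eq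
    (by field_simp; ring)) (h.abs_deriv_multiplier_le hε he) hM ⟨hr.1, hr.2.le⟩
  rw [hrt]
  linarith

/-- On the untruncated range of the Hamiltonian the projection of `X_H` is `m^♯` for the momentum
`m`. There `½|m|² ≥ k - U - ε₀/2`, while `½|θ|² ≤ k - U - ε₀`, which leaves the gap `ε₀/2`. The
constant under the root bounds both squared norms. -/
theorem le_mul_pullOneForm (h : IsBoundedFlow g U k ξ b μ σ β A J v η)
    (hp : IsUniversalCovering n p) {θ : CovectorField n N'} {ε₀ u₀ : ℝ} (hε₀ : 0 < ε₀)
    (hθ : ∀ x, liftedDualNormSq g p x (θ x) / 2 + U (p x) ≤ k - ε₀) (hu₀ : ∀ x, |U x| ≤ u₀)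
    {q' : ℝ × ℝ → N'} (hq' : ContMDiff 𝓘(ℝ, ℝ × ℝ) (𝓡 n) ∞ q')
    (hpq : ∀ z, p (q' z) = baseMap v z) {ε s t r : ℝ} (hε : 0 < ε)
    (hε₁ : (1 + A) * ε < ξ - min (1 / 3) (ξ / 3)) (hε₂ : (1 + A) * ε ≤ ε₀ / 2)
    (hH : |definingHamiltonian g U k b (v s t)| ≤ (1 + A) * ε) (hr : |r| = 1)
    (hη : r * η s = |η s|) :
    |η s| * (ε₀ / 2) - √(2 * (|k| + ε₀ + u₀)) *
        (A * (flowDensity (twistedDeformation μ σ β) J v (s, t) / ε + ε)) -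
        r * cylinderLiouville v (s, t) (0, 1) ≤
      r * pullOneForm (𝓡 n) θ q' (s, t) (0, 1) := by
  obtain ⟨a, ha, haθ⟩ := exists_covector_pullOneForm_eq hp g θ hq' hpq (s, t)
  obtain ⟨hlevel, hderiv⟩ := h.cutoff.of_abs_le hε₁ hH
  set m : TangentSpace (𝓡 n) (v s t).proj →L[ℝ] ℝ := (v s t).snd with hm
  have hlevel' : |dualNormSq g (v s t).proj m / 2 + U (v s t).proj - k| ≤ (1 + A) * ε := hlevel
  have hθ' := hθ (q' (s, t))
  rw [← ha, hpq] at hθ'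
  change dualNormSq g (v s t).proj a / 2 + U (v s t).proj ≤ k - ε₀ at hθ'
  have hu := abs_le.1 (hu₀ (v s t).proj)
  have hl := abs_le.1 hlevel'
  have hk := le_abs_self k
  set y := dProj (v s t) (J t s (v s t) (partialS v s t)) with hy
  have hham : dProj (v s t) (h.ham s t) = sharp g (v s t).proj m := by
    have := dProj_hamVectorField (σ := fun x => μ x + β s • σ x) g h.potential k h.cutoff.smooth
      (h.compatibleAt t s (v s t)).nondegenerate
    rw [hderiv, one_smul] at this
    exact this
  have hT : dProj (v s t) (partialT v s t) = y + η s • sharp g (v s t).proj m := by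
    rw [h.partialT_eq, dProj_add, dProj_smul, hham]
  have key := le_mul_apply_add g (v s t).proj (m := m) (a := a) (y := y) (η := η s) (r := r)
    (C := 2 * (|k| + ε₀ + u₀)) (d := ε₀ / 2) (by linarith) (by linarith) (by linarith) hr hη
  rw [← hT] at key
  have h1 : cylinderLiouville v (s, t) (0, 1) = m (dProj (v s t) (partialT v s t)) :=
    h.cylinder.cylinderLiouville_partialT s t
  have h2 : pullOneForm (𝓡 n) θ q' (s, t) (0, 1) = a (dProj (v s t) (partialT v s t)) := by
    rw [haθ, h.cylinder.dProj_partialT]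
  rw [← h1] at key
  replace key := key.trans_eq
    (congrArg (fun x : ℝ => r * (cylinderLiouville v (s, t) (0, 1) + x)) h2.symm)
  have h3 := (h.compatibleAt t s (v s t)).tangentNorm_le g h.one_le
    (h.bounded.proj_le t s (v s t)) (partialS v s t) hε
  have h4 := mul_le_mul_of_nonneg_left h3 (Real.sqrt_nonneg (2 * (|k| + ε₀ + u₀)))
  change _ ≤ √(2 * (|k| + ε₀ + u₀)) *
    (A * (flowDensity (twistedDeformation μ σ β) J v (s, t) / ε + ε) / 2) at h4
  change √(2 * (|k| + ε₀ + u₀)) * tangentNorm g (v s t).proj y ≤ _ at h4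
  linarith

end IsBoundedFlow

end SmallEnergy

end RabinowitzFloer
end

noncomputable section

namespace RabinowitzFloer

set_option linter.unusedSectionVars false

/-! ### Bounds on finite windows -/

section Window

variable {n : ℕ} {N : Type*} [TopologicalSpace N] [ChartedSpace (EuclideanSpace ℝ (Fin n)) N]
  [IsManifold (𝓡 n) ∞ N]
  {N' : Type*} [TopologicalSpace N'] [ChartedSpace (EuclideanSpace ℝ (Fin n)) N']
  [IsManifold (𝓡 n) ∞ N'] {p : N' → N}
  {v : ℝ → ℝ → CotangentBundle n N} {η : ℝ → ℝ} {g : Metric n N} {U : N → ℝ} {k ξ : ℝ}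
  {b : ℝ → ℝ} {μ σ : FormField n N} {β : ℝ → ℝ} {A : ℝ} {J : EndoFamily n N}

/-- The constant in the bound of the multiplier by the action at times of small energy. -/
def actionConst (k ε₀ u₀ A : ℝ) : ℝ :=
  4 / ε₀ * (1 + ε₀ + √(2 * (|k| + ε₀ + u₀)) + 2 * √(2 * (|k| + ε₀ + u₀)) * A)

namespace IsBoundedFlow

/-- Integrating the pointwise inequality over the loop, with the integral of `θ` replaced by the
μ-area through averaging over long strips. The strip estimate is one-sided, so it is applied to `r •
μ` and `r • θ` with `r` the sign of the multiplier. -/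
theorem mul_le_mul_action (h : IsBoundedFlow g U k ξ b μ σ β A J v η)
    (hp : IsUniversalCovering n p) {θ : CovectorField n N'} (hprim : IsPrimitive p μ θ)
    (hσ : Continuous (planeForm σ (baseMap v))) {ε₀ u₀ : ℝ} (hε₀ : 0 < ε₀)
    (hθ : ∀ x, liftedDualNormSq g p x (θ x) / 2 + U (p x) ≤ k - ε₀) (hu₀ : ∀ x, |U x| ≤ u₀)
    {ε s r : ℝ} (S : ℝ) (hε : 0 < ε)
    (hε₁ : (1 + A) * ε < ξ - min (1 / 3) (ξ / 3)) (hε₂ : (1 + A) * ε ≤ ε₀ / 2)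
    (he : energyDensity (twistedDeformation μ σ β) J v η s ≤ ε ^ 2) (hr : |r| = 1)
    (hη : r * η s = |η s|) :
    |η s| * (ε₀ / 2) ≤ r * (liouvilleAction v s + baseArea μ v S s) +
      √(2 * (|k| + ε₀ + u₀)) * (2 * A * ε + loopLength g v S) := by
  have hμ : Continuous (planeForm μ (baseMap v)) :=
    continuous_planeForm hp hprim h.cylinder.baseMap
  obtain ⟨q', hq', hpq⟩ := hp.exists_lift h.cylinder.baseMap
  set C := 2 * (|k| + ε₀ + u₀) with hC
  have hcurve : Continuous fun t : ℝ => (s, t) := by fun_prop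
  have c0 : Continuous fun t : ℝ => flowDensity (twistedDeformation μ σ β) J v (s, t) :=
    (h.continuous_flowDensity hμ hσ).comp hcurve
  have c1 : Continuous fun t : ℝ => cylinderLiouville v (s, t) (0, 1) :=
    (h.cylinder.contDiff_cylinderLiouville.continuous.comp hcurve).clm_apply continuous_const
  -- The zero summand brings `f` into the shape of `integral_add_add_mul_sub_mul`.
  obtain ⟨f, hf⟩ : ∃ f : ℝ → ℝ, f = fun t => (|η s| * (ε₀ / 2) - √C * A * ε) + 0 +
    (-(√C * A / ε)) * flowDensity (twistedDeformation μ σ β) J v (s, t) -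
      r * cylinderLiouville v (s, t) (0, 1) := ⟨_, rfl⟩
  have hfc : Continuous f := by
    rw [hf]
    fun_prop
  have hfper : ∀ t, f (t + 1) = f t := by
    intro t
    simp only [hf, h.flowDensity_periodic, h.cylinder.cylinderLiouville_periodic]
  have hfle : ∀ t, f t ≤ r * pullOneForm (𝓡 n) θ q' (s, t) (0, 1) := by
    intro t
    refine le_trans (le_of_eq ?_) (h.le_mul_pullOneForm hp hε₀ hθ hu₀ hq' hpq hε hε₁ hε₂
      (h.abs_hamiltonian_le hμ hσ hε he t) hr hη)
    rw [hf, hC]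
    field_simp
    ring
  have hr2 : r ^ 2 = 1 := by rw [← sq_abs, hr, one_pow]
  have hbound : ∀ x, liftedDualNormSq g p x ((r • θ) x) ≤ C := by
    intro x
    have h1 := (abs_le.1 (hu₀ (p x))).1
    have h2 := hθ x
    have h3 := le_abs_self k
    change liftedDualNormSq g p x (r • θ x) ≤ C
    rw [liftedDualNormSq_smul, hr2]
    linarith
  have key := le_integral_planeForm hp g (hprim.const_smul r) hbound h.cylinder.baseMap
    h.cylinder.baseMap_periodic hq' hpq S s hfc hfper hfle
  have h1 : (∫ t in (0 : ℝ)..1, f t) = (|η s| * (ε₀ / 2) - √C * A * ε) +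
      (-(√C * A / ε)) * (∫ t in (0 : ℝ)..1, flowDensity (twistedDeformation μ σ β) J v (s, t)) -
        r * liouvilleAction v s := by
    rw [hf, integral_add_add_mul_sub_mul continuous_const continuous_const c0 c1]
    simp [liouvilleAction]
  have h2 : (∫ r' in S..s, ∫ t in (0 : ℝ)..1, planeForm (r • μ) (baseMap v) (r', t)) =
      r * baseArea μ v S s := by
    simp only [baseArea, ← intervalIntegral.integral_const_mul]
    rfl
  rw [h1, h2] at key
  change _ - √C * loopLength g v S ≤ _ at key
  have h3 : √C * A / ε * (∫ t in (0 : ℝ)..1,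
      flowDensity (twistedDeformation μ σ β) J v (s, t)) ≤ √C * A * ε := by
    have hA := h.one_le
    refine (mul_le_mul_of_nonneg_left (integral_flowDensity_le s he) (by positivity)).trans_eq ?_
    field_simp
  linarith

/-- At times of small energy the multiplier is bounded by the action. -/
theorem abs_multiplier_le (h : IsBoundedFlow g U k ξ b μ σ β A J v η)
    (hp : IsUniversalCovering n p) {θ : CovectorField n N'} (hprim : IsPrimitive p μ θ)
    (hσ : Continuous (planeForm σ (baseMap v))) {ε₀ u₀ : ℝ} (hε₀ : 0 < ε₀)
    (hθ : ∀ x, liftedDualNormSq g p x (θ x) / 2 + U (p x) ≤ k - ε₀) (hu₀ : ∀ x, |U x| ≤ u₀)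
    {ε s S κ D : ℝ} (hε : 0 < ε) (hε1 : ε ≤ 1) (hε8 : ε ≤ ε₀ / 8)
    (hε₁ : (1 + A) * ε < ξ - min (1 / 3) (ξ / 3)) (hε₂ : (1 + A) * ε ≤ ε₀ / 2)
    (hκ : 0 ≤ κ) (hκA : κ * A ≤ ε₀ / 8)
    (hQ : |baseArea σ v S s| ≤ κ * (loopLength g v s + loopLength g v S))
    (hD : loopLength g v S ≤ D)
    (he : energyDensity (twistedDeformation μ σ β) J v η s ≤ ε ^ 2) :
    |η s| ≤ actionConst k ε₀ u₀ A *
      (1 + D + |flowAction μ σ β (definingHamiltonian g U k b) v η S s|) := by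
  have hμ : Continuous (planeForm μ (baseMap v)) :=
    continuous_planeForm hp hprim h.cylinder.baseMap
  have hA := h.one_le
  obtain ⟨r, hr, hη⟩ : ∃ r : ℝ, |r| = 1 ∧ r * η s = |η s| := by
    rcases le_total 0 (η s) with h0 | h0
    · exact ⟨1, abs_one, by rw [one_mul, abs_of_nonneg h0]⟩
    · exact ⟨-1, by rw [abs_neg, abs_one], by rw [abs_of_nonpos h0]; ring⟩
  have key := h.mul_le_mul_action hp hprim hσ hε₀ hθ hu₀ S hε hε₁ hε₂ he hr hη
  rw [actionConst]
  set R := √(2 * (|k| + ε₀ + u₀)) with hR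
  have hR0 : 0 ≤ R := Real.sqrt_nonneg _
  obtain ⟨a, ha⟩ : ∃ a, a = flowAction μ σ β (definingHamiltonian g U k b) v η S s := ⟨_, rfl⟩
  obtain ⟨q, hq⟩ : ∃ q, q = baseArea σ v S s := ⟨_, rfl⟩
  obtain ⟨x, hx⟩ : ∃ x, x = ∫ t in (0 : ℝ)..1, definingHamiltonian g U k b (v s t) := ⟨_, rfl⟩
  have hxε : |x| ≤ ε := hx ▸ h.abs_deriv_multiplier_le hε he
  have hsum : liouvilleAction v s + baseArea μ v S s = a - β s * q + η s * x := by
    rw [ha, hq, hx, flowAction]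
    ring
  have hβ := h.time.mem_unit s
  have h1 : r * (liouvilleAction v s + baseArea μ v S s) ≤ |a| + |q| + |η s| * ε := by
    refine (le_abs_self _).trans ?_
    rw [abs_mul, hr, one_mul, hsum]
    refine (abs_add_le _ _).trans (add_le_add ((abs_sub _ _).trans (add_le_add le_rfl ?_)) ?_)
    · rw [abs_mul, abs_of_nonneg hβ.1]
      exact mul_le_of_le_one_left (abs_nonneg _) hβ.2
    · rw [abs_mul]
      exact mul_le_mul_of_nonneg_left hxε (abs_nonneg _)
  have hl := h.loopLength_le hμ hσ s
  have hl' : loopLength g v s ≤ A * (2 + |η s|) := by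
    refine hl.trans (mul_le_mul_of_nonneg_left ?_ (by linarith))
    nlinarith
  rw [← hq] at hQ
  rw [← ha]
  have hl0 : 0 ≤ loopLength g v S := loopLength_nonneg S
  have h2 : |q| ≤ ε₀ / 4 + ε₀ / 8 * |η s| + ε₀ / 8 * D := by
    have h3 := mul_le_mul_of_nonneg_left (add_le_add hl' hD) hκ
    have h4 : κ * A * (2 + |η s|) ≤ ε₀ / 8 * (2 + |η s|) :=
      mul_le_mul_of_nonneg_right hκA (by positivity)
    have h5 : κ * D ≤ ε₀ / 8 * D := by
      refine mul_le_mul_of_nonneg_right (le_trans ?_ hκA) (hl0.trans hD)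
      nlinarith
    nlinarith
  have h6 : |η s| * ε ≤ |η s| * (ε₀ / 8) := mul_le_mul_of_nonneg_left hε8 (abs_nonneg _)
  have h7 : R * (2 * A * ε + loopLength g v S) ≤ R * (2 * A * 1 + D) := by
    refine mul_le_mul_of_nonneg_left (add_le_add ?_ hD) hR0
    exact mul_le_mul_of_nonneg_left hε1 (by linarith)
  -- Of the coefficient `ε₀ / 2` of `|η s|`, one part `ε₀ / 8` is spent on the term with the
  -- Hamiltonian and another on the σ-area, whose length factor contains `|η s|`. The remaining `ε₀
  -- / 4` explains the factor `4 / ε₀` in `actionConst`.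
  have h8 : |η s| * (ε₀ / 4) ≤ (1 + ε₀ + R + 2 * R * A) * (1 + D + |a|) := by
    have hD0 := hl0.trans hD
    have ha0 := abs_nonneg a
    have h9 : 0 ≤ R * A := mul_nonneg hR0 (by linarith)
    nlinarith [mul_nonneg hR0 ha0, mul_nonneg h9 ha0, mul_nonneg h9 hD0, mul_nonneg hε₀.le ha0,
      mul_nonneg hε₀.le hD0]
  rw [div_mul_eq_mul_div, div_mul_eq_mul_div, le_div_iff₀ hε₀]
  linarith

end IsBoundedFlow

end Window

end RabinowitzFloer
end

noncomputable section

namespace RabinowitzFloer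

set_option linter.unusedSectionVars false

/-! ### Behaviour near the ends -/

section Ends

variable {n : ℕ} {N : Type*} [TopologicalSpace N] [ChartedSpace (EuclideanSpace ℝ (Fin n)) N]
  [IsManifold (𝓡 n) ∞ N]

theorem continuous_tangentNorm (g : Metric n N) :
    Continuous fun X : TangentBundle (𝓡 n) N => tangentNorm g X.proj X.snd := by
  have h : ContMDiff (𝓡 n).tangent 𝓘(ℝ, ℝ) ∞
      fun X : TangentBundle (𝓡 n) N => g.inner X.proj X.snd X.snd := by
    intro X
    have h0 : ContMDiffAt (𝓡 n).tangent (𝓡 n).tangent ∞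
      (fun X : TangentBundle (𝓡 n) N =>
        (TotalSpace.mk' (EuclideanSpace ℝ (Fin n)) X.proj X.snd : TangentBundle (𝓡 n) N)) X :=
      contMDiffAt_id
    have h1 : ContMDiffAt (𝓡 n).tangent (𝓡 n) ∞ (fun X : TangentBundle (𝓡 n) N => X.proj) X :=
      contMDiff_proj (TangentSpace (𝓡 n)) X
    have h2 := ContMDiffAt.clm_bundle_apply₂ (F₃ := ℝ) (E₃ := fun _ : N => ℝ)
      ((g.contMDiff X.proj).comp X h1) h0 h0
    rw [contMDiffAt_totalSpace] at h2
    exact h2.2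
  exact Real.continuous_sqrt.comp h.continuous

/-- A continuous function on the tangent bundle of the cotangent bundle which dominates the Liouville
form and the length of the projection to the base. -/
def velocityBound (g : Metric n N) (X : TangentBundle (cotangentModel n) (CotangentBundle n N)) : ℝ :=
  (1 + √(dualNormSq g X.proj.proj X.proj.snd)) *
    tangentNorm g X.proj.proj (dProj X.proj X.snd)

theorem continuous_velocityBound (g : Metric n N) : Continuous (velocityBound (n := n) g) := by
  have h1 : Continuous fun X : TangentBundle (cotangentModel n) (CotangentBundle n N) =>
      dualNormSq g X.proj.proj X.proj.snd :=
    (contMDiff_dualNormSq g).continuous.comp (FiberBundle.continuous_proj _ _)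
  have h2 : Continuous fun X : TangentBundle (cotangentModel n) (CotangentBundle n N) =>
      tangentNorm g X.proj.proj (dProj X.proj X.snd) :=
    (continuous_tangentNorm g).comp (contMDiff_proj_cotangent.continuous_tangentMap (by simp))
  exact (continuous_const.add h1.sqrt).mul h2

theorem tangentNorm_le_velocityBound (g : Metric n N) (z : CotangentBundle n N)
    (u : TangentSpace (cotangentModel n) z) :
    tangentNorm g z.proj (dProj z u) ≤ velocityBound g ⟨z, u⟩ := by
  have h1 := Real.sqrt_nonneg (dualNormSq g z.proj z.snd)
  have h2 := tangentNorm_nonneg g z.proj (dProj z u)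
  change _ ≤ (1 + √(dualNormSq g z.proj z.snd)) * tangentNorm g z.proj (dProj z u)
  nlinarith

theorem abs_liouvilleForm_le_velocityBound (g : Metric n N) (z : CotangentBundle n N)
    (u : TangentSpace (cotangentModel n) z) :
    |liouvilleForm z u| ≤ velocityBound g ⟨z, u⟩ := by
  have h1 := tangentNorm_nonneg g z.proj (dProj z u)
  have h2 := abs_apply_le g z.proj z.snd (dProj z u)
  change |z.snd (dProj z u)| ≤
    (1 + √(dualNormSq g z.proj z.snd)) * tangentNorm g z.proj (dProj z u)
  nlinarith

/-- Families of loops that converge to a given loop are eventually bounded, by a bound that depends on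
the limit only. -/
theorem exists_eventually_bound (g : Metric n N) (w : (ℝ → CotangentBundle n N) × ℝ) :
    ∃ D : ℝ, 0 ≤ D ∧ (IsSmoothLoop w.1 →
      ∀ (v : ℝ → ℝ → CotangentBundle n N) (η : ℝ → ℝ) (l : Filter ℝ), ConvergesTo v η l w →
        ∀ᶠ s in l, (∀ t ∈ Set.Icc (0 : ℝ) 1, velocityBound g ⟨v s t, partialT v s t⟩ ≤ D) ∧
          |η s| ≤ D) := by
  by_cases hw : IsSmoothLoop w.1
  · have hlift : Continuous fun t : ℝ =>
        (⟨w.1 t, velocity w.1 t⟩ : TangentBundle (cotangentModel n) (CotangentBundle n N)) :=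
      continuous_iff_continuousAt.2 fun t =>
        (contMDiffAt_mfderiv_apply (hw.smooth t) (1 : ℝ)).continuousAt
    obtain ⟨C, hC⟩ := (isCompact_Icc (a := (0 : ℝ)) (b := 1)).exists_bound_of_continuousOn
      ((continuous_velocityBound g).comp hlift).continuousOn
    refine ⟨|C| + |w.2| + 1, by positivity, fun _ v η l hconv => ?_⟩
    -- Continuous convergence at each `t₀` becomes a bound uniform in `t` by compactness of one
    -- period.
    have h1 : ∀ᶠ q in l ×ˢ 𝓝ˢ (Set.Icc (0 : ℝ) 1),
        velocityBound g ⟨v q.1 q.2, partialT v q.1 q.2⟩ < |C| + |w.2| + 1 := by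
      refine isCompact_Icc.mem_prod_nhdsSet_of_forall fun t ht => ?_
      have h2 := ((continuous_velocityBound g).tendsto _).comp (hconv.loops t)
      refine h2.eventually_lt_const ?_
      have h3 := (le_abs_self _).trans (hC t ht)
      have h4 := le_abs_self C
      have h5 := abs_nonneg w.2
      change velocityBound g ⟨w.1 t, velocity w.1 t⟩ ≤ C at h3
      linarith
    have h2 : ∀ᶠ s in l, |η s| < |C| + |w.2| + 1 :=
      hconv.multipliers.abs.eventually_lt_const (by linarith [abs_nonneg C])
    filter_upwards [h1.curry, h2] with s hs hs'
    exact ⟨fun t ht => (hs.self_of_nhdsSet t ht).le, hs'.le⟩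
  -- A default value, so that the bound can be chosen as a function of all pairs `w`, smooth or not.
  · exact ⟨0, le_rfl, fun h => absurd h hw⟩

variable {v : ℝ → ℝ → CotangentBundle n N}

theorem loopLength_le_of_velocityBound (hv : IsSmoothCylinder v) (g : Metric n N) {s D : ℝ}
    (h : ∀ t ∈ Set.Icc (0 : ℝ) 1, velocityBound g ⟨v s t, partialT v s t⟩ ≤ D) :
    loopLength g v s ≤ D := by
  have h1 := intervalIntegral.integral_mono_on (μ := volume) (zero_le_one' ℝ)
    (((continuous_planeSpeed g hv.baseMap (0, 1)).comp
      (Continuous.prodMk_right s)).intervalIntegrable 0 1)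
    ((continuous_const (y := D)).intervalIntegrable 0 1) fun t ht => by
      refine le_trans (le_of_eq ?_) ((tangentNorm_le_velocityBound g _ _).trans (h t ht))
      exact hv.planeSpeed_eq g s t
  simpa [loopLength] using h1

theorem abs_liouvilleAction_le_of_velocityBound (hv : IsSmoothCylinder v) (g : Metric n N) {s D : ℝ}
    (h : ∀ t ∈ Set.Icc (0 : ℝ) 1, velocityBound g ⟨v s t, partialT v s t⟩ ≤ D) :
    |liouvilleAction v s| ≤ D := by
  have := intervalIntegral.norm_integral_le_of_norm_le_const (a := (0 : ℝ)) (b := 1) (C := D)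
    (f := fun t => cylinderLiouville v (s, t) (0, 1)) fun t ht => by
      rw [Set.uIoc_of_le zero_le_one] at ht
      rw [hv.cylinderLiouville_partialT]
      exact (abs_liouvilleForm_le_velocityBound g _ _).trans (h t ⟨ht.1.le, ht.2⟩)
  simpa [liouvilleAction] using this

end Ends

end RabinowitzFloer
end

noncomputable section

namespace RabinowitzFloer

set_option linter.unusedSectionVars false

/-! ### Uniform bounds -/

section Bounds

/-- The symmetric intervals exhaust the line and the integrand is nonnegative, so their integrals
converge to the full one. -/
theorem lintegral_ofReal_le_of_eventually {e : ℝ → ℝ} (he : Continuous e) (he0 : ∀ s, 0 ≤ e s)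
    {B : ℝ} (h : ∀ᶠ S in atTop, ∫ s in (-S)..S, e s ≤ B) :
    ∫⁻ s, ENNReal.ofReal (e s) ≤ ENNReal.ofReal B := by
  have hcover : AECover (volume : Measure ℝ) atTop fun S : ℝ => Set.Icc (-S) S :=
    aecover_Icc tendsto_neg_atTop_atBot tendsto_id
  refine le_of_tendsto (hcover.lintegral_tendsto_of_countably_generated
    he.measurable.ennreal_ofReal.aemeasurable) ?_
  filter_upwards [h, eventually_ge_atTop 0] with S hS hS0
  rw [← ofReal_integral_eq_lintegral_ofReal (he.continuousOn.integrableOn_compact isCompact_Icc)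
    (ae_of_all _ he0)]
  refine ENNReal.ofReal_le_ofReal ?_
  rw [integral_Icc_eq_integral_Ioc, ← intervalIntegral.integral_of_le (by linarith)]
  exact hS

variable {n : ℕ} {N : Type*} [TopologicalSpace N] [ChartedSpace (EuclideanSpace ℝ (Fin n)) N]
  [IsManifold (𝓡 n) ∞ N]
  {N' : Type*} [TopologicalSpace N'] [ChartedSpace (EuclideanSpace ℝ (Fin n)) N']
  [IsManifold (𝓡 n) ∞ N'] {p : N' → N}
  {v : ℝ → ℝ → CotangentBundle n N} {η : ℝ → ℝ} {g : Metric n N} {U : N → ℝ} {k ξ : ℝ}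
  {b : ℝ → ℝ} {μ σ : FormField n N} {β : ℝ → ℝ} {A : ℝ} {J : EndoFamily n N}

/-- The bound of the energy and the multiplier in terms of a bound `D` for the ends. -/
def flowBound (k ξ A ε₀ u₀ ε D : ℝ) : ℝ :=
  (1 + multiplierConst (actionConst k ε₀ u₀ A) ξ ε) *
    (3 + 5 * ((1 + ξ + 2 * √(2 * (|k| + ε₀ + u₀)) + ε₀) * D))

theorem actionConst_nonneg {k ε₀ u₀ A : ℝ} (hε₀ : 0 < ε₀) (hA : 1 ≤ A) :
    0 ≤ actionConst k ε₀ u₀ A := by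
  rw [actionConst]
  positivity

theorem IsBoundedFlow.window_bound (h : IsBoundedFlow g U k ξ b μ σ β A J v η) (hξ : 0 < ξ)
    (hp : IsUniversalCovering n p) {θ : CovectorField n N'} (hprim : IsPrimitive p μ θ)
    (hσ : Continuous (planeForm σ (baseMap v))) {ε₀ u₀ : ℝ} (hε₀ : 0 < ε₀)
    (hθ : ∀ x, liftedDualNormSq g p x (θ x) / 2 + U (p x) ≤ k - ε₀) (hu₀ : ∀ x, |U x| ≤ u₀)
    {ε κ : ℝ} (hε : 0 < ε) (hε1 : ε ≤ 1) (hε8 : ε ≤ ε₀ / 8)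
    (hε₁ : (1 + A) * ε < ξ - min (1 / 3) (ξ / 3)) (hε₂ : (1 + A) * ε ≤ ε₀ / 2)
    (hκ : 0 ≤ κ) (hκA : κ * A ≤ ε₀ / 8)
    (hκ' : 12 * κ * A * (1 + multiplierConst (actionConst k ε₀ u₀ A) ξ ε) ≤ 1)
    (hcyl : CylinderBound g σ κ) {S₀ S₁ D : ℝ} (hS : S₀ ≤ S₁)
    (h₀ : ∀ t ∈ Set.Icc (0 : ℝ) 1, velocityBound g ⟨v S₀ t, partialT v S₀ t⟩ ≤ D)
    (h₁ : ∀ t ∈ Set.Icc (0 : ℝ) 1, velocityBound g ⟨v S₁ t, partialT v S₁ t⟩ ≤ D)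
    (hη₀ : |η S₀| ≤ D) (hη₁ : |η S₁| ≤ D) :
    ∫ s in S₀..S₁, energyDensity (twistedDeformation μ σ β) J v η s ≤
        flowBound k ξ A ε₀ u₀ ε D ∧
      ∀ s ∈ Set.Icc S₀ S₁, |η s| ≤ flowBound k ξ A ε₀ u₀ ε D := by
  have hμ : Continuous (planeForm μ (baseMap v)) :=
    continuous_planeForm hp hprim h.cylinder.baseMap
  have hA := h.one_le
  have hl₀ := loopLength_le_of_velocityBound h.cylinder g h₀
  have hl₁ := loopLength_le_of_velocityBound h.cylinder g h₁
  have hL₀ := abs_liouvilleAction_le_of_velocityBound h.cylinder g h₀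
  have hL₁ := abs_liouvilleAction_le_of_velocityBound h.cylinder g h₁
  have hD : 0 ≤ D := (abs_nonneg _).trans hη₀
  rw [flowBound]
  set R := √(2 * (|k| + ε₀ + u₀)) with hR
  have hR0 : 0 ≤ R := Real.sqrt_nonneg _
  -- A bound for the action at both ends of the window: `1` accounts for the Liouville form, `ξ` for
  -- the multiplier term, `2 * R` for the μ-area and `ε₀` for the σ-area. Both areas vanish at `S₀`,
  -- where the action is normalized.
  set D' := (1 + ξ + 2 * R + ε₀) * D with hD'
  have hRD : 0 ≤ R * D := mul_nonneg hR0 hD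
  have hξD : 0 ≤ ξ * D := mul_nonneg hξ.le hD
  have hεD : 0 ≤ ε₀ * D := mul_nonneg hε₀.le hD
  have hDD' : D ≤ D' := by rw [hD']; linarith
  have hQ : ∀ s, |baseArea σ v S₀ s| ≤ κ * (loopLength g v s + loopLength g v S₀) := fun s => by
    rw [add_comm (loopLength g v s)]
    exact hcyl _ h.cylinder.baseMap h.cylinder.baseMap_periodic S₀ s
  have hP : |baseArea μ v S₀ S₁| ≤ R * (loopLength g v S₀ + loopLength g v S₁) := by
    refine abs_integral_planeForm_le hp g hprim (C := 2 * (|k| + ε₀ + u₀)) (fun x => ?_)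
      h.cylinder.baseMap h.cylinder.baseMap_periodic S₀ S₁
    have h1 := (abs_le.1 (hu₀ (p x))).1
    have h2 := hθ x
    have h3 := le_abs_self k
    linarith
  have hηx : ∀ s, |η s| ≤ D →
      |η s * ∫ t in (0 : ℝ)..1, definingHamiltonian g U k b (v s t)| ≤ ξ * D := fun s hs => by
    rw [abs_mul, mul_comm ξ]
    exact mul_le_mul hs (h.abs_integral_hamiltonian_le s) (abs_nonneg _) hD
  have ha₀ : |flowAction μ σ β (definingHamiltonian g U k b) v η S₀ S₀| ≤ D' := by
    rw [flowAction, baseArea_self, baseArea_self, mul_zero, add_zero, add_zero]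
    refine (abs_sub _ _).trans ?_
    have := hηx S₀ hη₀
    rw [hD']
    linarith
  have ha₁ : |flowAction μ σ β (definingHamiltonian g U k b) v η S₀ S₁| ≤ D' := by
    have hβ := h.time.mem_unit S₁
    have h1 : |β S₁ * baseArea σ v S₀ S₁| ≤ ε₀ * D := by
      rw [abs_mul, abs_of_nonneg hβ.1]
      refine (mul_le_of_le_one_left (abs_nonneg _) hβ.2).trans ((hQ S₁).trans ?_)
      have h2 : κ ≤ ε₀ / 8 := by nlinarith
      nlinarith [mul_le_mul_of_nonneg_left (add_le_add hl₁ hl₀) hκ,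
        mul_le_mul_of_nonneg_right h2 hD]
    have h3 := mul_le_mul_of_nonneg_left (add_le_add hl₀ hl₁) hR0
    have h4 := hηx S₁ hη₁
    rw [flowAction]
    refine (abs_sub _ _).trans ?_
    have h5 := abs_add_le (liouvilleAction v S₁ + baseArea μ v S₀ S₁) (β S₁ * baseArea σ v S₀ S₁)
    have h6 := abs_add_le (liouvilleAction v S₁) (baseArea μ v S₀ S₁)
    rw [hD']
    linarith
  refine RabinowitzFloer.window_bound hA (actionConst_nonneg hε₀ hA) hξ.le hε hκ
    (hD.trans hDD') hκ' hS (h.continuous_energyDensity hμ hσ) h.energyDensity_nonneg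
    (continuous_iff_continuousAt.2 fun s => (hasDerivAt_baseArea hσ S₀ s).continuousAt)
    (h.time.smooth.of_le (by simp)) h.time.mem_unit h.time.deriv_nonneg h.time.deriv_le_two
    (h.hasDerivAt_flowAction hμ hσ S₀) h.abs_multiplier_sub_le (h.loopLength_le hμ hσ) hQ
    (fun s he => ?_) ha₀ ha₁ (hη₁.trans hDD') (hl₀.trans hDD')
  exact h.abs_multiplier_le hp hprim hσ hε₀ hθ hu₀ hε hε1 hε8 hε₁ hε₂ hκ hκA (hQ s)
    (hl₀.trans hDD') he

/-- A gradient flow line is bounded in terms of bounds near its ends. -/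
theorem IsBoundedFlow.energy_le (h : IsBoundedFlow g U k ξ b μ σ β A J v η) (hξ : 0 < ξ)
    (hp : IsUniversalCovering n p) {θ : CovectorField n N'} (hprim : IsPrimitive p μ θ)
    (hσ : Continuous (planeForm σ (baseMap v))) {ε₀ u₀ : ℝ} (hε₀ : 0 < ε₀)
    (hθ : ∀ x, liftedDualNormSq g p x (θ x) / 2 + U (p x) ≤ k - ε₀) (hu₀ : ∀ x, |U x| ≤ u₀)
    {ε κ : ℝ} (hε : 0 < ε) (hε1 : ε ≤ 1) (hε8 : ε ≤ ε₀ / 8)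
    (hε₁ : (1 + A) * ε < ξ - min (1 / 3) (ξ / 3)) (hε₂ : (1 + A) * ε ≤ ε₀ / 2)
    (hκ : 0 ≤ κ) (hκA : κ * A ≤ ε₀ / 8)
    (hκ' : 12 * κ * A * (1 + multiplierConst (actionConst k ε₀ u₀ A) ξ ε) ≤ 1)
    (hcyl : CylinderBound g σ κ) {D : ℝ}
    (h₀ : ∀ᶠ s in atBot, (∀ t ∈ Set.Icc (0 : ℝ) 1,
      velocityBound g ⟨v s t, partialT v s t⟩ ≤ D) ∧ |η s| ≤ D)
    (h₁ : ∀ᶠ s in atTop, (∀ t ∈ Set.Icc (0 : ℝ) 1,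
      velocityBound g ⟨v s t, partialT v s t⟩ ≤ D) ∧ |η s| ≤ D) :
    (∀ s, |η s| ≤ flowBound k ξ A ε₀ u₀ ε D) ∧
      energy (twistedDeformation μ σ β) J v η ≤
        ENNReal.ofReal (flowBound k ξ A ε₀ u₀ ε D) := by
  have hμ : Continuous (planeForm μ (baseMap v)) :=
    continuous_planeForm hp hprim h.cylinder.baseMap
  have key : ∀ᶠ S in atTop,
      ∫ s in (-S)..S, energyDensity (twistedDeformation μ σ β) J v η s ≤
          flowBound k ξ A ε₀ u₀ ε D ∧
        ∀ s ∈ Set.Icc (-S) S, |η s| ≤ flowBound k ξ A ε₀ u₀ ε D := by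
    filter_upwards [tendsto_neg_atTop_atBot.eventually h₀, h₁, eventually_ge_atTop 0]
      with S hS₀ hS₁ hS
    exact h.window_bound hξ hp hprim hσ hε₀ hθ hu₀ hε hε1 hε8 hε₁ hε₂ hκ hκA hκ' hcyl
      (by linarith) hS₀.1 hS₁.1 hS₀.2 hS₁.2
  refine ⟨fun s => ?_, lintegral_ofReal_le_of_eventually (h.continuous_energyDensity hμ hσ)
    h.energyDensity_nonneg (key.mono fun S hS => hS.1)⟩
  obtain ⟨S, hS, hsS⟩ := (key.and (eventually_ge_atTop |s|)).exists
  exact hS.2 s (abs_le.1 hsS)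

/-- A real number fits strictly between the supremum for a suitable `θ` and `k`, so the gap is
uniform over the points of the covering. -/
theorem exists_primitive_of_maneCriticalValue_lt
    (h : maneCriticalValue g p μ U < (k : EReal)) :
    ∃ θ : CovectorField n N', IsPrimitive p μ θ ∧ ∃ ε₀ > 0,
      ∀ x, liftedDualNormSq g p x (θ x) / 2 + U (p x) ≤ k - ε₀ := by
  obtain ⟨θ, h⟩ := iInf_lt_iff.1 h
  obtain ⟨hθ, h⟩ := iInf_lt_iff.1 h
  obtain ⟨k', hk', hk⟩ := EReal.lt_iff_exists_real_btwn.1 h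
  have hk := EReal.coe_lt_coe_iff.1 hk
  refine ⟨θ, hθ, k - k', by linarith, fun x => ?_⟩
  have h1 := EReal.coe_le_coe_iff.1 ((le_iSup (fun q : N' =>
    ((liftedDualNormSq g p q (θ q) / 2 + U (p q) : ℝ) : EReal)) x).trans hk'.le)
  linarith

theorem IsBoundedFamily.mono {H : CotangentBundle n N → ℝ} {Ω : ℝ → Pairing n N} {A' : ℝ}
    (h : IsBoundedFamily g Ω H J A)
    (hΩ : ∀ t s z (u : TangentSpace (cotangentModel n) z), 0 ≤ Ω s z u (J t s z u)) (hA : A ≤ A') :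
    IsBoundedFamily g Ω H J A' :=
  ⟨fun t s z u => (h.proj_le t s z u).trans (mul_le_mul_of_nonneg_right hA (hΩ t s z u)),
    fun t s z => (h.ham_le t s z).trans hA⟩

theorem CylinderBound.mono {C C' : ℝ} (h : CylinderBound g σ C) (hC : C ≤ C') :
    CylinderBound g σ C' := fun q hq hper s₀ s₁ =>
  (h q hq hper s₀ s₁).trans (mul_le_mul_of_nonneg_right hC
    (add_nonneg (integral_planeSpeed_nonneg _ _ _ _) (integral_planeSpeed_nonneg _ _ _ _)))

/-- The constants used in the estimate of the flow lines. -/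
theorem exists_flow_constants {ξ A ε₀ : ℝ} (hξ : 0 < ξ) (hA : 1 ≤ A) (hε₀ : 0 < ε₀) :
    ∃ ε : ℝ, 0 < ε ∧ ε ≤ 1 ∧ ε ≤ ε₀ / 8 ∧ (1 + A) * ε < ξ - min (1 / 3) (ξ / 3) ∧
      (1 + A) * ε ≤ ε₀ / 2 := by
  have hρ : 2 * ξ / 3 ≤ ξ - min (1 / 3) (ξ / 3) := by
    linarith [min_le_right (1 / 3 : ℝ) (ξ / 3)]
  have hA' : 0 < 1 + A := by linarith
  -- The identity range of the cutoff has radius at least `2 * ξ / 3`, so bounding `(1 + A) * ε` by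
  -- `ξ / 3` gives the strict inequality.
  refine ⟨min (min 1 (ε₀ / 8)) (min (ξ / 3 / (1 + A)) (ε₀ / 2 / (1 + A))), by positivity,
    (min_le_left _ _).trans (min_le_left _ _), (min_le_left _ _).trans (min_le_right _ _), ?_, ?_⟩
  · have h := (min_le_right (min 1 (ε₀ / 8)) (min (ξ / 3 / (1 + A)) (ε₀ / 2 / (1 + A)))).trans
      (min_le_left _ _)
    rw [le_div_iff₀ hA'] at h
    linarith
  · have h := (min_le_right (min 1 (ε₀ / 8)) (min (ξ / 3 / (1 + A)) (ε₀ / 2 / (1 + A)))).trans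
      (min_le_right _ _)
    rw [le_div_iff₀ hA'] at h
    linarith

theorem exists_area_constant {A ε₀ C : ℝ} (hA : 1 ≤ A) (hε₀ : 0 < ε₀) (hC : 0 ≤ C) :
    ∃ κ : ℝ, 0 < κ ∧ κ * A ≤ ε₀ / 8 ∧ 12 * κ * A * (1 + C) ≤ 1 := by
  have hA' : 0 < A := by linarith
  refine ⟨min (ε₀ / 8 / A) (1 / (12 * A * (1 + C))), by positivity, ?_, ?_⟩
  · have h := min_le_left (ε₀ / 8 / A) (1 / (12 * A * (1 + C)))
    rwa [le_div_iff₀ hA'] at h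
  · have h := min_le_right (ε₀ / 8 / A) (1 / (12 * A * (1 + C)))
    rw [le_div_iff₀ (by positivity)] at h
    linarith

theorem multiplierConst_nonneg {K ξ ε : ℝ} (hK : 0 ≤ K) (hξ : 0 ≤ ξ) : 0 ≤ multiplierConst K ξ ε := by
  rw [multiplierConst]
  positivity

end Bounds

end RabinowitzFloer
end

theorem proposition4p6 {n : ℕ}
    {N : Type*} [TopologicalSpace N] [ChartedSpace (EuclideanSpace ℝ (Fin n)) N]
    [IsManifold (𝓡 n) ∞ N] [CompactSpace N] [T2Space N] [ConnectedSpace N]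
    {N' : Type*} [TopologicalSpace N'] [ChartedSpace (EuclideanSpace ℝ (Fin n)) N']
    [IsManifold (𝓡 n) ∞ N']
    (p : N' → N) (hp : RabinowitzFloer.IsUniversalCovering n p)
    (g : RabinowitzFloer.Metric n N)
    (U : N → ℝ) (hU : ContMDiff (𝓡 n) 𝓘(ℝ, ℝ) ∞ U)
    (k ξ : ℝ) (hξ : 0 < ξ) (b : ℝ → ℝ) (hb : RabinowitzFloer.IsLevelCutoff ξ b)
    (μ : RabinowitzFloer.FormField n N) (hμ : RabinowitzFloer.HasBoundedPrimitive g p μ)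
    (β : ℝ → ℝ) (hβ : RabinowitzFloer.IsTimeCutoff β)
    (A : ℝ) :
    ∃ δ > 0, ∃ c : ((ℝ → RabinowitzFloer.CotangentBundle n N) × ℝ) →
        ((ℝ → RabinowitzFloer.CotangentBundle n N) × ℝ) → ℝ,
      ∀ σ : RabinowitzFloer.FormField n N, RabinowitzFloer.HasBoundedPrimitive g p σ →
        RabinowitzFloer.TwoFormNormLE g σ δ →
        (∀ s : ℝ, RabinowitzFloer.maneCriticalValue g p (fun x => μ x + β s • σ x) U
          < (k : EReal)) →
      ∀ J : RabinowitzFloer.EndoFamily n N,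
        RabinowitzFloer.IsCompatibleFamily (RabinowitzFloer.twistedDeformation μ σ β) J →
        RabinowitzFloer.IsBoundedFamily g (RabinowitzFloer.twistedDeformation μ σ β)
          (RabinowitzFloer.definingHamiltonian g U k b) J A →
      ∀ (x₀ : ℝ → RabinowitzFloer.CotangentBundle n N)
        (wm wp : (ℝ → RabinowitzFloer.CotangentBundle n N) × ℝ)
        (v : ℝ → ℝ → RabinowitzFloer.CotangentBundle n N) (η : ℝ → ℝ),
        RabinowitzFloer.IsSmoothLoop x₀ →
        RabinowitzFloer.IsCriticalPoint (RabinowitzFloer.twistedDeformation μ σ β 0)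
          (RabinowitzFloer.definingHamiltonian g U k b) x₀ wm →
        RabinowitzFloer.IsCriticalPoint (RabinowitzFloer.twistedDeformation μ σ β 1)
          (RabinowitzFloer.definingHamiltonian g U k b) x₀ wp →
        RabinowitzFloer.IsGradientFlowLine (RabinowitzFloer.twistedDeformation μ σ β)
          (RabinowitzFloer.definingHamiltonian g U k b) J v η →
        RabinowitzFloer.ConvergesTo v η atBot wm →
        RabinowitzFloer.ConvergesTo v η atTop wp →
        (∀ s : ℝ, |η s| ≤ c wm wp) ∧
          RabinowitzFloer.energy (RabinowitzFloer.twistedDeformation μ σ β) J v η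
            ≤ ENNReal.ofReal (c wm wp) := by
  open RabinowitzFloer in
  -- The primitive `θ` and the gap `ε₀` have to be fixed before `σ`. This is possible when the
  -- critical value of `μ` lies below `k`. Otherwise no `σ` satisfies the hypothesis at `s = 0`,
  -- where `β` vanishes, and any `δ` and bound will do.
  by_cases hgap : maneCriticalValue g p μ U < (k : EReal)
  · obtain ⟨θ, hprim, ε₀, hε₀, hθ⟩ := exists_primitive_of_maneCriticalValue_lt hgap
    obtain ⟨u₀, hu₀⟩ := isCompact_univ.exists_bound_of_continuousOn hU.continuous.continuousOn
    -- A family bounded by `A` is bounded by `|A| + 1`; the estimates are carried out with this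
    -- constant, which is at least one.
    have hA : 1 ≤ |A| + 1 := by linarith [abs_nonneg A]
    obtain ⟨ε, hε, hε1, hε8, hε₁, hε₂⟩ := exists_flow_constants hξ hA hε₀
    obtain ⟨κ, hκ, hκA, hκ'⟩ := exists_area_constant hA hε₀
      (multiplierConst_nonneg (ε := ε) (actionConst_nonneg (k := k) (u₀ := u₀) hε₀ hA) hξ.le)
    obtain ⟨C, hC, hcyl⟩ := exists_cylinderBound hp g
    choose D hD0 hD using exists_eventually_bound g
    -- With this `δ` the cylinder constant is `C * κ / (C + 1) ≤ κ`; the `+ 1` guards against `C =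
    -- 0`. The bound for the flow line takes the larger of the end bounds of `wm` and `wp`.
    refine ⟨κ / (C + 1), by positivity,
      fun wm wp => flowBound k ξ (|A| + 1) ε₀ u₀ ε (max (D wm) (D wp)), ?_⟩
    intro σ hσ hσδ _ J hJ hJA x₀ wm wp v η _ hwm hwp hflow hm hp'
    have hcyl' : CylinderBound g σ κ := by
      refine (hcyl σ hσ _ (by positivity) hσδ).mono ?_
      rw [mul_div_assoc', div_le_iff₀ (by linarith)]
      nlinarith
    have hΩ : ∀ t s z (u : TangentSpace (cotangentModel n) z),
        0 ≤ twistedDeformation μ σ β s z u (J t s z u) := fun t s z u => by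
      by_cases hu : u = 0
      · rw [hu]
        exact (congrArg (fun L => L (J t s z 0)) (LinearMap.map_zero
          (twistedBilin (fun x => μ x + β s • σ x) z))).ge
      · exact (hJ.pos t s z u hu).le
    have h : IsBoundedFlow g U k ξ b μ σ β (|A| + 1) J v η :=
      { potential := hU
        cutoff := hb
        time := hβ
        alternating_left := hμ.isTwoForm.alternating
        alternating_right := hσ.isTwoForm.alternating
        compatible := hJ
        bounded := hJA.mono hΩ (by linarith [le_abs_self A])
        one_le := hA
        flow := hflow }
    obtain ⟨θσ, hθσ, -⟩ := hσ.exists_primitive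
    refine h.energy_le hξ hp hprim (continuous_planeForm hp hθσ h.cylinder.baseMap) hε₀ hθ
      (fun x => hu₀ x trivial) hε hε1 hε8 hε₁ hε₂ hκ.le hκA hκ' hcyl' ?_ ?_
    · exact (hD wm hwm.isLoop v η atBot hm).mono fun s hs =>
        ⟨fun t ht => (hs.1 t ht).trans (le_max_left _ _), hs.2.trans (le_max_left _ _)⟩
    · exact (hD wp hwp.isLoop v η atTop hp').mono fun s hs =>
        ⟨fun t ht => (hs.1 t ht).trans (le_max_right _ _), hs.2.trans (le_max_right _ _)⟩
  · refine ⟨1, one_pos, fun _ _ => 0, fun σ _ _ hs => absurd ?_ hgap⟩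
    have h := hs 0
    have hμ0 : (fun x => μ x + β 0 • σ x) = μ := funext fun x =>
      ContinuousLinearMap.ext fun u => ContinuousLinearMap.ext fun w => by
        change μ x u w + β 0 * σ x u w = μ x u w
        rw [hβ.eq_zero 0 le_rfl, zero_mul, add_zero]
    rwa [hμ0] at h
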